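/- **Notation.** Let $d\ge 2$ be an integer, $\nu=\frac{d-2}{2}$, $r,s\in\mathbb R$. Write $y=\frac{z}{1-z}$, $\bar y=\frac{\bar z}{1-\bar z}$, and $$k^{r,s}_{2H}(x)=x^H(1-x)^{-r}{}_2F_1(H-r,H+s;2H;x),\qquad \omega(H)=\frac{\Gamma(H-r)\Gamma(H-s)}{\Gamma(2H-1)},$$ $$S^{r,s}_a(H)=\frac{\omega(H)}{\Gamma(-a-r)\Gamma(-a-s)}\,\frac{\Gamma(H-a-1)}{\Gamma(H+a+1)}.$$ The $SO(d,2)$ block is understood through its expansion in descendant levels $$G^{r,s}_{h,\bar h}(\bar z,1-z)=\sum_{m\ge 0}\sum_{j=-m}^{m}A^{r,s}_{m,j}(h,\bar h)\,\bar y^{h+m}\,k^{r,s}_{2(\bar h+j)}(1-z),\qquad A_{0,0}^{r,s}=1,$$ where the $A_{m,j}^{r,s}$ are the rational functions determined by the following equation. With $Y=1/y$, $\theta=\bar y\partial_{\bar y}$, $\Theta=Y\partial_Y$, the series is, order by order in $\bar y$, an eigenfunction with eigenvalue $h(h-1)+\bar h(\bar h-1)-2\nu h$ of the quadratic Casimir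 operator $$\theta(\theta-1)+\bar y(\theta-r)(\theta-s)+\Theta(\Theta-1)+Y(\Theta-r)(\Theta-s)+\frac{2\nu}{\bar y-Y}\big(Y(1+\bar y)\theta-\bar y(1+Y)\Theta\big).$$ The coefficients $C^{(n)r,s}_a(h_0,\bar h)$ are defined by $C^{(0)r,s}_a(h_0,\bar h)=S^{r,s}_a(\bar h)$ and, for $n>0$, $$C_a^{(n)r,s}(h_0,\bar h)=-\sum_{m=1}^n\sum_{j=-m}^m C_a^{(n-m)r,s}(h_0,\bar h-j)\,A^{r,s}_{m,j}(h_0+n-m,\bar h-j).$$ The operator $\mathcal C^{r,s}$ is the linear operator with $$\mathcal C^{r,s}:\ \bar y^{h_0}y^a\mapsto\sum_{n\ge 0}\bar y^{h_0+n}C_a^{(n)r,s}(h_0,\bar h),$$ extended to logarithms by $\mathcal C^{r,s}\big(\bar y^{h_0}\log^k\bar y\;y^a\log^l y\big)=\partial_{h_0}^k\partial_a^l\,\mathcal C^{r,s}(\bar y^{h_0}y^a)$. *Casimir-regular* terms, denoted $[\dots]_y$, are the terms $y^{n-r}$ and $y^{n-s}$ with $n\in\mathbb Z_{\ge0}$,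 together with $y^e\log y$ for exponents $e$ of both forms. For $r=s=0$ they are $y^n$ and $y^n\log y$. **Hypotheses.** Let $p,h$ be real functions of $\bar h$. * $p(\bar h)/\omega(\bar h)$ has, as $\bar h\to\infty$, an asymptotic expansion to all orders in terms $\bar h^{-c}\log^l\bar h$, with finitely many terms with $c\le N$ for each $N$. * $h$ is smooth for large $\bar h$, has an expansion of the same kind which may be differentiated term by term any number of times, and $h(\bar h)\to h_\infty$. * $h_\infty$ is not a pole of the coefficients $A_{m,0}$: $h_\infty\ne\nu-\frac q2$ for all integers $q\ge 1$, and also $h_\infty\neq\nu$ if $rs\ne0$. * $\bar h(\ell)$ is a differentiable solution of $\bar h(\ell)-h(\bar h(\ell))=\ell$ for real $\ell>\ell_0$, with $\bar h(\ell)\to\infty$ as $\ell\to\infty$. Let $$f(\bar y,y)=\sum_{m,k,a,l}f_{m,k,a,l}\,\bar y^{h_\infty+m}\log^k\bar y\;y^a\log^l y\qquad (m,k,l\in\mathbb Z_{\ge 0},\ a\in\mathbb R)$$ be a formal sum that, for each $m$ and $N$, has finitely many terms with $a\le N$. Let $\varepsilon>0$, and suppose that $$\sum_{\ell>\ell_0,\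 \ell\in\mathbb Z_{\ge0}}\frac{\partial\bar h}{\partial\ell}\,p(\bar h)\,G^{r,s}_{h(\bar h),\bar h}(\bar z,1-z)=f(\bar y,y)+[\dots]_y$$ in the following sense. For every level $m\ge 0$ and every fixed $\bar y\in(0,\varepsilon)$, the sum over $\ell$ of the level-$m$ terms (those with $\bar y^{h(\bar h)+m}$) converges for all $y>0$. As $y\to0^+$ it has, to all orders in $y$, the asymptotic expansion given by the terms $\bar y^{h_\infty+m}\log^k\bar y\,y^a\log^ly$ of $f$ plus Casimir-regular terms, whose coefficients may depend on $\bar y$. **Conclusion.** As $\bar h\to\infty$, for every fixed $\bar y\in(0,\varepsilon)$, $$p(\bar h)\,\bar y^{h(\bar h)}\sim(\mathcal C^{r,s}f)(\bar y,\bar h),$$ order by order in $\bar y^{h_\infty+n}$, $n\ge 0$. That is: let $(\mathcal C^{r,s}f)_{n,N}$ be the part of $\mathcal C^{r,s}f$ of order $\bar y^{h_\infty+n}$ (times powers of $\log\bar y$) that comes from the terms of $f$ with $a\le N$. Then for every real $N$ $$p(\bar h)\bar y^{h(\bar h)}-(\mathcal C^{r,s}f)_{0,N}(\bar y,\bar h)=o\big(\omega(\bar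 h)\bar h^{-2N-2}\big),\qquad (\mathcal C^{r,s}f)_{n,N}(\bar y,\bar h)=o\big(\omega(\bar h)\bar h^{-2N-2}\big)\quad(n\ge1).$$ The case $r=s=0$ is the statement for unmixed blocks. -/

import Mathlib

open Filter Topology Asymptotics

noncomputable section

namespace Lightcone

/-! ### One-dimensional blocks and their coefficients -/

/-- The mixed `SL(2,ℝ)` block `k^{r,s}_{2H}(x) = x^H (1-x)^{-r} ₂F₁(H-r, H+s; 2H; x)`. -/
def sl2Block (r s H x : ℝ) : ℝ :=
  x ^ H * (1 - x) ^ (-r) * ordinaryHypergeometric (H - r) (H + s) (2 * H) x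

/-- The common large-weight factor `Γ(H-r) Γ(H-s) / Γ(2H-1)` of the coefficients `S_a^{r,s}(H)`. -/
def sl2Weight (r s H : ℝ) : ℝ :=
  Real.Gamma (H - r) * Real.Gamma (H - s) / Real.Gamma (2 * H - 1)

/-- `S_a^{r,s}(H)`. Mathlib's `Real.Gamma` vanishes at the poles of `Γ`, so `(Real.Gamma x)⁻¹` is
the entire function `1/Γ`. -/
def sl2Coeff (r s a H : ℝ) : ℝ :=
  (Real.Gamma (-a - r))⁻¹ * (Real.Gamma (-a - s))⁻¹ * sl2Weight r s H *
    (Real.Gamma (H - a - 1) / Real.Gamma (H + a + 1))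

/-! ### `SO(d,2)` blocks, expanded in powers of the first cross-ratio -/

/-- `ν = (d-2)/2`. -/
def nu (d : ℕ) : ℝ := ((d : ℝ) - 2) / 2

/-- With `Y = x/(1-x)`, `θ = Y d/dY` and `k_H = k^{r,s}_{2H}(x)`, the one-dimensional blocks satisfy
`Y⁻¹ k_H = k_{H-1} + β_H k_H + γ_H k_{H+1}` and
`(1 + Y⁻¹) θ k_H = H k_{H-1} + β'_H k_H + (1-H) γ_H k_{H+1}`.
This is `β_H`. -/
def shiftBeta (r s H : ℝ) : ℝ := -(1 / 2) + r * s / (2 * H * (H - 1))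

/-- The coefficient `β'_H` of the relations stated at `shiftBeta`. -/
def shiftBeta' (r s H : ℝ) : ℝ := (r + s) / 2 + r * s / (2 * H * (H - 1))

/-- The coefficient `γ_H` of the relations stated at `shiftBeta`. -/
def shiftGamma (r s H : ℝ) : ℝ :=
  (H ^ 2 - r ^ 2) * (H ^ 2 - s ^ 2) / (4 * H ^ 2 * (4 * H ^ 2 - 1))

/-- The coefficients `A_{m,j}^{r,s}(h, hb)` of the `SO(d,2)` block
`G^{r,s}_{h,hb}(z, z') = ∑_m ∑_{|j| ≤ m} A_{m,j}(h, hb) y^{h+m} k^{r,s}_{2(hb+j)}(z')`,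
`y = z/(1-z)`.  In the variables `y` and `Y = z'/(1-z')`, with `θ = y ∂_y` and `Θ = Y ∂_Y`, the block
is the eigenfunction, with eigenvalue `h(h-1) + hb(hb-1) - 2νh`, of the quadratic Casimir operator
`θ(θ-1) + y(θ-r)(θ-s) + Θ(Θ-1) + Y(Θ-r)(Θ-s) + 2ν/(y-Y) (Y(1+y)θ - y(1+Y)Θ)`
whose leading term is `y^h k_{2hb}(z')`.  Multiplying the eigenvalue equation by `1 - y/Y` and reading
off the coefficient of `y^{h+m} k_{2(hb+j)}` gives a recursion for `A_{m,j}` in terms of the levels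
`m-1` and `m-2`.  The levels `0` and `1` are written in closed form. -/
def blockA (ν r s h hb : ℝ) : ℕ → ℤ → ℝ
  | 0, j => if j = 0 then 1 else 0
  | 1, j =>
    if j = -1 then ν * (hb - h) / (hb - h + ν - 1)
    else if j = 0 then
      (s + r - h) / 2
        - r * s * (hb ^ 2 - hb - h * ν + ν) / (2 * (hb - 1) * hb * (h - ν))
    else if j = 1 then
      ν * (h + hb - 1) * (hb - r) * (hb + r) * (hb - s) * (hb + s)
        / (4 * hb ^ 2 * (2 * hb - 1) * (2 * hb + 1) * (h + hb - ν))
    else 0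
  | m + 2, j =>
    let η : ℝ := h + m + 2
    let E : ℝ → ℝ := fun H =>
      (η - 1) * (η - 2) + H * (H - 1) - (h * (h - 1) + hb * (hb - 1) - 2 * ν * h)
    let β : ℝ := shiftBeta r s (hb + j)
    let β' : ℝ := shiftBeta' r s (hb + j)
    let γ : ℝ := shiftGamma r s (hb + j - 1)
    let num : ℝ :=
      ((η - 1 - r) * (η - 1 - s) - 2 * ν * (η - 1)) * blockA ν r s h hb (m + 1) j
        + (2 * ν * (hb + j + 1) - E (hb + j + 1)) * blockA ν r s h hb (m + 1) (j + 1)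
        + (2 * ν * β' - β * E (hb + j)) * blockA ν r s h hb (m + 1) j
        + γ * (2 * ν * (2 - hb - j) - E (hb + j - 1)) * blockA ν r s h hb (m + 1) (j - 1)
        - (η - 2 - r) * (η - 2 - s) *
          (blockA ν r s h hb m (j + 1) + β * blockA ν r s h hb m j
            + γ * blockA ν r s h hb m (j - 1))
    let den : ℝ := ((m : ℝ) + 2) * (2 * h + m + 1 - 2 * ν) + j * (2 * hb + j - 1)
    (-num) / den

/-- The coefficient of `yb^{h+m}` in `G^{r,s}_{h,hb}(zb, 1-z)`, as a function of `y = z/(1-z)`;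
here `yb = zb/(1-zb)` and `1 - z = 1/(1+y)`. -/
def blockLevel (ν r s h hb : ℝ) (m : ℕ) (y : ℝ) : ℝ :=
  ∑ j ∈ Finset.Icc (-(m : ℤ)) (m : ℤ),
    blockA ν r s h hb m j * sl2Block r s (hb + j) (1 / (1 + y))

/-! ### The coefficients `C_a^{(n)}` -/

/-- `C_a^{(n)r,s}(h₀, hb)`: `C^{(0)} = S_a`, and for `n > 0`
`C^{(n)}(h₀, hb) = -∑_{m=1}^n ∑_{|j| ≤ m} C^{(n-m)}(h₀, hb-j) A_{m,j}(h₀+n-m, hb-j)`.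
The sum is indexed by `i = n - m`. -/
def coeffC (ν r s a h₀ : ℝ) : ℕ → ℝ → ℝ
  | 0, hb => sl2Coeff r s a hb
  | n + 1, hb =>
    -∑ i : Fin (n + 1), ∑ j ∈ Finset.Icc (-((n + 1 - i : ℕ) : ℤ)) ((n + 1 - i : ℕ) : ℤ),
      coeffC ν r s a h₀ i (hb - j) * blockA ν r s (h₀ + (i : ℕ)) (hb - j) (n + 1 - i) j
  termination_by n => n
  decreasing_by exact i.2

/-! ### Asymptotic expansions in powers and logarithms -/

/-- A formal series `∑ coeff c l · x^{-c} (log x)^l` with finitely many terms `c ≤ N` for each `N`. -/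
structure PowerLogSeries where
  coeff : ℝ → ℕ → ℝ
  finite : ∀ N : ℝ, {t : ℝ × ℕ | t.1 ≤ N ∧ coeff t.1 t.2 ≠ 0}.Finite

/-- The sum of the terms with `c ≤ N`. -/
def PowerLogSeries.trunc (b : PowerLogSeries) (N x : ℝ) : ℝ :=
  ∑ t ∈ (b.finite N).toFinset, b.coeff t.1 t.2 * x ^ (-t.1) * Real.log x ^ t.2

/-- `g` has an asymptotic expansion in powers and logarithms at infinity. -/
def HasExpansion (g : ℝ → ℝ) : Prop :=
  ∃ b : PowerLogSeries, ∀ N : ℝ,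
    (fun x => g x - b.trunc N x) =o[atTop] fun x : ℝ => x ^ (-N)

/-- `g` is smooth near infinity and has an asymptotic expansion in powers and logarithms that may be
differentiated term by term. -/
def HasSmoothExpansion (g : ℝ → ℝ) : Prop :=
  (∃ R : ℝ, ContDiffOn ℝ (⊤ : ℕ∞) g (Set.Ioi R)) ∧
  ∃ b : PowerLogSeries, ∀ (i : ℕ) (N : ℝ),
    iteratedDeriv i (fun x => g x - b.trunc N x) =o[atTop] fun x : ℝ => x ^ (-N - i)

/-- The formal sum
`f(yb, y) = ∑ coeff m k a l · yb^{h∞+m} (log yb)^k y^a (log y)^l`, the base exponent `h∞` being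
given separately. For each `m` and `N` there are finitely many terms with `a ≤ N`. -/
structure LightconeSeries where
  coeff : ℕ → ℕ → ℝ → ℕ → ℝ
  finite : ∀ (m : ℕ) (N : ℝ),
    {t : ℕ × ℝ × ℕ | t.2.1 ≤ N ∧ coeff m t.1 t.2.1 t.2.2 ≠ 0}.Finite

/-- The indices `(k, a, l)` with `a ≤ N` of the terms of `f` proportional to `yb^{h∞+m}`. -/
def LightconeSeries.index (f : LightconeSeries) (m : ℕ) (N : ℝ) : Finset (ℕ × ℝ × ℕ) :=
  (f.finite m N).toFinset

/-- The sum of the terms of `f` of order `yb^{h∞+m}` with `a ≤ N`. -/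
def LightconeSeries.trunc (f : LightconeSeries) (hInf : ℝ) (m : ℕ) (N yb y : ℝ) : ℝ :=
  ∑ t ∈ f.index m N, f.coeff m t.1 t.2.1 t.2.2 *
    (yb ^ (hInf + m) * Real.log yb ^ t.1) * (y ^ t.2.1 * Real.log y ^ t.2.2)

/-! ### Casimir-regular terms, Casimir-singular parts, and the operator `𝒞` -/

/-- Finite linear combinations of Casimir-regular terms for the blocks `k^{r,s}`: the powers
`y^{n-r}` and `y^{n-s}`, `n ∈ ℕ`, and `y^e log y` for the exponents `e` that are of both forms
(for `r = s = 0` these are `y^n` and `y^n log y`). -/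
def casimirRegular (r s : ℝ) : Submodule ℝ (ℝ → ℝ) :=
  Submodule.span ℝ
    ({g | ∃ e : ℝ, ((∃ n : ℕ, e + r = n) ∨ (∃ n : ℕ, e + s = n)) ∧ g = fun y => y ^ e} ∪
     {g | ∃ e : ℝ, ((∃ n : ℕ, e + r = n) ∧ (∃ n : ℕ, e + s = n)) ∧
        g = fun y => y ^ e * Real.log y})

/-- The contribution of spin `ℓ` to order `m` of
`∑_ℓ (∂hb/∂ℓ) p(hb) G^{r,s}_{h(hb),hb}(zb, 1-z)`. -/
def sumTerm (ν r s : ℝ) (p h hb : ℝ → ℝ) (m : ℕ) (yb y ℓ : ℝ) : ℝ :=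
  deriv hb ℓ * p (hb ℓ) * (yb ^ (h (hb ℓ) + m) * blockLevel ν r s (h (hb ℓ)) (hb ℓ) m y)

/-- `∑_{ℓ > ℓ₀} (∂hb/∂ℓ) p(hb) G^{r,s}_{h(hb),hb}(zb, 1-z) = f(yb, y) + [...]_y`, order by order in
the descendant level `m`, for `yb ∈ (0, ε)`: the sum over spins converges for `y > 0`, and as `y → 0⁺`
it has the asymptotic expansion given by `f`, modulo Casimir-regular terms. -/
def HasCasimirSingularPart (ν r s : ℝ) (p h hb : ℝ → ℝ) (ℓ₀ hInf ε : ℝ)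
    (f : LightconeSeries) : Prop :=
  ∀ m : ℕ, ∀ yb ∈ Set.Ioo 0 ε,
    (∀ y > 0, Summable fun ℓ : {ℓ : ℕ // ℓ₀ < ℓ} => sumTerm ν r s p h hb m yb y (ℓ : ℕ)) ∧
    ∀ N : ℝ, ∃ reg ∈ casimirRegular r s,
      (fun y => (∑' ℓ : {ℓ : ℕ // ℓ₀ < ℓ}, sumTerm ν r s p h hb m yb y (ℓ : ℕ))
          - f.trunc hInf m N yb y - reg y) =o[𝓝[>] 0] fun y : ℝ => y ^ N

/-- The `n`-th term of `𝒞^{r,s}` applied to `yb^{h₀} (log yb)^k y^a (log y)^l`, that is, of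
`∂_{h₀}^k ∂_a^l` applied to `𝒞^{r,s}(yb^{h₀} y^a) = ∑_n yb^{h₀+n} C_a^{(n)r,s}(h₀, hb)`. -/
def operatorCTerm (ν r s h₀ : ℝ) (k : ℕ) (a : ℝ) (l n : ℕ) (yb hb : ℝ) : ℝ :=
  iteratedDeriv k
    (fun u : ℝ => iteratedDeriv l (fun α : ℝ => yb ^ (u + n) * coeffC ν r s α u n hb) a) h₀

/-- The terms of order `yb^{h∞+n}` of `(𝒞^{r,s} f)(yb, hb)` that come from the terms of `f` with
`a ≤ N`. -/
def operatorCTrunc (ν r s hInf : ℝ) (f : LightconeSeries) (n : ℕ) (N yb hb : ℝ) : ℝ :=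
  ∑ m ∈ Finset.range (n + 1), ∑ t ∈ f.index m N,
    f.coeff m t.1 t.2.1 t.2.2 *
      operatorCTerm ν r s (hInf + m) t.1 t.2.1 t.2.2 (n - m) yb hb

/-- `p(hb) yb^{h(hb)} ∼ (𝒞^{r,s} f)(yb, hb)` as `hb → ∞`, order by order in the integer step `n` of
`yb^{h∞+n}`: since `h(hb) → h∞`, the left-hand side is of order `n = 0`. The asymptotic scale
`sl2Weight · hb^{-2N-2}` is the growth of `S_N^{r,s}(hb)`. -/
def AsymptoticDensity (ν r s : ℝ) (p h : ℝ → ℝ) (hInf ε : ℝ) (f : LightconeSeries) : Prop :=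
  ∀ n : ℕ, ∀ yb ∈ Set.Ioo 0 ε, ∀ N : ℝ,
    (fun hb => (if n = 0 then p hb * yb ^ h hb else 0) - operatorCTrunc ν r s hInf f n N yb hb)
      =o[atTop] fun hb : ℝ => sl2Weight r s hb * hb ^ (-2 * N - 2)

end Lightcone

end

/-! The proof takes the Mellin transform in y, under which a sum of blocks becomes a Dirichlet-like
series, and reads off the large-weight behaviour of the coefficients from the analytic continuation
of that series.

One-dimensional matching. For large weight H the Mellin transform of a block is an explicit quotient
of Gamma functions (`blockFun_mellin`). Multiplied by ω(H) and by the entire function γ(a) =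
1/(Γ(-a-r)Γ(-a-s)) it collapses to (2H-1) W_a(H), with W_a(H) = Γ(H+a)/Γ(H-a)
(`weight_mul_blockMellin`). At a fixed level and fixed ybar the sum over spins thus becomes a sum of
x'(ℓ) (2x-1) W_a(x) Q(x) over the points x(ℓ) = hb(ℓ) + j. Since x(ℓ) = ℓ + O(1) and the Jacobian x'
is present, Euler–Maclaurin summation shows that replacing these points by the integers changes the
sum only by a function holomorphic in a (`Reparam.zeta_difference`, `gammaRatio_sumComparable`).

The same Mellin transform is also known from the behaviour at y → 0. A term y^α log^l y of f
contributes the polar term γ(a) ∂_α^l (α-a)^{-1}. Casimir-regular terms contribute entire functions,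
because the zeros of γ cancel their poles. A remainder o(y^N) is holomorphic for Re a < N. A
telescoping identity (`telescoping_step`, `kernel_lattice_sum`) shows that the integer sum with Q
replaced by ∂_α^l S_α/ω has exactly the same polar term. So if E is the difference between the
actual and the predicted coefficients, the integer sum of (2H-1) W_a(H) E(H) continues to Re a < N.
Because E has a power-logarithmic expansion, its leading term has a fixed sign, and Landau's
argument on positive series (`isLittleO_of_continuation`) forces E to be correspondingly small. The
result is `coeff_expansion_of_blockSum`.

Logarithms of ybar. The matching holds for every ybar in (0, ε). Writing ybar^h = ybar^{h∞} exp(log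
ybar · (h-h∞)) and expanding the exponential, a Vandermonde argument separates the powers of log
ybar. Hence the terms of f with log^k ybar at level m determine the moments ∑_j p A_{m,j}
(h-h∞)^k/k! (`levelCoeff_expansion`).

Descendants. The recursion for C^{(n)} says that the operators C are a one-sided inverse of the
operators A; by triangularity they are also the inverse on the other side
(`sum_coeffOp_mul_blockOp`). Applying C^{(n-m)}, at the twist h+m, to the level-m sums and adding
over m therefore gives exactly p ybar^h for n = 0 and 0 for n ≥ 1 (`sum_coeffKernel_block_eq`).
Taylor expansion of the kernel of C^{(n-m)} around the twist h∞+m expresses the same sums through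
the moments, hence through f, and the Taylor coefficients reproduce the derivatives ∂_{h₀}^k in the
definition of the operator (`taylor_level`, `operatorCTerm_eventually_eq`).

The Taylor remainder is controlled because A_{m,j} is a rational function of the twist and of 1/H,
regular at (h∞, 0) (`blockA_rational`). For j ≠ 0 the denominators of the recursion grow like H. For
j = 0 they are bounded and nonzero by the hypothesis on h∞, while the numerator has terms of order
H; these cancel thanks to the asymptotic symmetry A_{m,-j} ≈ 16^j A_{m,j}. -/

open Filter Topology Asymptotics

namespace Lightcone

/-! ### Power-logarithmic expansions at infinity -/

/-- The monomial `x^c (log x)^l`. -/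
noncomputable def powerLogMonomial (t : ℝ × ℕ) (x : ℝ) : ℝ := x ^ t.1 * Real.log x ^ t.2

/-- Finite linear combinations of monomials `x^c (log x)^l`. -/
def powerLog : Submodule ℝ (ℝ → ℝ) := Submodule.span ℝ (Set.range powerLogMonomial)

/-- Approximability to every order by finite sums of power-logarithmic monomials. -/
def Expandable (g : ℝ → ℝ) : Prop :=
  ∀ N : ℝ, ∃ u ∈ powerLog, (fun x => g x - u x) =o[atTop] fun x : ℝ => x ^ (-N)

theorem powerLogMonomial_mem (t : ℝ × ℕ) : powerLogMonomial t ∈ powerLog :=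
  Submodule.subset_span ⟨t, rfl⟩

theorem powerLogMonomial_isLittleO {c b : ℝ} (l : ℕ) (h : c < b) :
    powerLogMonomial (c, l) =o[atTop] fun x : ℝ => x ^ b := by
  have h1 : (fun x : ℝ => Real.log x ^ (l : ℝ)) =o[atTop] fun x : ℝ => x ^ (b - c) :=
    isLittleO_log_rpow_rpow_atTop (l : ℝ) (sub_pos.2 h)
  have h2 := (isBigO_refl (fun x : ℝ => x ^ c) atTop).mul_isLittleO h1
  refine h2.congr' ?_ ?_
  · filter_upwards with x
    simp [powerLogMonomial]
  · filter_upwards [eventually_gt_atTop 0] with x hx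
    rw [← Real.rpow_add hx]; ring_nf

theorem rpow_isLittleO_rpow {c b : ℝ} (h : c < b) :
    (fun x : ℝ => x ^ c) =o[atTop] fun x : ℝ => x ^ b := by
  refine (powerLogMonomial_isLittleO 0 h).congr_left fun x => ?_
  simp [powerLogMonomial]

theorem rpow_isBigO_rpow {c b : ℝ} (h : c ≤ b) :
    (fun x : ℝ => x ^ c) =O[atTop] fun x : ℝ => x ^ b := by
  rcases h.eq_or_lt with rfl | h
  · exact isBigO_refl _ _
  · exact (rpow_isLittleO_rpow h).isBigO

theorem rpow_mul_rpow_eventuallyEq (a b : ℝ) :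
    (fun x : ℝ => x ^ a * x ^ b) =ᶠ[atTop] fun x : ℝ => x ^ (a + b) := by
  filter_upwards [eventually_gt_atTop 0] with x hx
  rw [Real.rpow_add hx]

theorem powerLog_isBigO {u : ℝ → ℝ} (hu : u ∈ powerLog) :
    ∃ A : ℝ, u =O[atTop] fun x : ℝ => x ^ A := by
  induction hu using Submodule.span_induction with
  | mem x hx =>
    obtain ⟨t, rfl⟩ := hx
    exact ⟨t.1 + 1, (powerLogMonomial_isLittleO t.2 (by linarith)).isBigO⟩
  | zero => exact ⟨0, isBigO_zero _ _⟩
  | add x y _ _ hx hy =>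
    obtain ⟨A, hA⟩ := hx
    obtain ⟨B, hB⟩ := hy
    exact ⟨max A B, (hA.trans (rpow_isBigO_rpow (le_max_left _ _))).add
      (hB.trans (rpow_isBigO_rpow (le_max_right _ _)))⟩
  | smul a x _ hx =>
    obtain ⟨A, hA⟩ := hx
    exact ⟨A, hA.const_mul_left a⟩

theorem powerLog_mul {u v : ℝ → ℝ} (hu : u ∈ powerLog) (hv : v ∈ powerLog) :
    ∃ w ∈ powerLog, (fun x => u x * v x) =ᶠ[atTop] w := by
  induction hu using Submodule.span_induction with
  | mem u hu =>
    obtain ⟨t, rfl⟩ := hu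
    induction hv using Submodule.span_induction with
    | mem v hv =>
      obtain ⟨t', rfl⟩ := hv
      refine ⟨_, powerLogMonomial_mem (t.1 + t'.1, t.2 + t'.2), ?_⟩
      filter_upwards [eventually_gt_atTop 0] with x hx
      simp only [powerLogMonomial, Real.rpow_add hx, pow_add]
      ring
    | zero => exact ⟨0, zero_mem _, by simp; rfl⟩
    | add v v' _ _ h h' =>
      obtain ⟨w, hw, hw'⟩ := h
      obtain ⟨z, hz, hz'⟩ := h'
      refine ⟨w + z, add_mem hw hz, ?_⟩
      filter_upwards [hw', hz'] with x h1 h2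
      simp only [Pi.add_apply, mul_add, h1, h2]
    | smul a v _ h =>
      obtain ⟨w, hw, hw'⟩ := h
      refine ⟨a • w, Submodule.smul_mem _ _ hw, ?_⟩
      filter_upwards [hw'] with x h1
      simp only [Pi.smul_apply, smul_eq_mul, ← h1]; ring
  | zero => exact ⟨0, zero_mem _, by simp; rfl⟩
  | add v v' _ _ h h' =>
    obtain ⟨w, hw, hw'⟩ := h
    obtain ⟨z, hz, hz'⟩ := h'
    refine ⟨w + z, add_mem hw hz, ?_⟩
    filter_upwards [hw', hz'] with x h1 h2
    simp only [Pi.add_apply, add_mul, h1, h2]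
  | smul a v _ h =>
    obtain ⟨w, hw, hw'⟩ := h
    refine ⟨a • w, Submodule.smul_mem _ _ hw, ?_⟩
    filter_upwards [hw'] with x h1
    simp only [Pi.smul_apply, smul_eq_mul, ← h1]; ring

/-- Order the monomials lexicographically by power and then by power of the logarithm: every other
monomial in the support is negligible against the largest one. -/
theorem powerLog_leading_mem_support {c : (ℝ × ℕ) →₀ ℝ} (hc : c ≠ 0) : ∃ t ∈ c.support,
    (fun x => (c.sum fun i a => a • powerLogMonomial i) x - c t * powerLogMonomial t x)
      =o[atTop] powerLogMonomial t := by
  obtain ⟨t, ht, hmax⟩ := Finset.exists_max_image c.support (fun t => toLex t)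
    (Finsupp.support_nonempty_iff.2 hc)
  refine ⟨t, ht, ?_⟩
  have : (fun x => (c.sum fun i a => a • powerLogMonomial i) x - c t * powerLogMonomial t x)
      = fun x => ∑ i ∈ c.support.erase t, c i * powerLogMonomial i x := by
    ext x
    rw [Finsupp.sum, ← Finset.add_sum_erase _ _ ht]
    simp
  rw [this]
  refine IsLittleO.fun_sum fun i hi => ?_
  rw [Finset.mem_erase] at hi
  refine IsLittleO.const_mul_left ?_ _
  have hlt : toLex i < toLex t := lt_of_le_of_ne (hmax i hi.2) (fun h => hi.1 (toLex.injective h))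
  rw [Prod.Lex.lt_iff] at hlt
  rcases hlt with h1 | ⟨h1, h2⟩
  · simp only [ofLex_toLex] at h1
    have h3 : powerLogMonomial i =o[atTop] fun x : ℝ => x ^ t.1 := powerLogMonomial_isLittleO i.2 h1
    refine h3.trans_isBigO ?_
    refine IsBigO.of_bound 1 ?_
    filter_upwards [eventually_ge_atTop (Real.exp 1)] with x hx
    have hl : 1 ≤ Real.log x := by
      rw [Real.le_log_iff_exp_le (lt_of_lt_of_le (Real.exp_pos 1) hx)]; exact hx
    rw [one_mul, powerLogMonomial, norm_mul]
    refine le_mul_of_one_le_right (norm_nonneg _) ?_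
    rw [norm_pow, Real.norm_eq_abs, abs_of_nonneg (by linarith)]
    exact one_le_pow₀ hl
  · simp only [ofLex_toLex] at h1 h2
    have h3 : (fun x : ℝ => Real.log x ^ i.2) =o[atTop] fun x => Real.log x ^ t.2 :=
      (isLittleO_pow_pow_atTop_of_lt h2).comp_tendsto Real.tendsto_log_atTop
    have h4 := (isBigO_refl (fun x : ℝ => x ^ t.1) atTop).mul_isLittleO h3
    refine h4.congr' (Eventually.of_forall fun x => ?_) (Eventually.of_forall fun x => ?_)
    · simp [powerLogMonomial, h1]
    · simp [powerLogMonomial]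

/-- A nonzero power-logarithmic sum is asymptotic to a multiple of one monomial. -/
theorem powerLog_leading {u : ℝ → ℝ} (hu : u ∈ powerLog) :
    u = 0 ∨ ∃ κ : ℝ, κ ≠ 0 ∧ ∃ t : ℝ × ℕ,
      (fun x => u x - κ * powerLogMonomial t x) =o[atTop] powerLogMonomial t := by
  obtain ⟨c, rfl⟩ := (Finsupp.mem_span_range_iff_exists_finsupp).1 hu
  rcases eq_or_ne c 0 with rfl | h
  · left; simp
  · obtain ⟨t, ht, h⟩ := powerLog_leading_mem_support h
    exact Or.inr ⟨c t, Finsupp.mem_support_iff.1 ht, t, h⟩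

theorem Expandable.of_mem {u : ℝ → ℝ} (hu : u ∈ powerLog) : Expandable u :=
  fun N => ⟨u, hu, by simp⟩

theorem Expandable.congr' {f g : ℝ → ℝ} (hf : Expandable f) (h : f =ᶠ[atTop] g) :
    Expandable g := fun N => by
  obtain ⟨u, hu, hu'⟩ := hf N
  refine ⟨u, hu, hu'.congr' ?_ EventuallyEq.rfl⟩
  filter_upwards [h] with x hx
  rw [hx]

theorem Expandable.isBigO {f : ℝ → ℝ} (hf : Expandable f) :
    ∃ A : ℝ, f =O[atTop] fun x : ℝ => x ^ A := by
  obtain ⟨u, hu, hu'⟩ := hf 0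
  obtain ⟨A, hA⟩ := powerLog_isBigO hu
  refine ⟨max A (-0), ?_⟩
  have := (hu'.isBigO.trans (rpow_isBigO_rpow (le_max_right A (-0)))).add
    (hA.trans (rpow_isBigO_rpow (le_max_left A (-0))))
  simpa using this

theorem Expandable.add {f g : ℝ → ℝ} (hf : Expandable f) (hg : Expandable g) :
    Expandable fun x => f x + g x := fun N => by
  obtain ⟨u, hu, hu'⟩ := hf N
  obtain ⟨v, hv, hv'⟩ := hg N
  refine ⟨u + v, add_mem hu hv, (hu'.add hv').congr_left fun x => ?_⟩
  simp only [Pi.add_apply]; ring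

theorem Expandable.const_mul {f : ℝ → ℝ} (a : ℝ) (hf : Expandable f) :
    Expandable fun x => a * f x := fun N => by
  obtain ⟨u, hu, hu'⟩ := hf N
  refine ⟨a • u, Submodule.smul_mem _ _ hu, (hu'.const_mul_left a).congr_left fun x => ?_⟩
  simp only [Pi.smul_apply, smul_eq_mul]; ring

theorem Expandable.neg {f : ℝ → ℝ} (hf : Expandable f) : Expandable fun x => -f x := by
  simpa using hf.const_mul (-1)

theorem Expandable.sub {f g : ℝ → ℝ} (hf : Expandable f) (hg : Expandable g) :
    Expandable fun x => f x - g x := by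
  simpa [sub_eq_add_neg] using hf.add hg.neg

theorem Expandable.mul {f g : ℝ → ℝ} (hf : Expandable f) (hg : Expandable g) :
    Expandable fun x => f x * g x := fun N => by
  obtain ⟨A, hA⟩ := hg.isBigO
  -- Since fg - uv = (f-u)g + u(g-v), the approximation orders are raised by the growth exponents A
  -- of g and B of u.
  obtain ⟨u, hu, hu'⟩ := hf (N + A)
  obtain ⟨B, hB⟩ := powerLog_isBigO hu
  obtain ⟨v, hv, hv'⟩ := hg (N + B)
  obtain ⟨w, hw, hw'⟩ := powerLog_mul hu hv
  refine ⟨w, hw, ?_⟩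
  have h1 := (hu'.mul_isBigO hA).trans_eventuallyEq (rpow_mul_rpow_eventuallyEq (-(N + A)) A)
  have h2 := (hB.mul_isLittleO hv').trans_eventuallyEq (rpow_mul_rpow_eventuallyEq B (-(N + B)))
  have e1 : -(N + A) + A = -N := by ring
  have e2 : B + -(N + B) = -N := by ring
  rw [e1] at h1
  rw [e2] at h2
  refine (h1.add h2).congr' ?_ EventuallyEq.rfl
  filter_upwards [hw'] with x hx
  rw [← hx]; ring

theorem Expandable.rpow_mul_log (c : ℝ) (l : ℕ) :
    Expandable fun x : ℝ => x ^ c * Real.log x ^ l :=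
  Expandable.of_mem (powerLogMonomial_mem (c, l))

theorem Expandable.rpow (c : ℝ) : Expandable fun x : ℝ => x ^ c := by
  simpa using Expandable.rpow_mul_log c 0

theorem Expandable.const (a : ℝ) : Expandable fun _ => a := by
  simpa using (Expandable.rpow 0).const_mul a

theorem Expandable.inv_id : Expandable fun x => x⁻¹ := by
  simpa [Real.rpow_neg_one] using Expandable.rpow (-1)

theorem Expandable.log : Expandable Real.log := by
  simpa using Expandable.rpow_mul_log 0 1

theorem Expandable.sum {ι : Type*} {f : ι → ℝ → ℝ} {S : Finset ι}
    (h : ∀ i ∈ S, Expandable (f i)) : Expandable fun x => ∑ i ∈ S, f i x := by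
  classical
  induction S using Finset.induction_on with
  | empty => simpa using Expandable.const 0
  | insert i S hi ih =>
    simp only [Finset.sum_insert hi]
    exact (h i (by simp)).add (ih fun j hj => h j (by simp [hj]))

theorem Expandable.pow {f : ℝ → ℝ} (hf : Expandable f) (n : ℕ) :
    Expandable fun x => f x ^ n := by
  induction n with
  | zero => simpa using Expandable.const 1
  | succ n ih => simpa [pow_succ] using ih.mul hf

theorem Expandable.of_approx {f : ℝ → ℝ}
    (h : ∀ N : ℝ, ∃ g, Expandable g ∧ (fun x => f x - g x) =o[atTop] fun x : ℝ => x ^ (-N)) :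
    Expandable f := fun N => by
  obtain ⟨g, hg, hg'⟩ := h N
  obtain ⟨u, hu, hu'⟩ := hg N
  exact ⟨u, hu, (hg'.add hu').congr_left fun x => by ring⟩

/-- An expandable function is negligible to order `N`, or is asymptotic to a monomial. -/
theorem Expandable.leading {f : ℝ → ℝ} (hf : Expandable f) (N : ℝ) :
    (f =o[atTop] fun x : ℝ => x ^ (-N)) ∨ ∃ κ : ℝ, κ ≠ 0 ∧ ∃ t : ℝ × ℕ, -N ≤ t.1 ∧
      (fun x => f x - κ * powerLogMonomial t x) =o[atTop] powerLogMonomial t := by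
  obtain ⟨u, hu, hu'⟩ := hf N
  rcases powerLog_leading hu with rfl | ⟨κ, hκ, t, ht⟩
  · left; simpa using hu'
  · rcases lt_or_ge t.1 (-N) with h | h
    · left
      have h1 : powerLogMonomial t =o[atTop] fun x : ℝ => x ^ (-N) :=
        powerLogMonomial_isLittleO t.2 h
      have h2 := (hu'.add (ht.trans h1)).add (h1.const_mul_left κ)
      exact h2.congr_left fun x => by ring
    · right
      refine ⟨κ, hκ, t, h, ?_⟩
      have h1 : (fun x : ℝ => x ^ (-N)) =O[atTop] powerLogMonomial t := by
        refine (rpow_isBigO_rpow h).trans (IsBigO.of_bound 1 ?_)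
        filter_upwards [eventually_ge_atTop (Real.exp 1)] with x hx
        have hl : 1 ≤ Real.log x := by
          rw [Real.le_log_iff_exp_le (lt_of_lt_of_le (Real.exp_pos 1) hx)]; exact hx
        rw [one_mul, powerLogMonomial, norm_mul]
        refine le_mul_of_one_le_right (norm_nonneg _) ?_
        rw [norm_pow, Real.norm_eq_abs, abs_of_nonneg (by linarith)]
        exact one_le_pow₀ hl
      exact ((hu'.trans_isBigO h1).add ht).congr_left fun x => by ring

theorem isBigO_powerLogMonomial_of_leading {f : ℝ → ℝ} {κ : ℝ} (hκ : κ ≠ 0) {t : ℝ × ℕ}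
    (h : (fun x => f x - κ * powerLogMonomial t x) =o[atTop] powerLogMonomial t) :
    powerLogMonomial t =O[atTop] f := by
  have h1 : (fun x => f x - κ * powerLogMonomial t x) =o[atTop]
      fun x => κ * powerLogMonomial t x := h.trans_isBigO (isBigO_self_const_mul hκ _ _)
  exact (isBigO_self_const_mul hκ _ _).trans (IsEquivalent.isBigO_symm h1)

/-- An expandable function tending to zero decays like a negative power. -/
theorem Expandable.isBigO_of_tendsto_zero {f : ℝ → ℝ} (hf : Expandable f)
    (h0 : Tendsto f atTop (𝓝 0)) : ∃ δ : ℝ, 0 < δ ∧ f =O[atTop] fun x : ℝ => x ^ (-δ) := by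
  rcases hf.leading 1 with h | ⟨κ, hκ, t, -, ht⟩
  · exact ⟨1, one_pos, h.isBigO⟩
  · have hb := isBigO_powerLogMonomial_of_leading hκ ht
    -- A monomial with nonnegative power is at least 1 for x ≥ e, which contradicts the limit 0.
    have hlt : t.1 < 0 := by
      by_contra hcon
      have h1 : Tendsto (powerLogMonomial t) atTop (𝓝 0) := hb.trans_tendsto h0
      have h2 : ∀ᶠ x in atTop, 1 ≤ powerLogMonomial t x := by
        filter_upwards [eventually_ge_atTop (Real.exp 1), eventually_ge_atTop 1] with x hx hx1
        have hl : 1 ≤ Real.log x := by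
          rw [Real.le_log_iff_exp_le (lt_of_lt_of_le (Real.exp_pos 1) hx)]; exact hx
        exact one_le_mul_of_one_le_of_one_le (Real.one_le_rpow hx1 (not_lt.1 hcon)) (one_le_pow₀ hl)
      have h3 := h1.eventually (gt_mem_nhds (show (0 : ℝ) < 1 by norm_num))
      obtain ⟨x, hx, hx'⟩ := (h2.and h3).exists
      linarith
    -- Half of the decay is given up to absorb the logarithms.
    refine ⟨-t.1 / 2, by linarith, ?_⟩
    have h1 : powerLogMonomial t =o[atTop] fun x : ℝ => x ^ (-(-t.1 / 2)) :=
      powerLogMonomial_isLittleO t.2 (by linarith)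
    have h2 := (ht.trans h1).add (h1.const_mul_left κ)
    exact (h2.congr_left fun x => by ring).isBigO

/-- As f is O(x^{-δ}), the K-th Taylor remainder of φ is O(x^{-Kδ}); once Kδ > N only a polynomial
in f remains. -/
theorem Expandable.analytic_comp {f φ : ℝ → ℝ} (hf : Expandable f)
    (h0 : Tendsto f atTop (𝓝 0)) (hφ : AnalyticAt ℝ φ 0) : Expandable fun x => φ (f x) := by
  obtain ⟨δ, hδ, hfδ⟩ := hf.isBigO_of_tendsto_zero h0
  obtain ⟨p, hp⟩ := hφ
  refine Expandable.of_approx fun N => ?_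
  obtain ⟨K, hK⟩ := exists_nat_gt (N / δ)
  have hKN : N < K * δ := (div_lt_iff₀ hδ).1 hK
  refine ⟨fun x => p.partialSum K (f x), ?_, ?_⟩
  · simp only [FormalMultilinearSeries.partialSum]
    refine Expandable.sum fun i _ => ?_
    have : (fun x => p i fun _ => f x) = fun x => p.coeff i * f x ^ i := by
      ext x
      rw [FormalMultilinearSeries.apply_eq_pow_smul_coeff, smul_eq_mul, mul_comm]
    rw [this]
    exact (hf.pow i).const_mul _
  · have h1 := (hp.isBigO_sub_partialSum_pow K).comp_tendsto h0
    have h2 : (fun x => ‖f x‖ ^ K) =O[atTop] fun x : ℝ => (x ^ (-δ)) ^ K := hfδ.norm_left.pow K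
    have h3 : (fun x : ℝ => (x ^ (-δ)) ^ K) =ᶠ[atTop] fun x => x ^ (-(K * δ)) := by
      filter_upwards [eventually_gt_atTop 0] with x hx
      rw [← Real.rpow_natCast, ← Real.rpow_mul hx.le]; ring_nf
    have h4 := (h1.trans (h2.trans_eventuallyEq h3)).trans_isLittleO
      (rpow_isLittleO_rpow (show -(K * δ) < -N by linarith))
    simpa [Function.comp_def] using h4

theorem Expandable.inv {f : ℝ → ℝ} (hf : Expandable f) {d : ℝ} (hd : d ≠ 0)
    (h : Tendsto f atTop (𝓝 d)) : Expandable fun x => (f x)⁻¹ := by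
  have h1 : Tendsto (fun x => f x - d) atTop (𝓝 0) := by simpa using h.sub_const d
  have h2 : AnalyticAt ℝ (fun t : ℝ => (t + d)⁻¹) 0 :=
    (analyticAt_id.add analyticAt_const).inv (by simpa using hd)
  simpa using (hf.sub (Expandable.const d)).analytic_comp h1 h2

theorem Expandable.const_rpow {f : ℝ → ℝ} (hf : Expandable f) {d b : ℝ} (hb : 0 < b)
    (h : Tendsto f atTop (𝓝 d)) : Expandable fun x => b ^ f x := by
  have h1 : Tendsto (fun x => f x - d) atTop (𝓝 0) := by simpa using h.sub_const d
  have h2 : AnalyticAt ℝ (fun t : ℝ => Real.exp (Real.log b * (t + d))) 0 := by fun_prop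
  have := (hf.sub (Expandable.const d)).analytic_comp h1 h2
  simpa [Real.rpow_def_of_pos hb] using this

theorem tendsto_const_div_atTop_zero (j : ℝ) : Tendsto (fun x : ℝ => j * x⁻¹) atTop (𝓝 0) := by
  simpa using tendsto_inv_atTop_zero.const_mul j

theorem isLittleO_comp_add_const {f : ℝ → ℝ} {c : ℝ} (j : ℝ)
    (h : f =o[atTop] fun x : ℝ => x ^ c) :
    (fun x => f (x + j)) =o[atTop] fun x : ℝ => x ^ c := by
  have h1 := h.comp_tendsto (tendsto_atTop_add_const_right atTop j tendsto_id)
  refine h1.trans_isBigO ?_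
  have h2 : Tendsto (fun x : ℝ => (1 + j * x⁻¹) ^ c) atTop (𝓝 1) := by
    have := ((tendsto_const_div_atTop_zero j).const_add 1).rpow_const (p := c) (by simp)
    simpa using this
  have h3 : (fun x : ℝ => x ^ c * (1 + j * x⁻¹) ^ c) =O[atTop] fun x : ℝ => x ^ c * 1 :=
    (isBigO_refl _ _).mul (h2.isBigO_one ℝ)
  refine h3.congr' ?_ (by simp)
  filter_upwards [eventually_gt_atTop 0, eventually_gt_atTop (-j)] with x hx hj
  have : 0 ≤ 1 + j * x⁻¹ := by
    rw [show 1 + j * x⁻¹ = (x + j) / x by field_simp]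
    exact div_nonneg (by linarith) hx.le
  rw [← Real.mul_rpow hx.le this]
  simp only [Function.comp, id]
  congr 1
  field_simp

/-- Writing x + j = x(1 + j/x), the power (x+j)^c is x^c times, and log(x+j) is log x plus, an
analytic function of 1/x. -/
theorem Expandable.comp_add_const {f : ℝ → ℝ} (hf : Expandable f) (j : ℝ) :
    Expandable fun x => f (x + j) := by
  refine Expandable.of_approx fun N => ?_
  obtain ⟨u, hu, hu'⟩ := hf N
  refine ⟨fun x => u (x + j), ?_, isLittleO_comp_add_const j hu'⟩
  clear hu'
  induction hu using Submodule.span_induction with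
  | mem u hu =>
    obtain ⟨⟨c, l⟩, rfl⟩ := hu
    have e1 : Expandable fun x : ℝ => (1 + j * x⁻¹) ^ c := by
      have h2 : AnalyticAt ℝ (fun t : ℝ => (1 + t) ^ c) 0 := by
        have h3 : AnalyticAt ℝ (fun t : ℝ => Real.exp (Real.log (1 + t) * c)) 0 :=
          (AnalyticAt.mul (AnalyticAt.log (by fun_prop) (by simp)) analyticAt_const).rexp
        refine h3.congr ?_
        filter_upwards [lt_mem_nhds (show (-1 : ℝ) < 0 by norm_num)] with t ht
        rw [Real.rpow_def_of_pos (by linarith)]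
      exact (Expandable.inv_id.const_mul j).analytic_comp (tendsto_const_div_atTop_zero j) h2
    have e2 : Expandable fun x : ℝ => Real.log (1 + j * x⁻¹) := by
      have h2 : AnalyticAt ℝ (fun t : ℝ => Real.log (1 + t)) 0 := by
        apply AnalyticAt.log <;> first | fun_prop | simp
      exact (Expandable.inv_id.const_mul j).analytic_comp (tendsto_const_div_atTop_zero j) h2
    refine (((Expandable.rpow c).mul e1).mul ((Expandable.log.add e2).pow l)).congr' ?_
    filter_upwards [eventually_gt_atTop 0, eventually_gt_atTop (-j)] with x hx hj
    have h1 : 0 < 1 + j * x⁻¹ := by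
      rw [show 1 + j * x⁻¹ = (x + j) / x by field_simp]
      exact div_pos (by linarith) hx
    rw [← Real.mul_rpow hx.le h1.le, ← Real.log_mul hx.ne' h1.ne', powerLogMonomial]
    have : x * (1 + j * x⁻¹) = x + j := by field_simp
    rw [this]
  | zero => simpa using Expandable.const 0
  | add u v _ _ h1 h2 => simpa using h1.add h2
  | smul a u _ h => simpa using h.const_mul a

theorem HasExpansion.expandable {g : ℝ → ℝ} (h : HasExpansion g) : Expandable g := fun N => by
  obtain ⟨b, hb⟩ := h
  refine ⟨b.trunc N, ?_, hb N⟩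
  have : b.trunc N = ∑ t ∈ (b.finite N).toFinset,
      b.coeff t.1 t.2 • powerLogMonomial (-t.1, t.2) := by
    ext x
    simp [PowerLogSeries.trunc, powerLogMonomial, mul_assoc]
  rw [this]
  exact Submodule.sum_mem _ fun t _ => Submodule.smul_mem _ _ (powerLogMonomial_mem _)

/-! ### Symbol estimates for holomorphic families -/

/-- `g w H` is, for `H` large, holomorphic in `w ∈ Ω` and bounded by a multiple of `H ^ σ w`. -/
@[reducible] def SymbolBound (Ω : Set ℂ) (σ : ℂ → ℝ) (g : ℂ → ℝ → ℂ) : Prop :=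
  ∃ C : ℝ, ∀ᶠ H : ℝ in atTop,
    DifferentiableOn ℂ (fun w => g w H) Ω ∧ ∀ w ∈ Ω, ‖g w H‖ ≤ C * H ^ σ w

/-- `g w H` is, for `H` large, holomorphic in `w ∈ Ω`, bounded by a multiple of `H ^ σ w`, and `n`
times differentiable in `H`, each derivative lowering the exponent by one. -/
@[reducible] def SymbolFamily (Ω : Set ℂ) : ℕ → (ℂ → ℝ) → (ℂ → ℝ → ℂ) → Prop
  | 0, σ, g => SymbolBound Ω σ g
  | n + 1, σ, g => SymbolBound Ω σ g ∧ ∃ g', SymbolFamily Ω n (fun w => σ w - 1) g' ∧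
      ∀ᶠ H : ℝ in atTop, ∀ w ∈ Ω, HasDerivAt (g w) (g' w H) H

namespace SymbolFamily

variable {Ω : Set ℂ} {σ τ : ℂ → ℝ} {f g : ℂ → ℝ → ℂ}

theorem to_zero : ∀ {n : ℕ}, SymbolFamily Ω n σ g → SymbolFamily Ω 0 σ g
  | 0, h => h
  | _ + 1, h => h.1

theorem of_succ : ∀ {n : ℕ} {σ : ℂ → ℝ} {g : ℂ → ℝ → ℂ},
    SymbolFamily Ω (n + 1) σ g → SymbolFamily Ω n σ g
  | 0, _, _, h => h.1
  | _ + 1, _, _, ⟨h, g', h1, h2⟩ => ⟨h, g', of_succ h1, h2⟩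

theorem congr_exp {n : ℕ} (h : SymbolFamily Ω n σ g) (e : ∀ w, σ w = τ w) :
    SymbolFamily Ω n τ g := by
  have : σ = τ := funext e
  rwa [← this]

theorem add : ∀ {n : ℕ} {σ : ℂ → ℝ} {f g : ℂ → ℝ → ℂ}, SymbolFamily Ω n σ f →
    SymbolFamily Ω n σ g → SymbolFamily Ω n σ fun w H => f w H + g w H
  | 0, σ, f, g, ⟨C, hf⟩, ⟨D, hg⟩ => by
    refine ⟨C + D, ?_⟩
    filter_upwards [hf, hg] with H h1 h2
    refine ⟨h1.1.add h2.1, fun w hw => ?_⟩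
    calc ‖f w H + g w H‖ ≤ ‖f w H‖ + ‖g w H‖ := norm_add_le _ _
      _ ≤ C * H ^ σ w + D * H ^ σ w := add_le_add (h1.2 w hw) (h2.2 w hw)
      _ = _ := by ring
  | n + 1, σ, f, g, ⟨hf, f', hf', hf''⟩, ⟨hg, g', hg', hg''⟩ => by
    refine ⟨add (n := 0) hf hg, fun w H => f' w H + g' w H, add hf' hg', ?_⟩
    filter_upwards [hf'', hg''] with H h1 h2 w hw
    exact (h1 w hw).add (h2 w hw)

theorem mul : ∀ {n : ℕ} {σ τ : ℂ → ℝ} {f g : ℂ → ℝ → ℂ}, SymbolFamily Ω n σ f →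
    SymbolFamily Ω n τ g → SymbolFamily Ω n (fun w => σ w + τ w) fun w H => f w H * g w H
  | 0, σ, τ, f, g, ⟨C, hf⟩, ⟨D, hg⟩ => by
    refine ⟨C * D, ?_⟩
    filter_upwards [hf, hg, eventually_gt_atTop 0] with H h1 h2 hH
    refine ⟨h1.1.mul h2.1, fun w hw => ?_⟩
    calc ‖f w H * g w H‖ = ‖f w H‖ * ‖g w H‖ := norm_mul _ _
      _ ≤ (C * H ^ σ w) * (D * H ^ τ w) :=
        mul_le_mul (h1.2 w hw) (h2.2 w hw) (norm_nonneg _) ((norm_nonneg _).trans (h1.2 w hw))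
      _ = _ := by rw [Real.rpow_add hH]; ring
  | n + 1, σ, τ, f, g, hF@⟨hf, f', hf', hf''⟩, hG@⟨hg, g', hg', hg''⟩ => by
    refine ⟨mul (n := 0) hf hg, fun w H => f' w H * g w H + f w H * g' w H,
      add ((mul hf' (of_succ hG)).congr_exp fun w => by ring)
        ((mul (of_succ hF) hg').congr_exp fun w => by ring), ?_⟩
    filter_upwards [hf'', hg''] with H h1 h2 w hw
    exact (h1 w hw).mul (h2 w hw)

theorem neg {n : ℕ} (h : SymbolFamily Ω n σ g) : SymbolFamily Ω n σ fun w H => -g w H := by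
  induction n generalizing σ g with
  | zero =>
    obtain ⟨C, hC⟩ := h
    refine ⟨C, hC.mono fun H h => ⟨h.1.neg, fun w hw => ?_⟩⟩
    simpa using h.2 w hw
  | succ n ih =>
    obtain ⟨⟨C, hC⟩, g', h1, h2⟩ := h
    refine ⟨⟨C, hC.mono fun H h => ⟨h.1.neg, fun w hw => by simpa using h.2 w hw⟩⟩, _, ih h1, ?_⟩
    filter_upwards [h2] with H h w hw
    exact (h w hw).neg

theorem const (n : ℕ) (c : ℂ) : SymbolFamily Ω n (fun _ => 0) fun _ _ => c := by
  have key : ∀ (n : ℕ) (σ : ℂ → ℝ), SymbolFamily Ω n σ fun _ _ => 0 := by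
    intro n
    induction n with
    | zero =>
      intro σ
      refine ⟨0, Eventually.of_forall fun H => ⟨differentiableOn_const _, fun w _ => by simp⟩⟩
    | succ n ih =>
      intro σ
      refine ⟨⟨0, Eventually.of_forall fun H => ⟨differentiableOn_const _, fun w _ => by simp⟩⟩,
        fun _ _ => 0, ih _, Eventually.of_forall fun H w _ => hasDerivAt_const _ _⟩
  have h0 : SymbolFamily Ω 0 (fun _ => 0) fun _ _ => c :=
    ⟨‖c‖, Eventually.of_forall fun H => ⟨differentiableOn_const _, fun w _ => by simp⟩⟩
  cases n with
  | zero => exact h0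
  | succ n => exact ⟨h0, fun _ _ => 0, key _ _,
      Eventually.of_forall fun H w _ => hasDerivAt_const _ _⟩

/-- The reciprocal of a symbol of order zero that is bounded below. -/
theorem inv {n : ℕ} (h : SymbolFamily Ω n (fun _ => 0) g) {m : ℝ} (hm : 0 < m)
    (hlow : ∀ᶠ H : ℝ in atTop, ∀ w ∈ Ω, m ≤ ‖g w H‖) :
    SymbolFamily Ω n (fun _ => 0) fun w H => (g w H)⁻¹ := by
  have h0 : SymbolFamily Ω 0 (fun _ => 0) fun w H => (g w H)⁻¹ := by
    obtain ⟨C, hC⟩ := h.to_zero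
    refine ⟨m⁻¹, ?_⟩
    filter_upwards [hC, hlow] with H h1 h2
    refine ⟨h1.1.inv fun w hw h0 => ?_, fun w hw => ?_⟩
    · have := h2 w hw
      rw [h0, norm_zero] at this
      linarith
    · rw [norm_inv, Real.rpow_zero, mul_one]
      exact inv_anti₀ hm (h2 w hw)
  induction n with
  | zero => exact h0
  | succ n ih =>
    have ih' := ih h.of_succ
    obtain ⟨-, g', h1, h2⟩ := h
    refine ⟨h0, fun w H => -(g' w H * ((g w H)⁻¹ * (g w H)⁻¹)), ?_, ?_⟩
    · exact ((h1.mul (ih'.mul ih')).neg).congr_exp fun w => by simp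
    · filter_upwards [h2, hlow] with H h3 h4 w hw
      have hne : g w H ≠ 0 := fun h0 => by
        have := h4 w hw
        rw [h0, norm_zero] at this
        linarith
      refine ((h3 w hw).inv hne).congr_deriv ?_
      field_simp

/-- Each H-derivative lowers the exponent by one and multiplies the coefficient by c - w, which is
holomorphic and bounded because Ω is bounded. The induction therefore runs over all coefficients κ.
-/
theorem cpow (n : ℕ) {κ : ℂ → ℂ} (hκ : DifferentiableOn ℂ κ Ω) {B : ℝ} (hB : ∀ w ∈ Ω, ‖κ w‖ ≤ B)
    {M : ℝ} (hM : ∀ w ∈ Ω, ‖w‖ ≤ M) (c : ℝ) :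
    SymbolFamily Ω n (fun w => c - w.re) fun w H => κ w * (H : ℂ) ^ ((c : ℂ) - w) := by
  have h0 : ∀ {κ : ℂ → ℂ} (_ : DifferentiableOn ℂ κ Ω) {B : ℝ} (_ : ∀ w ∈ Ω, ‖κ w‖ ≤ B) (c : ℝ),
      SymbolFamily Ω 0 (fun w => c - w.re) fun w H => κ w * (H : ℂ) ^ ((c : ℂ) - w) := by
    intro κ hκ B hB c
    refine ⟨B, ?_⟩
    filter_upwards [eventually_gt_atTop 0] with H hH
    refine ⟨hκ.mul fun w _ => ?_, fun w hw => ?_⟩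
    · refine (DifferentiableAt.const_cpow (by fun_prop) (Or.inl ?_)).differentiableWithinAt
      exact_mod_cast hH.ne'
    · rw [norm_mul, Complex.norm_cpow_eq_rpow_re_of_pos hH]
      simpa using mul_le_mul_of_nonneg_right (hB w hw) (Real.rpow_nonneg hH.le (c - w.re))
  induction n generalizing κ B c with
  | zero => exact h0 hκ hB c
  | succ n ih =>
    refine ⟨h0 hκ hB c, fun w H => κ w * ((c : ℂ) - w) * (H : ℂ) ^ (((c - 1 : ℝ) : ℂ) - w), ?_, ?_⟩
    · refine (ih (κ := fun w => κ w * ((c : ℂ) - w)) (hκ.mul (by fun_prop)) (B := B * (|c| + M))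
        (fun w hw => ?_) (c - 1)).congr_exp fun w => by ring
      rw [norm_mul]
      refine mul_le_mul (hB w hw) ?_ (norm_nonneg _) ((norm_nonneg _).trans (hB w hw))
      refine (norm_sub_le _ _).trans (add_le_add ?_ (hM w hw))
      simp
    · filter_upwards [eventually_gt_atTop 0] with H hH w _
      -- Where the exponent vanishes the power is constant in H, and the factor c - w makes the
      -- claimed derivative zero.
      by_cases hcw : (c : ℂ) - w = 0
      · simp only [hcw, Complex.cpow_zero, mul_zero, zero_mul]
        exact hasDerivAt_const _ _
      · have h1 := (hasDerivAt_ofReal_cpow_const hH.ne' hcw).const_mul (κ w)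
        refine h1.congr_deriv ?_
        push_cast
        rw [mul_assoc]
        congr 3
        ring

/-- Composition with a reparametrization `x(ℓ) = ℓ + O(1)`, `x' = q ∘ x` with `q` of order zero. -/
theorem comp {n : ℕ} {x : ℝ → ℝ} {q : ℝ → ℝ} {M B : ℝ} (hM : ∀ w ∈ Ω, |σ w| ≤ M)
    (hq : SymbolFamily Ω n (fun _ => 0) fun _ H => (q H : ℂ))
    (hx : ∀ᶠ ℓ : ℝ in atTop, HasDerivAt x (q (x ℓ)) ℓ) (hB : ∀ᶠ ℓ : ℝ in atTop, |x ℓ - ℓ| ≤ B)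
    (h : SymbolFamily Ω n σ g) : SymbolFamily Ω n σ fun w ℓ => g w (x ℓ) := by
  have htop : Tendsto x atTop atTop := by
    refine tendsto_atTop_mono' atTop ?_ (tendsto_atTop_add_const_right atTop (-B) tendsto_id)
    filter_upwards [hB] with ℓ h
    have := (abs_le.1 h).1
    simp only [id]; linarith
  have h0 : ∀ {σ : ℂ → ℝ} {M : ℝ} {g : ℂ → ℝ → ℂ} (_ : ∀ w ∈ Ω, |σ w| ≤ M),
      SymbolFamily Ω 0 σ g → SymbolFamily Ω 0 σ fun w ℓ => g w (x ℓ) := by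
    rintro σ M g hM ⟨C, hC⟩
    -- Eventually ℓ/2 ≤ x(ℓ) ≤ 2ℓ, so x^σ is at most 2^|σ| ≤ 2^M times ℓ^σ, whatever the sign of σ.
    refine ⟨|C| * 2 ^ M, ?_⟩
    filter_upwards [htop.eventually hC, hB, eventually_gt_atTop (2 * B), eventually_gt_atTop 0]
      with ℓ h1 h2 h3 h4
    refine ⟨h1.1, fun w hw => (h1.2 w hw).trans ?_⟩
    have h5 := abs_le.1 h2
    have hB0 : 0 ≤ B := (abs_nonneg _).trans h2
    have h6 : ℓ / 2 ≤ x ℓ := by linarith [h5.1]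
    have h7 : x ℓ ≤ 2 * ℓ := by linarith [h5.2]
    have hx0 : 0 < x ℓ := by linarith
    have key : x ℓ ^ σ w ≤ 2 ^ M * ℓ ^ σ w := by
      have hM' := abs_le.1 (hM w hw)
      rcases le_total 0 (σ w) with hs | hs
      · calc x ℓ ^ σ w ≤ (2 * ℓ) ^ σ w := Real.rpow_le_rpow hx0.le h7 hs
          _ = 2 ^ σ w * ℓ ^ σ w := Real.mul_rpow (by norm_num) h4.le
          _ ≤ _ := mul_le_mul_of_nonneg_right
            (Real.rpow_le_rpow_of_exponent_le (by norm_num) hM'.2) (Real.rpow_nonneg h4.le _)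
      · calc x ℓ ^ σ w ≤ (ℓ / 2) ^ σ w := Real.rpow_le_rpow_of_nonpos (by linarith) h6 hs
          _ = 2 ^ (-σ w) * ℓ ^ σ w := by
            rw [Real.div_rpow h4.le (by norm_num), Real.rpow_neg (by norm_num)]; field_simp
          _ ≤ _ := mul_le_mul_of_nonneg_right
            (Real.rpow_le_rpow_of_exponent_le (by norm_num) (by linarith)) (Real.rpow_nonneg h4.le _)
    calc C * x ℓ ^ σ w ≤ |C| * x ℓ ^ σ w :=
          mul_le_mul_of_nonneg_right (le_abs_self _) (Real.rpow_nonneg hx0.le _)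
      _ ≤ |C| * (2 ^ M * ℓ ^ σ w) := mul_le_mul_of_nonneg_left key (abs_nonneg _)
      _ = _ := by ring
  induction n generalizing σ M g with
  | zero => exact h0 hM h
  | succ n ih =>
    obtain ⟨hg, g', hg', hd⟩ := h
    refine ⟨h0 hM hg, fun w ℓ => (q (x ℓ) : ℂ) * g' w (x ℓ), ?_, ?_⟩
    · have h1 : SymbolFamily Ω n (fun w => σ w - 1) fun w H => (q H : ℂ) * g' w H :=
        (hq.of_succ.mul hg').congr_exp fun w => by simp
      exact ih (M := M + 1) (fun w hw => (abs_sub _ _).trans (by simpa using hM w hw)) hq.of_succ h1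
    · filter_upwards [htop.eventually hd, hx] with ℓ h1 h2 w hw
      have h3 := (h1 w hw).scomp ℓ h2
      rwa [Complex.real_smul] at h3

/-- Unfolds the nested existentials into one sequence of successive derivatives, the form that
Taylor's formula and Euler–Maclaurin require. -/
theorem exists_seq {n : ℕ} (h : SymbolFamily Ω n σ g) : ∃ D : ℕ → ℂ → ℝ → ℂ, D 0 = g ∧
    (∀ i ≤ n, SymbolFamily Ω 0 (fun w => σ w - i) (D i)) ∧
    ∀ i < n, ∀ᶠ H : ℝ in atTop, ∀ w ∈ Ω, HasDerivAt (D i w) (D (i + 1) w H) H := by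
  induction n generalizing σ g with
  | zero =>
    refine ⟨fun _ => g, rfl, fun i hi => ?_, fun i hi => by omega⟩
    obtain rfl : i = 0 := by omega
    exact h.congr_exp fun w => by simp
  | succ n ih =>
    obtain ⟨h0, g', h1, h2⟩ := h
    obtain ⟨D, hD0, hD1, hD2⟩ := ih h1
    refine ⟨fun i => Nat.casesOn i g D, rfl, fun i hi => ?_, fun i hi => ?_⟩
    · cases i with
      | zero => exact congr_exp (n := 0) h0 fun w => by simp
      | succ i => exact (hD1 i (by omega)).congr_exp fun w => by push_cast; ring
    · cases i with
      | zero => simpa [hD0] using h2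
      | succ i => exact hD2 i (by omega)

end SymbolFamily

/-! ### Euler–Maclaurin summation -/

/-- The s-derivative of the remainder of order n+1 is the remainder of order n for the shifted
sequence, and on an interval of length one the mean value inequality preserves the constant. The
usual factorial in the error is not needed. -/
theorem norm_sub_taylor_le (n : ℕ) {D : ℕ → ℝ → ℂ} {a C : ℝ}
    (hD : ∀ i ≤ n, ∀ s ∈ Set.Icc (0 : ℝ) 1, HasDerivAt (D i) (D (i + 1) (a + s)) (a + s))
    (hC : ∀ s ∈ Set.Icc (0 : ℝ) 1, ‖D (n + 1) (a + s)‖ ≤ C) :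
    ∀ s ∈ Set.Icc (0 : ℝ) 1,
      ‖D 0 (a + s) - ∑ t ∈ Finset.range (n + 1), ((s : ℂ) ^ t / (t.factorial : ℂ)) * D t a‖ ≤ C := by
  have hC0 : 0 ≤ C := (norm_nonneg _).trans (hC 0 (by simp))
  have mvt : ∀ {f f' : ℝ → ℂ}, (∀ s ∈ Set.Icc (0 : ℝ) 1, HasDerivAt f (f' s) s) →
      (∀ s ∈ Set.Icc (0 : ℝ) 1, ‖f' s‖ ≤ C) → f 0 = 0 → ∀ s ∈ Set.Icc (0 : ℝ) 1, ‖f s‖ ≤ C := by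
    intro f f' h1 h2 h3 s hs
    have := (convex_Icc (0 : ℝ) 1).norm_image_sub_le_of_norm_hasDerivWithin_le
      (fun x hx => (h1 x hx).hasDerivWithinAt) h2 (x := 0) (y := s) (by simp) hs
    rw [h3, sub_zero, sub_zero, Real.norm_eq_abs, abs_of_nonneg hs.1] at this
    exact this.trans (mul_le_of_le_one_right hC0 hs.2)
  induction n generalizing D with
  | zero =>
    refine mvt (f' := fun s => D 1 (a + s)) (fun s hs => ?_) hC (by simp)
    have h1 := (hD 0 le_rfl s hs).comp_const_add a s
    simpa using h1.sub_const (D 0 a)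
  | succ n ih =>
    have h2 := ih (D := fun i => D (i + 1)) (fun i hi s hs => hD (i + 1) (by omega) s hs) hC
    refine mvt (fun s hs => ?_) h2 ?_
    · have h1 := (hD 0 (by omega) s hs).comp_const_add a s
      refine h1.sub ?_
      have e : (fun s : ℝ => ∑ t ∈ Finset.range (n + 1 + 1),
          ((s : ℂ) ^ t / (t.factorial : ℂ)) * D t a) = fun s : ℝ =>
          (∑ t ∈ Finset.range (n + 1), ((s : ℂ) ^ (t + 1) / ((t + 1).factorial : ℂ)) * D (t + 1) a)
            + D 0 a := by
        ext s
        rw [Finset.sum_range_succ']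
        simp
      rw [e]
      refine HasDerivAt.add_const _ (HasDerivAt.fun_sum fun t _ => ?_)
      have h3 : HasDerivAt (fun s : ℝ => (s : ℂ) ^ (t + 1)) (((t : ℂ) + 1) * (s : ℂ) ^ t) s := by
        have := ((hasDerivAt_id s).ofReal_comp).fun_pow (t + 1)
        simpa using this
      refine ((h3.div_const _).mul_const _).congr_deriv ?_
      rw [Nat.factorial_succ]
      push_cast
      have : (t : ℂ) + 1 ≠ 0 := by exact_mod_cast Nat.succ_ne_zero t
      have h4 : (t.factorial : ℂ) ≠ 0 := by exact_mod_cast t.factorial_ne_zero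
      field_simp
    · rw [Finset.sum_range_succ']
      simp

/-- The coefficient form of (t/(e^t - 1)) · (e^t - 1) = t. -/
theorem sum_bernoulli_div_factorial (n : ℕ) :
    ∑ i ∈ Finset.range n, ((bernoulli i : ℂ) / (i.factorial : ℂ)) / ((n - i).factorial : ℂ) =
      if n = 1 then 1 else 0 := by
  have h := sum_bernoulli n
  have h1 : ((∑ k ∈ Finset.range n, ((n.choose k : ℚ) * bernoulli k : ℚ) : ℚ) : ℂ) =
      if n = 1 then 1 else 0 := by
    rw [h]
    split_ifs <;> simp
  have h2 : (n.factorial : ℂ) ≠ 0 := by exact_mod_cast n.factorial_ne_zero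
  have h3 : ∑ i ∈ Finset.range n, ((bernoulli i : ℂ) / (i.factorial : ℂ)) / ((n - i).factorial : ℂ)
      = ((∑ k ∈ Finset.range n, ((n.choose k : ℚ) * bernoulli k : ℚ) : ℚ) : ℂ)
        / (n.factorial : ℂ) := by
    rw [Rat.cast_sum, Finset.sum_div]
    refine Finset.sum_congr rfl fun i hi => ?_
    have hi' : i ≤ n := (Finset.mem_range.1 hi).le
    have h4 : (i.factorial : ℂ) ≠ 0 := by exact_mod_cast i.factorial_ne_zero
    have h5 : ((n - i).factorial : ℂ) ≠ 0 := by exact_mod_cast (n - i).factorial_ne_zero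
    have h6 : (n.choose i : ℂ) * i.factorial * (n - i).factorial = n.factorial := by
      exact_mod_cast Nat.choose_mul_factorial_mul_factorial hi'
    push_cast
    rw [← h6] at h2 ⊢
    have h7 : (n.choose i : ℂ) ≠ 0 := fun h => h2 (by simp [h])
    field_simp
  rw [h3, h1]
  split_ifs with hn
  · subst hn; simp
  · simp

/-- With ∂ the shift D i ↦ D (i+1), this is (∑ B_i ∂^i/i!)(e^∂ - 1) = ∂ with all orders above K
discarded. -/
theorem euler_maclaurin_taylor_sum {K : ℕ} (hK : 1 ≤ K) (D : ℕ → ℂ) :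
    ∑ i ∈ Finset.range (K + 1), ((bernoulli i : ℂ) / (i.factorial : ℂ)) *
      ((∑ t ∈ Finset.range (K - i + 1), ((1 : ℂ) / (t.factorial : ℂ)) * D (i + t)) - D i) = D 1 := by
  have h1 : ∀ i ∈ Finset.range (K + 1), ((bernoulli i : ℂ) / (i.factorial : ℂ)) *
      ((∑ t ∈ Finset.range (K - i + 1), ((1 : ℂ) / (t.factorial : ℂ)) * D (i + t)) - D i) =
      ∑ m ∈ Finset.range (K + 1), if i < m then
        ((bernoulli i : ℂ) / (i.factorial : ℂ)) / ((m - i).factorial : ℂ) * D m else 0 := by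
    intro i hi
    have hi' : i ≤ K := by simpa [Nat.lt_succ_iff] using hi
    rw [Finset.sum_range_succ']
    simp only [Nat.factorial_zero, Nat.cast_one, div_one, one_mul, add_zero, add_sub_cancel_right]
    rw [← Finset.sum_filter]
    have e : (Finset.range (K + 1)).filter (fun m => i < m) =
        (Finset.range (K - i)).image (fun t => i + (t + 1)) := by
      ext m
      simp only [Finset.mem_filter, Finset.mem_range, Finset.mem_image]
      constructor
      · rintro ⟨h1, h2⟩
        exact ⟨m - i - 1, by omega, by omega⟩
      · rintro ⟨t, ht, rfl⟩
        omega
    rw [e, Finset.sum_image (by intro a _ b _ h; simpa using h), Finset.mul_sum]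
    refine Finset.sum_congr rfl fun t _ => ?_
    rw [Nat.add_sub_cancel_left]
    ring
  rw [Finset.sum_congr rfl h1, Finset.sum_comm]
  have h2 : ∀ m ∈ Finset.range (K + 1), (∑ i ∈ Finset.range (K + 1), if i < m then
        ((bernoulli i : ℂ) / (i.factorial : ℂ)) / ((m - i).factorial : ℂ) * D m else 0) =
      if m = 1 then D 1 else 0 := by
    intro m hm
    have hm' : m < K + 1 := by simpa using hm
    rw [← Finset.sum_filter]
    have e : (Finset.range (K + 1)).filter (fun i => i < m) = Finset.range m := by
      ext i
      simp only [Finset.mem_filter, Finset.mem_range]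
      omega
    rw [e, ← Finset.sum_mul, sum_bernoulli_div_factorial]
    split_ifs with h
    · rw [h]; simp
    · simp
  rw [Finset.sum_congr rfl h2, Finset.sum_ite_eq' (Finset.range (K + 1)) 1 fun _ => D 1]
  simp only [Finset.mem_range, ite_eq_left_iff]
  omega

/-- Euler–Maclaurin: the sum of the derivative of a symbol family continues holomorphically. -/
theorem euler_maclaurin {Ω : Set ℂ} (hΩ : IsOpen Ω) {K : ℕ} (hK : 1 ≤ K) {σ : ℂ → ℝ}
    {X X' : ℂ → ℝ → ℂ} (hX : SymbolFamily Ω (K + 1) σ X)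
    (hX' : ∀ᶠ ℓ : ℝ in atTop, ∀ w ∈ Ω, HasDerivAt (X w) (X' w ℓ) ℓ)
    (hσ : ∀ w ∈ Ω, σ w ≤ K - 1) :
    ∀ᶠ L : ℕ in atTop, ∃ Ψ : ℂ → ℂ, DifferentiableOn ℂ Ψ Ω ∧
      (∀ w ∈ Ω, σ w < 0 → HasSum (fun n : ℕ => X' w (L + n : ℕ)) (Ψ w)) ∧
      ∀ w ∈ Ω, (∀ ℓ : ℝ, X w ℓ = 1) → Ψ w = -1 := by
  obtain ⟨D, hD0, hD1, hD2⟩ := hX.exists_seq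
  choose! C hC using hD1
  have hev : ∀ᶠ ℓ : ℝ in atTop, 1 ≤ ℓ ∧ (∀ w ∈ Ω, HasDerivAt (X w) (X' w ℓ) ℓ) ∧
      (∀ i ∈ Finset.range (K + 2), DifferentiableOn ℂ (fun w => D i w ℓ) Ω ∧
        ∀ w ∈ Ω, ‖D i w ℓ‖ ≤ C i * ℓ ^ (σ w - i)) ∧
      ∀ i ∈ Finset.range (K + 1), ∀ w ∈ Ω, HasDerivAt (D i w) (D (i + 1) w ℓ) ℓ := by
    refine (eventually_ge_atTop 1).and (hX'.and (Eventually.and ?_ ?_))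
    · rw [Finset.eventually_all]
      exact fun i hi => hC i (by simpa [Nat.lt_succ_iff] using hi)
    · rw [Finset.eventually_all]
      exact fun i hi => hD2 i (by simpa using hi)
  obtain ⟨R, hR⟩ := eventually_atTop.1 hev
  filter_upwards [eventually_ge_atTop (⌈R⌉₊ + 1)] with L hL
  have hLR' : ∀ n : ℕ, R < ((L + n : ℕ) : ℝ) := fun n =>
    (Nat.le_ceil R).trans_lt (by exact_mod_cast (show ⌈R⌉₊ < L + n by omega))
  have hLR : ∀ n : ℕ, R ≤ ((L + n : ℕ) : ℝ) := fun n => (hLR' n).le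
  set β : ℕ → ℂ := fun i => (bernoulli i : ℂ) / (i.factorial : ℂ) with hβ
  -- P is an approximate discrete primitive of X': its increments agree with X' up to the error E
  -- below. The assumption σ ≤ K - 1 makes E of order ℓ^{-2}, so the series of E converges uniformly
  -- on Ω even where that of X' diverges.
  set P : ℂ → ℝ → ℂ := fun w ℓ => ∑ i ∈ Finset.range (K + 1), β i * D i w ℓ with hP
  set E : ℕ → ℂ → ℂ := fun n w => P w (L + n + 1 : ℕ) - P w (L + n : ℕ) - D 1 w (L + n : ℕ) with hE
  set B : ℝ := ∑ i ∈ Finset.range (K + 1), ‖β i‖ * |C (K + 1)| with hBdef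
  have hPdiff : ∀ n : ℕ, DifferentiableOn ℂ (fun w => P w (L + n : ℕ)) Ω := fun n =>
    DifferentiableOn.fun_sum fun i hi => (differentiableOn_const _).mul
      (((hR _ (hLR n)).2.2.1 i (by simp at hi ⊢; omega)).1)
  have hEdiff : ∀ n, DifferentiableOn ℂ (E n) Ω := fun n =>
    ((hPdiff (n + 1)).sub (hPdiff n)).sub ((hR _ (hLR n)).2.2.1 1 (by simp)).1
  have hEbound : ∀ n, ∀ w ∈ Ω, ‖E n w‖ ≤ B * (((L + n : ℕ) : ℝ) ^ (-2 : ℝ)) := by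
    intro n w hw
    set a : ℝ := ((L + n : ℕ) : ℝ) with ha
    have ha1 : 1 ≤ a := (hR a (hLR n)).1
    have hbd : ∀ s ∈ Set.Icc (0 : ℝ) 1, ‖D (K + 1) w (a + s)‖ ≤ |C (K + 1)| * a ^ (-2 : ℝ) := by
      intro s hs
      have h1 := (hR (a + s) ((hLR n).trans (by linarith [hs.1]))).2.2.1 (K + 1) (by simp)
      refine (h1.2 w hw).trans ?_
      have h2 : (a + s) ^ (σ w - ((K + 1 : ℕ) : ℝ)) ≤ a ^ (-2 : ℝ) := by
        have h3 := hσ w hw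
        calc (a + s) ^ (σ w - ((K + 1 : ℕ) : ℝ)) ≤ a ^ (σ w - ((K + 1 : ℕ) : ℝ)) :=
              Real.rpow_le_rpow_of_nonpos (by linarith) (by linarith [hs.1]) (by push_cast; linarith)
          _ ≤ _ := Real.rpow_le_rpow_of_exponent_le ha1 (by push_cast; linarith)
      exact mul_le_mul (le_abs_self _) h2 (Real.rpow_nonneg (by linarith [hs.1]) _) (abs_nonneg _)
    have hT : ∀ i ∈ Finset.range (K + 1), ‖D i w (a + 1) - ∑ t ∈ Finset.range (K - i + 1),
        ((1 : ℂ) / (t.factorial : ℂ)) * D (i + t) w a‖ ≤ |C (K + 1)| * a ^ (-2 : ℝ) := by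
      intro i hi
      have hi' : i ≤ K := by simpa [Nat.lt_succ_iff] using hi
      have := norm_sub_taylor_le (K - i) (D := fun t => D (i + t) w) (a := a)
        (fun t ht s hs => (hR (a + s) ((hLR n).trans (by linarith [hs.1]))).2.2.2 (i + t)
          (by simp; omega) w hw)
        (by
          have : i + (K - i + 1) = K + 1 := by omega
          simpa only [this] using hbd) 1 (by simp)
      simpa using this
    have hEeq : E n w = ∑ i ∈ Finset.range (K + 1), β i * (D i w (a + 1) -
        ∑ t ∈ Finset.range (K - i + 1), ((1 : ℂ) / (t.factorial : ℂ)) * D (i + t) w a) := by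
      have h1 := euler_maclaurin_taylor_sum hK (fun i => D i w a)
      have h2 : ((L + n + 1 : ℕ) : ℝ) = a + 1 := by push_cast [ha]; ring
      simp only [hE, hP, h2, ← ha]
      rw [← h1, ← Finset.sum_sub_distrib, ← Finset.sum_sub_distrib]
      refine Finset.sum_congr rfl fun i _ => ?_
      simp only [hβ]
      ring
    rw [hEeq, hBdef, Finset.sum_mul]
    refine norm_sum_le_of_le _ fun i hi => ?_
    rw [norm_mul, mul_assoc]
    exact mul_le_mul_of_nonneg_left (hT i hi) (norm_nonneg _)
  have hsum : Summable fun n : ℕ => B * (((L + n : ℕ) : ℝ) ^ (-2 : ℝ)) := by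
    refine Summable.mul_left _ ?_
    have h1 : Summable fun n : ℕ => (n : ℝ) ^ (-2 : ℝ) := Real.summable_nat_rpow.2 (by norm_num)
    have := (summable_nat_add_iff L).2 h1
    simpa [add_comm] using this
  -- The value of ∑ X' from L on, obtained by telescoping with P → 0 when σ < 0; the expression
  -- itself makes sense on all of Ω.
  refine ⟨fun w => -P w L - ∑' n, E n w, ?_, ?_, ?_⟩
  · refine DifferentiableOn.sub ?_ (Complex.differentiableOn_tsum_of_summable_norm hsum hEdiff hΩ hEbound)
    simpa using (hPdiff 0).neg
  · intro w hw hneg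
    have hX1 : ∀ n : ℕ, X' w (L + n : ℕ) = D 1 w (L + n : ℕ) := fun n => by
      have h1 := (hR _ (hLR n)).2.1 w hw
      have h2 := (hR _ (hLR n)).2.2.2 0 (by simp) w hw
      rw [hD0] at h2
      exact h1.unique h2
    have hlim : Tendsto (fun n : ℕ => P w (L + n : ℕ)) atTop (𝓝 0) := by
      have : (0 : ℂ) = ∑ i ∈ Finset.range (K + 1), β i * 0 := by simp
      rw [this]
      refine tendsto_finsetSum _ fun i hi => Tendsto.const_mul _ ?_
      have h1 : Tendsto (fun n : ℕ => C i * ((L + n : ℕ) : ℝ) ^ (σ w - i)) atTop (𝓝 0) := by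
        have h2 : Tendsto (fun n : ℕ => ((L + n : ℕ) : ℝ)) atTop atTop := by
          refine tendsto_natCast_atTop_atTop.comp ?_
          simpa [add_comm] using tendsto_add_atTop_nat L
        have h3 : 0 < -(σ w - i) := by
          have : (0 : ℝ) ≤ i := Nat.cast_nonneg i
          linarith
        have := ((tendsto_rpow_neg_atTop h3).comp h2).const_mul (C i)
        simpa using this
      exact squeeze_zero_norm (fun n => ((hR _ (hLR n)).2.2.1 i (by simp at hi ⊢; omega)).2 w hw) h1
    have hsm : Summable fun n : ℕ => X' w (L + n : ℕ) := by
      have h1 : Summable fun n : ℕ => C 1 * ((L + n : ℕ) : ℝ) ^ (σ w - 1) := by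
        refine Summable.mul_left _ ?_
        have h1 : Summable fun n : ℕ => (n : ℝ) ^ (σ w - 1) :=
          Real.summable_nat_rpow.2 (by linarith)
        have := (summable_nat_add_iff L).2 h1
        simpa [add_comm] using this
      refine Summable.of_norm_bounded h1 fun n => ?_
      rw [hX1]
      simpa using ((hR _ (hLR n)).2.2.1 1 (by simp)).2 w hw
    have hEs : Summable fun n => E n w := Summable.of_norm_bounded hsum fun n => hEbound n w hw
    refine hsm.hasSum_iff_tendsto_nat.2 ?_
    have h1 : ∀ N : ℕ, ∑ n ∈ Finset.range N, X' w (L + n : ℕ) =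
        P w (L + N : ℕ) - P w L - ∑ n ∈ Finset.range N, E n w := by
      intro N
      induction N with
      | zero => simp
      | succ N ih =>
        rw [Finset.sum_range_succ, ih, Finset.sum_range_succ, hX1]
        simp only [hE, ← add_assoc]
        ring
    simp only [h1]
    have h2 := (hlim.sub_const (P w L)).sub hEs.hasSum.tendsto_sum_nat
    simpa using h2
  -- When X is identically 1 its derivatives vanish beyond R, so only the term B_0 = 1 of P
  -- survives. This value later fixes the residue of the zeta-type sums.
  · intro w hw hone
    have hz : ∀ i < K + 1, ∀ ℓ, R < ℓ → D (i + 1) w ℓ = 0 := by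
      intro i
      induction i with
      | zero =>
        intro _ ℓ hℓ
        have h2 := (hR _ hℓ.le).2.2.2 0 (by simp) w hw
        rw [hD0, show X w = fun _ => 1 from funext hone] at h2
        exact h2.unique (hasDerivAt_const _ _)
      | succ i ih =>
        intro hi ℓ hℓ
        have h2 := (hR _ hℓ.le).2.2.2 (i + 1) (by simpa using hi) w hw
        have h3 : D (i + 1) w =ᶠ[𝓝 ℓ] fun _ => 0 := by
          filter_upwards [lt_mem_nhds hℓ] with t ht
          exact ih (by omega) t ht
        exact h2.unique ((hasDerivAt_const ℓ (0 : ℂ)).congr_of_eventuallyEq h3)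
    have hP1 : ∀ n : ℕ, P w (L + n : ℕ) = 1 := by
      intro n
      simp only [hP]
      rw [Finset.sum_range_succ', Finset.sum_eq_zero fun i hi => ?_]
      · simp [hβ, hD0, hone]
      · rw [hz i (by simp at hi; omega) _ (hLR' n), mul_zero]
    have hE1 : ∀ n, E n w = 0 := fun n => by
      simp only [hE]
      rw [hP1, show L + n + 1 = L + (n + 1) by ring, hP1, hz 0 (by omega) _ (hLR' n)]
      simp
    simp only [hE1, tsum_zero, sub_zero]
    rw [show P w L = 1 by simpa using hP1 0]

/-! ### Zeta-type sums along a reparametrization of the integers -/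

/-- A reparametrization `x(ℓ) = ℓ + O(1)` with `x' = q(x)`, `q` a symbol of order zero. -/
structure Reparam (x q : ℝ → ℝ) : Prop where
  hasDerivAt : ∀ᶠ ℓ : ℝ in atTop, HasDerivAt x (q (x ℓ)) ℓ
  bounded : ∃ B : ℝ, ∀ᶠ ℓ : ℝ in atTop, |x ℓ - ℓ| ≤ B
  symbol : ∀ (Ω : Set ℂ) (n : ℕ), SymbolFamily Ω n (fun _ => 0) fun _ H => (q H : ℂ)

theorem Reparam.id : Reparam (fun ℓ => ℓ) fun _ => 1 where
  hasDerivAt := Eventually.of_forall fun ℓ => hasDerivAt_id ℓ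
  bounded := ⟨0, by simp⟩
  symbol Ω n := by simpa using SymbolFamily.const n 1

theorem Reparam.tendsto {x q : ℝ → ℝ} (h : Reparam x q) : Tendsto x atTop atTop := by
  obtain ⟨B, hB⟩ := h.bounded
  refine tendsto_atTop_mono' atTop ?_ (tendsto_atTop_add_const_right atTop (-B) tendsto_id)
  filter_upwards [hB] with ℓ h
  have := (abs_le.1 h).1
  simp only [_root_.id]; linarith

theorem Reparam.isBigO_one {x q : ℝ → ℝ} (h : Reparam x q) :
    (fun ℓ => q (x ℓ)) =O[atTop] fun _ => (1 : ℝ) := by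
  obtain ⟨C, hC⟩ := h.symbol {0} 0
  have : q =O[atTop] fun _ => (1 : ℝ) := by
    refine IsBigO.of_bound C ?_
    filter_upwards [hC] with H hH
    simpa using hH.2 0 (by simp)
  exact this.comp_tendsto h.tendsto

theorem Reparam.isBigO_rpow {x q : ℝ → ℝ} (h : Reparam x q) (e : ℝ) :
    (fun ℓ => x ℓ ^ e) =O[atTop] fun ℓ : ℝ => ℓ ^ e := by
  obtain ⟨B, hB⟩ := h.bounded
  have hlim : Tendsto (fun ℓ : ℝ => (x ℓ / ℓ) ^ e) atTop (𝓝 1) := by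
    have h1 : Tendsto (fun ℓ : ℝ => x ℓ / ℓ) atTop (𝓝 1) := by
      have h2 : Tendsto (fun ℓ : ℝ => (x ℓ - ℓ) / ℓ) atTop (𝓝 0) := by
        refine squeeze_zero_norm' (a := fun ℓ : ℝ => B * ℓ⁻¹) ?_ ?_
        · filter_upwards [hB, eventually_gt_atTop 0] with ℓ h1 h2
          rw [norm_div, Real.norm_eq_abs, Real.norm_eq_abs, abs_of_pos h2, div_eq_mul_inv]
          exact mul_le_mul_of_nonneg_right h1 (inv_nonneg.2 h2.le)
        · exact tendsto_const_div_atTop_zero B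
      have h3 := h2.const_add 1
      rw [add_zero] at h3
      refine h3.congr' ?_
      filter_upwards [eventually_gt_atTop 0] with ℓ h2
      field_simp; ring
    simpa using h1.rpow_const (p := e) (by simp)
  have h3 : (fun ℓ : ℝ => (x ℓ / ℓ) ^ e * ℓ ^ e) =O[atTop] fun ℓ : ℝ => 1 * ℓ ^ e :=
    (hlim.isBigO_one ℝ).mul (isBigO_refl _ _)
  refine h3.congr' ?_ (by simp)
  filter_upwards [eventually_gt_atTop 0, h.tendsto.eventually (eventually_gt_atTop 0)] with ℓ h1 h2
  rw [Real.div_rpow h2.le h1.le, div_mul_cancel₀]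
  exact (Real.rpow_pos_of_pos h1 _).ne'

theorem Reparam.summable {x q : ℝ → ℝ} (h : Reparam x q) {g : ℝ → ℝ} {e : ℝ} (he : e < -1)
    (hg : g =O[atTop] fun x : ℝ => x ^ e) (L : ℕ) :
    Summable fun n : ℕ => |q (x (L + n : ℕ))| * |g (x (L + n : ℕ))| := by
  have h1 : (fun ℓ => |q (x ℓ)| * |g (x ℓ)|) =O[atTop] fun ℓ : ℝ => 1 * ℓ ^ e :=
    h.isBigO_one.abs_left.mul ((hg.comp_tendsto h.tendsto).abs_left.trans (h.isBigO_rpow e))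
  have h2 := h1.comp_tendsto tendsto_natCast_atTop_atTop
  have h3 : Summable fun n : ℕ => 1 * (n : ℝ) ^ e := by
    simpa using Real.summable_nat_rpow.2 he
  have h4 := (summable_nat_add_iff L).2 (summable_of_isBigO_nat h3 h2)
  simpa [add_comm] using h4

theorem Reparam.zeta_term_summable {x q : ℝ → ℝ} (h : Reparam x q) {e : ℝ} (he : e < -1) (l L : ℕ) :
    Summable fun n : ℕ => |q (x (L + n : ℕ))| *
      |x (L + n : ℕ) ^ e * Real.log (x (L + n : ℕ)) ^ l| :=
  h.summable (e := (e - 1) / 2) (by linarith)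
    ((powerLogMonomial_isLittleO l (show e < (e - 1) / 2 by linarith)).isBigO) L

/-- Euler–Maclaurin is applied to x(ℓ)^{1-w}, whose ℓ-derivative is (1-w) q(x) x^{-w}. At w = 1 the
function is constant, so the sum has a simple pole with residue 1 for every reparametrization. -/
theorem Reparam.zeta_continuation {x q : ℝ → ℝ} (h : Reparam x q) {Ω : Set ℂ} (hΩ : IsOpen Ω)
    {M : ℝ} (hM : ∀ w ∈ Ω, ‖w‖ ≤ M) (h1 : (1 : ℂ) ∈ Ω) :
    ∀ᶠ L : ℕ in atTop, ∃ Ψ : ℂ → ℂ, DifferentiableOn ℂ Ψ Ω ∧ Ψ 1 = -1 ∧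
      ∀ w ∈ Ω, 1 < w.re →
        (1 - w) * ∑' n : ℕ, (q (x (L + n : ℕ)) : ℂ) * (x (L + n : ℕ) : ℂ) ^ (-w) = Ψ w := by
  obtain ⟨B, hB⟩ := h.bounded
  obtain ⟨K, hK⟩ := exists_nat_gt (M + 2)
  have hM0 : 0 ≤ M := (norm_nonneg _).trans (hM 1 h1)
  have hK1 : 1 ≤ K := by
    have : (1 : ℝ) ≤ K := by linarith
    exact_mod_cast this
  have hre : ∀ w ∈ Ω, |w.re| ≤ M := fun w hw => (Complex.abs_re_le_norm w).trans (hM w hw)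
  have hpow : SymbolFamily Ω (K + 1) (fun w => 1 - w.re) fun w H => (H : ℂ) ^ (1 - w) := by
    simpa using SymbolFamily.cpow (Ω := Ω) (K + 1) (κ := fun _ => 1) (differentiableOn_const _)
      (B := 1) (by simp) hM 1
  have hX := SymbolFamily.comp (x := x) (q := q) (M := 1 + M) (B := B)
    (fun w hw => (abs_sub _ _).trans (by simpa using hre w hw)) (h.symbol Ω (K + 1))
    h.hasDerivAt hB hpow
  have hX' : ∀ᶠ ℓ : ℝ in atTop, ∀ w ∈ Ω, HasDerivAt (fun ℓ => (x ℓ : ℂ) ^ (1 - w))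
      ((1 - w) * ((q (x ℓ) : ℂ) * (x ℓ : ℂ) ^ (-w))) ℓ := by
    filter_upwards [h.hasDerivAt, h.tendsto.eventually (eventually_gt_atTop 0)] with ℓ h2 h3 w _
    have h4 : HasDerivAt (fun z : ℂ => z ^ (1 - w)) _ (x ℓ : ℂ) :=
      (hasDerivAt_id (x ℓ : ℂ)).cpow_const (c := 1 - w) (Or.inl (by simpa using h3))
    have h5 := h4.scomp ℓ h2.ofReal_comp
    refine h5.congr_deriv ?_
    simp only [_root_.id, smul_eq_mul, mul_one]
    rw [show (1 : ℂ) - w - 1 = -w by ring]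
    ring
  filter_upwards [euler_maclaurin hΩ hK1 hX hX' (fun w hw => by
    have := (abs_le.1 (hre w hw)).1
    linarith)] with L hL
  obtain ⟨Ψ, hΨ, hsum, hone⟩ := hL
  refine ⟨Ψ, hΨ, hone 1 h1 (by simp), fun w hw hw1 => ?_⟩
  rw [← (hsum w hw (by linarith)).tsum_eq, tsum_mul_left]

/-- The difference of the zeta-type sums along two reparametrizations continues holomorphically. -/
theorem Reparam.zeta_difference {x q x' q' : ℝ → ℝ} (h : Reparam x q) (h' : Reparam x' q')
    {Ω : Set ℂ} (hΩ : IsOpen Ω) {M : ℝ} (hM : ∀ w ∈ Ω, ‖w‖ ≤ M) (h1 : (1 : ℂ) ∈ Ω) :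
    ∀ᶠ L : ℕ in atTop, ∀ᶠ L' : ℕ in atTop, ∀ l : ℕ, ∃ Δ : ℂ → ℂ, DifferentiableOn ℂ Δ Ω ∧
      ∀ w ∈ Ω, 1 < w.re →
        (∑' n : ℕ, (q (x (L + n : ℕ)) : ℂ) * (x (L + n : ℕ) : ℂ) ^ (-w)
          * (Real.log (x (L + n : ℕ)) : ℂ) ^ l) -
        (∑' n : ℕ, (q' (x' (L' + n : ℕ)) : ℂ) * (x' (L' + n : ℕ) : ℂ) ^ (-w)
          * (Real.log (x' (L' + n : ℕ)) : ℂ) ^ l) = Δ w := by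
  have hpos : ∀ {x q : ℝ → ℝ}, Reparam x q → ∀ᶠ L : ℕ in atTop, ∀ n : ℕ, 1 ≤ x (L + n : ℕ) := by
    intro x q h
    obtain ⟨R, hR⟩ := eventually_atTop.1
      ((h.tendsto.comp tendsto_natCast_atTop_atTop).eventually (eventually_ge_atTop 1))
    filter_upwards [eventually_ge_atTop R] with L hL n
    exact hR _ (by omega)
  have key : ∀ {x q : ℝ → ℝ} (_ : Reparam x q) (L : ℕ) (_ : ∀ n : ℕ, 1 ≤ x (L + n : ℕ)) (l : ℕ)
      (w : ℂ), 1 < w.re → HasDerivAt (fun w => ∑' n : ℕ, (q (x (L + n : ℕ)) : ℂ) *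
        (x (L + n : ℕ) : ℂ) ^ (-w) * (Real.log (x (L + n : ℕ)) : ℂ) ^ l)
        (-∑' n : ℕ, (q (x (L + n : ℕ)) : ℂ) *
        (x (L + n : ℕ) : ℂ) ^ (-w) * (Real.log (x (L + n : ℕ)) : ℂ) ^ (l + 1)) w := by
    intro x q h L hL l w hw
    -- On the half plane Re w > η > 1 the series has a summable majorant, which permits termwise
    -- differentiation.
    obtain ⟨η, hη1, hη2⟩ := exists_between hw
    have hU : IsOpen {w : ℂ | η < w.re} := isOpen_lt continuous_const Complex.continuous_re
    have hd : ∀ (n : ℕ) (w : ℂ), HasDerivAt (fun w => (q (x (L + n : ℕ)) : ℂ) *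
        (x (L + n : ℕ) : ℂ) ^ (-w) * (Real.log (x (L + n : ℕ)) : ℂ) ^ l)
        (-((q (x (L + n : ℕ)) : ℂ) *
        (x (L + n : ℕ) : ℂ) ^ (-w) * (Real.log (x (L + n : ℕ)) : ℂ) ^ (l + 1))) w := by
      intro n w
      have hx := zero_lt_one.trans_le (hL n)
      have h2 := ((hasDerivAt_neg w).const_cpow (c := (x (L + n : ℕ) : ℂ))
        (Or.inl (by exact_mod_cast hx.ne')))
      refine ((h2.const_mul _).mul_const _).congr_deriv ?_
      rw [← Complex.ofReal_log hx.le]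
      ring
    have hb : ∀ (n : ℕ) (w : ℂ), w ∈ {w : ℂ | η < w.re} → ‖(q (x (L + n : ℕ)) : ℂ) *
        (x (L + n : ℕ) : ℂ) ^ (-w) * (Real.log (x (L + n : ℕ)) : ℂ) ^ l‖ ≤
        |q (x (L + n : ℕ))| * |x (L + n : ℕ) ^ (-η) * Real.log (x (L + n : ℕ)) ^ l| := by
      intro n w hw
      have hx := zero_lt_one.trans_le (hL n)
      rw [mul_assoc, norm_mul, norm_mul, Complex.norm_cpow_eq_rpow_re_of_pos hx, abs_mul,
        Complex.norm_real, norm_pow, Complex.norm_real, Real.norm_eq_abs, Real.norm_eq_abs, abs_pow,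
        abs_of_pos (Real.rpow_pos_of_pos hx _)]
      gcongr
      · exact hL n
      · simpa using (show η < w.re from hw).le
    have hs := h.zeta_term_summable (e := -η) (by linarith) l L
    have hdiff := Complex.differentiableOn_tsum_of_summable_norm hs
      (fun n w _ => (hd n w).differentiableAt.differentiableWithinAt) hU hb
    have hsd := Complex.hasSum_deriv_of_summable_norm hs
      (fun n w _ => (hd n w).differentiableAt.differentiableWithinAt) hU hb (show η < w.re from hη2)
    have h3 := (hdiff.differentiableAt (hU.mem_nhds hη2)).hasDerivAt
    rw [← hsd.tsum_eq] at h3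
    refine h3.congr_deriv ?_
    rw [← tsum_neg]
    exact tsum_congr fun n => (hd n w).deriv
  filter_upwards [h.zeta_continuation hΩ hM h1, hpos h] with L ⟨Ψ, hΨ, hΨ1, hΨs⟩ hL
  filter_upwards [h'.zeta_continuation hΩ hM h1, hpos h'] with L' ⟨Ψ', hΨ', hΨ1', hΨs'⟩ hL'
  intro l
  induction l with
  | zero =>
    -- Both continuations equal -1 at w = 1, so their difference is divisible by 1 - w: the two
    -- poles cancel.
    refine ⟨fun w => -dslope (fun w => Ψ w - Ψ' w) 1 w,
      ((Complex.differentiableOn_dslope (hΩ.mem_nhds h1)).2 (hΨ.sub hΨ')).neg, fun w hw hw1 => ?_⟩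
    have hne : w ≠ 1 := fun h => by simp [h] at hw1
    have hne' : (1 : ℂ) - w ≠ 0 := sub_ne_zero.2 hne.symm
    have hne'' : w - 1 ≠ 0 := sub_ne_zero.2 hne
    beta_reduce
    rw [dslope_of_ne _ hne, slope_def_field, ← hΨs w hw hw1, ← hΨs' w hw hw1, hΨ1, hΨ1']
    simp only [pow_zero, mul_one, sub_self, sub_zero]
    rw [← mul_sub, show (1 : ℂ) - w = -(w - 1) by ring, neg_mul, neg_div, neg_neg,
      mul_div_cancel_left₀ _ hne'']
  | succ l ih =>
    obtain ⟨Δ, hΔ, hΔs⟩ := ih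
    -- A derivative in w multiplies each term by -log x, which produces the next power of the
    -- logarithm.
    refine ⟨fun w => -deriv Δ w, (hΔ.deriv hΩ).neg, fun w hw hw1 => ?_⟩
    have h2 := (key h L hL l w hw1).fun_sub (key h' L' hL' l w hw1)
    have h3 : Δ =ᶠ[𝓝 w] fun w => (∑' n : ℕ, (q (x (L + n : ℕ)) : ℂ) * (x (L + n : ℕ) : ℂ) ^ (-w)
          * (Real.log (x (L + n : ℕ)) : ℂ) ^ l) -
        (∑' n : ℕ, (q' (x' (L' + n : ℕ)) : ℂ) * (x' (L' + n : ℕ) : ℂ) ^ (-w)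
          * (Real.log (x' (L' + n : ℕ)) : ℂ) ^ l) := by
      filter_upwards [hΩ.mem_nhds hw, (isOpen_lt continuous_const Complex.continuous_re).mem_nhds hw1]
        with v hv hv1
      exact (hΔs v hv hv1).symm
    beta_reduce
    rw [h3.deriv_eq, HasDerivAt.deriv h2]
    ring

/-! ### Large-weight expansion of `Γ(H+a)/Γ(H-a)` -/

/-- The ratio `Γ(H+a)/Γ(H-a)`. -/
noncomputable def gammaRatio (a : ℂ) (H : ℝ) : ℂ := Complex.Gamma (H + a) / Complex.Gamma (H - a)

/-- The generalized binomial coefficient as an entire function. -/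
noncomputable def binomCoeff (n : ℕ) (κ : ℂ) : ℂ := (∏ j ∈ Finset.range n, (κ - j)) / n.factorial

theorem binomCoeff_differentiable (n : ℕ) : Differentiable ℂ (binomCoeff n) := by
  unfold binomCoeff
  fun_prop

theorem binomCoeff_bound (n : ℕ) {M : ℝ} {κ : ℂ} (h : ‖κ‖ ≤ M) :
    ‖∏ j ∈ Finset.range n, (κ - j)‖ ≤ (M + n) ^ n := by
  rw [norm_prod]
  have hM : 0 ≤ M := (norm_nonneg _).trans h
  calc ∏ j ∈ Finset.range n, ‖κ - j‖ ≤ ∏ _j ∈ Finset.range n, (M + n) := by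
        refine Finset.prod_le_prod (fun _ _ => norm_nonneg _) fun j hj => ?_
        refine (norm_sub_le _ _).trans (add_le_add h ?_)
        simpa using (Finset.mem_range.1 hj).le
    _ = _ := by simp

/-- Taylor's formula on [0,1] for u ↦ (1+tu)^κ; every derivative in u supplies a factor t. -/
theorem norm_one_add_cpow_sub_le (n : ℕ) {M t : ℝ} {κ : ℂ} (h : ‖κ‖ ≤ M) (ht : 0 ≤ t) (ht1 : t ≤ 1) :
    ‖((1 + t : ℝ) : ℂ) ^ κ - ∑ i ∈ Finset.range (n + 1), binomCoeff i κ * (t : ℂ) ^ i‖ ≤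
      (M + (n + 1)) ^ (n + 1) * 2 ^ M * t ^ (n + 1) := by
  have hM : 0 ≤ M := (norm_nonneg _).trans h
  have hre := Complex.abs_re_le_norm κ
  have key := norm_sub_taylor_le n (a := 0) (C := (M + (n + 1)) ^ (n + 1) * 2 ^ M * t ^ (n + 1))
    (D := fun i u => (t : ℂ) ^ i * (∏ j ∈ Finset.range i, (κ - j)) *
      ((1 + t * u : ℝ) : ℂ) ^ (κ - i)) (fun i _ u hu => ?_) (fun u hu => ?_) 1 (by simp)
  · simp only [zero_add, mul_one, mul_zero, add_zero, Complex.ofReal_one, Complex.one_cpow, one_pow,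
      Finset.range_zero, Finset.prod_empty, pow_zero, one_mul, Nat.cast_zero, sub_zero] at key
    refine le_of_eq_of_le ?_ key
    congr 2
    refine Finset.sum_congr rfl fun i _ => ?_
    rw [binomCoeff]; ring
  · have hpos : 0 < 1 + t * (0 + u) := by nlinarith [hu.1]
    have h1 : HasDerivAt (fun u : ℝ => ((1 + t * u : ℝ) : ℂ)) (t : ℂ) (0 + u) := by
      have := (((hasDerivAt_id (0 + u)).const_mul t).const_add 1).ofReal_comp
      simpa using this
    have h4 : HasDerivAt (fun z : ℂ => z ^ (κ - i)) _ ((1 + t * (0 + u) : ℝ) : ℂ) :=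
      (hasDerivAt_id _).cpow_const (c := κ - i) (Or.inl (by simpa using hpos))
    have h5 := (HasDerivAt.scomp (h := fun u : ℝ => ((1 + t * u : ℝ) : ℂ)) (0 + u) h4 h1).const_mul ((t : ℂ) ^ i * (∏ j ∈ Finset.range i, (κ - j)))
    refine h5.congr_deriv ?_
    rw [Finset.prod_range_succ]
    simp only [id, smul_eq_mul, mul_one]
    push_cast
    rw [show κ - (i : ℂ) - 1 = κ - (i + 1) by ring]
    ring
  · have hpos : 1 ≤ 1 + t * (0 + u) := by nlinarith [hu.1]
    have hle : 1 + t * (0 + u) ≤ 2 := by nlinarith [hu.1, hu.2]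
    rw [norm_mul, norm_mul, Complex.norm_cpow_eq_rpow_re_of_pos (by linarith), norm_pow,
      Complex.norm_real, Real.norm_eq_abs, abs_of_nonneg ht]
    have h1 := binomCoeff_bound (n + 1) h
    have h2 : (1 + t * (0 + u)) ^ (κ - ((n + 1 : ℕ) : ℂ)).re ≤ 2 ^ M := by
      calc (1 + t * (0 + u)) ^ (κ - ((n + 1 : ℕ) : ℂ)).re ≤ (1 + t * (0 + u)) ^ M := by
            refine Real.rpow_le_rpow_of_exponent_le hpos ?_
            have := (abs_le.1 (hre.trans h)).2
            simp only [Complex.sub_re, Complex.natCast_re]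
            have : (0 : ℝ) ≤ ((n + 1 : ℕ) : ℝ) := Nat.cast_nonneg _
            linarith
        _ ≤ _ := Real.rpow_le_rpow (by linarith) hle hM
    push_cast at h1 h2 ⊢
    have h3 : 0 ≤ (M + ((n : ℝ) + 1)) ^ (n + 1) := by positivity
    calc t ^ (n + 1) * ‖∏ j ∈ Finset.range (n + 1), (κ - (j : ℂ))‖ *
        (1 + t * (0 + u)) ^ (κ - ((n : ℂ) + 1)).re ≤
          t ^ (n + 1) * (M + ((n : ℝ) + 1)) ^ (n + 1) * 2 ^ M := by
          gcongr
      _ = _ := by ring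

/-- The coefficients of `(1+t)^(2 a-i) (1-at) - (1+at)` in powers of `t`. -/
noncomputable def defectCoeff (i : ℕ) (a : ℂ) : ℕ → ℂ
  | 0 => binomCoeff 0 (2 * a - i) - 1
  | 1 => binomCoeff 1 (2 * a - i) - a * binomCoeff 0 (2 * a - i) - a
  | p + 2 => binomCoeff (p + 2) (2 * a - i) - a * binomCoeff (p + 1) (2 * a - i)

theorem defectCoeff_zero (i : ℕ) (a : ℂ) : defectCoeff i a 0 = 0 := by
  simp [defectCoeff, binomCoeff]

/-- Together with the vanishing at order zero, the value -i is what makes the recursion solvable: in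
the equation at order t^{m+1} the newest unknown `gammaRatioCoeff m a` has the factor -m, nonzero
for m ≥ 1. -/
theorem defectCoeff_one (i : ℕ) (a : ℂ) : defectCoeff i a 1 = -i := by
  simp [defectCoeff, binomCoeff]; ring

theorem defectCoeff_differentiable (i p : ℕ) : Differentiable ℂ fun a => defectCoeff i a p := by
  have h : ∀ n, Differentiable ℂ fun a : ℂ => binomCoeff n (2 * a - i) := fun n =>
    (binomCoeff_differentiable n).comp (by fun_prop)
  match p with
  | 0 => exact (h 0).sub_const _
  | 1 => exact ((h 1).sub (differentiable_id.mul (h 0))).sub differentiable_id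
  | p + 2 => exact (h (p + 2)).sub (differentiable_id.mul (h (p + 1)))

theorem sum_defectCoeff (n i : ℕ) (a t : ℂ) :
    ∑ p ∈ Finset.range (n + 2), defectCoeff i a p * t ^ p =
      (∑ p ∈ Finset.range (n + 1 + 1), binomCoeff p (2 * a - i) * t ^ p) -
        a * t * (∑ p ∈ Finset.range (n + 1), binomCoeff p (2 * a - i) * t ^ p) - (1 + a * t) := by
  induction n with
  | zero =>
    simp [Finset.sum_range_succ, defectCoeff]
    ring
  | succ n ih =>
    rw [Finset.sum_range_succ, ih, Finset.sum_range_succ _ (n + 1 + 1),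
      Finset.sum_range_succ _ (n + 1), defectCoeff]
    ring

theorem norm_defect_sub_le (n i : ℕ) (M : ℝ) : ∃ C : ℝ, 0 ≤ C ∧ ∀ (t : ℝ) (a : ℂ), 0 ≤ t → t ≤ 1 →
    ‖a‖ ≤ M → ‖((1 + t : ℝ) : ℂ) ^ (2 * a - i) * (1 - a * t) - (1 + a * t) -
      ∑ p ∈ Finset.range (n + 2), defectCoeff i a p * (t : ℂ) ^ p‖ ≤ C * t ^ (n + 2) := by
  set M' : ℝ := 2 * |M| + i with hM'
  set B : ℝ := (M' + ((n + 1 : ℕ) + 1)) ^ ((n + 1) + 1) * 2 ^ M' with hB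
  set B' : ℝ := (M' + (n + 1)) ^ (n + 1) * 2 ^ M' with hB'
  have hM0 : 0 ≤ M' := by positivity
  refine ⟨B + |M| * B', by positivity, fun t a ht ht1 ha => ?_⟩
  have hκ : ‖2 * a - (i : ℂ)‖ ≤ M' := by
    refine (norm_sub_le _ _).trans ?_
    rw [norm_mul]
    simp only [Complex.norm_ofNat, Complex.norm_natCast, hM']
    linarith [le_abs_self M]
  have h1 := norm_one_add_cpow_sub_le (n + 1) hκ ht ht1
  have h2 := norm_one_add_cpow_sub_le n hκ ht ht1
  have e : ((1 + t : ℝ) : ℂ) ^ (2 * a - i) * (1 - a * t) - (1 + a * t) -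
      ∑ p ∈ Finset.range (n + 2), defectCoeff i a p * (t : ℂ) ^ p =
      (((1 + t : ℝ) : ℂ) ^ (2 * a - i) -
        ∑ p ∈ Finset.range (n + 1 + 1), binomCoeff p (2 * a - i) * (t : ℂ) ^ p) -
      a * t * (((1 + t : ℝ) : ℂ) ^ (2 * a - i) -
        ∑ p ∈ Finset.range (n + 1), binomCoeff p (2 * a - i) * (t : ℂ) ^ p) := by
    have hs := sum_defectCoeff n i a t
    rw [hs]; ring
  rw [e]
  refine (norm_sub_le _ _).trans ?_
  rw [norm_mul, norm_mul, Complex.norm_real, Real.norm_eq_abs, abs_of_nonneg ht]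
  calc _ ≤ B * t ^ (n + 1 + 1) + |M| * t * (B' * t ^ (n + 1)) := by
        refine add_le_add h1 (mul_le_mul ?_ h2 (norm_nonneg _) (by positivity))
        exact mul_le_mul_of_nonneg_right (ha.trans (le_abs_self _)) ht
    _ = _ := by ring

/-- The coefficients of the expansion of `Γ(H+a)/Γ(H-a)` in powers `H^(2 a-i)`. -/
noncomputable def gammaRatioCoeff : ℕ → ℂ → ℂ
  | 0, _ => 1
  | m + 1, a => (1 / ((m : ℂ) + 1)) *
      ∑ i : Fin (m + 1), gammaRatioCoeff i a * defectCoeff i a (m + 2 - i)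
  termination_by n => n
  decreasing_by exact i.2

theorem gammaRatioCoeff_zero (a : ℂ) : gammaRatioCoeff 0 a = 1 := by rw [gammaRatioCoeff]

theorem gammaRatioCoeff_differentiable (i : ℕ) : Differentiable ℂ (gammaRatioCoeff i) := by
  induction i using Nat.strong_induction_on with
  | _ m ih =>
    cases m with
    | zero =>
      have : gammaRatioCoeff 0 = fun _ => 1 := funext gammaRatioCoeff_zero
      rw [this]; fun_prop
    | succ m =>
      have : gammaRatioCoeff (m + 1) = fun a => (1 / ((m : ℂ) + 1)) *
          ∑ i : Fin (m + 1), gammaRatioCoeff i a * defectCoeff i a (m + 2 - i) := by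
        ext a; rw [gammaRatioCoeff]
      rw [this]
      exact (Differentiable.fun_sum fun (i : Fin (m + 1)) _ =>
        (ih i i.2).mul (defectCoeff_differentiable i _)).const_mul _

theorem gammaRatioCoeff_rec (m : ℕ) (a : ℂ) :
    ∑ i ∈ Finset.range (m + 1), gammaRatioCoeff i a * defectCoeff i a (m + 1 - i) = 0 := by
  rw [Finset.sum_range_succ, show m + 1 - m = 1 by omega, defectCoeff_one]
  cases m with
  | zero => simp
  | succ m =>
    have hm : ((m : ℂ) + 1) ≠ 0 := by exact_mod_cast Nat.succ_ne_zero m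
    rw [show gammaRatioCoeff (m + 1) a = (1 / ((m : ℂ) + 1)) *
          ∑ i : Fin (m + 1), gammaRatioCoeff i a * defectCoeff i a (m + 2 - i) by
        rw [gammaRatioCoeff],
      Fin.sum_univ_eq_sum_range (fun i => gammaRatioCoeff i a * defectCoeff i a (m + 2 - i))]
    push_cast
    field_simp
    ring

/-- Grouped by total power of t, each coefficient is one of the vanishing sums of
`gammaRatioCoeff_rec`. -/
theorem gammaRatioCoeff_defect (K : ℕ) (a t : ℂ) :
    ∑ i ∈ Finset.range K, gammaRatioCoeff i a * t ^ i *
      ∑ p ∈ Finset.range (K + 1 - i), defectCoeff i a p * t ^ p = 0 := by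
  have h1 : ∀ i ∈ Finset.range K, gammaRatioCoeff i a * t ^ i *
      ∑ p ∈ Finset.range (K + 1 - i), defectCoeff i a p * t ^ p =
      ∑ m ∈ Finset.range (K + 1), if i < m then
        gammaRatioCoeff i a * defectCoeff i a (m - i) * t ^ m else 0 := by
    intro i hi
    have hi' := Finset.mem_range.1 hi
    rw [show K + 1 - i = (K - i) + 1 by omega, Finset.sum_range_succ', defectCoeff_zero, zero_mul,
      add_zero, ← Finset.sum_filter]
    have e : (Finset.range (K + 1)).filter (fun m => i < m) =
        (Finset.range (K - i)).image (fun t => i + (t + 1)) := by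
      ext m
      simp only [Finset.mem_filter, Finset.mem_range, Finset.mem_image]
      constructor
      · rintro ⟨h1, h2⟩
        exact ⟨m - i - 1, by omega, by omega⟩
      · rintro ⟨t, ht, rfl⟩
        omega
    rw [e, Finset.sum_image (by intro a _ b _ h; simpa using h), Finset.mul_sum]
    refine Finset.sum_congr rfl fun p _ => ?_
    rw [Nat.add_sub_cancel_left, pow_add]
    ring
  rw [Finset.sum_congr rfl h1, Finset.sum_comm]
  refine Finset.sum_eq_zero fun m hm => ?_
  have hm' := Finset.mem_range.1 hm
  rw [← Finset.sum_filter]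
  have e : (Finset.range K).filter (fun i => i < m) = Finset.range m := by
    ext i
    simp only [Finset.mem_filter, Finset.mem_range]
    omega
  rw [e, ← Finset.sum_mul]
  cases m with
  | zero => simp
  | succ m => rw [gammaRatioCoeff_rec, zero_mul]

/-- The truncated expansion of `Γ(H+a)/Γ(H-a)`. -/
noncomputable def gammaRatioTrunc (K : ℕ) (a : ℂ) (H : ℝ) : ℂ :=
  ∑ i ∈ Finset.range K, gammaRatioCoeff i a * (H : ℂ) ^ (2 * a - i)

theorem exists_bound_of_differentiable {f : ℂ → ℂ} (hf : Differentiable ℂ f) (M : ℝ) :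
    ∃ B : ℝ, 0 ≤ B ∧ ∀ a : ℂ, ‖a‖ ≤ M → ‖f a‖ ≤ B := by
  obtain ⟨B, hB⟩ := (isCompact_closedBall (0 : ℂ) M).exists_bound_of_continuousOn
    hf.continuous.continuousOn
  refine ⟨max B 0, le_max_right _ _, fun a ha => (hB a (by simpa using ha)).trans (le_max_left _ _)⟩

theorem gammaRatioTrunc_eq (K : ℕ) (a : ℂ) {H : ℝ} (hH : 0 < H) :
    gammaRatioTrunc K a H =
      (H : ℂ) ^ (2 * a) * ∑ i ∈ Finset.range K, gammaRatioCoeff i a * ((H⁻¹ : ℝ) : ℂ) ^ i := by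
  have hne : (H : ℂ) ≠ 0 := by exact_mod_cast hH.ne'
  rw [gammaRatioTrunc, Finset.mul_sum]
  refine Finset.sum_congr rfl fun i _ => ?_
  rw [Complex.cpow_sub _ _ hne, Complex.cpow_natCast]
  push_cast
  rw [inv_pow]
  field_simp

theorem gammaRatioTrunc_near {K : ℕ} (hK : 1 ≤ K) (M : ℝ) : ∃ B : ℝ, 0 ≤ B ∧ ∀ (H : ℝ) (a : ℂ),
    1 ≤ H → ‖a‖ ≤ M → ‖gammaRatioTrunc K a H - (H : ℂ) ^ (2 * a)‖ ≤ B * H⁻¹ * H ^ (2 * a.re) := by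
  have hb : ∀ i, ∃ B : ℝ, 0 ≤ B ∧ ∀ a : ℂ, ‖a‖ ≤ M → ‖gammaRatioCoeff i a‖ ≤ B := fun i =>
    exists_bound_of_differentiable (gammaRatioCoeff_differentiable i) M
  choose B hB0 hB using hb
  refine ⟨∑ i ∈ Finset.range K, B i, Finset.sum_nonneg fun i _ => hB0 i, fun H a hH ha => ?_⟩
  have hpos : 0 < H := by linarith
  have hinv : H⁻¹ ≤ 1 := inv_le_one_of_one_le₀ hH
  obtain ⟨K, rfl⟩ : ∃ k, K = k + 1 := ⟨K - 1, by omega⟩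
  rw [gammaRatioTrunc_eq _ _ hpos, Finset.sum_range_succ', gammaRatioCoeff_zero, pow_zero, mul_one,
    mul_add, mul_one, add_sub_cancel_right, norm_mul, Complex.norm_cpow_eq_rpow_re_of_pos hpos]
  rw [mul_comm]
  have e : (2 * a).re = 2 * a.re := by simp
  rw [e]
  refine mul_le_mul_of_nonneg_right ?_ (Real.rpow_nonneg hpos.le _)
  rw [Finset.sum_range_succ', add_mul, Finset.sum_mul]
  refine (norm_sum_le_of_le _ fun i _ => ?_).trans
    (le_add_of_nonneg_right (mul_nonneg (hB0 0) (inv_nonneg.2 hpos.le)))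
  rw [norm_mul, norm_pow, Complex.norm_real, Real.norm_eq_abs, abs_of_pos (inv_pos.2 hpos)]
  refine mul_le_mul (hB _ a ha) ?_ (by positivity) (hB0 _)
  rw [pow_succ]
  exact mul_le_of_le_one_left (inv_nonneg.2 hpos.le) (pow_le_one₀ (inv_nonneg.2 hpos.le) hinv)

/-- The coefficients are chosen so that the truncation solves W(H+1)(H-a) = W(H)(H+a) approximately:
after factoring out H^{2a+1} and setting t = 1/H, all powers through t^K cancel. -/
theorem gammaRatioTrunc_defect (K : ℕ) (M : ℝ) : ∃ C : ℝ, 0 ≤ C ∧ ∀ (H : ℝ) (a : ℂ), 1 ≤ H →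
    ‖a‖ ≤ M → ‖gammaRatioTrunc K a (H + 1) * (H - a) - gammaRatioTrunc K a H * (H + a)‖ ≤
      C * H ^ (2 * a.re + 1) * H⁻¹ ^ (K + 1) := by
  have hb : ∀ i, ∃ B : ℝ, 0 ≤ B ∧ ∀ a : ℂ, ‖a‖ ≤ M → ‖gammaRatioCoeff i a‖ ≤ B := fun i =>
    exists_bound_of_differentiable (gammaRatioCoeff_differentiable i) M
  choose B hB0 hB using hb
  choose C hC0 hC using fun i => norm_defect_sub_le (K - 1 - i) i M
  refine ⟨∑ i ∈ Finset.range K, B i * C i,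
    Finset.sum_nonneg fun i _ => mul_nonneg (hB0 i) (hC0 i), fun H a hH ha => ?_⟩
  have hpos : 0 < H := by linarith
  have hne : (H : ℂ) ≠ 0 := by exact_mod_cast hpos.ne'
  have hinv : H⁻¹ ≤ 1 := inv_le_one_of_one_le₀ hH
  have hinv0 : 0 ≤ H⁻¹ := inv_nonneg.2 hpos.le
  have e1 : ∀ i : ℕ, ((H + 1 : ℝ) : ℂ) ^ (2 * a - i) =
      (H : ℂ) ^ (2 * a) * ((H⁻¹ : ℝ) : ℂ) ^ i * ((1 + H⁻¹ : ℝ) : ℂ) ^ (2 * a - i) := by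
    intro i
    have : H + 1 = H * (1 + H⁻¹) := by field_simp
    rw [this, Complex.ofReal_mul, Complex.mul_cpow_ofReal_nonneg hpos.le (by positivity),
      Complex.cpow_sub _ _ hne, Complex.cpow_natCast]
    push_cast
    rw [inv_pow]
    field_simp
  have e2 : gammaRatioTrunc K a (H + 1) * (H - a) - gammaRatioTrunc K a H * (H + a) =
      (H : ℂ) ^ (2 * a + 1) * ∑ i ∈ Finset.range K, gammaRatioCoeff i a * ((H⁻¹ : ℝ) : ℂ) ^ i *
        (((1 + H⁻¹ : ℝ) : ℂ) ^ (2 * a - i) * (1 - a * (H⁻¹ : ℝ)) - (1 + a * (H⁻¹ : ℝ)) -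
          ∑ p ∈ Finset.range (K + 1 - i), defectCoeff i a p * ((H⁻¹ : ℝ) : ℂ) ^ p) := by
    simp only [mul_sub (gammaRatioCoeff _ a * _), Finset.sum_sub_distrib, gammaRatioCoeff_defect,
      sub_zero]
    rw [gammaRatioTrunc_eq K a hpos, gammaRatioTrunc, Complex.cpow_add _ _ hne, Complex.cpow_one,
      ← Finset.sum_sub_distrib, Finset.mul_sum, Finset.sum_mul, Finset.mul_sum, Finset.sum_mul,
      ← Finset.sum_sub_distrib]
    refine Finset.sum_congr rfl fun i _ => ?_
    rw [e1]
    push_cast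
    field_simp
  rw [e2, norm_mul, Complex.norm_cpow_eq_rpow_re_of_pos hpos]
  have e3 : (2 * a + 1).re = 2 * a.re + 1 := by simp
  rw [e3, mul_comm (∑ i ∈ Finset.range K, B i * C i) _, mul_assoc]
  refine mul_le_mul_of_nonneg_left ?_ (Real.rpow_nonneg hpos.le _)
  rw [Finset.sum_mul]
  refine norm_sum_le_of_le _ fun i hi => ?_
  have hi' := Finset.mem_range.1 hi
  have h1 := hC i H⁻¹ a hinv0 hinv ha
  rw [show K - 1 - i + 2 = K + 1 - i by omega] at h1
  rw [norm_mul, norm_mul, norm_pow, Complex.norm_real, Real.norm_eq_abs, abs_of_nonneg hinv0]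
  calc _ ≤ B i * H⁻¹ ^ i * (C i * H⁻¹ ^ (K + 1 - i)) :=
        mul_le_mul (mul_le_mul_of_nonneg_right (hB i a ha) (by positivity)) h1 (norm_nonneg _)
          (mul_nonneg (hB0 i) (by positivity))
    _ = B i * C i * (H⁻¹ ^ i * H⁻¹ ^ (K + 1 - i)) := by ring
    _ = _ := by rw [← pow_add, show i + (K + 1 - i) = K + 1 by omega]

theorem gammaRatio_add_one (a : ℂ) {H : ℝ} (hH : ‖a‖ < H) :
    gammaRatio a (H + 1) * (H - a) = gammaRatio a H * (H + a) := by
  have hre := abs_le.1 (Complex.abs_re_le_norm a)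
  have h1 : (H : ℂ) + a ≠ 0 := fun h => by
    have := congrArg Complex.re h
    simp at this; linarith
  have h2 : (H : ℂ) - a ≠ 0 := fun h => by
    have := congrArg Complex.re h
    simp at this; linarith
  have h3 : Complex.Gamma (H - a) ≠ 0 := Complex.Gamma_ne_zero_of_re_pos (by simp; linarith)
  rw [gammaRatio, gammaRatio]
  push_cast
  rw [show (H : ℂ) + 1 + a = (H + a) + 1 by ring, show (H : ℂ) + 1 - a = (H - a) + 1 by ring,
    Complex.Gamma_add_one _ h1, Complex.Gamma_add_one _ h2]
  field_simp

theorem Gamma_add_nat_succ (s : ℂ) (hs : 0 < s.re) (n : ℕ) :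
    Complex.Gamma (s + (n + 1 : ℕ)) = (∏ j ∈ Finset.range (n + 1), (s + j)) * Complex.Gamma s := by
  induction n with
  | zero =>
    have h : s ≠ 0 := fun h => by simp [h] at hs
    simp [Complex.Gamma_add_one s h]
  | succ n ih =>
    have h : s + ((n + 1 : ℕ) : ℂ) ≠ 0 := fun h => by
      have := congrArg Complex.re h
      simp at this
      have h0 : (0 : ℝ) ≤ n := Nat.cast_nonneg n
      linarith
    rw [Finset.prod_range_succ, show s + ((n + 1 + 1 : ℕ) : ℂ) = s + ((n + 1 : ℕ) : ℂ) + 1 by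
      push_cast; ring, Complex.Gamma_add_one _ h, ih]
    ring

/-- Euler's limit formula for Γ at H + a and at H - a, divided. It selects the exact ratio among all
solutions of the difference equation, which alone fixes a solution only up to a periodic factor. -/
theorem gammaRatio_tendsto (a : ℂ) {H : ℝ} (hH : ‖a‖ < H) :
    Tendsto (fun n : ℕ => gammaRatio a (H + n) / ((H + n : ℝ) : ℂ) ^ (2 * a)) atTop (𝓝 1) := by
  have hre := abs_le.1 (Complex.abs_re_le_norm a)
  have hH0 : 0 < H := (norm_nonneg a).trans_lt hH
  have hs : 0 < ((H : ℂ) + a).re := by simp; linarith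
  have hs' : 0 < ((H : ℂ) - a).re := by simp; linarith
  have key : ∀ s : ℂ, 0 < s.re →
      Tendsto (fun n => Complex.Gamma s / Complex.GammaSeq s n) atTop (𝓝 1) := by
    intro s hs
    have h0 := Complex.Gamma_ne_zero_of_re_pos hs
    have := (Complex.GammaSeq_tendsto_Gamma s).inv₀ h0 |>.const_mul (Complex.Gamma s)
    rwa [mul_inv_cancel₀ h0] at this
  have h1 := (key _ hs).div (key _ hs') one_ne_zero
  rw [div_one] at h1
  have h2 : Tendsto (fun n : ℕ => (((n : ℝ) / (H + (n + 1)) : ℝ) : ℂ) ^ (2 * a)) atTop (𝓝 1) := by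
    have h3 : Tendsto (fun n : ℕ => (n : ℝ) / (H + (n + 1))) atTop (𝓝 1) := by
      have h4 : Tendsto (fun n : ℕ => (1 : ℝ) - (H + 1) * (H + 1 + n)⁻¹) atTop (𝓝 (1 - (H + 1) * 0)) := by
        refine Tendsto.const_sub _ (Tendsto.const_mul _ (tendsto_inv_atTop_zero.comp ?_))
        exact tendsto_atTop_add_const_left _ _ tendsto_natCast_atTop_atTop
      simp only [mul_zero, sub_zero] at h4
      refine h4.congr fun n => ?_
      have : H + 1 + (n : ℝ) ≠ 0 := by positivity
      have : H + ((n : ℝ) + 1) ≠ 0 := by positivity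
      field_simp
      ring
    have h5 : ContinuousAt (fun z : ℂ => z ^ (2 * a)) ((1 : ℝ) : ℂ) := by
      exact ContinuousAt.cpow continuousAt_id continuousAt_const (by simp)
    have h6 := h5.tendsto.comp ((Complex.continuous_ofReal.tendsto 1).comp h3)
    simp only [Complex.ofReal_one, Complex.one_cpow] at h6
    exact h6
  have h3 := h1.mul h2
  rw [one_mul] at h3
  rw [← tendsto_add_atTop_iff_nat 1]
  refine h3.congr' ?_
  filter_upwards [eventually_gt_atTop 0] with n hn
  have hn' : (0 : ℝ) < n := by exact_mod_cast hn
  have hn0 : (n : ℂ) ≠ 0 := by exact_mod_cast hn.ne'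
  have hpos : 0 < H + ((n : ℝ) + 1) := by positivity
  have hG := Complex.Gamma_ne_zero_of_re_pos hs
  have hG' := Complex.Gamma_ne_zero_of_re_pos hs'
  have hp : ∀ s : ℂ, 0 < s.re → ∏ j ∈ Finset.range (n + 1), (s + j) ≠ 0 := by
    intro s hs
    refine Finset.prod_ne_zero_iff.2 fun j _ h => ?_
    have := congrArg Complex.re h
    simp at this
    have h0 : (0 : ℝ) ≤ j := Nat.cast_nonneg j
    linarith
  have hq : ((H + (n + 1) : ℝ) : ℂ) ^ (2 * a) ≠ 0 := by
    rw [Complex.cpow_ne_zero_iff]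
    left; exact_mod_cast hpos.ne'
  have e1 : gammaRatio a (H + ((n + 1 : ℕ) : ℝ)) =
      (∏ j ∈ Finset.range (n + 1), ((H : ℂ) + a + j)) * Complex.Gamma (H + a) /
      ((∏ j ∈ Finset.range (n + 1), ((H : ℂ) - a + j)) * Complex.Gamma (H - a)) := by
    rw [← Gamma_add_nat_succ _ hs, ← Gamma_add_nat_succ _ hs', gammaRatio]
    push_cast
    congr 2 <;> ring
  have e2 : ((n : ℝ) : ℂ) ^ (2 * a) = (n : ℂ) ^ ((H : ℂ) + a) / (n : ℂ) ^ ((H : ℂ) - a) := by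
    rw [← Complex.cpow_sub _ _ hn0]
    simp only [Complex.ofReal_natCast]
    congr 1
    ring
  have hc1 : (n : ℂ) ^ ((H : ℂ) + a) ≠ 0 := by
    rw [Complex.cpow_ne_zero_iff]; left; exact hn0
  have hc2 : (n : ℂ) ^ ((H : ℂ) - a) ≠ 0 := by
    rw [Complex.cpow_ne_zero_iff]; left; exact hn0
  have e3 : (((n : ℝ) / (H + (n + 1)) : ℝ) : ℂ) ^ (2 * a) =
      ((n : ℝ) : ℂ) ^ (2 * a) / ((H + (n + 1) : ℝ) : ℂ) ^ (2 * a) := by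
    rw [Complex.ofReal_div, Complex.div_cpow_ofReal_nonneg hn'.le hpos.le]
  simp only [Pi.div_apply]
  rw [e1, e3, e2, Complex.GammaSeq, Complex.GammaSeq]
  have hf : (n.factorial : ℂ) ≠ 0 := by exact_mod_cast n.factorial_ne_zero
  have hp1 := hp _ hs
  have hp2 := hp _ hs'
  push_cast at hq ⊢
  field_simp

/-- All but two powers of (H+n)^{-1} are bounded by those of H^{-1}; the remaining (H+n)^{-2} is at
most the telescoping difference 1/(H+n-1) - 1/(H+n). -/
theorem sum_inv_pow_le {K : ℕ} (hK : 1 ≤ K) {H : ℝ} (hH : 2 ≤ H) (m : ℕ) :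
    ∑ n ∈ Finset.range m, (H + n)⁻¹ ^ (K + 1) ≤ 2 * H⁻¹ ^ K := by
  obtain ⟨k, rfl⟩ : ∃ k, K = k + 1 := ⟨K - 1, by omega⟩
  have h1 : ∀ n : ℕ, (H + n)⁻¹ ^ (k + 1 + 1) ≤ H⁻¹ ^ k * ((H + n - 1)⁻¹ - (H + (n + 1 : ℕ) - 1)⁻¹) := by
    intro n
    have hn : (0 : ℝ) ≤ n := Nat.cast_nonneg n
    have hp : 0 < H + n - 1 := by linarith
    have hp' : 0 < H + n := by linarith
    rw [pow_succ, pow_succ, mul_assoc]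
    refine mul_le_mul ?_ ?_ (by positivity) (by positivity)
    · exact pow_le_pow_left₀ (by positivity) (inv_anti₀ (by linarith) (by linarith)) _
    · push_cast
      rw [show H + ((n : ℝ) + 1) - 1 = H + n by ring, inv_sub_inv hp.ne' hp'.ne', ← mul_inv,
        show H + (n : ℝ) - (H + n - 1) = 1 by ring, one_div]
      exact inv_anti₀ (by positivity) (by nlinarith)
  refine (Finset.sum_le_sum fun n _ => h1 n).trans ?_
  rw [← Finset.mul_sum, Finset.sum_range_sub', pow_succ, ← mul_assoc, mul_comm 2, mul_assoc]
  refine mul_le_mul_of_nonneg_left ?_ (by positivity)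
  have hm : (0 : ℝ) ≤ m := Nat.cast_nonneg m
  have : 0 < H + (m : ℝ) - 1 := by linarith
  have h2 : (H + ((0 : ℕ) : ℝ) - 1)⁻¹ ≤ 2 * H⁻¹ := by
    rw [← div_eq_mul_inv, inv_le_comm₀ (by simp; linarith) (by positivity), inv_div]
    simp; linarith
  have h3 : 0 ≤ (H + (m : ℝ) - 1)⁻¹ := by positivity
  linarith

/-- The expansion of `Γ(H+a)/Γ(H-a)` in powers `H^(2 a-i)`, uniformly for bounded `a`. -/
theorem gammaRatio_expansion {K : ℕ} (hK : 1 ≤ K) (M : ℝ) : ∃ C : ℝ, 0 ≤ C ∧ ∀ᶠ H : ℝ in atTop,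
    ∀ a : ℂ, ‖a‖ ≤ M → ‖gammaRatio a H - gammaRatioTrunc K a H‖ ≤ C * H ^ (2 * a.re - K) := by
  obtain ⟨B, hB0, hB⟩ := gammaRatioTrunc_near hK M
  obtain ⟨C, hC0, hC⟩ := gammaRatioTrunc_defect K M
  -- Beyond R the truncation is within a factor 2 of H^{2a} in norm, |x+a| ≥ x/2 with all Gamma
  -- arguments in the right half plane, and the accumulated defect S is at most 1.
  set R : ℝ := max (max 2 (2 * B)) (max (2 * |M| + 1) (16 * C)) with hR
  refine ⟨2 * (16 * C), by positivity, ?_⟩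
  filter_upwards [eventually_ge_atTop R] with H hH a ha
  have hH2 : 2 ≤ H := (le_max_left _ _).trans ((le_max_left _ _).trans hH)
  have hHB : 2 * B ≤ H := (le_max_right _ _).trans ((le_max_left _ _).trans hH)
  have hHM : 2 * |M| + 1 ≤ H := (le_max_left _ _).trans ((le_max_right _ _).trans hH)
  have hHC : 16 * C ≤ H := (le_max_right _ _).trans ((le_max_right _ _).trans hH)
  have haM : ‖a‖ ≤ |M| := ha.trans (le_abs_self _)
  have hlow : ∀ x : ℝ, H ≤ x → x ^ (2 * a.re) / 2 ≤ ‖gammaRatioTrunc K a x‖ ∧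
      ‖gammaRatioTrunc K a x‖ ≤ 2 * x ^ (2 * a.re) := by
    intro x hx
    have hx0 : 0 < x := by linarith
    have h1 := hB x a (by linarith) ha
    have h2 : ‖(x : ℂ) ^ (2 * a)‖ = x ^ (2 * a.re) := by
      rw [Complex.norm_cpow_eq_rpow_re_of_pos hx0]; simp
    have h3 : B * x⁻¹ ≤ 1 / 2 := by
      rw [← div_eq_mul_inv, div_le_iff₀ hx0]; linarith
    have h4 : B * x⁻¹ * x ^ (2 * a.re) ≤ 1 / 2 * x ^ (2 * a.re) :=
      mul_le_mul_of_nonneg_right h3 (Real.rpow_nonneg hx0.le _)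
    have h5 := norm_sub_norm_le (gammaRatioTrunc K a x) ((x : ℂ) ^ (2 * a))
    have h6 := norm_sub_norm_le ((x : ℂ) ^ (2 * a)) (gammaRatioTrunc K a x)
    rw [norm_sub_rev, h2] at h6
    rw [h2] at h5
    have h7 := Real.rpow_pos_of_pos hx0 (2 * a.re)
    constructor <;> linarith
  have hE0 : ∀ x : ℝ, H ≤ x → gammaRatioTrunc K a x ≠ 0 := fun x hx h => by
    have h1 := (hlow x hx).1
    rw [h, norm_zero] at h1
    have := Real.rpow_pos_of_pos (show 0 < x by linarith) (2 * a.re)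
    linarith
  have hxa : ∀ x : ℝ, H ≤ x → x / 2 ≤ ‖(x : ℂ) + a‖ := fun x hx => by
    have h1 := norm_sub_norm_le (x : ℂ) (-a)
    rw [sub_neg_eq_add, norm_neg, Complex.norm_real, Real.norm_eq_abs, abs_of_pos (by linarith)] at h1
    linarith
  have hW0 : ∀ x : ℝ, H ≤ x → gammaRatio a x ≠ 0 := fun x hx => by
    have hre := abs_le.1 (Complex.abs_re_le_norm a)
    exact div_ne_zero (Complex.Gamma_ne_zero_of_re_pos (by simp; linarith))
      (Complex.Gamma_ne_zero_of_re_pos (by simp; linarith))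
  -- The quotient of exact and truncated solution satisfies ρ(x) = (1+e(x)) ρ(x+1) and tends to 1
  -- along H + n. So ρ(H) is the infinite product of the factors 1+e(H+n), and summability of e
  -- gives ρ(H) = 1 + O(H^{-K}).
  set ρ : ℝ → ℂ := fun x => gammaRatio a x / gammaRatioTrunc K a x with hρ
  set e : ℝ → ℂ := fun x => (gammaRatioTrunc K a (x + 1) * (x - a) -
    gammaRatioTrunc K a x * (x + a)) / (gammaRatioTrunc K a x * (x + a)) with he
  have hstep : ∀ x : ℝ, H ≤ x → ρ x = (1 + e x) * ρ (x + 1) := by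
    intro x hx
    have h1 := gammaRatio_add_one a (H := x) (by linarith)
    have h2 := hE0 x hx
    have h3 := hE0 (x + 1) (by linarith)
    have h4 : (x : ℂ) + a ≠ 0 := fun h => by
      have := hxa x hx
      rw [h, norm_zero] at this; linarith
    simp only [hρ, he]
    field_simp
    have h5 : gammaRatioTrunc K a x * (x + a) + (gammaRatioTrunc K a (x + 1) * (x - a) -
      gammaRatioTrunc K a x * (x + a)) = gammaRatioTrunc K a (x + 1) * (x - a) := by ring
    rw [h5]
    linear_combination (-gammaRatioTrunc K a (x + 1)) * h1
  have heb : ∀ x : ℝ, H ≤ x → ‖e x‖ ≤ 4 * C * x⁻¹ ^ (K + 1) := by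
    intro x hx
    have hx0 : 0 < x := by linarith
    have h1 := hC x a (by linarith) ha
    have h2 := (hlow x hx).1
    have h3 := hxa x hx
    have h7 := Real.rpow_pos_of_pos hx0 (2 * a.re)
    simp only [he]
    rw [norm_div, norm_mul, div_le_iff₀ (mul_pos (by linarith) (by linarith))]
    calc _ ≤ C * x ^ (2 * a.re + 1) * x⁻¹ ^ (K + 1) := h1
      _ = 4 * C * x⁻¹ ^ (K + 1) * (x ^ (2 * a.re) / 2 * (x / 2)) := by
        rw [Real.rpow_add hx0, Real.rpow_one]; ring
      _ ≤ _ := by gcongr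
  have hprod : ∀ m : ℕ, ρ H = (∏ n ∈ Finset.range m, (1 + e (H + n))) * ρ (H + m) := by
    intro m
    induction m with
    | zero => simp
    | succ m ih =>
      rw [Finset.prod_range_succ, ih, hstep (H + m) (by linarith [Nat.cast_nonneg (α := ℝ) m])]
      push_cast
      rw [← add_assoc]
      ring
  have hlim : Tendsto (fun m : ℕ => ρ (H + m)) atTop (𝓝 1) := by
    have h1 := gammaRatio_tendsto a (H := H) (by linarith)
    have h2 : Tendsto (fun m : ℕ => gammaRatioTrunc K a (H + m) / ((H + m : ℝ) : ℂ) ^ (2 * a))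
        atTop (𝓝 1) := by
      rw [tendsto_iff_norm_sub_tendsto_zero]
      have h3 : Tendsto (fun m : ℕ => B * (H + m)⁻¹) atTop (𝓝 (B * 0)) :=
        Tendsto.const_mul _ (tendsto_inv_atTop_zero.comp
          (tendsto_atTop_add_const_left _ _ tendsto_natCast_atTop_atTop))
      rw [mul_zero] at h3
      refine squeeze_zero (fun m => norm_nonneg _) (fun m => ?_) h3
      have hx : H ≤ H + (m : ℝ) := by linarith [Nat.cast_nonneg (α := ℝ) m]
      have hx0 : 0 < H + (m : ℝ) := by linarith
      have hne : ((H + m : ℝ) : ℂ) ^ (2 * a) ≠ 0 := by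
        rw [Complex.cpow_ne_zero_iff]; left; exact_mod_cast hx0.ne'
      rw [div_sub_one hne, norm_div, Complex.norm_cpow_eq_rpow_re_of_pos hx0,
        show (2 * a).re = 2 * a.re by simp, div_le_iff₀ (Real.rpow_pos_of_pos hx0 _)]
      exact hB _ a (by linarith) ha
    have h4 := h1.div h2 one_ne_zero
    rw [div_one] at h4
    refine h4.congr fun m => ?_
    have hx : H ≤ H + (m : ℝ) := by linarith [Nat.cast_nonneg (α := ℝ) m]
    have hx0 : 0 < H + (m : ℝ) := by linarith
    have hne : ((H + m : ℝ) : ℂ) ^ (2 * a) ≠ 0 := by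
      rw [Complex.cpow_ne_zero_iff]; left; exact_mod_cast hx0.ne'
    have := hE0 _ hx
    simp only [hρ, Pi.div_apply]
    field_simp
  set S : ℝ := 8 * C * H⁻¹ ^ K with hS
  have hH1 : H⁻¹ ^ K ≤ H⁻¹ := by
    obtain ⟨k, rfl⟩ : ∃ k, K = k + 1 := ⟨K - 1, by omega⟩
    rw [pow_succ]
    exact mul_le_of_le_one_left (by positivity)
      (pow_le_one₀ (by positivity) (inv_le_one_of_one_le₀ (by linarith)))
  have hS1 : S ≤ 1 := by
    calc S ≤ 8 * C * H⁻¹ := mul_le_mul_of_nonneg_left hH1 (by positivity)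
      _ ≤ 1 := by rw [← div_eq_mul_inv, div_le_one (by linarith)]; linarith
  have hS0 : 0 ≤ S := by positivity
  have hpb : ∀ m : ℕ, ‖(∏ n ∈ Finset.range m, (1 + e (H + n))) - 1‖ ≤ 2 * S := by
    intro m
    refine (Finset.norm_prod_one_add_sub_one_le _ _).trans ?_
    have h1 : ∑ n ∈ Finset.range m, ‖e (H + n)‖ ≤ S := by
      calc _ ≤ ∑ n ∈ Finset.range m, 4 * C * (H + n)⁻¹ ^ (K + 1) :=
            Finset.sum_le_sum fun n _ => heb _ (by linarith [Nat.cast_nonneg (α := ℝ) n])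
        _ ≤ 4 * C * (2 * H⁻¹ ^ K) := by
          rw [← Finset.mul_sum]
          exact mul_le_mul_of_nonneg_left (sum_inv_pow_le hK hH2 m) (by positivity)
        _ = S := by rw [hS]; ring
    have h2 : Real.exp S - 1 ≤ 2 * S := by
      have := Real.abs_exp_sub_one_le (x := S) (by rwa [abs_of_nonneg hS0])
      rw [abs_of_nonneg hS0] at this
      exact (le_abs_self _).trans this
    linarith [Real.exp_le_exp.2 h1]
  have hρ1 : ‖ρ H - 1‖ ≤ 2 * S := by
    have h1 : Tendsto (fun m : ℕ => ∏ n ∈ Finset.range m, (1 + e (H + n))) atTop (𝓝 (ρ H)) := by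
      have h2 := (tendsto_const_nhds (x := ρ H)).div hlim one_ne_zero
      rw [div_one] at h2
      refine h2.congr fun m => ?_
      have hx : H ≤ H + (m : ℝ) := by linarith [Nat.cast_nonneg (α := ℝ) m]
      have h3 : ρ (H + m) ≠ 0 := div_ne_zero (hW0 _ hx) (hE0 _ hx)
      simp only [Pi.div_apply]
      rw [hprod m, mul_div_cancel_right₀ _ h3]
    exact le_of_tendsto ((h1.sub_const 1).norm) (Eventually.of_forall hpb)
  have hfin : gammaRatio a H - gammaRatioTrunc K a H = gammaRatioTrunc K a H * (ρ H - 1) := by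
    have := hE0 H le_rfl
    simp only [hρ]
    field_simp
  have hH0 : 0 < H := by linarith
  rw [hfin, norm_mul]
  calc _ ≤ (2 * H ^ (2 * a.re)) * (2 * S) :=
        mul_le_mul (hlow H le_rfl).2 hρ1 (norm_nonneg _) (by positivity)
    _ = 2 * (16 * C) * (H ^ (2 * a.re) * H⁻¹ ^ K) := by rw [hS]; ring
    _ = _ := by
      rw [Real.rpow_sub hH0, Real.rpow_natCast, inv_pow]
      field_simp

/-! ### Derivatives of the coefficients S_a in the exponent a. -/

theorem iteratedDeriv_differentiableOn {F : ℂ → ℂ} {U : Set ℂ} (hU : IsOpen U)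
    (hF : DifferentiableOn ℂ F U) (l : ℕ) : DifferentiableOn ℂ (iteratedDeriv l F) U := by
  induction l with
  | zero => simpa using hF
  | succ l ih => rw [iteratedDeriv_succ]; exact ih.deriv hU

/-- The real derivatives that define the action on logarithms are restrictions of complex ones, so
Cauchy estimates apply to them. -/
theorem iteratedDeriv_ofReal {F : ℂ → ℂ} {f : ℝ → ℝ} {U : Set ℂ} (hU : IsOpen U)
    (hF : DifferentiableOn ℂ F U) (hf : ∀ x : ℝ, (x : ℂ) ∈ U → (f x : ℂ) = F x) (l : ℕ) :
    ∀ x : ℝ, (x : ℂ) ∈ U → ((iteratedDeriv l f x : ℝ) : ℂ) = iteratedDeriv l F x := by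
  induction l with
  | zero => simpa using hf
  | succ l ih =>
    intro x hx
    rw [iteratedDeriv_succ, iteratedDeriv_succ]
    have h1 : HasDerivAt (iteratedDeriv l F) (deriv (iteratedDeriv l F) x) x :=
      ((iteratedDeriv_differentiableOn hU hF l).differentiableAt (hU.mem_nhds hx)).hasDerivAt
    have hev : ∀ᶠ y : ℝ in 𝓝 x, (y : ℂ) ∈ U :=
      Complex.continuous_ofReal.continuousAt.eventually (hU.mem_nhds hx)
    have h2 := h1.real_of_complex
    have h3 : HasDerivAt (iteratedDeriv l f) (deriv (iteratedDeriv l F) x).re x := by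
      refine h2.congr_of_eventuallyEq ?_
      filter_upwards [hev] with y hy
      rw [← ih y hy, Complex.ofReal_re]
    have h4 : HasDerivAt (fun y : ℝ => ((iteratedDeriv l f y : ℝ) : ℂ))
        (deriv (iteratedDeriv l F) x) x := by
      refine h1.comp_ofReal.congr_of_eventuallyEq ?_
      filter_upwards [hev] with y hy
      exact ih y hy
    rw [h3.deriv]
    exact h3.ofReal_comp.unique h4

/-- The entire function `b ↦ 1 / (Γ(-b-r) Γ(-b-s))`. -/
noncomputable def gammaInv (r s : ℝ) (b : ℂ) : ℂ :=
  (Complex.Gamma (-b - r))⁻¹ * (Complex.Gamma (-b - s))⁻¹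

theorem gammaInv_differentiable (r s : ℝ) : Differentiable ℂ (gammaInv r s) := by
  unfold gammaInv
  have h : ∀ t : ℝ, Differentiable ℂ fun b : ℂ => (Complex.Gamma (-b - t))⁻¹ := fun t =>
    Complex.differentiable_one_div_Gamma.comp (f := fun b : ℂ => -b - t) (by fun_prop)
  exact (h r).mul (h s)

theorem gammaRatio_differentiableOn (H : ℝ) :
    DifferentiableOn ℂ (fun a => gammaRatio a H) (Metric.ball 0 H) := by
  intro a ha
  have ha' : ‖a‖ < H := by simpa using ha
  have hre := abs_le.1 (Complex.abs_re_le_norm a)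
  have key : ∀ z : ℂ, 0 < z.re → DifferentiableAt ℂ Complex.Gamma z := fun z hz =>
    Complex.differentiableAt_Gamma z fun m h => by
      rw [h] at hz; simp at hz
      have : (0 : ℝ) ≤ m := Nat.cast_nonneg m
      linarith
  have h1 : 0 < ((H : ℂ) + a).re := by simp; linarith
  have h2 : 0 < ((H : ℂ) - a).re := by simp; linarith
  refine DifferentiableAt.differentiableWithinAt ?_
  unfold gammaRatio
  refine DifferentiableAt.div ?_ ?_ (Complex.Gamma_ne_zero_of_re_pos h2)
  · exact (key _ h1).comp a (f := fun a : ℂ => (H : ℂ) + a) (by fun_prop)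
  · exact (key _ h2).comp a (f := fun a : ℂ => (H : ℂ) - a) (by fun_prop)

theorem gammaRatio_norm_le (M : ℝ) : ∃ C : ℝ, 0 ≤ C ∧ ∀ᶠ H : ℝ in atTop,
    ∀ a : ℂ, ‖a‖ ≤ M → ‖gammaRatio a H‖ ≤ C * H ^ (2 * a.re) := by
  obtain ⟨C, hC0, hC⟩ := gammaRatio_expansion le_rfl M
  refine ⟨C + 1, by positivity, ?_⟩
  filter_upwards [hC, eventually_ge_atTop 1] with H h1 hH a ha
  have hH0 : 0 < H := by linarith
  have h2 := h1 a ha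
  have h3 : ‖gammaRatioTrunc 1 a H‖ = H ^ (2 * a.re) := by
    simp [gammaRatioTrunc, gammaRatioCoeff, Complex.norm_cpow_eq_rpow_re_of_pos hH0]
  have h4 : H ^ (2 * a.re - (1 : ℕ)) ≤ H ^ (2 * a.re) :=
    Real.rpow_le_rpow_of_exponent_le hH (by simp)
  have h5 := norm_sub_norm_le (gammaRatio a H) (gammaRatioTrunc 1 a H)
  nlinarith [mul_le_mul_of_nonneg_left h4 hC0]

/-- `γ(b) Γ(H-b-1) / Γ(H+b+1)`, the coefficient `S_b(H)` without its weight. -/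
noncomputable def kernel (r s : ℝ) (b : ℂ) (H : ℝ) : ℂ := gammaInv r s b * gammaRatio (-b - 1) H

/-- The derivatives of `S_α(H) / ω(H)` in `α`. -/
noncomputable def kernelDeriv (r s : ℝ) (l : ℕ) (a H : ℝ) : ℝ :=
  iteratedDeriv l (fun α : ℝ => (Real.Gamma (-α - r))⁻¹ * (Real.Gamma (-α - s))⁻¹ *
    (Real.Gamma (H - α - 1) / Real.Gamma (H + α + 1))) a

theorem kernel_ofReal (r s a H : ℝ) : (((Real.Gamma (-a - r))⁻¹ * (Real.Gamma (-a - s))⁻¹ *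
    (Real.Gamma (H - a - 1) / Real.Gamma (H + a + 1)) : ℝ) : ℂ) = kernel r s a H := by
  unfold kernel gammaInv gammaRatio
  push_cast [← Complex.Gamma_ofReal]
  rw [show (H : ℂ) + (-a - 1) = H - a - 1 by ring, show (H : ℂ) - (-a - 1) = H + a + 1 by ring]

theorem kernel_differentiableOn (r s H : ℝ) :
    DifferentiableOn ℂ (fun b => kernel r s b H) (Metric.ball 0 (H - 1)) := by
  refine (gammaInv_differentiable r s).differentiableOn.mul ?_
  refine (gammaRatio_differentiableOn H).comp (g := fun a => gammaRatio a H)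
    (f := fun b : ℂ => -b - 1) (by fun_prop) ?_
  intro b hb
  simp only [mem_ball_zero_iff] at hb ⊢
  calc ‖-b - 1‖ ≤ ‖-b‖ + ‖(1 : ℂ)‖ := norm_sub_le _ _
    _ < H := by simp; linarith

theorem kernelDeriv_ofReal (r s : ℝ) (l : ℕ) {a H : ℝ} (h : |a| < H - 1) :
    (kernelDeriv r s l a H : ℂ) = iteratedDeriv l (fun b => kernel r s b H) a :=
  iteratedDeriv_ofReal Metric.isOpen_ball (kernel_differentiableOn r s H)
    (fun x _ => kernel_ofReal r s x H) l a (by simpa using h)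

theorem iteratedDeriv_const_cpow {H : ℝ} (hH : 0 < H) (c d : ℂ) (j : ℕ) (b : ℂ) :
    iteratedDeriv j (fun b : ℂ => (H : ℂ) ^ (c * b + d)) b =
      (c * Real.log H) ^ j * (H : ℂ) ^ (c * b + d) := by
  induction j generalizing b with
  | zero => simp
  | succ j ih =>
    rw [iteratedDeriv_succ, show iteratedDeriv j (fun b : ℂ => (H : ℂ) ^ (c * b + d)) =
      fun b => (c * Real.log H) ^ j * (H : ℂ) ^ (c * b + d) from funext ih]
    have h1 : HasDerivAt (fun b : ℂ => c * b + d) c b := by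
      simpa using ((hasDerivAt_id b).const_mul c).add_const d
    have h2 := (h1.const_cpow (c := (H : ℂ)) (Or.inl (by exact_mod_cast hH.ne'))).const_mul
      ((c * Real.log H) ^ j)
    rw [h2.deriv, ← Complex.ofReal_log hH.le]
    ring

/-- Cauchy's estimate on the unit circle around a bounds the l-th derivative of the kernel minus its
truncated expansion in H^{-2b-2-i}; Leibniz' rule applied to the truncation produces the powers of
log H. On that circle Re b ≥ a - 1, which costs a factor H² in the error. -/
theorem kernelDeriv_approx (r s : ℝ) (l : ℕ) (a : ℝ) {K : ℕ} (hK : 1 ≤ K) : ∃ u ∈ powerLog,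
    (∀ δ > 0, u =o[atTop] fun H : ℝ => H ^ (-2 * a - 2 + δ)) ∧
    (fun H => kernelDeriv r s l a H - u H) =O[atTop] fun H : ℝ => H ^ (-2 * a - K) := by
  set v : ℕ → ℂ → ℂ := fun i b => gammaInv r s b * gammaRatioCoeff i (-b - 1) with hv
  have hvd : ∀ i, Differentiable ℂ (v i) := fun i => (gammaInv_differentiable r s).mul
    ((gammaRatioCoeff_differentiable i).comp (f := fun b : ℂ => -b - 1) (by fun_prop))
  set κ : ℕ → ℕ → ℝ := fun i j =>
    l.choose j * (iteratedDeriv j (v i) a).re * (-2) ^ (l - j) with hκ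
  set u : ℝ → ℝ := ∑ i ∈ Finset.range K, ∑ j ∈ Finset.range (l + 1),
    κ i j • powerLogMonomial (-2 * a - 2 - i, l - j) with hu
  have hu' : ∀ H, u H = ∑ i ∈ Finset.range K, ∑ j ∈ Finset.range (l + 1),
      κ i j * (H ^ (-2 * a - 2 - i) * Real.log H ^ (l - j)) := fun H => by
    simp [hu, Finset.sum_apply, powerLogMonomial]
  refine ⟨u, ?_, ?_, ?_⟩
  · exact Submodule.sum_mem _ fun i _ => Submodule.sum_mem _ fun j _ =>
      Submodule.smul_mem _ _ (powerLogMonomial_mem _)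
  · intro δ hδ
    rw [show u = fun H => _ from funext hu']
    refine IsLittleO.fun_sum fun i _ => IsLittleO.fun_sum fun j _ => IsLittleO.const_mul_left ?_ _
    exact powerLogMonomial_isLittleO (l - j) (by
      have : (0 : ℝ) ≤ i := Nat.cast_nonneg i
      linarith)
  · obtain ⟨B, hB0, hB⟩ := exists_bound_of_differentiable (gammaInv_differentiable r s) (|a| + 1)
    obtain ⟨C, hC0, hC⟩ := gammaRatio_expansion hK (|a| + 2)
    refine IsBigO.of_bound (l.factorial * (B * C)) ?_
    filter_upwards [hC, eventually_ge_atTop 1, eventually_gt_atTop (|a| + 2)] with H h1 hH hHa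
    have hH0 : 0 < H := by linarith
    set E : ℂ → ℂ := fun b => ∑ i ∈ Finset.range K, v i b * (H : ℂ) ^ ((-2 : ℂ) * b + (-2 - i)) with hE
    have hpd : ∀ i : ℕ, Differentiable ℂ fun b : ℂ => (H : ℂ) ^ ((-2 : ℂ) * b + (-2 - i)) :=
      fun i b => (DifferentiableAt.const_cpow (by fun_prop) (Or.inl (by exact_mod_cast hH0.ne')))
    have hEd : Differentiable ℂ E :=
      Differentiable.fun_sum fun i _ => (hvd i).mul (hpd i)
    have hcl : Metric.closedBall (a : ℂ) 1 ⊆ Metric.ball 0 (H - 1) := by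
      intro b hb
      simp only [Metric.mem_closedBall, dist_eq_norm, mem_ball_zero_iff] at hb ⊢
      calc ‖b‖ ≤ ‖b - a‖ + ‖(a : ℂ)‖ := by simpa using norm_add_le (b - a) (a : ℂ)
        _ < H - 1 := by simp; linarith
    have hdiff : DifferentiableOn ℂ (fun b => kernel r s b H - E b) (Metric.ball 0 (H - 1)) :=
      (kernel_differentiableOn r s H).sub hEd.differentiableOn
    have hcauchy := Complex.norm_iteratedDeriv_le_of_forall_mem_sphere_norm_le (c := (a : ℂ)) (R := 1)
      (C := B * (C * H ^ (-2 * a - K))) (f := fun b => kernel r s b H - E b) l one_pos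
      (DifferentiableOn.diffContOnCl_ball (U := Metric.ball 0 (H - 1)) hdiff hcl) (by
        intro b hb
        have hb1 : ‖b - a‖ = 1 := by simpa [dist_eq_norm] using hb
        have hbn : ‖b‖ ≤ |a| + 1 := by
          calc ‖b‖ ≤ ‖b - a‖ + ‖(a : ℂ)‖ := by simpa using norm_add_le (b - a) (a : ℂ)
            _ ≤ _ := by simp; linarith
        have hbn' : ‖-b - 1‖ ≤ |a| + 2 := by
          calc ‖-b - 1‖ ≤ ‖-b‖ + ‖(1 : ℂ)‖ := norm_sub_le _ _
            _ ≤ _ := by simp; linarith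
        have hre : a - 1 ≤ b.re := by
          have := (abs_le.1 (Complex.abs_re_le_norm (b - a))).1
          simp [hb1] at this; linarith
        have e1 : kernel r s b H - E b =
            gammaInv r s b * (gammaRatio (-b - 1) H - gammaRatioTrunc K (-b - 1) H) := by
          simp only [kernel, hE, gammaRatioTrunc, mul_sub, Finset.mul_sum, hv]
          congr 1
          refine Finset.sum_congr rfl fun i _ => ?_
          rw [show (2 : ℂ) * -b - 2 * 1 - i = -2 * b + (-2 - i) by ring]
          ring
        rw [e1, norm_mul]
        refine mul_le_mul (hB b hbn) ((h1 _ hbn').trans ?_) (norm_nonneg _) hB0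
        refine mul_le_mul_of_nonneg_left ?_ hC0
        refine Real.rpow_le_rpow_of_exponent_le hH ?_
        simp; linarith)
    have hid : iteratedDeriv l (fun b => kernel r s b H - E b) a =
        kernelDeriv r s l a H - iteratedDeriv l E a := by
      rw [kernelDeriv_ofReal r s l (by linarith)]
      refine iteratedDeriv_sub ?_ ?_
      · exact ((kernel_differentiableOn r s H).analyticOnNhd Metric.isOpen_ball a
          (by simp; linarith)).contDiffAt
      · exact hEd.contDiff.contDiffAt
    have hEa : (iteratedDeriv l E a).re = u H := by
      rw [hE, iteratedDeriv_fun_sum fun i _ => ((hvd i).fun_mul (hpd i)).contDiff.contDiffAt,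
        Complex.re_sum, hu']
      refine Finset.sum_congr rfl fun i _ => ?_
      rw [iteratedDeriv_fun_mul (hvd i).contDiff.contDiffAt (hpd i).contDiff.contDiffAt,
        Complex.re_sum]
      refine Finset.sum_congr rfl fun j _ => ?_
      rw [iteratedDeriv_const_cpow hH0]
      have e2 : (-2 * (Real.log H : ℂ)) ^ (l - j) * (H : ℂ) ^ ((-2 : ℂ) * a + (-2 - i)) =
          (((-2) ^ (l - j) * (H ^ (-2 * a - 2 - i) * Real.log H ^ (l - j)) : ℝ) : ℂ) := by
        push_cast [Complex.ofReal_cpow hH0.le]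
        rw [show (-2 : ℂ) * a + (-2 - i) = -2 * a - 2 - i by ring]
        ring
      rw [e2, Complex.re_mul_ofReal, ← Complex.ofReal_natCast, Complex.re_ofReal_mul]
      simp only [hκ]; ring
    rw [hid] at hcauchy
    have h6 := (Complex.abs_re_le_norm _).trans hcauchy
    rw [Complex.sub_re, Complex.ofReal_re, hEa] at h6
    rw [Real.norm_eq_abs, Real.norm_eq_abs, abs_of_pos (Real.rpow_pos_of_pos hH0 _)]
    calc _ ≤ _ := h6
      _ = _ := by rw [one_pow, div_one]; ring

theorem kernelDeriv_expandable (r s : ℝ) (l : ℕ) (a : ℝ) : Expandable (kernelDeriv r s l a) := by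
  intro N
  obtain ⟨K, hK⟩ := exists_nat_gt (max 1 (N - 2 * a))
  obtain ⟨u, hu, -, h⟩ := kernelDeriv_approx r s l a (K := K) (by
    have := (le_max_left _ _).trans_lt hK
    exact_mod_cast this.le)
  refine ⟨u, hu, h.trans_isLittleO (rpow_isLittleO_rpow ?_)⟩
  have := (le_max_right _ _).trans_lt hK
  linarith

theorem kernelDeriv_isLittleO (r s : ℝ) (l : ℕ) (a : ℝ) {δ : ℝ} (hδ : 0 < δ) :
    kernelDeriv r s l a =o[atTop] fun H : ℝ => H ^ (-2 * a - 2 + δ) := by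
  obtain ⟨u, hu, h1, h2⟩ := kernelDeriv_approx r s l a (K := 2) (by norm_num)
  refine ((h2.trans_isLittleO (rpow_isLittleO_rpow ?_)).add (h1 δ hδ)).congr_left fun H => ?_
  · push_cast; linarith
  · ring

/-! ### Divided differences and telescoping sums over the integers. -/

theorem iteratedDeriv_inv_sub (j : ℕ) (a b : ℂ) :
    iteratedDeriv j (fun b : ℂ => (b - a)⁻¹) b = (-1) ^ j * j.factorial * ((b - a)⁻¹) ^ (j + 1) := by
  have h := iter_deriv_inv_linear_sub j (1 : ℂ) a
  rw [iteratedDeriv_eq_iterate]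
  have h1 : (fun x : ℂ => ((1 : ℂ) * x - a)⁻¹) = fun b : ℂ => (b - a)⁻¹ := by simp
  rw [h1] at h
  rw [congrFun h b]
  rw [show (-1 - (j : ℤ)) = -((j + 1 : ℕ) : ℤ) by push_cast; ring, zpow_neg, zpow_natCast, inv_pow]
  simp

/-- The divided difference of a holomorphic function extends holomorphically, with all derivatives
in one of the two points. -/
theorem exists_divided_difference {g : ℂ → ℂ} {U : Set ℂ} (hU : IsOpen U)
    (hg : DifferentiableOn ℂ g U) {c : ℂ} (hc : c ∈ U) (l : ℕ) :
    ∃ K : ℂ → ℂ, DifferentiableOn ℂ K U ∧ ∀ a ∈ U, a ≠ c →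
      K a = iteratedDeriv l (fun b => g b * (b - a)⁻¹) c
        - g a * iteratedDeriv l (fun b => (b - a)⁻¹) c := by
  set K₀ : ℂ → ℂ := fun a => iteratedDeriv l (fun b => g b * (b - a)⁻¹) c
        - g a * iteratedDeriv l (fun b => (b - a)⁻¹) c with hK₀
  have hgc : ContDiffAt ℂ l g c := (hg.analyticOnNhd hU c hc).contDiffAt
  have hinv : ∀ a, a ≠ c → ContDiffAt ℂ l (fun b : ℂ => (b - a)⁻¹) c := fun a ha =>
    (contDiffAt_id.sub contDiffAt_const).inv (sub_ne_zero.2 (Ne.symm ha))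
  have hd : DifferentiableOn ℂ K₀ (U \ {c}) := by
    have h1 : DifferentiableOn ℂ (fun a : ℂ => (∑ i ∈ Finset.range (l + 1), (l.choose i : ℂ) *
        iteratedDeriv i g c * ((-1) ^ (l - i) * (l - i).factorial * ((c - a)⁻¹) ^ (l - i + 1)))
        - g a * ((-1) ^ l * l.factorial * ((c - a)⁻¹) ^ (l + 1))) (U \ {c}) := by
      have h2 : DifferentiableOn ℂ (fun a : ℂ => (c - a)⁻¹) (U \ {c}) :=
        DifferentiableOn.inv (by fun_prop) fun a ha => sub_ne_zero.2 (Ne.symm ha.2)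
      refine DifferentiableOn.sub (DifferentiableOn.fun_sum fun i _ => ?_) ?_
      · exact ((h2.pow _).const_mul _).const_mul _
      · exact (hg.mono Set.sdiff_subset).mul ((h2.pow _).const_mul _)
    refine h1.congr fun a ha => ?_
    simp only [hK₀]
    rw [iteratedDeriv_fun_mul hgc (hinv a ha.2)]
    simp only [iteratedDeriv_inv_sub]
  obtain ⟨ρ, hρ, hball⟩ : ∃ ρ > 0, Metric.closedBall c (2 * ρ) ⊆ U := by
    obtain ⟨ρ, hρ, h⟩ := Metric.nhds_basis_closedBall.mem_iff.1 (hU.mem_nhds hc)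
    exact ⟨ρ / 2, by positivity, by rwa [mul_div_cancel₀ _ two_ne_zero]⟩
  obtain ⟨B, hB⟩ := (isCompact_closedBall c (2 * ρ)).exists_bound_of_continuousOn
    (hg.continuousOn.mono hball)
  have hsub : Metric.ball c ρ ⊆ U := fun a ha => hball (by
    simp only [Metric.mem_ball, Metric.mem_closedBall] at ha ⊢; linarith)
  -- For a ≠ c the value K₀(a) is the l-th derivative at c of (g(b)-g(a))/(b-a) in b. Cauchy's
  -- estimate on the circle of radius 2ρ, where |b-a| ≥ ρ, bounds it uniformly as a → c, so the
  -- singularity is removable.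
  have hbdd : BddAbove (norm ∘ K₀ '' (Metric.ball c ρ \ {c})) := by
    refine ⟨l.factorial * ((B + B) * ρ⁻¹) / (2 * ρ) ^ l, ?_⟩
    rintro _ ⟨a, ⟨ha, hac⟩, rfl⟩
    have haU : a ∈ U := hsub ha
    have hac' : a ≠ c := hac
    have hds : DifferentiableOn ℂ (dslope g a) U :=
      (Complex.differentiableOn_dslope (hU.mem_nhds haU)).2 hg
    have hb := Complex.norm_iteratedDeriv_le_of_forall_mem_sphere_norm_le (c := c) (R := 2 * ρ)
      (C := (B + B) * ρ⁻¹) (f := dslope g a) l (by positivity)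
      (hds.diffContOnCl_ball hball) (by
        intro b hb
        have hba : ρ ≤ ‖b - a‖ := by
          rw [Metric.mem_ball, dist_eq_norm] at ha
          rw [Metric.mem_sphere, dist_eq_norm] at hb
          have := norm_sub_norm_le (b - c) (a - c)
          rw [show b - c - (a - c) = b - a by ring] at this
          linarith
        have hne : b ≠ a := fun h => by simp [h] at hba; linarith
        rw [dslope_of_ne _ hne, slope_def_field, norm_div, div_eq_mul_inv]
        have h1 := hB b (Metric.sphere_subset_closedBall hb)
        have h2 := hB a (by
          simp only [Metric.mem_ball, Metric.mem_closedBall] at ha ⊢; linarith)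
        have hB0 : 0 ≤ B := (norm_nonneg _).trans h1
        exact mul_le_mul ((norm_sub_le _ _).trans (add_le_add h1 h2)) (inv_anti₀ hρ hba)
          (by positivity) (by positivity))
    refine le_trans (le_of_eq ?_) hb
    simp only [Function.comp, hK₀]
    congr 1
    have hev : (fun b => g b * (b - a)⁻¹ - g a * (b - a)⁻¹) =ᶠ[𝓝 c] dslope g a := by
      filter_upwards [eventually_ne_nhds (Ne.symm hac')] with b hb
      rw [dslope_of_ne _ hb, slope_def_field]
      ring
    rw [← hev.iteratedDeriv_eq l, ← iteratedDeriv_const_mul_field]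
    exact (iteratedDeriv_fun_sub (hgc.mul (hinv a hac')) (contDiffAt_const.mul (hinv a hac'))).symm
  refine ⟨Function.update K₀ c ((𝓝[≠] c).limUnder K₀), ?_, fun a _ hac => by
    rw [Function.update_of_ne hac]⟩
  have h1 := Complex.differentiableOn_update_limUnder_of_bddAbove (Metric.ball_mem_nhds c hρ)
    (hd.mono (Set.sdiff_subset_sdiff_left hsub)) hbdd
  intro a ha
  by_cases hac : a = c
  · subst hac
    exact (h1.differentiableAt (Metric.ball_mem_nhds a hρ)).differentiableWithinAt
  · have h2 := hd.differentiableAt ((hU.sdiff isClosed_singleton).mem_nhds ⟨ha, hac⟩)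
    refine (h2.congr_of_eventuallyEq ?_).differentiableWithinAt
    filter_upwards [eventually_ne_nhds hac] with b hb
    rw [Function.update_of_ne hb]

theorem gammaRatio_mul_neg (a : ℂ) {H : ℝ} (hH : ‖a‖ + 1 < H) :
    gammaRatio (-a - 1) H * (H + a) * (gammaRatio a H * (H - a - 1)) = 1 := by
  have hre := abs_le.1 (Complex.abs_re_le_norm a)
  have h0 := norm_nonneg a
  have h1 : 0 < ((H : ℂ) + a).re := by simp; linarith
  have h2 : 0 < ((H : ℂ) - a - 1).re := by simp; linarith
  have h1' : (H : ℂ) + a ≠ 0 := fun h => by simp [h] at h1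
  have h2' : (H : ℂ) - a - 1 ≠ 0 := fun h => by simp [h] at h2
  have g1 := Complex.Gamma_ne_zero_of_re_pos h1
  have g2 := Complex.Gamma_ne_zero_of_re_pos h2
  unfold gammaRatio
  rw [show (H : ℂ) + (-a - 1) = H - a - 1 by ring, show (H : ℂ) - (-a - 1) = H + a + 1 by ring,
    Complex.Gamma_add_one _ h1', show Complex.Gamma ((H : ℂ) - a) =
      (H - a - 1) * Complex.Gamma (H - a - 1) by
        rw [← Complex.Gamma_add_one _ h2']; congr 1; ring]
  field_simp

/-- The functional equations of W_a and W_{-b-1} reduce the left-hand side to a common factor times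
(H+b)(H-a-1) - (H-b-1)(H+a), which equals (b-a)(2H-1). -/
theorem telescoping_step (r s : ℝ) (a b : ℂ) {H : ℝ} (ha : ‖a‖ < H) (hb : ‖b‖ + 1 < H) :
    kernel r s b H * (H + b) * (gammaRatio a H * (H - a - 1)) -
      kernel r s b (H + 1) * (H + 1 + b) * (gammaRatio a (H + 1) * (H - a)) =
    (b - a) * ((2 * H - 1) * gammaRatio a H * kernel r s b H) := by
  have hb' : ‖-b - 1‖ < H := (norm_sub_le _ _).trans_lt (by simpa using hb)
  have h1 := gammaRatio_add_one a ha
  have h2 := gammaRatio_add_one (-b - 1) hb'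
  unfold kernel
  rw [h1, show gammaInv r s b * gammaRatio (-b - 1) (H + 1) * (H + 1 + b) =
    gammaInv r s b * (gammaRatio (-b - 1) (H + 1) * (H - (-b - 1))) by ring, h2]
  ring

theorem summable_of_isBigO_rpow {g : ℝ → ℝ} {e : ℝ} (he : e < -1)
    (hg : g =O[atTop] fun x : ℝ => x ^ e) (L : ℕ) :
    Summable fun n : ℕ => |g (L + n : ℕ)| := by
  simpa using Reparam.id.summable he hg L

theorem gammaRatio_isBigO (a : ℂ) :
    (fun H : ℝ => ‖gammaRatio a H‖) =O[atTop] fun H : ℝ => H ^ (2 * a.re) := by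
  obtain ⟨C, hC0, hC⟩ := gammaRatio_norm_le ‖a‖
  refine IsBigO.of_bound C ?_
  filter_upwards [hC, eventually_gt_atTop 0] with H h hH
  rw [norm_norm, Real.norm_of_nonneg (Real.rpow_nonneg hH.le _)]
  exact h a le_rfl

theorem two_mul_sub_one_isBigO : (fun H : ℝ => 2 * H - 1) =O[atTop] fun H : ℝ => H ^ (1 : ℝ) := by
  refine IsBigO.of_bound 2 ?_
  filter_upwards [eventually_ge_atTop 1] with H hH
  rw [Real.rpow_one, Real.norm_of_nonneg (by linarith), Real.norm_of_nonneg (by linarith)]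
  linarith

theorem kernel_norm_le (r s M : ℝ) : ∃ C : ℝ, 0 ≤ C ∧ ∀ᶠ H : ℝ in atTop,
    ∀ b : ℂ, ‖b‖ ≤ M → ‖kernel r s b H‖ ≤ C * H ^ (-2 * b.re - 2) := by
  obtain ⟨B, hB0, hB⟩ := exists_bound_of_differentiable (gammaInv_differentiable r s) M
  obtain ⟨C, hC0, hC⟩ := gammaRatio_norm_le (M + 1)
  refine ⟨B * C, by positivity, ?_⟩
  filter_upwards [hC] with H h b hb
  have h1 := h (-b - 1) ((norm_sub_le _ _).trans (by simpa using hb))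
  rw [kernel, norm_mul, mul_assoc]
  refine mul_le_mul (hB b hb) (h1.trans (le_of_eq ?_)) (norm_nonneg _) hB0
  congr 2
  simp; ring

/-- Cauchy's estimate on the circle of radius ρ = (c-a)/2 bounds the derivative by H^{-2(c-ρ)-1};
the other factor grows at most like H^{2a+1}, which leaves H^{-2ρ}. -/
theorem kernel_telescoping_tendsto (r s : ℝ) (l : ℕ) {a c : ℝ} (hac : a < c) :
    Tendsto (fun H : ℝ => iteratedDeriv l (fun b : ℂ => kernel r s b H * (H + b) * (b - a)⁻¹) c *
      (gammaRatio a H * (H - a - 1))) atTop (𝓝 0) := by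
  set ρ : ℝ := (c - a) / 2 with hρ
  have hρ0 : 0 < ρ := by simp only [hρ]; linarith
  obtain ⟨C, hC0, hC⟩ := kernel_norm_le r s (|c| + ρ)
  have h1 : (fun H : ℝ => iteratedDeriv l
      (fun b : ℂ => kernel r s b H * (H + b) * (b - a)⁻¹) c) =O[atTop]
      fun H : ℝ => H ^ (-2 * (c - ρ) - 2) * H := by
    refine IsBigO.of_bound (l.factorial * (C * 2 * ρ⁻¹) / ρ ^ l) ?_
    filter_upwards [hC, eventually_ge_atTop 1, eventually_gt_atTop (|c| + ρ + 1)] with H h2 hH hHc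
    have hH0 : 0 < H := by linarith
    have hcb : ∀ b ∈ Metric.closedBall (c : ℂ) ρ, ‖b‖ ≤ |c| + ρ := fun b hb => by
      have : ‖b‖ ≤ ‖b - c‖ + ‖(c : ℂ)‖ := by simpa using norm_add_le (b - c) (c : ℂ)
      rw [Metric.mem_closedBall, dist_eq_norm] at hb
      simp at this; linarith
    have hba : ∀ b ∈ Metric.closedBall (c : ℂ) ρ, ρ ≤ ‖b - a‖ := fun b hb => by
      rw [Metric.mem_closedBall, dist_eq_norm] at hb
      have h3 := norm_sub_norm_le ((c : ℂ) - a) (c - b)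
      rw [show (c : ℂ) - a - (c - b) = b - a by ring, norm_sub_rev (c : ℂ) b,
        ← Complex.ofReal_sub, Complex.norm_real, Real.norm_of_nonneg (by linarith)] at h3
      simp only [hρ] at hb ⊢; linarith
    have hd : DifferentiableOn ℂ (fun b : ℂ => kernel r s b H * (H + b) * (b - a)⁻¹)
        (Metric.ball 0 (H - 1) ∩ {b : ℂ | b ≠ a}) := by
      refine (((kernel_differentiableOn r s H).mono Set.inter_subset_left).mul
        (by fun_prop)).mul (DifferentiableOn.inv (by fun_prop) fun b hb => sub_ne_zero.2 hb.2)
    have hcl : Metric.closedBall (c : ℂ) ρ ⊆ Metric.ball 0 (H - 1) ∩ {b : ℂ | b ≠ a} := by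
      intro b hb
      refine ⟨?_, fun h => ?_⟩
      · have := hcb b hb
        simp only [mem_ball_zero_iff]; linarith
      · have := hba b hb
        rw [h, sub_self, norm_zero] at this; linarith
    have h4 := Complex.norm_iteratedDeriv_le_of_forall_mem_sphere_norm_le (c := (c : ℂ)) (R := ρ)
      (C := C * H ^ (-2 * (c - ρ) - 2) * (2 * H) * ρ⁻¹)
      (f := fun b : ℂ => kernel r s b H * (H + b) * (b - a)⁻¹) l hρ0 (hd.diffContOnCl_ball hcl) (by
        intro b hb
        have hb' := Metric.sphere_subset_closedBall hb
        have h5 := h2 b (hcb b hb')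
        have h6 : ‖(H : ℂ) + b‖ ≤ 2 * H := by
          refine (norm_add_le _ _).trans ?_
          have := hcb b hb'
          rw [Complex.norm_real, Real.norm_of_nonneg hH0.le]; linarith
        have h7 : C * H ^ (-2 * b.re - 2) ≤ C * H ^ (-2 * (c - ρ) - 2) := by
          refine mul_le_mul_of_nonneg_left (Real.rpow_le_rpow_of_exponent_le hH ?_) hC0
          have := (abs_le.1 (Complex.abs_re_le_norm (b - c))).1
          rw [Metric.mem_sphere, dist_eq_norm] at hb
          simp [hb] at this; linarith
        rw [norm_mul, norm_mul, norm_inv]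
        have h8 := inv_anti₀ hρ0 (hba b hb')
        gcongr
        exact h5.trans h7)
    refine h4.trans (le_of_eq ?_)
    rw [norm_mul, Real.norm_of_nonneg (Real.rpow_nonneg hH0.le _), Real.norm_of_nonneg hH0.le]
    ring
  have h2 : (fun H : ℝ => (H : ℂ) - a - 1) =O[atTop] fun H : ℝ => H := by
    refine IsBigO.of_bound 2 ?_
    filter_upwards [eventually_ge_atTop (|a| + 1)] with H hH
    have hH0 : 0 < H := by have := abs_nonneg a; linarith
    rw [show (H : ℂ) - a - 1 = ((H - a - 1 : ℝ) : ℂ) by push_cast; ring, Complex.norm_real,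
      Real.norm_of_nonneg hH0.le, Real.norm_eq_abs, abs_le]
    have := abs_le.1 (le_refl |a|)
    constructor <;> linarith
  have h3 := h1.mul ((gammaRatio_isBigO a).of_norm_left.mul h2)
  refine (isLittleO_one_iff ℝ).1 (h3.trans_isLittleO ?_)
  have h4 : Tendsto (fun H : ℝ => H ^ (-(2 * ρ))) atTop (𝓝 0) := tendsto_rpow_neg_atTop (by linarith)
  rw [isLittleO_one_iff]
  refine h4.congr' ?_
  filter_upwards [eventually_gt_atTop 0] with H hH
  have e : H ^ (-(2 * ρ)) = H ^ (-2 * (c - ρ) - 2) * H ^ (1 : ℝ) * (H ^ (2 * a) * H ^ (1 : ℝ)) := by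
    rw [← Real.rpow_add hH, ← Real.rpow_add hH, ← Real.rpow_add hH]
    congr 1; simp only [hρ]; ring
  simpa using e

/-- After division by b - a and l derivatives at b = c the summand telescopes, so the sum is its
boundary term at H = L. Its divided-difference part extends holomorphically in a; what is left is
the polar term that y^c log^l y produces in the Mellin transform. -/
theorem kernel_lattice_sum (r s : ℝ) (l : ℕ) {c : ℝ} {L : ℕ} (hL : |c| + 2 < L) :
    ∃ Δ : ℂ → ℂ, DifferentiableOn ℂ Δ (Metric.ball 0 (L - 2)) ∧ ∀ a : ℝ, |a| < L - 2 → a < c →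
      HasSum (fun n : ℕ => ((2 * (L + n : ℕ) - 1 : ℝ) : ℂ) * gammaRatio a (L + n : ℕ) *
        kernelDeriv r s l c (L + n : ℕ))
        (gammaInv r s a * iteratedDeriv l (fun b : ℂ => (b - a)⁻¹) c + Δ a) := by
  set g : ℂ → ℂ := fun b => kernel r s b L * (L + b) with hgdef
  have hg : DifferentiableOn ℂ g (Metric.ball 0 (L - 2)) := by
    refine DifferentiableOn.mul ((kernel_differentiableOn r s L).mono
      (Metric.ball_subset_ball (by linarith))) (by fun_prop)
  obtain ⟨K, hK, hKa⟩ := exists_divided_difference Metric.isOpen_ball hg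
    (c := (c : ℂ)) (by simp; linarith) l
  refine ⟨fun a => gammaRatio a L * (L - a - 1) * K a, ?_, ?_⟩
  · refine DifferentiableOn.mul (DifferentiableOn.mul ((gammaRatio_differentiableOn L).mono
      (Metric.ball_subset_ball (by linarith))) (by fun_prop)) hK
  intro a haL hac
  have hne : (a : ℂ) ≠ c := by exact_mod_cast hac.ne
  set f : ℕ → ℂ := fun n => iteratedDeriv l (fun b : ℂ => kernel r s b (L + n : ℕ) *
    (((L + n : ℕ) : ℝ) + b) * (b - a)⁻¹) c *
      (gammaRatio a (L + n : ℕ) * (((L + n : ℕ) : ℝ) - a - 1)) with hf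
  have hf0 : Tendsto f atTop (𝓝 0) := by
    have h1 : Tendsto (fun n : ℕ => ((L + n : ℕ) : ℝ)) atTop atTop :=
      tendsto_natCast_atTop_atTop.comp (tendsto_atTop_mono (fun n => Nat.le_add_left n L) tendsto_id)
    exact (kernel_telescoping_tendsto r s l hac).comp h1
  have hstep : ∀ n : ℕ, ((2 * (L + n : ℕ) - 1 : ℝ) : ℂ) * gammaRatio a (L + n : ℕ) *
        kernelDeriv r s l c (L + n : ℕ) = f n - f (n + 1) := by
    intro n
    set H : ℝ := ((L + n : ℕ) : ℝ) with hH
    have hHL : (L : ℝ) ≤ H := by rw [hH]; push_cast; linarith [(Nat.cast_nonneg n : (0 : ℝ) ≤ n)]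
    have hH1 : ((L + (n + 1) : ℕ) : ℝ) = H + 1 := by rw [hH]; push_cast; ring
    have hcd : ∀ H' : ℝ, H ≤ H' → ContDiffAt ℂ l
        (fun b : ℂ => kernel r s b H' * (H' + b) * (b - a)⁻¹) c := by
      intro H' hH'
      have h1 : DifferentiableOn ℂ (fun b : ℂ => kernel r s b H' * (H' + b) * (b - a)⁻¹)
          (Metric.ball 0 (H' - 1) ∩ {b : ℂ | b ≠ a}) := by
        refine (((kernel_differentiableOn r s H').mono Set.inter_subset_left).mul
          (by fun_prop)).mul (DifferentiableOn.inv (by fun_prop) fun b hb => sub_ne_zero.2 hb.2)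
      refine (h1.analyticOnNhd (Metric.isOpen_ball.inter isOpen_ne) c ⟨?_, hne.symm⟩).contDiffAt
      simp; linarith
    have hcdk : ContDiffAt ℂ l (fun b : ℂ => kernel r s b H) c :=
      ((kernel_differentiableOn r s H).analyticOnNhd Metric.isOpen_ball c
        (by simp; linarith)).contDiffAt
    rw [kernelDeriv_ofReal r s l (by linarith), ← iteratedDeriv_const_mul_field]
    simp only [hf]
    rw [hH1, ← hH, mul_comm (iteratedDeriv _ _ _), mul_comm (iteratedDeriv _ _ _),
      ← iteratedDeriv_const_mul_field, ← iteratedDeriv_const_mul_field,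
      ← iteratedDeriv_fun_sub (contDiffAt_const.mul (hcd H le_rfl))
        (contDiffAt_const.mul (hcd (H + 1) (by linarith)))]
    refine EventuallyEq.iteratedDeriv_eq l ?_
    have hball : ∀ᶠ b : ℂ in 𝓝 (c : ℂ), ‖b‖ + 1 < H :=
      (continuous_norm.add continuous_const).continuousAt.eventually_lt continuousAt_const
        (by simp; linarith)
    filter_upwards [hball, eventually_ne_nhds hne.symm] with b hb hba
    have h0 := sub_ne_zero.2 hba
    have h1 := telescoping_step r s a b (H := H) (by simp; linarith) hb
    have h2 : ((2 * H - 1 : ℝ) : ℂ) * gammaRatio a H * kernel r s b H =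
        (b - a)⁻¹ * ((b - a) * ((2 * H - 1) * gammaRatio a H * kernel r s b H)) := by
      rw [inv_mul_cancel_left₀ h0]; push_cast; ring
    rw [h2, ← h1, Complex.ofReal_add, Complex.ofReal_one]
    ring
  have hsummable : Summable fun n : ℕ => ((2 * (L + n : ℕ) - 1 : ℝ) : ℂ) *
      gammaRatio a (L + n : ℕ) * kernelDeriv r s l c (L + n : ℕ) := by
    have h1 : (fun H : ℝ => (2 * H - 1) * ‖gammaRatio a H‖ * kernelDeriv r s l c H) =O[atTop]
        fun H : ℝ => H ^ (-1 - (c - a)) := by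
      have h2 := (two_mul_sub_one_isBigO.mul (gammaRatio_isBigO a)).mul
        (kernelDeriv_isLittleO r s l c (δ := c - a) (by linarith)).isBigO
      refine h2.trans (EventuallyEq.isBigO ?_)
      filter_upwards [eventually_gt_atTop 0] with H hH
      rw [← Real.rpow_add hH, ← Real.rpow_add hH]
      congr 1; simp; ring
    refine Summable.of_norm ((summable_of_isBigO_rpow (by linarith) h1 L).congr fun n => ?_)
    simp only [norm_mul, abs_mul, abs_norm, Complex.norm_real, Real.norm_eq_abs]
  have hsum : HasSum (fun n => f n - f (n + 1)) (f 0) := by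
    have h1 : Summable fun n => f n - f (n + 1) := hsummable.congr hstep
    have h2 := h1.hasSum.tendsto_sum_nat
    have h3 : Tendsto (fun n => ∑ i ∈ Finset.range n, (f i - f (i + 1))) atTop (𝓝 (f 0 - 0)) := by
      simp only [Finset.sum_range_sub']
      exact tendsto_const_nhds.sub hf0
    rw [sub_zero] at h3
    rw [← tendsto_nhds_unique h2 h3]
    exact h1.hasSum
  simp only [hstep]
  convert hsum using 1
  have h4 := hKa a (by simpa using haL) hne
  -- At b = a the boundary factors multiply to 1, so the coefficient of the polar term is exactly
  -- γ(a).
  have h5 := gammaRatio_mul_neg (a : ℂ) (H := L) (by simp; linarith)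
  have h6 : gammaInv r s a = g a * (gammaRatio a L * (L - a - 1)) := by
    simp only [hgdef, kernel]
    simp only [Complex.ofReal_natCast] at h5
    linear_combination (-gammaInv r s a) * h5
  rw [h4, h6]
  simp only [hf, hgdef, add_zero, Complex.ofReal_natCast]
  ring

/-! ### Comparison of sums along a reparametrization with sums over the integers. -/

theorem rpow_isBigO_powerLogMonomial (t : ℝ × ℕ) :
    (fun x : ℝ => x ^ t.1) =O[atTop] powerLogMonomial t := by
  refine IsBigO.of_bound 1 ?_
  filter_upwards [eventually_ge_atTop (Real.exp 1)] with x hx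
  have hl : 1 ≤ Real.log x := by
    rw [Real.le_log_iff_exp_le (lt_of_lt_of_le (Real.exp_pos 1) hx)]; exact hx
  rw [one_mul, powerLogMonomial, norm_mul]
  refine le_mul_of_one_le_right (norm_nonneg _) ?_
  rw [norm_pow, Real.norm_eq_abs, abs_of_nonneg (by linarith)]
  exact one_le_pow₀ hl

theorem le_of_rpow_isBigO_rpow {b c : ℝ} (h : (fun x : ℝ => x ^ b) =O[atTop] fun x : ℝ => x ^ c) :
    b ≤ c := by
  by_contra! hlt
  have h1 := h.trans_isLittleO (rpow_isLittleO_rpow hlt)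
  refine isLittleO_irrefl ?_ h1
  refine Eventually.frequently ?_
  filter_upwards [eventually_gt_atTop 0] with x hx
  exact (Real.rpow_pos_of_pos hx b).ne'

/-- The monomials of a power-logarithmic sum do not exceed its growth. -/
theorem powerLog_exists_finsupp {u : ℝ → ℝ} (hu : u ∈ powerLog) {β : ℝ}
    (hβ : u =O[atTop] fun x : ℝ => x ^ β) : ∃ c : (ℝ × ℕ) →₀ ℝ, (∀ t ∈ c.support, t.1 ≤ β) ∧
      u = c.sum fun i a => a • powerLogMonomial i := by
  classical
  obtain ⟨c, rfl⟩ := (Finsupp.mem_span_range_iff_exists_finsupp).1 hu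
  have hsplit := Finsupp.filter_add_filter_not c fun t : ℝ × ℕ => t.1 ≤ β
  set c₁ := c.filter fun t : ℝ × ℕ => t.1 ≤ β with hc₁
  set c₂ := c.filter fun t : ℝ × ℕ => ¬ t.1 ≤ β with hc₂
  have hsum : (c.sum fun i a => a • powerLogMonomial i) =
      (c₁.sum fun i a => a • powerLogMonomial i) + c₂.sum fun i a => a • powerLogMonomial i := by
    rw [← hsplit, Finsupp.sum_add_index' (by simp) (by intros; rw [add_smul])]
  -- Otherwise the monomials with power above β would have a leading one, of power t.1 > β, although
  -- their sum is u minus the rest and grows no faster than the intermediate power (β + t.1)/2.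
  have h2 : c₂ = 0 := by
    by_contra h2
    obtain ⟨t, ht, hlead⟩ := powerLog_leading_mem_support h2
    have htβ : β < t.1 := by
      have := Finsupp.support_filter (fun t : ℝ × ℕ => ¬ t.1 ≤ β) c
      rw [hc₂, this, Finset.mem_filter] at ht
      exact not_le.1 ht.2
    have h3 := isBigO_powerLogMonomial_of_leading (Finsupp.mem_support_iff.1 ht) hlead
    have h4 : (c₁.sum fun i a => a • powerLogMonomial i) =O[atTop]
        fun x : ℝ => x ^ ((β + t.1) / 2) := by
      rw [Finsupp.sum]
      refine IsBigO.sum fun i hi => IsBigO.const_smul_left ?_ _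
      rw [hc₁, Finsupp.support_filter, Finset.mem_filter] at hi
      exact (powerLogMonomial_isLittleO (c := i.1) i.2 (by have := hi.2; linarith)).isBigO
    have h5 : (c₂.sum fun i a => a • powerLogMonomial i) =O[atTop]
        fun x : ℝ => x ^ ((β + t.1) / 2) := by
      refine ((hβ.trans (rpow_isBigO_rpow (by linarith))).sub h4).congr_left fun x => ?_
      rw [hsum]; simp
    have := le_of_rpow_isBigO_rpow ((rpow_isBigO_powerLogMonomial t).trans (h3.trans h5))
    linarith
  refine ⟨c₁, fun t ht => ?_, ?_⟩
  · rw [hc₁, Finsupp.support_filter, Finset.mem_filter] at ht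
    exact ht.2
  · rw [hsum, h2]; simp

/-- The sums of `G a` over the sequence `x`, weighted by its derivative, and over the natural
numbers differ by a function holomorphic in `D`. -/
def SumComparable (D : Set ℂ) (σ : ℝ) (x q : ℝ → ℝ) (G : ℂ → ℝ → ℂ) : Prop :=
  ∀ᶠ L : ℕ in atTop, ∀ᶠ L' : ℕ in atTop, ∃ Δ : ℂ → ℂ, DifferentiableOn ℂ Δ D ∧
    ∀ a : ℝ, (a : ℂ) ∈ D → a < σ →
      Summable (fun n : ℕ => (q (x (L + n : ℕ)) : ℂ) * G a (x (L + n : ℕ))) ∧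
      Summable (fun n : ℕ => G a (L' + n : ℕ)) ∧
      (∑' n : ℕ, (q (x (L + n : ℕ)) : ℂ) * G a (x (L + n : ℕ))) - ∑' n : ℕ, G a (L' + n : ℕ) = Δ a

namespace SumComparable

variable {D : Set ℂ} {σ : ℝ} {x q : ℝ → ℝ} {G G' : ℂ → ℝ → ℂ}

theorem add (h : SumComparable D σ x q G) (h' : SumComparable D σ x q G') :
    SumComparable D σ x q fun a H => G a H + G' a H := by
  filter_upwards [h, h'] with L h1 h1'
  filter_upwards [h1, h1'] with L' ⟨Δ, hΔ, h2⟩ ⟨Δ', hΔ', h2'⟩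
  refine ⟨fun a => Δ a + Δ' a, hΔ.add hΔ', fun a ha has => ?_⟩
  obtain ⟨s1, s2, e⟩ := h2 a ha has
  obtain ⟨s1', s2', e'⟩ := h2' a ha has
  simp only [mul_add]
  refine ⟨s1.add s1', s2.add s2', ?_⟩
  rw [s1.tsum_add s1', s2.tsum_add s2', ← e, ← e']
  ring

theorem mul_left (h : SumComparable D σ x q G) {κ : ℂ → ℂ} (hκ : DifferentiableOn ℂ κ D) :
    SumComparable D σ x q fun a H => κ a * G a H := by
  filter_upwards [h] with L h1
  filter_upwards [h1] with L' ⟨Δ, hΔ, h2⟩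
  refine ⟨fun a => κ a * Δ a, hκ.mul hΔ, fun a ha has => ?_⟩
  obtain ⟨s1, s2, e⟩ := h2 a ha has
  simp only [mul_left_comm _ (κ a)]
  refine ⟨s1.mul_left _, s2.mul_left _, ?_⟩
  rw [tsum_mul_left, tsum_mul_left, ← e, mul_sub]

theorem zero : SumComparable D σ x q fun _ _ => 0 :=
  Eventually.of_forall fun _ => Eventually.of_forall fun _ =>
    ⟨fun _ => 0, differentiableOn_const _, fun _ _ _ => by simp [summable_zero]⟩

theorem sum {ι : Type*} {S : Finset ι} {G : ι → ℂ → ℝ → ℂ}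
    (h : ∀ i ∈ S, SumComparable D σ x q (G i)) :
    SumComparable D σ x q fun a H => ∑ i ∈ S, G i a H := by
  classical
  induction S using Finset.induction_on with
  | empty => simpa using zero
  | insert i S hi ih =>
    simp only [Finset.sum_insert hi]
    exact (h i (by simp)).add (ih fun j hj => h j (by simp [hj]))

theorem congr' (h : SumComparable D σ x q G) (hx : Tendsto x atTop atTop)
    (e : ∀ᶠ H : ℝ in atTop, ∀ a ∈ D, G a H = G' a H) : SumComparable D σ x q G' := by
  obtain ⟨R, hR⟩ := eventually_atTop.1 e
  obtain ⟨R', hR'⟩ := eventually_atTop.1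
    ((hx.comp tendsto_natCast_atTop_atTop).eventually (eventually_ge_atTop R))
  obtain ⟨R'', hR''⟩ := exists_nat_ge R
  filter_upwards [h, eventually_ge_atTop R'] with L h1 hL
  filter_upwards [h1, eventually_ge_atTop R''] with L' ⟨Δ, hΔ, h2⟩ hL'
  refine ⟨Δ, hΔ, fun a ha has => ?_⟩
  have e1 : ∀ n : ℕ, G a (x (L + n : ℕ)) = G' a (x (L + n : ℕ)) := fun n =>
    hR _ (hR' (L + n) (by omega)) a ha
  have e2 : ∀ n : ℕ, G a (L' + n : ℕ) = G' a (L' + n : ℕ) := fun n =>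
    hR _ (hR''.trans (by exact_mod_cast (by omega : R'' ≤ L' + n))) a ha
  simpa only [e1, e2] using h2 a ha has

/-- A uniform bound H^{-2} makes both series converge normally, so each sum is holomorphic by
itself. -/
theorem of_bound (h : Reparam x q) (hD : IsOpen D) {C : ℝ}
    (hG : ∀ᶠ H : ℝ in atTop, DifferentiableOn ℂ (fun a => G a H) D ∧
      ∀ a ∈ D, ‖G a H‖ ≤ C * H ^ (-2 : ℝ)) : SumComparable D σ x q G := by
  have key : ∀ {x q : ℝ → ℝ}, Reparam x q → ∀ᶠ L : ℕ in atTop,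
      DifferentiableOn ℂ (fun a => ∑' n : ℕ, (q (x (L + n : ℕ)) : ℂ) * G a (x (L + n : ℕ))) D ∧
      ∀ a ∈ D, Summable (fun n : ℕ => (q (x (L + n : ℕ)) : ℂ) * G a (x (L + n : ℕ))) := by
    intro x q h
    obtain ⟨R, hR⟩ := eventually_atTop.1
      ((h.tendsto.comp tendsto_natCast_atTop_atTop).eventually (hG.and (eventually_gt_atTop 0)))
    filter_upwards [eventually_ge_atTop R] with L hL
    have hs := (h.summable (g := fun x : ℝ => C * x ^ (-2 : ℝ)) (e := -2) (by norm_num)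
      ((isBigO_refl _ _).const_mul_left C) L)
    have hb : ∀ (n : ℕ) (a : ℂ), a ∈ D → ‖(q (x (L + n : ℕ)) : ℂ) * G a (x (L + n : ℕ))‖ ≤
        |q (x (L + n : ℕ))| * |C * x (L + n : ℕ) ^ (-2 : ℝ)| := by
      intro n a ha
      rw [norm_mul, Complex.norm_real, Real.norm_eq_abs]
      exact mul_le_mul_of_nonneg_left (((hR (L + n) (by omega)).1.2 a ha).trans (le_abs_self _))
        (abs_nonneg _)
    exact ⟨Complex.differentiableOn_tsum_of_summable_norm hs
      (fun n => ((hR (L + n) (by omega)).1.1.const_mul _)) hD hb,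
      fun a ha => Summable.of_norm_bounded hs fun n => hb n a ha⟩
  filter_upwards [key h] with L h1
  filter_upwards [key Reparam.id] with L' h2
  simp only [Complex.ofReal_one, one_mul] at h2
  exact ⟨_, h1.1.sub h2.1, fun a ha _ => ⟨h1.2 a ha, h2.2 a ha, rfl⟩⟩

/-- The substitution w = -2a - e in `Reparam.zeta_difference`; the condition on σ places w in the
half plane of convergence Re w > 1. -/
theorem cpow_mul_log (h : Reparam x q) {M : ℝ} (hM : ∀ a ∈ D, ‖a‖ ≤ M) {e : ℝ} (l : ℕ)
    (he : 2 * σ + e ≤ -1) :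
    SumComparable D σ x q fun a H => (H : ℂ) ^ (2 * a + e) * (Real.log H : ℂ) ^ l := by
  set Ω : Set ℂ := Metric.ball 0 (2 * M + |e| + 2) with hΩ
  have hpos : ∀ {x q : ℝ → ℝ}, Reparam x q → ∀ᶠ L : ℕ in atTop, ∀ n : ℕ, 1 ≤ x (L + n : ℕ) := by
    intro x q h
    obtain ⟨R, hR⟩ := eventually_atTop.1
      ((h.tendsto.comp tendsto_natCast_atTop_atTop).eventually (eventually_ge_atTop 1))
    filter_upwards [eventually_ge_atTop R] with L hL n
    exact hR _ (by omega)
  rcases D.eq_empty_or_nonempty with rfl | ⟨a₀, ha₀⟩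
  · exact Eventually.of_forall fun L => Eventually.of_forall fun L' => ⟨0, by simp, by simp⟩
  have hM0 : 0 ≤ M := (norm_nonneg _).trans (hM a₀ ha₀)
  have hsum : ∀ {x q : ℝ → ℝ} (_ : Reparam x q) (L : ℕ) (_ : ∀ n : ℕ, 1 ≤ x (L + n : ℕ)) (a : ℝ),
      a < σ → Summable (fun n : ℕ => (q (x (L + n : ℕ)) : ℂ) *
        ((x (L + n : ℕ) : ℂ) ^ (2 * (a : ℂ) + e) * (Real.log (x (L + n : ℕ)) : ℂ) ^ l)) := by
    intro x q h L hL a ha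
    refine Summable.of_norm ((h.zeta_term_summable (e := 2 * a + e) (by linarith) l L).congr
      fun n => ?_)
    have hx := zero_lt_one.trans_le (hL n)
    rw [norm_mul, norm_mul, Complex.norm_cpow_eq_rpow_re_of_pos hx, abs_mul,
        Complex.norm_real, norm_pow, Complex.norm_real, Real.norm_eq_abs, Real.norm_eq_abs, abs_pow,
        abs_of_pos (Real.rpow_pos_of_pos hx _)]
    simp
  filter_upwards [h.zeta_difference Reparam.id (Ω := Ω) Metric.isOpen_ball
    (M := 2 * M + |e| + 2) (fun w hw => by
      rw [hΩ, mem_ball_zero_iff] at hw; exact hw.le)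
    (by rw [hΩ, mem_ball_zero_iff, norm_one]; have := abs_nonneg e; linarith), hpos h] with L h1 hL
  filter_upwards [h1, hpos Reparam.id] with L' h2 hL'
  obtain ⟨Δ, hΔ, h3⟩ := h2 l
  have hmaps : ∀ a ∈ D, -2 * a - e ∈ Ω := fun a ha => by
    rw [hΩ, mem_ball_zero_iff]
    calc ‖-2 * a - e‖ ≤ ‖-2 * a‖ + ‖(e : ℂ)‖ := norm_sub_le _ _
      _ ≤ 2 * M + |e| := by
        rw [norm_mul]; simp; exact hM a ha
      _ < _ := by linarith
  refine ⟨fun a => Δ (-2 * a - e), hΔ.comp (by fun_prop) hmaps, fun a ha has => ⟨hsum h L hL a has,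
    ?_, ?_⟩⟩
  · simpa using hsum Reparam.id L' hL' a has
  · have h4 := h3 (-2 * a - e) (hmaps a ha) (by simp; linarith)
    beta_reduce
    rw [← h4]
    congr 1
    · refine tsum_congr fun n => ?_
      rw [mul_assoc, show -(-2 * (a : ℂ) - e) = 2 * a + e by ring]
    · refine tsum_congr fun n => ?_
      rw [show -(-2 * (a : ℂ) - e) = 2 * a + e by ring]
      simp

end SumComparable

theorem gammaRatioTrunc_norm_le (K : ℕ) (M : ℝ) : ∃ C : ℝ, 0 ≤ C ∧ ∀ H : ℝ, 1 ≤ H →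
    ∀ a : ℂ, ‖a‖ ≤ M → ‖gammaRatioTrunc K a H‖ ≤ C * H ^ (2 * a.re) := by
  choose B hB0 hB using fun i => exists_bound_of_differentiable (gammaRatioCoeff_differentiable i) M
  refine ⟨∑ i ∈ Finset.range K, B i, Finset.sum_nonneg fun i _ => hB0 i, fun H hH a ha => ?_⟩
  have hH0 : 0 < H := by linarith
  rw [gammaRatioTrunc, Finset.sum_mul]
  refine (norm_sum_le _ _).trans (Finset.sum_le_sum fun i _ => ?_)
  rw [norm_mul, Complex.norm_cpow_eq_rpow_re_of_pos hH0]
  refine mul_le_mul (hB i a ha) (Real.rpow_le_rpow_of_exponent_le hH ?_) (by positivity) (hB0 i)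
  simp

theorem gammaRatioTrunc_differentiable (K : ℕ) {H : ℝ} (hH : 0 < H) :
    Differentiable ℂ fun a => gammaRatioTrunc K a H := by
  unfold gammaRatioTrunc
  refine Differentiable.fun_sum fun i _ => (gammaRatioCoeff_differentiable i).mul fun a => ?_
  exact DifferentiableAt.const_cpow (by fun_prop) (Or.inl (by exact_mod_cast hH.ne'))

/-- Expanding both W_a(H) and Q(H) leaves finitely many terms H^{2a+e} log^l H, covered by
`SumComparable.cpow_mul_log`, and a remainder. The orders K and N are so large that the remainder is
O(H^{-2}) for all |a| < M. -/
theorem gammaRatio_sumComparable {x q : ℝ → ℝ} (h : Reparam x q) {Q : ℝ → ℝ} (hQ : Expandable Q)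
    {β σ : ℝ} (hβ : Q =O[atTop] fun x : ℝ => x ^ β) (hσ : 2 * σ + (1 + β) ≤ -1) (M : ℝ) :
    SumComparable (Metric.ball 0 M) σ x q
      fun a H => ((2 * H - 1 : ℝ) : ℂ) * gammaRatio a H * Q H := by
  obtain ⟨K, hK⟩ := exists_nat_gt (max 1 (2 * M + β + 3))
  have hK1 : 1 ≤ K := by exact_mod_cast ((le_max_left _ _).trans_lt hK).le
  have hKβ : 2 * M + β + 3 < K := (le_max_right _ _).trans_lt hK
  set N : ℝ := max (2 * M + 3) (-β) with hN
  obtain ⟨u, hu, hQu⟩ := hQ N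
  have huβ : u =O[atTop] fun x : ℝ => x ^ β := by
    have h1 := hQu.isBigO.trans (rpow_isBigO_rpow (show -N ≤ β by
      have := le_max_right (2 * M + 3) (-β); rw [← hN] at this; linarith))
    exact (hβ.sub h1).congr_left fun x => by ring
  -- Because the approximant grows no faster than Q, each of its monomials has power at most β and
  -- its series converges for a < σ.
  obtain ⟨c, hc, rfl⟩ := powerLog_exists_finsupp hu huβ
  set u : ℝ → ℝ := c.sum fun i a => a • powerLogMonomial i with hudef
  have hu' : ∀ H, u H = ∑ t ∈ c.support, c t * (H ^ t.1 * Real.log H ^ t.2) := fun H => by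
    simp [hudef, Finsupp.sum, Finset.sum_apply, powerLogMonomial]
  have hD : ∀ a ∈ Metric.ball (0 : ℂ) M, ‖a‖ ≤ M := fun a ha => by
    rw [mem_ball_zero_iff] at ha; exact ha.le
  -- the explicit part
  have hmain : SumComparable (Metric.ball 0 M) σ x q
      fun a H => ((2 * H - 1 : ℝ) : ℂ) * gammaRatioTrunc K a H * u H := by
    have h1 : SumComparable (Metric.ball 0 M) σ x q fun a H => ∑ i ∈ Finset.range K,
        ∑ t ∈ c.support, ((2 * c t * gammaRatioCoeff i a) *
          ((H : ℂ) ^ (2 * a + ((1 + t.1 - i : ℝ) : ℂ)) * (Real.log H : ℂ) ^ t.2) +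
          (-(c t * gammaRatioCoeff i a)) *
          ((H : ℂ) ^ (2 * a + ((t.1 - i : ℝ) : ℂ)) * (Real.log H : ℂ) ^ t.2)) := by
      refine SumComparable.sum fun i _ => SumComparable.sum fun t ht => ?_
      have hi : (0 : ℝ) ≤ i := Nat.cast_nonneg i
      have htβ := hc t ht
      refine SumComparable.add (SumComparable.mul_left (SumComparable.cpow_mul_log h hD t.2
        (by linarith)) ?_) (SumComparable.mul_left (SumComparable.cpow_mul_log h hD t.2
        (by linarith)) ?_)
      · exact ((gammaRatioCoeff_differentiable i).const_mul _).differentiableOn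
      · exact ((gammaRatioCoeff_differentiable i).const_mul _).neg.differentiableOn
    refine h1.congr' h.tendsto ?_
    filter_upwards [eventually_gt_atTop 0] with H hH a ha
    have hH0 : (H : ℂ) ≠ 0 := by exact_mod_cast hH.ne'
    rw [hu', gammaRatioTrunc]
    push_cast
    rw [Finset.sum_comm, Finset.mul_sum]
    refine Finset.sum_congr rfl fun t _ => ?_
    rw [Finset.mul_sum, Finset.sum_mul]
    refine Finset.sum_congr rfl fun i _ => ?_
    rw [show 2 * a + (1 + (t.1 : ℂ) - i) = 1 + (2 * a - i) + t.1 by ring,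
      show 2 * a + ((t.1 : ℂ) - i) = (2 * a - i) + t.1 by ring, Complex.cpow_add _ _ hH0,
      Complex.cpow_add _ _ hH0, Complex.cpow_add _ _ hH0, Complex.cpow_one,
      Complex.ofReal_cpow hH.le]
    ring
  -- the remainder
  obtain ⟨C, hC0, hC⟩ := gammaRatio_expansion hK1 M
  obtain ⟨C', hC'0, hC'⟩ := gammaRatioTrunc_norm_le K M
  obtain ⟨B, hB0, hB⟩ := hβ.exists_nonneg
  have hrem : SumComparable (Metric.ball 0 M) σ x q
      fun a H => ((2 * H - 1 : ℝ) : ℂ) * ((gammaRatio a H - gammaRatioTrunc K a H) * Q H +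
        gammaRatioTrunc K a H * (Q H - u H : ℝ)) := by
    refine SumComparable.of_bound h Metric.isOpen_ball (C := 2 * (C * B + C')) ?_
    filter_upwards [hC, hB.bound, (hQu.bound one_pos), eventually_ge_atTop 1,
      eventually_ge_atTop M] with H h1 h2 h3 hH hHM
    have hH0 : 0 < H := by linarith
    refine ⟨?_, fun a ha => ?_⟩
    · refine DifferentiableOn.const_mul (DifferentiableOn.add (DifferentiableOn.mul_const
        (((gammaRatio_differentiableOn H).mono (Metric.ball_subset_ball hHM)).sub
          (gammaRatioTrunc_differentiable K hH0).differentiableOn) _)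
        ((gammaRatioTrunc_differentiable K hH0).differentiableOn.mul_const _)) _
    · have hre := (abs_le.1 (Complex.abs_re_le_norm a)).2
      have haM := hD a ha
      have h4 := h1 a haM
      have h5 := hC' H hH a haM
      rw [Real.norm_of_nonneg (Real.rpow_nonneg hH0.le _)] at h2 h3
      rw [one_mul] at h3
      have h6 : H ^ (2 * a.re - K) * H ^ β ≤ H ^ (-3 : ℝ) := by
        rw [← Real.rpow_add hH0]
        exact Real.rpow_le_rpow_of_exponent_le hH (by linarith)
      have h7 : H ^ (2 * a.re) * H ^ (-N) ≤ H ^ (-3 : ℝ) := by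
        rw [← Real.rpow_add hH0]
        refine Real.rpow_le_rpow_of_exponent_le hH ?_
        have := le_max_left (2 * M + 3) (-β); rw [← hN] at this; linarith
      have h8 : ‖((2 * H - 1 : ℝ) : ℂ)‖ ≤ 2 * H := by
        rw [Complex.norm_real, Real.norm_of_nonneg (by linarith)]; linarith
      have h9 : ‖(gammaRatio a H - gammaRatioTrunc K a H) * Q H +
          gammaRatioTrunc K a H * (Q H - u H : ℝ)‖ ≤ (C * B + C') * H ^ (-3 : ℝ) := by
        refine (norm_add_le _ _).trans ?_
        rw [norm_mul, norm_mul, Complex.norm_real, Complex.norm_real]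
        calc _ ≤ C * H ^ (2 * a.re - K) * (B * H ^ β) + C' * H ^ (2 * a.re) * H ^ (-N) := by
              gcongr
          _ = C * B * (H ^ (2 * a.re - K) * H ^ β) + C' * (H ^ (2 * a.re) * H ^ (-N)) := by ring
          _ ≤ C * B * H ^ (-3 : ℝ) + C' * H ^ (-3 : ℝ) := by gcongr
          _ = _ := by ring
      rw [norm_mul]
      calc _ ≤ 2 * H * ((C * B + C') * H ^ (-3 : ℝ)) := by gcongr
        _ = 2 * (C * B + C') * (H ^ (1 : ℝ) * H ^ (-3 : ℝ)) := by rw [Real.rpow_one]; ring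
        _ = _ := by rw [← Real.rpow_add hH0]; norm_num
  refine (hmain.add hrem).congr' h.tendsto (Eventually.of_forall fun H a _ => ?_)
  push_cast
  ring

/-! ### A Landau-type theorem: continuation of a positive series forces decay. -/

theorem gammaRatio_ofReal (a H : ℝ) :
    gammaRatio a H = ((Real.Gamma (H + a) / Real.Gamma (H - a) : ℝ) : ℂ) := by
  rw [gammaRatio]
  push_cast [← Complex.Gamma_ofReal]
  rfl

theorem gammaRatio_real_pos {a H : ℝ} (h : |a| < H) : 0 < Real.Gamma (H + a) / Real.Gamma (H - a) := by
  have := abs_lt.1 h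
  exact div_pos (Real.Gamma_pos_of_pos (by linarith)) (Real.Gamma_pos_of_pos (by linarith))

theorem gammaRatio_real_lower (a : ℝ) : ∀ᶠ H : ℝ in atTop,
    H ^ (2 * a) / 2 ≤ Real.Gamma (H + a) / Real.Gamma (H - a) := by
  obtain ⟨C, hC0, hC⟩ := gammaRatio_expansion le_rfl |a|
  filter_upwards [hC, eventually_ge_atTop 1, eventually_ge_atTop (2 * C)] with H h hH hHC
  have hH0 : 0 < H := by linarith
  have h1 := h a (by simp)
  have e1 : gammaRatioTrunc 1 a H = ((H ^ (2 * a) : ℝ) : ℂ) := by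
    simp [gammaRatioTrunc, gammaRatioCoeff, Complex.ofReal_cpow hH0.le]
  rw [gammaRatio_ofReal, e1, ← Complex.ofReal_sub, Complex.norm_real, Complex.ofReal_re] at h1
  have h2 : C * H ^ (2 * a - (1 : ℕ)) ≤ H ^ (2 * a) / 2 := by
    rw [Nat.cast_one, Real.rpow_sub hH0, Real.rpow_one, mul_div_assoc', div_le_iff₀ hH0]
    nlinarith [Real.rpow_pos_of_pos hH0 (2 * a)]
  have := (abs_le.1 h1).1
  linarith

/-- Holomorphic functions that agree on a real interval agree. -/
theorem eqOn_of_eq_on_real {S : Set ℂ} (hS : IsOpen S) (hc : IsPreconnected S) {f g : ℂ → ℂ}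
    (hf : DifferentiableOn ℂ f S) (hg : DifferentiableOn ℂ g S) {p q : ℝ} (hpq : p < q)
    (hmem : ∀ x : ℝ, p < x → x < q → (x : ℂ) ∈ S)
    (heq : ∀ x : ℝ, p < x → x < q → f x = g x) : Set.EqOn f g S := by
  have hm1 : p < (p + q) / 2 := by linarith
  have hm2 : (p + q) / 2 < q := by linarith
  refine (hf.analyticOnNhd hS).eqOn_of_preconnected_of_frequently_eq (hg.analyticOnNhd hS) hc
    (hmem _ hm1 hm2) ?_
  have h1 : Tendsto (fun x : ℝ => (x : ℂ)) (𝓝[≠] ((p + q) / 2)) (𝓝[≠] (((p + q) / 2 : ℝ) : ℂ)) := by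
    refine tendsto_nhdsWithin_iff.2 ⟨(Complex.continuous_ofReal.tendsto _).mono_left
      nhdsWithin_le_nhds, ?_⟩
    filter_upwards [self_mem_nhdsWithin] with x hx
    exact fun h => hx (Complex.ofReal_injective h)
  refine h1.frequently (Eventually.frequently ?_)
  filter_upwards [mem_nhdsWithin_of_mem_nhds (Ioo_mem_nhds hm1 hm2)] with x hx
  exact heq x hx.1 hx.2

/-- A Landau-type theorem: if the Dirichlet-like series `∑ (2 H-1) W_a(H) E(H)` continues past its
abscissa of convergence, then `E` is correspondingly small. -/
theorem isLittleO_of_continuation {E : ℝ → ℝ} (hE : Expandable E) {β B M N : ℝ}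
    (hβ : E =O[atTop] fun x : ℝ => x ^ β) (hB : 2 * (-B) + (1 + β) < -1) (hB0 : 0 < B) (hBM : B < M)
    (hNM : N ≤ M)
    (h : ∀ᶠ L : ℕ in atTop, ∃ Φ : ℂ → ℂ, DifferentiableOn ℂ Φ (Metric.ball 0 M ∩ {z | z.re < N}) ∧
      ∀ a : ℝ, -M < a → a < -B → ∑' n : ℕ, ((2 * (L + n : ℕ) - 1 : ℝ) : ℂ) *
        gammaRatio a (L + n : ℕ) * E (L + n : ℕ) = Φ a)
    {N' : ℝ} (hN' : N' < N) : E =o[atTop] fun x : ℝ => x ^ (-2 * N' - 2) := by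
  rcases hE.leading (2 * N' + 2) with h0 | ⟨κ, hκ, t, ht, hlead⟩
  · rwa [show -2 * N' - 2 = -(2 * N' + 2) by ring]
  exfalso
  -- Up to logarithms the summand is of order H^{1+2a+t.1}, and a₀ is the point where this exponent
  -- reaches -1. If the claimed bound fails, then a₀ ≤ N' < N, so a₀ lies inside the domain of Φ.
  set a₀ : ℝ := -1 - t.1 / 2 with ha₀
  have ht1 : t.1 = -2 - 2 * a₀ := by rw [ha₀]; ring
  have ha₀N : a₀ < N := by rw [ha₀]; linarith
  have htβ : t.1 ≤ β := le_of_rpow_isBigO_rpow ((rpow_isBigO_powerLogMonomial t).trans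
    ((isBigO_powerLogMonomial_of_leading hκ hlead).trans hβ))
  have hBa : -B < a₀ := by rw [ha₀]; linarith
  have hEt : ∀ δ > 0, E =O[atTop] fun x : ℝ => x ^ (t.1 + δ) := fun δ hδ => by
    have h1 : powerLogMonomial t =o[atTop] fun x : ℝ => x ^ (t.1 + δ) :=
      powerLogMonomial_isLittleO (c := t.1) t.2 (by linarith)
    exact ((hlead.isBigO.trans h1.isBigO).add (h1.isBigO.const_mul_left κ)).congr_left
      fun x => by ring
  -- lower bound with a fixed sign
  have hlow : ∀ᶠ H : ℝ in atTop, κ ^ 2 / 2 * H ^ t.1 ≤ κ * E H := by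
    have hκ2 : 0 < |κ| / 2 := by positivity
    filter_upwards [hlead.bound hκ2, eventually_ge_atTop (Real.exp 1)] with H h1 hH
    have hH0 : 0 < H := (Real.exp_pos 1).trans_le hH
    have hl : 1 ≤ Real.log H := by rwa [Real.le_log_iff_exp_le hH0]
    have hm : H ^ t.1 ≤ powerLogMonomial t H := by
      rw [powerLogMonomial]
      exact le_mul_of_one_le_right (Real.rpow_nonneg hH0.le _) (one_le_pow₀ hl)
    have hm0 : 0 < powerLogMonomial t H := (Real.rpow_pos_of_pos hH0 _).trans_le hm
    rw [Real.norm_eq_abs, Real.norm_of_nonneg hm0.le] at h1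
    have h2 : |κ * (E H - κ * powerLogMonomial t H)| ≤ κ ^ 2 / 2 * powerLogMonomial t H := by
      rw [abs_mul]
      calc |κ| * |E H - κ * powerLogMonomial t H| ≤ |κ| * (|κ| / 2 * powerLogMonomial t H) := by
            gcongr
        _ = _ := by rw [← sq_abs κ]; ring
    have h3 := (abs_le.1 h2).1
    have h4 : κ ^ 2 / 2 * H ^ t.1 ≤ κ ^ 2 / 2 * powerLogMonomial t H := by gcongr
    nlinarith
  obtain ⟨C, hC0, hC⟩ := gammaRatio_norm_le M
  obtain ⟨R, hR⟩ := eventually_atTop.1 ((hlow.and hC).and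
    ((gammaRatio_real_lower a₀).and (eventually_ge_atTop (M + 1))))
  obtain ⟨R', hR'⟩ := exists_nat_ge (max R 1)
  obtain ⟨L, ⟨Φ, hΦ, hsum⟩, hL⟩ := (h.and (eventually_ge_atTop R')).exists
  have hLn : ∀ n : ℕ, R ≤ ((L + n : ℕ) : ℝ) ∧ (1 : ℝ) ≤ ((L + n : ℕ) : ℝ) := fun n => by
    have h1 : (R' : ℝ) ≤ ((L + n : ℕ) : ℝ) := by exact_mod_cast (by omega : R' ≤ L + n)
    exact ⟨(le_max_left _ _).trans (hR'.trans h1), (le_max_right _ _).trans (hR'.trans h1)⟩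
  set F : ℕ → ℂ → ℂ := fun n a => ((2 * (L + n : ℕ) - 1 : ℝ) : ℂ) *
        gammaRatio a (L + n : ℕ) * E (L + n : ℕ) with hF
  have hFd : ∀ n, DifferentiableOn ℂ (F n) (Metric.ball 0 M) := fun n =>
    ((((gammaRatio_differentiableOn ((L + n : ℕ) : ℝ)).mono (Metric.ball_subset_ball
      (by have := (hR _ (hLn n).1).2.2; linarith))).const_mul _).mul_const _)
  have hmemball : ∀ a : ℝ, -M < a → a < M → (a : ℂ) ∈ Metric.ball (0 : ℂ) M := fun a h1 h2 => by
    simpa using abs_lt.2 ⟨h1, h2⟩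
  -- bounds on half planes
  have hbound : ∀ σ < a₀, ∃ v : ℕ → ℝ, Summable v ∧
      ∀ n, ∀ a ∈ Metric.ball (0 : ℂ) M ∩ {z | z.re < σ}, ‖F n a‖ ≤ v n := by
    intro σ hσ
    have h1 : (fun H : ℝ => (2 * H - 1) * (C * H ^ (2 * σ)) * E H) =O[atTop]
        fun H : ℝ => H ^ (-1 - (a₀ - σ)) := by
      refine ((two_mul_sub_one_isBigO.mul ((isBigO_refl _ _).const_mul_left C)).mul
        (hEt (a₀ - σ) (by linarith))).trans (EventuallyEq.isBigO ?_)
      filter_upwards [eventually_gt_atTop 0] with H hH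
      rw [← Real.rpow_add hH, ← Real.rpow_add hH, ht1]
      congr 1; ring
    refine ⟨_, summable_of_isBigO_rpow (by linarith) h1 L, fun n a ha => ?_⟩
    have h2 := (hR _ (hLn n).1).1.2 a (by have := ha.1; rw [mem_ball_zero_iff] at this; exact this.le)
    have hH1 := (hLn n).2
    simp only [hF, norm_mul, abs_mul, Complex.norm_real, Real.norm_eq_abs]
    have h3 : ‖gammaRatio a ((L + n : ℕ) : ℝ)‖ ≤ |C| * |((L + n : ℕ) : ℝ) ^ (2 * σ)| := by
      rw [abs_of_nonneg hC0, abs_of_nonneg (by positivity)]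
      refine h2.trans (mul_le_mul_of_nonneg_left ?_ hC0)
      refine Real.rpow_le_rpow_of_exponent_le hH1 ?_
      have : a.re < σ := ha.2
      linarith
    gcongr
  have hsummable : ∀ a : ℝ, -M < a → a < a₀ → Summable fun n => F n a := by
    intro a h1 h2
    obtain ⟨v, hv, hb⟩ := hbound ((a + a₀) / 2) (by linarith)
    refine Summable.of_norm_bounded hv fun n => hb n a ⟨hmemball a h1 (by linarith), ?_⟩
    show (a : ℂ).re < _
    rw [Complex.ofReal_re]; linarith
  -- Identity theorem: the sum and Φ are holomorphic on the convex set |z| < M, Re z < σ with σ <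
  -- a₀, and agree on (-M, -B).
  have hΦeq : ∀ a : ℝ, -B < a → a < a₀ → ∑' n, F n a = Φ a := by
    intro a h1 h2
    set σ : ℝ := (a + a₀) / 2 with hσ
    obtain ⟨v, hv, hb⟩ := hbound σ (by rw [hσ]; linarith)
    have hSo : IsOpen (Metric.ball (0 : ℂ) M ∩ {z | z.re < σ}) :=
      Metric.isOpen_ball.inter (isOpen_lt Complex.continuous_re continuous_const)
    have hSc : Convex ℝ (Metric.ball (0 : ℂ) M ∩ {z | z.re < σ}) :=
      (convex_ball _ _).inter (convex_halfSpace_re_lt σ)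
    have hZ := Complex.differentiableOn_tsum_of_summable_norm hv
      (fun n => (hFd n).mono Set.inter_subset_left) hSo hb
    have := eqOn_of_eq_on_real hSo hSc.isPreconnected hZ
      (hΦ.mono (Set.inter_subset_inter_right _ fun z (hz : z.re < σ) => by
        show z.re < N
        rw [hσ] at hz; linarith)) (p := -M) (q := -B) (by linarith)
      (fun x hx1 hx2 => ⟨hmemball x hx1 (by linarith), by
        show (x : ℂ).re < σ
        rw [Complex.ofReal_re, hσ]; linarith⟩)
      (fun x hx1 hx2 => hsum x hx1 hx2)
    refine this ⟨hmemball a (by linarith) (by linarith), ?_⟩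
    show (a : ℂ).re < σ
    rw [Complex.ofReal_re, hσ]; linarith
  -- positivity
  set T : ℕ → ℝ → ℝ := fun n a => (2 * ((L + n : ℕ) : ℝ) - 1) *
    (Real.Gamma ((L + n : ℕ) + a) / Real.Gamma ((L + n : ℕ) - a)) * (κ * E (L + n : ℕ)) with hT
  have hTF : ∀ n (a : ℝ), κ * F n a = T n a := fun n a => by
    simp only [hF, hT, gammaRatio_ofReal]; push_cast; ring
  have hT0 : ∀ n (a : ℝ), |a| < M → 0 ≤ T n a := fun n a ha => by
    have h1 := hR _ (hLn n).1
    have h2 := gammaRatio_real_pos (a := a) (H := ((L + n : ℕ) : ℝ)) (by linarith [h1.2.2])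
    have h3 := (hLn n).2
    have h4 : 0 ≤ κ * E (L + n : ℕ) := le_trans (by positivity) h1.1.1
    exact mul_nonneg (mul_nonneg (by linarith) h2.le) h4
  have ha₀M : |a₀| < M := abs_lt.2 ⟨by linarith, by linarith⟩
  -- After multiplication by κ all terms are nonnegative, so every finite partial sum is bounded by
  -- the full sum.
  have hpart : ∀ (S : Finset ℕ) (a : ℝ), -B < a → a < a₀ → ∑ n ∈ S, T n a ≤ (κ * Φ a).re := by
    intro S a h1 h2
    have h3 : HasSum (fun n => (T n a : ℂ)) (κ * Φ a) := by
      rw [← hΦeq a h1 h2]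
      simp only [← hTF]
      exact (hsummable a (by linarith) h2).hasSum.mul_left _
    have h4 : HasSum (fun n => T n a) (κ * Φ a).re := by
      simpa using Complex.hasSum_re h3
    exact sum_le_hasSum S (fun n _ => hT0 n a (abs_lt.2 ⟨by linarith, by linarith⟩)) h4
  have hTc : ∀ n, ContinuousAt (T n) a₀ := fun n => by
    have h1 : ContinuousAt (fun a : ℝ => (κ * F n a).re) a₀ := by
      refine Complex.continuous_re.continuousAt.comp (continuousAt_const.mul ?_)
      exact ((hFd n).continuousOn.continuousAt (Metric.isOpen_ball.mem_nhds
        (hmemball a₀ (by linarith) (by linarith)))).comp Complex.continuous_ofReal.continuousAt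
    simpa only [hTF, Complex.ofReal_re] using h1
  have hΦc : ContinuousAt (fun a : ℝ => (κ * Φ a).re) a₀ := by
    refine Complex.continuous_re.continuousAt.comp (continuousAt_const.mul ?_)
    refine ContinuousAt.comp (hΦ.continuousOn.continuousAt ((Metric.isOpen_ball.inter (isOpen_lt
      Complex.continuous_re continuous_const)).mem_nhds
        ⟨hmemball a₀ (by linarith) (by linarith), ?_⟩)) Complex.continuous_ofReal.continuousAt
    show (a₀ : ℂ).re < N
    rwa [Complex.ofReal_re]
  -- Let a increase to a₀: continuity of Φ there bounds every partial sum at a₀ itself, so the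
  -- series of nonnegative terms converges at a₀.
  have hlim : ∀ S : Finset ℕ, ∑ n ∈ S, T n a₀ ≤ (κ * Φ a₀).re := by
    intro S
    have h1 : Tendsto (fun a => ∑ n ∈ S, T n a) (𝓝[<] a₀) (𝓝 (∑ n ∈ S, T n a₀)) :=
      tendsto_finsetSum _ fun n _ => (hTc n).tendsto.mono_left nhdsWithin_le_nhds
    have h2 : Tendsto (fun a : ℝ => (κ * Φ a).re) (𝓝[<] a₀) (𝓝 (κ * Φ a₀).re) :=
      hΦc.tendsto.mono_left nhdsWithin_le_nhds
    refine le_of_tendsto_of_tendsto h1 h2 ?_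
    filter_upwards [Ioo_mem_nhdsLT hBa] with a ha
    exact hpart S a ha.1 ha.2
  have hsT : Summable fun n => T n a₀ :=
    summable_of_sum_le (fun n => hT0 n a₀ ha₀M) hlim
  -- At a₀ the terms dominate a multiple of the harmonic series, which gives the contradiction.
  have hcmp : ∀ n, κ ^ 2 / 4 * ((L + n : ℕ) : ℝ)⁻¹ ≤ T n a₀ := by
    intro n
    have h1 := hR _ (hLn n).1
    have hH1 := (hLn n).2
    set H : ℝ := ((L + n : ℕ) : ℝ) with hH
    have hH0 : 0 < H := by linarith
    have e : κ ^ 2 / 4 * H⁻¹ = H ^ (1 : ℝ) * (H ^ (2 * a₀) / 2) * (κ ^ 2 / 2 * H ^ t.1) := by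
      have : H⁻¹ = H ^ (1 : ℝ) * H ^ (2 * a₀) * H ^ t.1 := by
        rw [← Real.rpow_add hH0, ← Real.rpow_add hH0, ← Real.rpow_neg_one, ht1]
        congr 1; ring
      rw [this]; ring
    rw [e]
    simp only [hT]
    rw [← hH, Real.rpow_one]
    have h2 := h1.2.1
    have h3 := h1.1.1
    have h4 : 0 ≤ H ^ (2 * a₀) / 2 := by positivity
    have h5 : 0 ≤ κ ^ 2 / 2 * H ^ t.1 := by positivity
    exact mul_le_mul (mul_le_mul (by linarith) h2 h4 (by linarith)) h3 h5
      (mul_nonneg (by linarith) (h4.trans h2))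
  have hdiv : Summable fun n : ℕ => κ ^ 2 / 4 * ((L + n : ℕ) : ℝ)⁻¹ :=
    Summable.of_nonneg_of_le (fun n => by positivity) hcmp hsT
  have hκ4 : κ ^ 2 / 4 ≠ 0 := by positivity
  have h6 : Summable fun n : ℕ => ((L + n : ℕ) : ℝ)⁻¹ := (summable_mul_left_iff hκ4).1 hdiv
  have h7 : Summable fun n : ℕ => ((n + L : ℕ) : ℝ)⁻¹ := h6.congr fun n => by rw [add_comm]
  exact Real.not_summable_natCast_inv ((summable_nat_add_iff L).1 h7)

open MeasureTheory

/-! ### The one-dimensional blocks and their Mellin transforms -/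

theorem one_le_radius_ordinaryHypergeometricSeries (a b c : ℝ) :
    1 ≤ (ordinaryHypergeometricSeries ℝ a b c).radius := by
  by_cases h : ∀ k : ℕ, (k : ℝ) ≠ -a ∧ (k : ℝ) ≠ -b ∧ (k : ℝ) ≠ -c
  · exact (ordinaryHypergeometricSeries_radius_eq_one ℝ a b c h).ge
  · push Not at h
    obtain ⟨k, hk⟩ := h
    by_cases ha : (k : ℝ) = -a
    · rw [show a = -(k : ℝ) by linarith, ordinaryHypergeometric_radius_top_of_neg_nat₁]; simp
    by_cases hb : (k : ℝ) = -b
    · rw [show b = -(k : ℝ) by linarith, ordinaryHypergeometric_radius_top_of_neg_nat₂]; simp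
    rw [show c = -(k : ℝ) by linarith [hk ha hb], ordinaryHypergeometric_radius_top_of_neg_nat₃]
    simp

theorem hasFPowerSeriesOnBall_ordinaryHypergeometric (a b c : ℝ) :
    HasFPowerSeriesOnBall (ordinaryHypergeometric a b c : ℝ → ℝ)
      (ordinaryHypergeometricSeries ℝ a b c) 0 1 :=
  ((ordinaryHypergeometricSeries ℝ a b c).hasFPowerSeriesOnBall
    (zero_lt_one.trans_le (one_le_radius_ordinaryHypergeometricSeries a b c))).mono zero_lt_one
    (one_le_radius_ordinaryHypergeometricSeries a b c)

theorem hasSum_ordinaryHypergeometric (a b c : ℝ) {x : ℝ} (hx : |x| < 1) :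
    HasSum (fun n => ordinaryHypergeometricCoefficient a b c n * x ^ n)
      (ordinaryHypergeometric a b c x) := by
  have h := (hasFPowerSeriesOnBall_ordinaryHypergeometric a b c).hasSum (y := x) (by
    rw [Metric.mem_eball, edist_dist, ENNReal.ofReal_lt_one]
    simpa using hx)
  simpa only [ordinaryHypergeometricSeries_apply_eq, zero_add, smul_eq_mul] using h

theorem continuousOn_ordinaryHypergeometric (a b c : ℝ) :
    ContinuousOn (ordinaryHypergeometric a b c : ℝ → ℝ) (Set.Ioo (-1) 1) := by
  refine (hasFPowerSeriesOnBall_ordinaryHypergeometric a b c).continuousOn.mono fun x hx => ?_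
  rw [Metric.mem_eball, edist_dist, ENNReal.ofReal_lt_one]
  simpa using abs_lt.2 ⟨hx.1, hx.2⟩

/-- The block `k_{2 H}` as a function of `y`. -/
noncomputable def blockFun (r s H y : ℝ) : ℝ := sl2Block r s H (1 / (1 + y))

/-- The Taylor coefficients of the hypergeometric factor of `k_{2 H}`. -/
noncomputable def blockCoeff (r s H : ℝ) (n : ℕ) : ℝ :=
  ordinaryHypergeometricCoefficient (H - r) (H + s) (2 * H) n

theorem blockFun_hasSum (r s H : ℝ) {y : ℝ} (hy : 0 < y) :
    HasSum (fun n : ℕ => blockCoeff r s H n * (y ^ (-r) * (1 + y) ^ (r - H - n)))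
      (blockFun r s H y) := by
  have h1 : 0 < 1 + y := by linarith
  have hx0 : 0 < 1 / (1 + y) := by positivity
  have hx1 : 1 / (1 + y) < 1 := by rw [div_lt_one h1]; linarith
  have h := (hasSum_ordinaryHypergeometric (H - r) (H + s) (2 * H)
    (abs_lt.2 ⟨by linarith, hx1⟩)).mul_left ((1 / (1 + y)) ^ H * (1 - 1 / (1 + y)) ^ (-r))
  have e : (1 / (1 + y)) ^ H * (1 - 1 / (1 + y)) ^ (-r) = y ^ (-r) * (1 + y) ^ (r - H) := by
    rw [show 1 - 1 / (1 + y) = y / (1 + y) by field_simp; ring, Real.div_rpow hy.le h1.le,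
      one_div, Real.inv_rpow h1.le, Real.rpow_neg h1.le r, div_inv_eq_mul, Real.rpow_sub h1]
    ring
  rw [blockFun, sl2Block]
  refine h.congr_fun fun n => ?_
  rw [e, blockCoeff, Real.rpow_sub_natCast h1.ne', one_div, inv_pow]
  ring

theorem blockFun_continuousOn (r s H : ℝ) : ContinuousOn (blockFun r s H) (Set.Ioi 0) := by
  have h1 : ContinuousOn (fun y : ℝ => 1 / (1 + y)) (Set.Ioi 0) :=
    ContinuousOn.div continuousOn_const (by fun_prop) fun y (hy : 0 < y) => by positivity
  have hm : ∀ y : ℝ, 0 < y → 0 < 1 / (1 + y) ∧ 1 / (1 + y) < 1 := fun y hy =>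
    ⟨by positivity, by rw [div_lt_one (by linarith)]; linarith⟩
  refine ContinuousOn.mul (ContinuousOn.mul (h1.rpow_const fun y hy => Or.inl (hm y hy).1.ne')
    ((continuousOn_const.sub h1).rpow_const fun y hy => Or.inl (sub_pos.2 (hm y hy).2).ne')) ?_
  exact (continuousOn_ordinaryHypergeometric _ _ _).comp h1 fun y hy =>
    ⟨by linarith [(hm y hy).1], (hm y hy).2⟩

/-- The Beta distribution has total mass one. Lower integrals of nonnegative functions allow sums
and integrals to be exchanged below without a prior proof of convergence. -/
theorem lintegral_beta {b c : ℝ} (hb : 0 < b) (hc : 0 < c) :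
    ∫⁻ t in Set.Ioo (0 : ℝ) 1, ENNReal.ofReal (t ^ (b - 1) * (1 - t) ^ (c - 1)) =
      ENNReal.ofReal (Real.Gamma b * Real.Gamma c / Real.Gamma (b + c)) := by
  have h := ProbabilityTheory.lintegral_betaPDF_eq_one hb hc
  have hpos := ProbabilityTheory.beta_pos hb hc
  rw [ProbabilityTheory.lintegral_betaPDF] at h
  simp only [mul_assoc] at h
  simp only [ENNReal.ofReal_mul (show 0 ≤ 1 / ProbabilityTheory.beta b c by positivity)] at h
  rw [lintegral_const_mul' _ _ ENNReal.ofReal_ne_top, one_div, ENNReal.ofReal_inv_of_pos hpos] at h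
  rw [← ProbabilityTheory.beta]
  have h0 : ENNReal.ofReal (ProbabilityTheory.beta b c) ≠ 0 := by simpa using hpos
  calc _ = ENNReal.ofReal (ProbabilityTheory.beta b c) *
        ((ENNReal.ofReal (ProbabilityTheory.beta b c))⁻¹ *
        ∫⁻ t in Set.Ioo (0 : ℝ) 1, ENNReal.ofReal (t ^ (b - 1) * (1 - t) ^ (c - 1))) := by
        rw [← mul_assoc, ENNReal.mul_inv_cancel h0 ENNReal.ofReal_ne_top, one_mul]
    _ = _ := by rw [h, mul_one]

/-- The substitution t = y/(1+y). -/
theorem lintegral_beta_Ioi {b c : ℝ} (hb : 0 < b) (hc : 0 < c) :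
    ∫⁻ y in Set.Ioi (0 : ℝ), ENNReal.ofReal (y ^ (b - 1) * (1 + y) ^ (-(b + c))) =
      ENNReal.ofReal (Real.Gamma b * Real.Gamma c / Real.Gamma (b + c)) := by
  rw [← lintegral_beta hb hc]
  have himage : (fun y : ℝ => y / (1 + y)) '' Set.Ioi 0 = Set.Ioo 0 1 := by
    ext t
    simp only [Set.mem_image, Set.mem_Ioi, Set.mem_Ioo]
    constructor
    · rintro ⟨y, hy, rfl⟩
      exact ⟨by positivity, by rw [div_lt_one (by linarith)]; linarith⟩
    · rintro ⟨h0, h1⟩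
      have : 1 - t ≠ 0 := by linarith
      refine ⟨t / (1 - t), div_pos h0 (by linarith), ?_⟩
      field_simp
      ring
  have hinj : Set.InjOn (fun y : ℝ => y / (1 + y)) (Set.Ioi 0) := by
    intro x hx y hy h
    simp only [Set.mem_Ioi] at hx hy
    simp only at h
    have hx1 : 1 + x ≠ 0 := by positivity
    have hy1 : 1 + y ≠ 0 := by positivity
    rw [div_eq_div_iff hx1 hy1] at h
    linarith
  have hderiv : ∀ y ∈ Set.Ioi (0 : ℝ),
      HasDerivWithinAt (fun y : ℝ => y / (1 + y)) (1 / (1 + y) ^ 2) (Set.Ioi 0) y := by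
    intro y hy
    simp only [Set.mem_Ioi] at hy
    have h1 : HasDerivAt (fun y : ℝ => 1 + y) 1 y := by simpa using (hasDerivAt_id y).const_add 1
    have := ((hasDerivAt_id y).fun_div h1 (by positivity)).hasDerivWithinAt (s := Set.Ioi 0)
    refine this.congr_deriv ?_
    simp only [id]; ring
  rw [← himage, lintegral_image_eq_lintegral_abs_deriv_mul measurableSet_Ioi hderiv hinj]
  refine setLIntegral_congr_fun measurableSet_Ioi fun y hy => ?_
  simp only [Set.mem_Ioi] at hy
  have h1 : 0 < 1 + y := by linarith
  rw [← ENNReal.ofReal_mul (abs_nonneg _), abs_of_nonneg (by positivity),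
    show 1 - y / (1 + y) = (1 + y)⁻¹ by field_simp; ring, Real.div_rpow hy.le h1.le,
    Real.inv_rpow h1.le, ← Real.rpow_natCast, show -(b + c) = -((2 : ℕ) : ℝ) - (b - 1) - (c - 1) by
      push_cast; ring, Real.rpow_sub h1, Real.rpow_sub h1, Real.rpow_neg h1.le]
  congr 1
  ring

theorem hasSum_one_sub_rpow_neg (e : ℝ) {t : ℝ} (h0 : 0 < t) (h1 : t < 1) :
    HasSum (fun n : ℕ => (ascPochhammer ℝ n).eval e / n.factorial * t ^ n) ((1 - t) ^ (-e)) := by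
  have h := (Real.one_div_one_sub_rpow_hasFPowerSeriesOnBall_zero e).hasSum (y := t) (by
    rw [Metric.mem_eball, edist_dist, ENNReal.ofReal_lt_one]
    simpa using abs_lt.2 ⟨by linarith, h1⟩)
  rw [zero_add, one_div, ← Real.rpow_neg (by linarith)] at h
  refine h.congr_fun fun n => ?_
  rw [FormalMultilinearSeries.ofScalars_apply_eq, smul_eq_mul]
  congr 1
  have h2 := Ring.factorial_nsmul_multichoose_eq_ascPochhammer e n
  rw [Ring.choose, show e + n - 1 - n + 1 = e by ring]
  rw [Polynomial.ascPochhammer_smeval_eq_eval, nsmul_eq_mul] at h2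
  rw [← h2]
  have : (n.factorial : ℝ) ≠ 0 := by positivity
  field_simp

theorem ascPochhammer_eval_eq_Gamma {z : ℝ} (hz : 0 < z) (n : ℕ) :
    (ascPochhammer ℝ n).eval z = Real.Gamma (z + n) / Real.Gamma z := by
  induction n with
  | zero => simp [(Real.Gamma_pos_of_pos hz).ne']
  | succ n ih =>
    rw [ascPochhammer_succ_eval, ih, Nat.cast_succ, ← add_assoc,
      Real.Gamma_add_one (by positivity : z + n ≠ 0)]
    ring

/-- Gauss' summation of ₂F₁ at argument 1: write Γ(H+a+n)/Γ(2H+n) as a Beta integral, sum the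
binomial series of (1-t)^{-e} under the integral, and evaluate a second Beta integral. -/
theorem lintegral_gauss {e H a : ℝ} (he : 0 < e) (h1 : 0 < H + a) (h2 : 0 < H - a)
    (h3 : 0 < H - a - e) :
    ∑' n : ℕ, ENNReal.ofReal ((ascPochhammer ℝ n).eval e / n.factorial *
      (Real.Gamma (H + a + n) / Real.Gamma (2 * H + n))) =
      ENNReal.ofReal (Real.Gamma (H + a) * Real.Gamma (H - a - e) /
        (Real.Gamma (2 * H - e) * Real.Gamma (H - a))) := by
  have hG := Real.Gamma_pos_of_pos h2
  have hterm : ∀ n : ℕ, ENNReal.ofReal ((ascPochhammer ℝ n).eval e / n.factorial *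
      (Real.Gamma (H + a + n) / Real.Gamma (2 * H + n))) =
      ENNReal.ofReal (Real.Gamma (H - a))⁻¹ * ∫⁻ t in Set.Ioo (0 : ℝ) 1,
        ENNReal.ofReal ((ascPochhammer ℝ n).eval e / n.factorial * t ^ n) *
          ENNReal.ofReal (t ^ (H + a - 1) * (1 - t) ^ (H - a - 1)) := by
    intro n
    have hp : 0 ≤ (ascPochhammer ℝ n).eval e / n.factorial :=
      div_nonneg (ascPochhammer_pos n e he).le (by positivity)
    have h4 := lintegral_beta (b := H + a + n) (c := H - a) (by positivity) h2
    have h5 : ∫⁻ t in Set.Ioo (0 : ℝ) 1,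
        ENNReal.ofReal ((ascPochhammer ℝ n).eval e / n.factorial * t ^ n) *
          ENNReal.ofReal (t ^ (H + a - 1) * (1 - t) ^ (H - a - 1)) =
        ENNReal.ofReal ((ascPochhammer ℝ n).eval e / n.factorial) *
        ∫⁻ t in Set.Ioo (0 : ℝ) 1, ENNReal.ofReal (t ^ (H + a + n - 1) * (1 - t) ^ (H - a - 1)) := by
      rw [← lintegral_const_mul' _ _ ENNReal.ofReal_ne_top]
      refine setLIntegral_congr_fun measurableSet_Ioo fun t ht => ?_
      rw [← ENNReal.ofReal_mul (mul_nonneg hp (pow_nonneg ht.1.le _)), ← ENNReal.ofReal_mul hp,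
        show H + a + n - 1 = H + a - 1 + n by ring, Real.rpow_add_natCast ht.1.ne']
      congr 1
      ring
    rw [h5, h4, ← ENNReal.ofReal_mul hp, ← ENNReal.ofReal_mul (by positivity)]
    congr 1
    rw [show H + a + n + (H - a) = 2 * H + n by ring]
    field_simp
  simp only [hterm]
  rw [ENNReal.tsum_mul_left, ← lintegral_tsum fun n => by fun_prop]
  have h6 : ∫⁻ t in Set.Ioo (0 : ℝ) 1, ∑' n : ℕ,
        ENNReal.ofReal ((ascPochhammer ℝ n).eval e / n.factorial * t ^ n) *
          ENNReal.ofReal (t ^ (H + a - 1) * (1 - t) ^ (H - a - 1)) =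
      ∫⁻ t in Set.Ioo (0 : ℝ) 1, ENNReal.ofReal (t ^ (H + a - 1) * (1 - t) ^ (H - a - e - 1)) := by
    refine setLIntegral_congr_fun measurableSet_Ioo fun t ht => ?_
    have ht1 : 0 < 1 - t := sub_pos.2 ht.2
    have hs := hasSum_one_sub_rpow_neg e ht.1 ht.2
    rw [ENNReal.tsum_mul_right, ← ENNReal.ofReal_tsum_of_nonneg (fun n => mul_nonneg (div_nonneg
      (ascPochhammer_pos n e he).le (by positivity)) (pow_nonneg ht.1.le _)) hs.summable, hs.tsum_eq,
      ← ENNReal.ofReal_mul (Real.rpow_nonneg ht1.le _),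
      show H - a - e - 1 = -e + (H - a - 1) by ring, Real.rpow_add ht1]
    congr 1
    ring
  rw [h6, lintegral_beta h1 h3, ← ENNReal.ofReal_mul (by positivity)]
  congr 1
  rw [show H + a + (H - a - e) = 2 * H - e by ring]
  field_simp

theorem blockCoeff_nonneg {r s H : ℝ} (hr : |r| < H) (hs : |s| < H) (n : ℕ) :
    0 ≤ blockCoeff r s H n := by
  have h1 := abs_lt.1 hr
  have h2 := abs_lt.1 hs
  unfold blockCoeff
  have e1 := ascPochhammer_pos n (H - r) (by linarith)
  have e2 := ascPochhammer_pos n (H + s) (by linarith)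
  have e3 := ascPochhammer_pos n (2 * H) (by linarith)
  positivity

theorem blockFun_nonneg {r s H y : ℝ} (hr : |r| < H) (hs : |s| < H) (hy : 0 < y) :
    0 ≤ blockFun r s H y :=
  (blockFun_hasSum r s H hy).nonneg fun n => mul_nonneg (blockCoeff_nonneg hr hs n) (by positivity)

/-- The Mellin transform of the block. -/
noncomputable def blockMellin (r s a H : ℝ) : ℝ :=
  Real.Gamma (-a - r) * Real.Gamma (-a - s) * Real.Gamma (2 * H) * Real.Gamma (H + a) /
    (Real.Gamma (H - r) * Real.Gamma (H - s) * Real.Gamma (H - a))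

/-- Each power of 1+y in the block integrates to a Beta function, and the resulting series is Gauss'
with e = H + s. The exchange is legitimate because all coefficients are nonnegative. -/
theorem lintegral_blockFun {r s H a : ℝ} (hr : |r| < H) (hs : |s| < H) (har : a < -r) (has : a < -s)
    (haH : -H < a) :
    ∫⁻ y in Set.Ioi (0 : ℝ), ENNReal.ofReal (y ^ (-a - 1) * blockFun r s H y) =
      ENNReal.ofReal (blockMellin r s a H) := by
  have h1 := abs_lt.1 hr
  have h2 := abs_lt.1 hs
  have hH : 0 < H := (abs_nonneg r).trans_lt hr
  have g1 := Real.Gamma_pos_of_pos (show 0 < H - r by linarith)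
  have g2 := Real.Gamma_pos_of_pos (show 0 < -a - r by linarith)
  have g3 := Real.Gamma_pos_of_pos (show 0 < 2 * H by linarith)
  have hterm : ∀ n : ℕ, ∫⁻ y in Set.Ioi (0 : ℝ), ENNReal.ofReal
      (y ^ (-a - 1) * (blockCoeff r s H n * (y ^ (-r) * (1 + y) ^ (r - H - n)))) =
      ENNReal.ofReal (Real.Gamma (-a - r) * Real.Gamma (2 * H) / Real.Gamma (H - r)) *
      ENNReal.ofReal ((ascPochhammer ℝ n).eval (H + s) / n.factorial *
      (Real.Gamma (H + a + n) / Real.Gamma (2 * H + n))) := by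
    intro n
    have hn : (0 : ℝ) ≤ n := Nat.cast_nonneg n
    have e1 : ∫⁻ y in Set.Ioi (0 : ℝ), ENNReal.ofReal
      (y ^ (-a - 1) * (blockCoeff r s H n * (y ^ (-r) * (1 + y) ^ (r - H - n)))) =
      ENNReal.ofReal (blockCoeff r s H n) * ∫⁻ y in Set.Ioi (0 : ℝ), ENNReal.ofReal
        (y ^ ((-a - r) - 1) * (1 + y) ^ (-((-a - r) + (H + n + a)))) := by
      rw [← lintegral_const_mul' _ _ ENNReal.ofReal_ne_top]
      refine setLIntegral_congr_fun measurableSet_Ioi fun y hy => ?_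
      rw [← ENNReal.ofReal_mul (blockCoeff_nonneg hr hs n), show -a - r - 1 = (-a - 1) + (-r) by ring,
        Real.rpow_add hy, show -(-a - r + (H + n + a)) = r - H - n by ring]
      congr 1
      ring
    rw [e1, lintegral_beta_Ioi (by linarith) (by linarith),
      ← ENNReal.ofReal_mul (blockCoeff_nonneg hr hs n), ← ENNReal.ofReal_mul (by positivity)]
    congr 1
    rw [blockCoeff, ordinaryHypergeometricCoefficient, ascPochhammer_eval_eq_Gamma (z := H - r)
      (by linarith), ascPochhammer_eval_eq_Gamma (z := 2 * H) (by linarith),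
      show -a - r + (H + n + a) = H - r + n by ring, show H + n + a = H + a + n by ring]
    have g4 := Real.Gamma_pos_of_pos (show 0 < H - r + n by linarith)
    have g5 := Real.Gamma_pos_of_pos (show 0 < 2 * H + n by linarith)
    field_simp
  have e2 : ∫⁻ y in Set.Ioi (0 : ℝ), ENNReal.ofReal (y ^ (-a - 1) * blockFun r s H y) =
      ∫⁻ y in Set.Ioi (0 : ℝ), ∑' n : ℕ, ENNReal.ofReal
      (y ^ (-a - 1) * (blockCoeff r s H n * (y ^ (-r) * (1 + y) ^ (r - H - n)))) := by
    refine setLIntegral_congr_fun measurableSet_Ioi fun y (hy : 0 < y) => ?_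
    have h3 := (blockFun_hasSum r s H hy).mul_left (y ^ (-a - 1))
    have h4 : ∀ n, 0 ≤ y ^ (-a - 1) * (blockCoeff r s H n * (y ^ (-r) * (1 + y) ^ (r - H - n))) :=
      fun n => mul_nonneg (by positivity) (mul_nonneg (blockCoeff_nonneg hr hs n) (by positivity))
    rw [← ENNReal.ofReal_tsum_of_nonneg h4 h3.summable, h3.tsum_eq]
  rw [e2, lintegral_tsum fun n => by fun_prop]
  simp only [hterm]
  rw [ENNReal.tsum_mul_left, lintegral_gauss (by linarith) (by linarith) (by linarith) (by linarith),
    ← ENNReal.ofReal_mul (by positivity)]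
  congr 1
  rw [blockMellin, show H - a - (H + s) = -a - s by ring, show 2 * H - (H + s) = H - s by ring]
  field_simp

open MeasureTheory

theorem blockFun_mellin {r s H a : ℝ} (hr : |r| < H) (hs : |s| < H) (har : a < -r) (has : a < -s)
    (haH : -H < a) :
    IntegrableOn (fun y : ℝ => y ^ (-a - 1) * blockFun r s H y) (Set.Ioi 0) ∧
      ∫ y in Set.Ioi (0 : ℝ), y ^ (-a - 1) * blockFun r s H y = blockMellin r s a H := by
  have h1 := abs_lt.1 hr
  have h2 := abs_lt.1 hs
  have hH : 0 < H := (abs_nonneg r).trans_lt hr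
  have hl := lintegral_blockFun hr hs har has haH
  have hmeas : AEStronglyMeasurable (fun y : ℝ => y ^ (-a - 1) * blockFun r s H y)
      (volume.restrict (Set.Ioi 0)) :=
    (ContinuousOn.mul (continuousOn_id.rpow_const fun y hy => Or.inl (ne_of_gt hy))
      (blockFun_continuousOn r s H)).aestronglyMeasurable measurableSet_Ioi
  have hnn : 0 ≤ᵐ[volume.restrict (Set.Ioi 0)] fun y : ℝ => y ^ (-a - 1) * blockFun r s H y := by
    filter_upwards [ae_restrict_mem measurableSet_Ioi] with y (hy : 0 < y)
    exact mul_nonneg (by positivity) (blockFun_nonneg hr hs hy)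
  have hv : 0 ≤ blockMellin r s a H := by
    have g1 := Real.Gamma_pos_of_pos (show 0 < H - r by linarith)
    have g2 := Real.Gamma_pos_of_pos (show 0 < -a - r by linarith)
    have g3 := Real.Gamma_pos_of_pos (show 0 < 2 * H by linarith)
    have g4 := Real.Gamma_pos_of_pos (show 0 < H - s by linarith)
    have g5 := Real.Gamma_pos_of_pos (show 0 < -a - s by linarith)
    have g6 := Real.Gamma_pos_of_pos (show 0 < H + a by linarith)
    have g7 := Real.Gamma_pos_of_pos (show 0 < H - a by linarith)
    unfold blockMellin
    positivity
  refine ⟨⟨hmeas, ?_⟩, ?_⟩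
  · rw [hasFiniteIntegral_iff_ofReal hnn, hl]
    exact ENNReal.ofReal_lt_top
  · rw [integral_eq_lintegral_of_nonneg_ae hnn hmeas, hl, ENNReal.toReal_ofReal hv]

/-! ### Holomorphy of Mellin integrals. -/

theorem abs_log_le_rpow {η y : ℝ} (hη : 0 < η) (hy : 0 < y) :
    |Real.log y| ≤ (y ^ η + y ^ (-η)) / η := by
  have h1 := Real.log_le_rpow_div hy.le hη
  have h2 := Real.log_le_rpow_div (inv_pos.2 hy).le hη
  rw [Real.log_inv, Real.inv_rpow hy.le, ← Real.rpow_neg hy.le] at h2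
  have h3 : 0 ≤ y ^ η / η := by positivity
  have h4 : 0 ≤ y ^ (-η) / η := by positivity
  rw [add_div, abs_le]
  constructor <;> linarith

theorem rpow_le_add_of_mem_Icc {p q e y : ℝ} (hy : 0 < y) (h1 : p ≤ e) (h2 : e ≤ q) :
    y ^ e ≤ y ^ p + y ^ q := by
  rcases le_total y 1 with h | h
  · have := Real.rpow_le_rpow_of_exponent_ge hy h h1
    have := Real.rpow_nonneg hy.le q
    linarith
  · have := Real.rpow_le_rpow_of_exponent_le h h2
    have := Real.rpow_nonneg hy.le p
    linarith

/-- Mellin integrals may be differentiated in the strip where they converge. -/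
theorem hasDerivAt_mellin {S : Set ℝ} (hS : MeasurableSet S) (hpos : ∀ y ∈ S, 0 < y)
    {g : ℝ → ℝ} {p q : ℝ} (hp : IntegrableOn (fun y : ℝ => y ^ (-p - 1) * g y) S)
    (hq : IntegrableOn (fun y : ℝ => y ^ (-q - 1) * g y) S)
    {a₀ : ℂ} (h1 : p < a₀.re) (h2 : a₀.re < q) :
    Integrable (fun y : ℝ => (y : ℂ) ^ (-a₀ - 1) * g y * (-Real.log y : ℝ)) (volume.restrict S) ∧
    HasDerivAt (fun a : ℂ => ∫ y in S, (y : ℂ) ^ (-a - 1) * g y)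
      (∫ y in S, (y : ℂ) ^ (-a₀ - 1) * g y * (-Real.log y : ℝ)) a₀ := by
  -- The margin η is used twice: for the disc in which a varies and for the bound of |log y| by (y^η
  -- + y^{-η})/η.
  obtain ⟨η, hη, hη1, hη2⟩ : ∃ η > 0, p + 2 * η ≤ a₀.re ∧ a₀.re + 2 * η ≤ q := by
    refine ⟨min ((a₀.re - p) / 2) ((q - a₀.re) / 2), lt_min (by linarith) (by linarith), ?_, ?_⟩
    · have := min_le_left ((a₀.re - p) / 2) ((q - a₀.re) / 2); linarith
    · have := min_le_right ((a₀.re - p) / 2) ((q - a₀.re) / 2); linarith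
  have hnorm : ∀ (a : ℂ), ∀ y ∈ S, ‖(y : ℂ) ^ (-a - 1) * g y‖ = y ^ (-a.re - 1) * |g y| := by
    intro a y hy
    rw [norm_mul, Complex.norm_cpow_eq_rpow_re_of_pos (hpos y hy), Complex.norm_real,
      Real.norm_eq_abs]
    simp
  have hgm : AEStronglyMeasurable (fun y : ℝ => (g y : ℂ)) (volume.restrict S) := by
    have h3 : AEStronglyMeasurable (fun y : ℝ => y ^ (p + 1) * (y ^ (-p - 1) * g y))
        (volume.restrict S) :=
      AEStronglyMeasurable.mul (by fun_prop) hp.1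
    refine Complex.continuous_ofReal.comp_aestronglyMeasurable (h3.congr ?_)
    filter_upwards [ae_restrict_mem hS] with y hy
    rw [← mul_assoc, ← Real.rpow_add (hpos y hy)]
    simp
  have hcm : ∀ a : ℂ, AEStronglyMeasurable (fun y : ℝ => (y : ℂ) ^ (-a - 1) * g y)
      (volume.restrict S) := fun a => by
    refine AEStronglyMeasurable.mul ?_ hgm
    refine ContinuousOn.aestronglyMeasurable (fun y hy => ?_) hS
    refine (ContinuousAt.cpow Complex.continuous_ofReal.continuousAt continuousAt_const
      ?_).continuousWithinAt
    simp [hpos y hy]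
  have hbd : Integrable (fun y : ℝ => y ^ (-p - 1) * |g y| + y ^ (-q - 1) * |g y|)
      (volume.restrict S) := by
    refine (hp.norm.add hq.norm).congr ?_
    filter_upwards [ae_restrict_mem hS] with y hy
    have := hpos y hy
    simp [abs_of_pos (Real.rpow_pos_of_pos (hpos y hy) _)]
  have hint : Integrable (fun y : ℝ => (y : ℂ) ^ (-a₀ - 1) * g y) (volume.restrict S) := by
    refine hbd.mono' (hcm a₀) ?_
    filter_upwards [ae_restrict_mem hS] with y hy
    rw [hnorm a₀ y hy, ← add_mul]
    refine mul_le_mul_of_nonneg_right ?_ (abs_nonneg _)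
    rw [add_comm]
    exact rpow_le_add_of_mem_Icc (hpos y hy) (by linarith) (by linarith)
  have hmain := hasDerivAt_integral_of_dominated_loc_of_deriv_le (μ := volume.restrict S) (𝕜 := ℂ)
    (F := fun (a : ℂ) (y : ℝ) => (y : ℂ) ^ (-a - 1) * g y)
    (F' := fun (a : ℂ) (y : ℝ) => (y : ℂ) ^ (-a - 1) * g y * (-Real.log y : ℝ))
    (x₀ := a₀) (s := Metric.ball a₀ η)
    (bound := fun y => 2 / η * (y ^ (-p - 1) * |g y| + y ^ (-q - 1) * |g y|))
    (Metric.ball_mem_nhds a₀ hη) (Eventually.of_forall hcm) hint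
    ((hcm a₀).mul (by
      refine Complex.continuous_ofReal.comp_aestronglyMeasurable ?_
      exact Real.measurable_log.neg.aestronglyMeasurable)) ?_ (hbd.const_mul _) ?_
  · exact hmain
  · filter_upwards [ae_restrict_mem hS] with y hy a ha
    have hy0 := hpos y hy
    have hre : |a.re - a₀.re| < η := by
      rw [Metric.mem_ball, dist_eq_norm] at ha
      simpa using (Complex.abs_re_le_norm (a - a₀)).trans_lt ha
    rw [abs_lt] at hre
    rw [norm_mul, hnorm a y hy, Complex.norm_real, norm_neg, Real.norm_eq_abs]
    have h3 : y ^ (-a.re - 1) * |Real.log y| ≤ 2 / η * (y ^ (-p - 1) + y ^ (-q - 1)) := by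
      have h4 := abs_log_le_rpow hη hy0
      have h5 : y ^ (-a.re - 1) * y ^ η ≤ y ^ (-q - 1) + y ^ (-p - 1) := by
        rw [← Real.rpow_add hy0]
        exact rpow_le_add_of_mem_Icc hy0 (by linarith) (by linarith)
      have h6 : y ^ (-a.re - 1) * y ^ (-η) ≤ y ^ (-q - 1) + y ^ (-p - 1) := by
        rw [← Real.rpow_add hy0]
        exact rpow_le_add_of_mem_Icc hy0 (by linarith) (by linarith)
      calc y ^ (-a.re - 1) * |Real.log y| ≤ y ^ (-a.re - 1) * ((y ^ η + y ^ (-η)) / η) := by gcongr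
        _ = (y ^ (-a.re - 1) * y ^ η + y ^ (-a.re - 1) * y ^ (-η)) / η := by ring
        _ ≤ (2 * (y ^ (-q - 1) + y ^ (-p - 1))) / η := by gcongr; linarith
        _ = _ := by ring
    calc y ^ (-a.re - 1) * |g y| * |Real.log y| = y ^ (-a.re - 1) * |Real.log y| * |g y| := by ring
      _ ≤ 2 / η * (y ^ (-p - 1) + y ^ (-q - 1)) * |g y| := by gcongr
      _ = _ := by ring
  · filter_upwards [ae_restrict_mem hS] with y hy a ha
    have hy0 : (y : ℂ) ≠ 0 := by exact_mod_cast (hpos y hy).ne'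
    have h3 : HasDerivAt (fun a : ℂ => -a - 1) (-1) a := (hasDerivAt_neg a).sub_const 1
    refine ((h3.const_cpow (Or.inl hy0)).mul_const _).congr_deriv ?_
    rw [← Complex.ofReal_log (hpos y hy).le]
    push_cast
    ring

/-- Mellin integrals are holomorphic in the strip where they converge. -/
theorem differentiableOn_mellin {S : Set ℝ} (hS : MeasurableSet S) (hpos : ∀ y ∈ S, 0 < y)
    {g : ℝ → ℝ} {p q : ℝ} (hp : IntegrableOn (fun y : ℝ => y ^ (-p - 1) * g y) S)
    (hq : IntegrableOn (fun y : ℝ => y ^ (-q - 1) * g y) S) :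
    DifferentiableOn ℂ (fun a : ℂ => ∫ y in S, (y : ℂ) ^ (-a - 1) * g y)
      {a | p < a.re ∧ a.re < q} := fun _ ha =>
  (hasDerivAt_mellin hS hpos hp hq ha.1 ha.2).2.differentiableAt.differentiableWithinAt

theorem integrableOn_rpow_mul_Ioo {g : ℝ → ℝ} {p q : ℝ} (hpq : p ≤ q)
    (hq : IntegrableOn (fun y : ℝ => y ^ (-q - 1) * g y) (Set.Ioo 0 1)) :
    IntegrableOn (fun y : ℝ => y ^ (-p - 1) * g y) (Set.Ioo 0 1) := by
  have h1 : AEStronglyMeasurable (fun y : ℝ => y ^ (q - p) * (y ^ (-q - 1) * g y))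
      (volume.restrict (Set.Ioo 0 1)) := AEStronglyMeasurable.mul (by fun_prop) hq.1
  have h2 : ∀ y ∈ Set.Ioo (0 : ℝ) 1, y ^ (q - p) * (y ^ (-q - 1) * g y) = y ^ (-p - 1) * g y := by
    intro y hy
    rw [← mul_assoc, ← Real.rpow_add hy.1]
    congr 2; ring
  refine Integrable.mono' hq.norm (h1.congr ?_) ?_
  · filter_upwards [ae_restrict_mem measurableSet_Ioo] with y hy using h2 y hy
  · filter_upwards [ae_restrict_mem measurableSet_Ioo] with y hy
    rw [← h2 y hy, norm_mul]
    refine mul_le_of_le_one_left (norm_nonneg _) ?_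
    rw [Real.norm_of_nonneg (Real.rpow_nonneg hy.1.le _)]
    exact Real.rpow_le_one hy.1.le hy.2.le (by linarith)

theorem integrableOn_rpow_mul_Ici {g : ℝ → ℝ} {p q : ℝ} (hpq : p ≤ q)
    (hp : IntegrableOn (fun y : ℝ => y ^ (-p - 1) * g y) (Set.Ici 1)) :
    IntegrableOn (fun y : ℝ => y ^ (-q - 1) * g y) (Set.Ici 1) := by
  have h1 : AEStronglyMeasurable (fun y : ℝ => y ^ (p - q) * (y ^ (-p - 1) * g y))
      (volume.restrict (Set.Ici 1)) := AEStronglyMeasurable.mul (by fun_prop) hp.1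
  have h2 : ∀ y ∈ Set.Ici (1 : ℝ), y ^ (p - q) * (y ^ (-p - 1) * g y) = y ^ (-q - 1) * g y := by
    intro y (hy : 1 ≤ y)
    rw [← mul_assoc, ← Real.rpow_add (by linarith)]
    congr 2; ring
  refine Integrable.mono' hp.norm (h1.congr ?_) ?_
  · filter_upwards [ae_restrict_mem measurableSet_Ici] with y hy using h2 y hy
  · filter_upwards [ae_restrict_mem measurableSet_Ici] with y hy
    have hy1 : 1 ≤ y := hy
    rw [← h2 y hy, norm_mul]
    refine mul_le_of_le_one_left (norm_nonneg _) ?_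
    rw [Real.norm_of_nonneg (Real.rpow_nonneg (by linarith) _)]
    exact Real.rpow_le_one_of_one_le_of_nonpos hy1 (by linarith)

theorem differentiableOn_mellin_Ioo {g : ℝ → ℝ} {q : ℝ}
    (hq : IntegrableOn (fun y : ℝ => y ^ (-q - 1) * g y) (Set.Ioo 0 1)) :
    DifferentiableOn ℂ (fun a : ℂ => ∫ y in Set.Ioo (0 : ℝ) 1, (y : ℂ) ^ (-a - 1) * g y)
      {a | a.re < q} := by
  intro a ha
  have ha' : a.re < q := ha
  have hop : IsOpen {z : ℂ | a.re - 1 < z.re ∧ z.re < q} :=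
    (isOpen_lt continuous_const Complex.continuous_re).inter
      (isOpen_lt Complex.continuous_re continuous_const)
  exact ((differentiableOn_mellin measurableSet_Ioo (fun y hy => hy.1)
    (integrableOn_rpow_mul_Ioo (show a.re - 1 ≤ q by linarith) hq) hq).differentiableAt
    (hop.mem_nhds ⟨by linarith, ha'⟩)).differentiableWithinAt

theorem differentiableOn_mellin_Ici {g : ℝ → ℝ} {p : ℝ}
    (hp : IntegrableOn (fun y : ℝ => y ^ (-p - 1) * g y) (Set.Ici 1)) :
    DifferentiableOn ℂ (fun a : ℂ => ∫ y in Set.Ici (1 : ℝ), (y : ℂ) ^ (-a - 1) * g y)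
      {a | p < a.re} := by
  intro a ha
  have ha' : p < a.re := ha
  have hop : IsOpen {z : ℂ | p < z.re ∧ z.re < a.re + 1} :=
    (isOpen_lt continuous_const Complex.continuous_re).inter
      (isOpen_lt Complex.continuous_re continuous_const)
  exact ((differentiableOn_mellin measurableSet_Ici (fun y (hy : 1 ≤ y) => by linarith) hp
    (integrableOn_rpow_mul_Ici (show p ≤ a.re + 1 by linarith) hp)).differentiableAt
    (hop.mem_nhds ⟨ha', by linarith⟩)).differentiableWithinAt

theorem integral_cpow_ofReal {S : Set ℝ} (hS : MeasurableSet S) (hpos : ∀ y ∈ S, 0 < y) (g : ℝ → ℝ)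
    (a : ℝ) : ∫ y in S, (y : ℂ) ^ (-(a : ℂ) - 1) * g y =
      ((∫ y in S, y ^ (-a - 1) * g y : ℝ) : ℂ) := by
  rw [← integral_complex_ofReal]
  refine setIntegral_congr_fun hS fun y hy => ?_
  rw [Complex.ofReal_mul, Complex.ofReal_cpow (hpos y hy).le]
  push_cast
  rfl

/-- Holomorphic functions on two overlapping half planes that agree on a real interval glue. -/
theorem exists_entire_of_half_planes {f g : ℂ → ℂ} {p q : ℝ} (hpq : p < q)
    (hf : DifferentiableOn ℂ f {z | p < z.re}) (hg : DifferentiableOn ℂ g {z | z.re < q})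
    (h : ∀ x : ℝ, p < x → x < q → f x = g x) :
    ∃ F : ℂ → ℂ, Differentiable ℂ F ∧ (∀ z : ℂ, z.re < q → F z = g z) := by
  classical
  have hSo : IsOpen {z : ℂ | p < z.re ∧ z.re < q} :=
    (isOpen_lt continuous_const Complex.continuous_re).inter
      (isOpen_lt Complex.continuous_re continuous_const)
  have hSc : Convex ℝ {z : ℂ | p < z.re ∧ z.re < q} :=
    (convex_halfSpace_re_gt p).inter (convex_halfSpace_re_lt q)
  have heq := eqOn_of_eq_on_real hSo hSc.isPreconnected (hf.mono fun z hz => hz.1)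
    (hg.mono fun z hz => hz.2) hpq (fun x h1 h2 => ⟨by simpa using h1, by simpa using h2⟩) h
  refine ⟨fun z => if z.re < q then g z else f z, fun z => ?_, fun z hz => by simp [hz]⟩
  rcases lt_or_ge z.re q with hz | hz
  · have h1 : {z : ℂ | z.re < q} ∈ 𝓝 z := (isOpen_lt Complex.continuous_re continuous_const).mem_nhds hz
    refine (hg.differentiableAt h1).congr_of_eventuallyEq ?_
    filter_upwards [h1] with w hw
    have : w.re < q := hw
    simp [this]
  · have h1 : {z : ℂ | p < z.re} ∈ 𝓝 z :=
      (isOpen_lt continuous_const Complex.continuous_re).mem_nhds (hpq.trans_le hz)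
    refine (hf.differentiableAt h1).congr_of_eventuallyEq ?_
    filter_upwards [h1] with w hw
    split_ifs with hwq
    · exact (heq ⟨hw, hwq⟩).symm
    · rfl

/-! ### Functions whose Mellin transform near the origin is entire after multiplication by γ. -/

open MeasureTheory

/-- `γ(a) ∫_0^1 y^{-a-1} g(y) dy`, defined for `a < -r, -s`, extends to an entire function. -/
def RegularMellin (r s : ℝ) (g : ℝ → ℝ) : Prop :=
  ∃ Ψ : ℂ → ℂ, Differentiable ℂ Ψ ∧ ∀ a < min (-r) (-s),
    IntegrableOn (fun y : ℝ => y ^ (-a - 1) * g y) (Set.Ioo 0 1) ∧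
      gammaInv r s a * ((∫ y in Set.Ioo (0 : ℝ) 1, y ^ (-a - 1) * g y : ℝ) : ℂ) = Ψ a

namespace RegularMellin

variable {r s : ℝ} {f g : ℝ → ℝ}

theorem congr (hf : RegularMellin r s f) (h : ∀ y, 0 < y → f y = g y) : RegularMellin r s g := by
  obtain ⟨Ψ, hΨ, hB⟩ := hf
  refine ⟨Ψ, hΨ, fun a ha => ?_⟩
  have e : Set.EqOn (fun y : ℝ => y ^ (-a - 1) * f y) (fun y : ℝ => y ^ (-a - 1) * g y)
      (Set.Ioo 0 1) := fun y hy => by simp only [h y hy.1]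
  obtain ⟨h1, h2⟩ := hB a ha
  exact ⟨h1.congr_fun e measurableSet_Ioo, by rwa [← setIntegral_congr_fun measurableSet_Ioo e]⟩

theorem add (hf : RegularMellin r s f) (hg : RegularMellin r s g) :
    RegularMellin r s fun y => f y + g y := by
  obtain ⟨Ψ, hΨ, hB⟩ := hf
  obtain ⟨Ψ', hΨ', hB'⟩ := hg
  refine ⟨fun a => Ψ a + Ψ' a, hΨ.add hΨ', fun a ha => ?_⟩
  obtain ⟨h1, h2⟩ := hB a ha
  obtain ⟨h1', h2'⟩ := hB' a ha
  simp only [mul_add]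
  refine ⟨h1.add h1', ?_⟩
  rw [integral_add h1 h1', Complex.ofReal_add, mul_add, h2, h2']

theorem const_mul (hf : RegularMellin r s f) (c : ℝ) : RegularMellin r s fun y => c * f y := by
  obtain ⟨Ψ, hΨ, hB⟩ := hf
  refine ⟨fun a => c * Ψ a, hΨ.const_mul _, fun a ha => ?_⟩
  obtain ⟨h1, h2⟩ := hB a ha
  simp only [mul_left_comm _ c]
  refine ⟨h1.const_mul c, ?_⟩
  rw [integral_const_mul, Complex.ofReal_mul, ← h2]
  ring

theorem sum {ι : Type*} {S : Finset ι} {f : ι → ℝ → ℝ} (h : ∀ i ∈ S, RegularMellin r s (f i)) :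
    RegularMellin r s fun y => ∑ i ∈ S, f i y := by
  classical
  induction S using Finset.induction_on with
  | empty => exact ⟨0, by fun_prop, fun a _ => by simp⟩
  | insert i S hi ih =>
    simp only [Finset.sum_insert hi]
    exact (h i (by simp)).add (ih fun j hj => h j (by simp [hj]))

theorem gammaInv_sub_one (r s : ℝ) (a : ℂ) (h1 : -a - r ≠ 0) (h2 : -a - s ≠ 0) :
    gammaInv r s a = (-a - r) * (-a - s) * gammaInv r s (a - 1) := by
  unfold gammaInv
  rw [show -(a - 1) - (r : ℂ) = -a - r + 1 by ring, show -(a - 1) - (s : ℂ) = -a - s + 1 by ring,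
    Complex.Gamma_add_one _ h1, Complex.Gamma_add_one _ h2, mul_inv, mul_inv]
  field_simp

/-- Multiplication by y replaces a by a - 1, and γ(a) = (-a-r)(-a-s) γ(a-1) compensates the shift.
-/
theorem mul_id (hf : RegularMellin r s f) : RegularMellin r s fun y => y * f y := by
  obtain ⟨Ψ, hΨ, hB⟩ := hf
  refine ⟨fun a => (-a - r) * (-a - s) * Ψ (a - 1),
    Differentiable.mul (by fun_prop) (hΨ.comp (by fun_prop)), fun a ha => ?_⟩
  have har := ha.trans_le (min_le_left _ _)
  have has := ha.trans_le (min_le_right _ _)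
  obtain ⟨h1, h2⟩ := hB (a - 1) (by linarith)
  have e : Set.EqOn (fun y : ℝ => y ^ (-(a - 1) - 1) * f y)
      (fun y : ℝ => y ^ (-a - 1) * (y * f y)) (Set.Ioo 0 1) := fun y hy => by
    beta_reduce
    rw [show -(a - 1) - 1 = -a - 1 + 1 by ring, Real.rpow_add_one hy.1.ne', mul_assoc]
  refine ⟨h1.congr_fun e measurableSet_Ioo, ?_⟩
  rw [← setIntegral_congr_fun measurableSet_Ioo e, gammaInv_sub_one r s a, mul_assoc]
  · beta_reduce
    rw [← Complex.ofReal_one, ← Complex.ofReal_sub, h2]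
  · intro h
    have : -a - r = 0 := by exact_mod_cast h
    linarith
  · intro h
    have : -a - s = 0 := by exact_mod_cast h
    linarith

/-- The integral over (0,1) times γ is holomorphic to the left of q. It is also γ times the full
transform minus the integral over [1,∞), which is holomorphic to the right of p. The two glue along
the strip between p and q. -/
theorem of_mellin {p q : ℝ} (hpq : p < q) (hrs : min (-r) (-s) ≤ q)
    (hint : ∀ a, p < a → a < q → IntegrableOn (fun y : ℝ => y ^ (-a - 1) * g y) (Set.Ioi 0))
    {Θ : ℂ → ℂ} (hΘ : DifferentiableOn ℂ Θ {z | p < z.re})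
    (hval : ∀ a : ℝ, p < a → a < q →
      gammaInv r s a * ((∫ y in Set.Ioi (0 : ℝ), y ^ (-a - 1) * g y : ℝ) : ℂ) = Θ a) :
    RegularMellin r s g := by
  have hI : Set.Ioo (0 : ℝ) 1 ∪ Set.Ici 1 = Set.Ioi 0 := Set.Ioo_union_Ici_eq_Ioi zero_lt_one
  have h01 : ∀ a, p < a → a < q → IntegrableOn (fun y : ℝ => y ^ (-a - 1) * g y) (Set.Ioo 0 1) :=
    fun a h1 h2 => (hint a h1 h2).mono_set (by rw [← hI]; exact Set.subset_union_left)
  have h1i : ∀ a, p < a → a < q → IntegrableOn (fun y : ℝ => y ^ (-a - 1) * g y) (Set.Ici 1) :=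
    fun a h1 h2 => (hint a h1 h2).mono_set (by rw [← hI]; exact Set.subset_union_right)
  have hd1 : DifferentiableOn ℂ (fun a : ℂ => Θ a - gammaInv r s a *
      ∫ y in Set.Ici (1 : ℝ), (y : ℂ) ^ (-a - 1) * g y) {z | p < z.re} := by
    refine hΘ.sub ((gammaInv_differentiable r s).differentiableOn.mul ?_)
    intro a (ha : p < a.re)
    obtain ⟨σ, h1, h2⟩ := exists_between (lt_min hpq ha)
    refine ((differentiableOn_mellin_Ici (h1i σ h1 (h2.trans_le (min_le_left _ _)))).differentiableAt
      ((isOpen_lt continuous_const Complex.continuous_re).mem_nhds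
        (h2.trans_le (min_le_right _ _)))).differentiableWithinAt
  have hd2 : DifferentiableOn ℂ (fun a : ℂ => gammaInv r s a *
      ∫ y in Set.Ioo (0 : ℝ) 1, (y : ℂ) ^ (-a - 1) * g y) {z | z.re < q} := by
    refine (gammaInv_differentiable r s).differentiableOn.mul ?_
    intro a (ha : a.re < q)
    obtain ⟨σ, h1, h2⟩ := exists_between (max_lt hpq ha)
    refine ((differentiableOn_mellin_Ioo (h01 σ ((le_max_left _ _).trans_lt h1) h2)).differentiableAt
      ((isOpen_lt Complex.continuous_re continuous_const).mem_nhds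
        ((le_max_right _ _).trans_lt h1))).differentiableWithinAt
  have hdisj : Disjoint (Set.Ioo (0 : ℝ) 1) (Set.Ici 1) :=
    Set.disjoint_left.2 fun y hy hy' => not_le.2 hy.2 hy'
  obtain ⟨Ψ, hΨ, hΨg⟩ := exists_entire_of_half_planes hpq hd1 hd2 fun a h1 h2 => by
    rw [← hval a h1 h2, integral_cpow_ofReal measurableSet_Ici (fun y (hy : 1 ≤ y) => by linarith),
      integral_cpow_ofReal measurableSet_Ioo (fun y hy => hy.1), ← hI,
      setIntegral_union hdisj measurableSet_Ici (h01 a h1 h2) (h1i a h1 h2)]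
    push_cast
    ring
  refine ⟨Ψ, hΨ, fun a ha' => ?_⟩
  have ha := ha'.trans_le hrs
  obtain ⟨σ, h1, h2⟩ := exists_between (max_lt hpq ha)
  refine ⟨integrableOn_rpow_mul_Ioo ((le_max_right _ _).trans h1.le)
    (h01 σ ((le_max_left _ _).trans_lt h1) h2), ?_⟩
  rw [hΨg a (by simpa using ha), integral_cpow_ofReal measurableSet_Ioo (fun y hy => hy.1)]

theorem differentiableOn_Gamma_add (c p : ℝ) (h : p + c = 0) :
    DifferentiableOn ℂ (fun a : ℂ => Complex.Gamma (c + a)) {z | p < z.re} := by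
  intro a (ha : p < a.re)
  refine DifferentiableAt.differentiableWithinAt ?_
  refine DifferentiableAt.comp a (g := Complex.Gamma) (f := fun a : ℂ => (c : ℂ) + a)
    (Complex.differentiableAt_Gamma _ fun m hm => ?_) (by fun_prop)
  have := congrArg Complex.re hm
  simp at this
  have h0 : (0 : ℝ) ≤ m := Nat.cast_nonneg m
  linarith

/-- In the Mellin transform of the block γ cancels Γ(-a-r)Γ(-a-s); up to a constant Γ(H+a)/Γ(H-a)
remains, whose poles lie in Re a ≤ -H. -/
theorem of_large_weight {H : ℝ} (hr : |r| < H) (hs : |s| < H) : RegularMellin r s (blockFun r s H) := by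
  have h1 := abs_lt.1 hr
  have h2 := abs_lt.1 hs
  refine of_mellin (p := -H) (q := min (-r) (-s)) (lt_min (by linarith) (by linarith)) le_rfl
    (fun a ha1 ha2 => (blockFun_mellin hr hs (ha2.trans_le (min_le_left _ _))
      (ha2.trans_le (min_le_right _ _)) ha1).1)
    (Θ := fun a => ((Real.Gamma (2 * H) / (Real.Gamma (H - r) * Real.Gamma (H - s)) : ℝ) : ℂ) *
      (Complex.Gamma (H + a) * (Complex.Gamma (H - a))⁻¹)) ?_ ?_
  · refine DifferentiableOn.const_mul (DifferentiableOn.mul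
      (differentiableOn_Gamma_add H (-H) (by ring)) ?_) _
    exact (Complex.differentiable_one_div_Gamma.comp (f := fun a : ℂ => (H : ℂ) - a)
      (by fun_prop)).differentiableOn
  · intro a ha1 ha2
    have har := ha2.trans_le (min_le_left _ _)
    have has := ha2.trans_le (min_le_right _ _)
    rw [(blockFun_mellin hr hs har has ha1).2, gammaInv, blockMellin]
    have g1 : Complex.Gamma (-a - r) ≠ 0 := Complex.Gamma_ne_zero_of_re_pos (by simp; linarith)
    have g2 : Complex.Gamma (-a - s) ≠ 0 := Complex.Gamma_ne_zero_of_re_pos (by simp; linarith)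
    push_cast [← Complex.Gamma_ofReal]
    field_simp

theorem rpow_one_add_of_neg {κ : ℝ} (hκ : κ < 0) :
    RegularMellin r s fun y => y ^ (-r) * (1 + y) ^ κ := by
  have hpt : ∀ a : ℝ, ∀ y : ℝ, 0 < y → y ^ (-a - 1) * (y ^ (-r) * (1 + y) ^ κ) =
      y ^ ((-a - r) - 1) * (1 + y) ^ (-((-a - r) + (a + r - κ))) := fun a y hy => by
    rw [← mul_assoc, ← Real.rpow_add hy]
    congr 2 <;> ring
  have key : ∀ a, κ - r < a → a < -r →
      IntegrableOn (fun y : ℝ => y ^ (-a - 1) * (y ^ (-r) * (1 + y) ^ κ)) (Set.Ioi 0) ∧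
      ∫ y in Set.Ioi (0 : ℝ), y ^ (-a - 1) * (y ^ (-r) * (1 + y) ^ κ) =
        Real.Gamma (-a - r) * Real.Gamma (a + r - κ) / Real.Gamma (-κ) := by
    intro a h1 h2
    have hl := lintegral_beta_Ioi (b := -a - r) (c := a + r - κ) (by linarith) (by linarith)
    rw [show -a - r + (a + r - κ) = -κ by ring] at hl
    have hpt' := hpt a
    rw [show -a - r + (a + r - κ) = -κ by ring] at hpt'
    have hmeas : AEStronglyMeasurable (fun y : ℝ => y ^ (-a - r - 1) * (1 + y) ^ (- -κ))
        (volume.restrict (Set.Ioi 0)) := by fun_prop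
    have hnn : 0 ≤ᵐ[volume.restrict (Set.Ioi 0)]
        fun y : ℝ => y ^ (-a - r - 1) * (1 + y) ^ (- -κ) := by
      filter_upwards [ae_restrict_mem measurableSet_Ioi] with y (hy : 0 < y)
      positivity
    have g1 := Real.Gamma_pos_of_pos (show 0 < -a - r by linarith)
    have g2 := Real.Gamma_pos_of_pos (show 0 < a + r - κ by linarith)
    have g3 := Real.Gamma_pos_of_pos (show 0 < -κ by linarith)
    have e : Set.EqOn (fun y : ℝ => y ^ (-a - r - 1) * (1 + y) ^ (- -κ))
        (fun y : ℝ => y ^ (-a - 1) * (y ^ (-r) * (1 + y) ^ κ)) (Set.Ioi 0) :=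
      fun y hy => (hpt' y hy).symm
    constructor
    · refine IntegrableOn.congr_fun ⟨hmeas, ?_⟩ e measurableSet_Ioi
      rw [hasFiniteIntegral_iff_ofReal hnn, hl]
      exact ENNReal.ofReal_lt_top
    · rw [← setIntegral_congr_fun measurableSet_Ioi e, integral_eq_lintegral_of_nonneg_ae hnn hmeas,
        hl, ENNReal.toReal_ofReal (by positivity)]
  refine of_mellin (p := κ - r) (q := -r) (by linarith) (min_le_left _ _) (fun a h1 h2 => (key a h1 h2).1)
    (Θ := fun a => ((Real.Gamma (-κ))⁻¹ : ℝ) * (Complex.Gamma ((r - κ : ℝ) + a) *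
      (Complex.Gamma (-a - s))⁻¹)) ?_ ?_
  · refine DifferentiableOn.const_mul (DifferentiableOn.mul
      (differentiableOn_Gamma_add (r - κ) (κ - r) (by ring)) ?_) _
    exact (Complex.differentiable_one_div_Gamma.comp (f := fun a : ℂ => -a - s)
      (by fun_prop)).differentiableOn
  · intro a h1 h2
    rw [(key a h1 h2).2, gammaInv]
    have g1 : Complex.Gamma (-a - r) ≠ 0 := Complex.Gamma_ne_zero_of_re_pos (by simp; linarith)
    push_cast [← Complex.Gamma_ofReal]
    rw [show (a : ℂ) + r - κ = r - κ + a by ring]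
    field_simp

/-- For negative κ this is a Beta integral; the relation (1+y)^{κ+1} = (1+y)^κ + y(1+y)^κ then
raises κ in unit steps. -/
theorem rpow_one_add (κ : ℝ) : RegularMellin r s fun y => y ^ (-r) * (1 + y) ^ κ := by
  obtain ⟨n, hn⟩ := exists_nat_gt κ
  have key : ∀ m : ℕ, RegularMellin r s fun y => y ^ (-r) * (1 + y) ^ (κ - n + m) := by
    intro m
    induction m with
    | zero => exact rpow_one_add_of_neg (by simpa using hn)
    | succ m ih =>
      refine (ih.add ih.mul_id).congr fun y hy => ?_
      rw [Nat.cast_succ, ← add_assoc, Real.rpow_add_one (by positivity)]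
      ring
  simpa using key n

end RegularMellin

/-! ### The contiguous relation and blocks of arbitrary weight. -/

open MeasureTheory

theorem ascPochhammer_succ_eval_left (n : ℕ) (z : ℝ) :
    (ascPochhammer ℝ (n + 1)).eval z = z * (ascPochhammer ℝ n).eval (z + 1) := by
  rw [ascPochhammer_succ_left]
  simp [Polynomial.eval_comp]

theorem blockCoeff_zero (r s H : ℝ) : blockCoeff r s H 0 = 1 := by
  simp [blockCoeff, ordinaryHypergeometricCoefficient]

/-- All Pochhammer symbols are reduced to the three symbols A, B, C of length n, after which the
claim is an identity of rational functions; the hypothesis on H keeps the denominators nonzero. -/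
theorem blockCoeff_contiguous (r s : ℝ) {H : ℝ} (hH : ∀ k : ℕ, 2 * (H - 1) ≠ -k) (n : ℕ) :
    blockCoeff r s H (n + 2) - blockCoeff r s (H - 1) (n + 2) =
      (1 + shiftBeta r s H) * blockCoeff r s H (n + 1) +
        shiftGamma r s H * blockCoeff r s (H + 1) n := by
  have hne : ∀ k : ℕ, 2 * H - 2 + k ≠ 0 := fun k h => hH k (by linarith)
  have h0 : H ≠ 0 := fun h => by have := hne 2; simp [h] at this
  have h1 : H - 1 ≠ 0 := fun h => by have := hne 0; apply this; push_cast; linarith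
  have h2 : 2 * H - 1 ≠ 0 := fun h => by have := hne 1; apply this; push_cast; linarith
  have h3 : 2 * H + 1 ≠ 0 := fun h => by have := hne 3; apply this; push_cast; linarith
  have h4 : 2 * H + n ≠ 0 := fun h => by have := hne (n + 2); apply this; push_cast; linarith
  have h5 : 2 * H + n + 1 ≠ 0 := fun h => by have := hne (n + 3); apply this; push_cast; linarith
  set A := (ascPochhammer ℝ n).eval (H - r + 1) with hA
  set B := (ascPochhammer ℝ n).eval (H + s + 1) with hB
  set C := (ascPochhammer ℝ n).eval (2 * H + 2) with hC
  have hC0 : C ≠ 0 := by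
    rw [hC, Ne, ascPochhammer_eval_eq_zero_iff]
    rintro ⟨k, -, hk⟩
    exact hne (k + 4) (by push_cast; linarith)
  have a1 : ∀ z : ℝ, (ascPochhammer ℝ (n + 1)).eval z = z * (ascPochhammer ℝ n).eval (z + 1) :=
    ascPochhammer_succ_eval_left n
  have a2 : ∀ z : ℝ, (ascPochhammer ℝ (n + 2)).eval z =
      z * (ascPochhammer ℝ n).eval (z + 1) * (z + n + 1) := fun z => by
    rw [ascPochhammer_succ_eval, a1]; push_cast; ring
  have a3 : ∀ z : ℝ, (ascPochhammer ℝ (n + 2)).eval z =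
      z * ((z + 1) * (ascPochhammer ℝ n).eval (z + 2)) := fun z => by
    rw [ascPochhammer_succ_eval_left, a1, show z + 1 + 1 = z + 2 by ring]
  have c1 : (ascPochhammer ℝ n).eval (2 * H + 1) = (2 * H + 1) * C / (2 * H + n + 1) := by
    rw [eq_div_iff h5]
    have := a1 (2 * H + 1)
    rw [ascPochhammer_succ_eval, show 2 * H + 1 + 1 = 2 * H + 2 by ring] at this
    linarith
  have c2 : (ascPochhammer ℝ n).eval (2 * H) =
      2 * H * (2 * H + 1) * C / ((2 * H + n) * (2 * H + n + 1)) := by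
    have := a1 (2 * H)
    rw [ascPochhammer_succ_eval, c1] at this
    rw [eq_div_iff (mul_ne_zero h4 h5), ← mul_assoc, this]
    field_simp
  have hf1 : ((n + 1).factorial : ℝ) = (n + 1) * n.factorial := by
    rw [Nat.factorial_succ]; push_cast; ring
  have hf2 : ((n + 2).factorial : ℝ) = (n + 2) * ((n + 1) * n.factorial) := by
    rw [Nat.factorial_succ, Nat.cast_mul, hf1]; push_cast; ring
  have hf0 : (n.factorial : ℝ) ≠ 0 := by positivity
  have hn1 : (n : ℝ) + 1 ≠ 0 := by positivity
  have hn2 : (n : ℝ) + 2 ≠ 0 := by positivity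
  simp only [blockCoeff, ordinaryHypergeometricCoefficient]
  have e1 : (ascPochhammer ℝ (n + 2)).eval (2 * H) = 2 * H * (2 * H + 1) * C := by
    rw [a3]; ring
  have e2 : (ascPochhammer ℝ (n + 2)).eval (2 * (H - 1)) =
      (2 * H - 2) * ((2 * H - 1) *
        (2 * H * (2 * H + 1) * C / ((2 * H + n) * (2 * H + n + 1)))) := by
    rw [a3, show 2 * (H - 1) + 2 = 2 * H by ring, c2]; ring
  have e3 : (ascPochhammer ℝ (n + 1)).eval (2 * H) =
      2 * H * ((2 * H + 1) * C / (2 * H + n + 1)) := by rw [a1, c1]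
  have e4 : (ascPochhammer ℝ n).eval (2 * (H + 1)) = C := by
    rw [hC]; congr 1; ring
  have e5 : (ascPochhammer ℝ n).eval (H + 1 - r) = A := by rw [hA]; congr 1; ring
  have e6 : (ascPochhammer ℝ n).eval (H + 1 + s) = B := by rw [hB]; congr 1; ring
  have e7 : (ascPochhammer ℝ (n + 2)).eval (H - 1 - r) = (H - 1 - r) * ((H - r) * A) := by
    rw [a3, hA, show H - 1 - r + 2 = H - r + 1 by ring]; ring
  have e8 : (ascPochhammer ℝ (n + 2)).eval (H - 1 + s) = (H - 1 + s) * ((H + s) * B) := by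
    rw [a3, hB, show H - 1 + s + 2 = H + s + 1 by ring]; ring
  rw [e1, e2, e3, e4, e5, e6, e7, e8, a2 (H - r), a2 (H + s), a1 (H - r), a1 (H + s), ← hA, ← hB,
    hf1, hf2, shiftBeta, shiftGamma]
  have h6 : 2 * H - 2 ≠ 0 := fun h => h1 (by linarith)
  have h7 : 4 * H ^ 2 - 1 ≠ 0 := by
    rw [show 4 * H ^ 2 - 1 = (2 * H - 1) * (2 * H + 1) by ring]; exact mul_ne_zero h2 h3
  rw [show 4 * H ^ 2 - 1 = (2 * H - 1) * (2 * H + 1) by ring,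
    show 2 * H - 2 = 2 * (H - 1) by ring]
  field_simp
  ring

/-- Add the block to both sides and expand in powers of 1+y, so that y becomes 1+y and β becomes
1+β. From index two on the coefficients match by `blockCoeff_contiguous`; indices zero and one are
checked directly. -/
theorem blockFun_contiguous (r s : ℝ) {H : ℝ} (hH : ∀ k : ℕ, 2 * (H - 1) ≠ -k) {y : ℝ}
    (hy : 0 < y) : y * blockFun r s H y = blockFun r s (H - 1) y +
      shiftBeta r s H * blockFun r s H y + shiftGamma r s H * blockFun r s (H + 1) y := by
  have h1 : 0 < 1 + y := by linarith
  set P : ℕ → ℝ := fun n => y ^ (-r) * (1 + y) ^ (r - H + 1 - n) with hP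
  have hs0 : HasSum (fun n => blockCoeff r s H n * P n) ((1 + y) * blockFun r s H y) := by
    refine ((blockFun_hasSum r s H hy).mul_left (1 + y)).congr_fun fun n => ?_
    simp only [hP]
    rw [show r - H + 1 - n = r - H - n + 1 by ring, Real.rpow_add_one h1.ne']
    ring
  have hs1 : HasSum (fun n => blockCoeff r s H n * P (n + 1)) (blockFun r s H y) := by
    refine (blockFun_hasSum r s H hy).congr_fun fun n => ?_
    simp only [hP]
    rw [show r - H + 1 - ((n + 1 : ℕ) : ℝ) = r - H - n by push_cast; ring]
  have hs2 : HasSum (fun n => blockCoeff r s (H - 1) n * P n) (blockFun r s (H - 1) y) := by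
    refine (blockFun_hasSum r s (H - 1) hy).congr_fun fun n => ?_
    simp only [hP]
    rw [show r - H + 1 - (n : ℝ) = r - (H - 1) - n by ring]
  have hs3 : HasSum (fun n => blockCoeff r s (H + 1) n * P (n + 2)) (blockFun r s (H + 1) y) := by
    refine (blockFun_hasSum r s (H + 1) hy).congr_fun fun n => ?_
    simp only [hP]
    rw [show r - H + 1 - ((n + 2 : ℕ) : ℝ) = r - (H + 1) - n by push_cast; ring]
  have hne : ∀ k : ℕ, 2 * H - 2 + k ≠ 0 := fun k h => hH k (by linarith)
  have h0 : H ≠ 0 := fun h => by have := hne 2; simp [h] at this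
  have h1' : H - 1 ≠ 0 := fun h => by have := hne 0; apply this; push_cast; linarith
  have hfirst : blockCoeff r s H 1 - blockCoeff r s (H - 1) 1 = 1 + shiftBeta r s H := by
    simp only [blockCoeff, ordinaryHypergeometricCoefficient, shiftBeta, ascPochhammer_one,
      Polynomial.eval_X, Nat.factorial_one, Nat.cast_one, inv_one, one_mul]
    field_simp
    ring
  have hL := (hasSum_nat_add_iff' 2).2 (hs0.sub hs2)
  have hR := ((hasSum_nat_add_iff' 1).2 hs1).mul_left (1 + shiftBeta r s H) |>.add
    (hs3.mul_left (shiftGamma r s H))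
  have heq := hL.unique (hR.congr_fun fun n => ?_)
  · rw [Finset.sum_range_succ, Finset.sum_range_one, Finset.sum_range_one, blockCoeff_zero,
      blockCoeff_zero] at heq
    have h2 : blockCoeff r s H 1 * P 1 - blockCoeff r s (H - 1) 1 * P 1 =
      (1 + shiftBeta r s H) * P 1 := by rw [← sub_mul, hfirst]
    simp only [zero_add] at heq
    linarith
  · have := blockCoeff_contiguous r s hH n
    rw [← sub_mul, this]
    ring_nf

namespace RegularMellin

/-- Finitely many spins may have small or negative weight, out of reach of the Mellin formula. The
contiguous relation, solved for the block of weight H - 1, descends from large weight in unit steps,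
carrying two consecutive weights. -/
theorem blockFun (r s H : ℝ) : RegularMellin r s (blockFun r s H) := by
  by_cases hH : ∃ k : ℕ, 2 * H = -k
  · obtain ⟨k, hk⟩ := hH
    have h1 : RegularMellin r s fun y => ∑ n ∈ Finset.range (k + 1),
        blockCoeff r s H n * (y ^ (-r) * (1 + y) ^ (r - H - n)) :=
      sum fun n _ => (rpow_one_add _).const_mul _
    refine h1.congr fun y hy => ?_
    refine (hasSum_sum_of_ne_finset_zero fun n hn => ?_).unique (blockFun_hasSum r s H hy)
    rw [Finset.mem_range, not_lt] at hn
    have : (ascPochhammer ℝ n).eval (2 * H) = 0 := by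
      rw [ascPochhammer_eval_eq_zero_iff]
      exact ⟨k, by omega, by linarith⟩
    simp [blockCoeff, ordinaryHypergeometricCoefficient, this]
  · push Not at hH
    obtain ⟨m, hm⟩ := exists_nat_gt (max |r| |s| - H)
    have hr : |r| < H + m := by have := le_max_left |r| |s|; linarith
    have hs : |s| < H + m := by have := le_max_right |r| |s|; linarith
    have key : ∀ i ≤ m, RegularMellin r s (Lightcone.blockFun r s (H + (m - i : ℕ))) ∧
        RegularMellin r s (Lightcone.blockFun r s (H + (m - i : ℕ) + 1)) := by
      intro i
      induction i with
      | zero => exact fun _ => ⟨of_large_weight hr hs, of_large_weight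
          (by rw [Nat.sub_zero]; linarith) (by rw [Nat.sub_zero]; linarith)⟩
      | succ i ih =>
        intro hi
        obtain ⟨h1, h2⟩ := ih (by omega)
        have e : (H + (m - (i + 1) : ℕ) : ℝ) = H + (m - i : ℕ) - 1 := by
          have : m - i = m - (i + 1) + 1 := by omega
          rw [this]; push_cast; ring
        refine ⟨?_, ?_⟩
        · have hH' : ∀ k : ℕ, 2 * (H + (m - i : ℕ) - 1) ≠ -k := fun k hk => by
            rw [← e] at hk
            refine hH (k + 2 * (m - (i + 1))) ?_
            push_cast
            linarith
          rw [e]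
          refine ((h1.mul_id.add (h1.const_mul (-shiftBeta r s (H + (m - i : ℕ))))).add
            (h2.const_mul (-shiftGamma r s (H + (m - i : ℕ))))).congr fun y hy => ?_
          rw [blockFun_contiguous r s hH' hy]
          ring
        · rw [e, sub_add_cancel]; exact h1
    simpa using (key m le_rfl).1

end RegularMellin

/-! ### Mellin transforms of powers and logarithms; Casimir-regular terms. -/

open MeasureTheory

theorem integrableOn_rpow_Ioo {e : ℝ} (he : -1 < e) :
    IntegrableOn (fun y : ℝ => y ^ e) (Set.Ioo 0 1) := by
  have := (intervalIntegral.intervalIntegrable_rpow' (a := 0) (b := 1) he)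
  rw [intervalIntegrable_iff_integrableOn_Ioo_of_le zero_le_one] at this
  exact this

theorem integral_cpow_Ioo {e : ℂ} (he : -1 < e.re) :
    ∫ y in Set.Ioo (0 : ℝ) 1, (y : ℂ) ^ e = (e + 1)⁻¹ := by
  have h := integral_cpow (a := 0) (b := 1) (r := e) (Or.inl he)
  rw [intervalIntegral.integral_of_le zero_le_one, integral_Ioc_eq_integral_Ioo] at h
  have h0 : e + 1 ≠ 0 := fun h => by
    have := congrArg Complex.re h
    simp at this
    linarith
  rw [h]
  simp [h0]

/-- The Mellin transform over `(0, 1)` of a power times a power of the logarithm. -/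
theorem mellin_rpow_mul_log (c : ℝ) (l : ℕ) :
    (∀ a < c, IntegrableOn (fun y : ℝ => y ^ (-a - 1) * (y ^ c * Real.log y ^ l)) (Set.Ioo 0 1)) ∧
    ∀ a : ℂ, a.re < c → ∫ y in Set.Ioo (0 : ℝ) 1, (y : ℂ) ^ (-a - 1) *
      ((y ^ c * Real.log y ^ l : ℝ) : ℂ) =
        (-1) ^ l * l.factorial * ((c - a)⁻¹) ^ (l + 1) := by
  induction l with
  | zero =>
    refine ⟨fun a ha => ?_, fun a ha => ?_⟩
    · refine (integrableOn_rpow_Ioo (e := -a - 1 + c) (by linarith)).congr_fun (fun y hy => ?_)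
        measurableSet_Ioo
      simp [Real.rpow_add hy.1]
    · have he : -1 < (-a - 1 + c).re := by simp; linarith
      rw [← setIntegral_congr_fun measurableSet_Ioo (f := fun y : ℝ => (y : ℂ) ^ (-a - 1 + c)),
        integral_cpow_Ioo he]
      · simp; ring
      · intro y hy
        beta_reduce
        rw [Complex.cpow_add _ _ (by exact_mod_cast hy.1.ne'), Complex.ofReal_mul,
          Complex.ofReal_cpow hy.1.le]
        simp
  | succ l ih =>
    have key : ∀ a : ℂ, a.re < c → Integrable (fun y : ℝ => (y : ℂ) ^ (-a - 1) *
        ((y ^ c * Real.log y ^ l : ℝ) : ℂ) * (-Real.log y : ℝ)) (volume.restrict (Set.Ioo 0 1)) ∧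
        HasDerivAt (fun a : ℂ => ∫ y in Set.Ioo (0 : ℝ) 1, (y : ℂ) ^ (-a - 1) *
          ((y ^ c * Real.log y ^ l : ℝ) : ℂ))
        (∫ y in Set.Ioo (0 : ℝ) 1, (y : ℂ) ^ (-a - 1) *
          ((y ^ c * Real.log y ^ l : ℝ) : ℂ) * (-Real.log y : ℝ)) a := fun a ha =>
      hasDerivAt_mellin measurableSet_Ioo (fun y hy => hy.1) (ih.1 (a.re - 1) (by linarith))
        (ih.1 ((a.re + c) / 2) (by linarith)) (by linarith) (by linarith)
    refine ⟨fun a ha => ?_, fun a ha => ?_⟩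
    · have h := (key a (by simpa using ha)).1.re.neg
      refine IntegrableOn.congr_fun (f := fun y : ℝ => -RCLike.re ((y : ℂ) ^ (-(a : ℂ) - 1) *
        ((y ^ c * Real.log y ^ l : ℝ) : ℂ) * (-Real.log y : ℝ))) h (fun y hy => ?_) measurableSet_Ioo
      have : (y : ℂ) ^ (-(a : ℂ) - 1) = ((y ^ (-a - 1) : ℝ) : ℂ) := by
        rw [Complex.ofReal_cpow hy.1.le]; push_cast; rfl
      simp only [this, ← Complex.ofReal_mul]
      simp only [RCLike.re_to_complex, Complex.ofReal_re]
      ring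
    · have hne : (c : ℂ) - a ≠ 0 := fun h => by
        have := congrArg Complex.re h
        simp at this
        linarith
      have h1 : HasDerivAt (fun a : ℂ => (-1) ^ l * (l.factorial : ℂ) * ((c - a)⁻¹) ^ (l + 1))
          ((-1) ^ l * l.factorial * ((l + 1) * ((c - a)⁻¹) ^ (l + 2))) a := by
        have := (((hasDerivAt_id' a).const_sub (c : ℂ)).fun_inv hne).fun_pow (l + 1)
        refine (this.const_mul ((-1) ^ l * (l.factorial : ℂ))).congr_deriv ?_
        simp only [Nat.add_sub_cancel, div_eq_mul_inv, ← inv_pow]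
        push_cast
        ring
      have h2 := (key a ha).2.unique (h1.congr_of_eventuallyEq (by
        filter_upwards [(isOpen_lt Complex.continuous_re continuous_const).mem_nhds ha] with z hz
        exact ih.2 z hz))
      have h3 : ∫ y in Set.Ioo (0 : ℝ) 1, (y : ℂ) ^ (-a - 1) *
          ((y ^ c * Real.log y ^ (l + 1) : ℝ) : ℂ) = -∫ y in Set.Ioo (0 : ℝ) 1, (y : ℂ) ^ (-a - 1) *
          ((y ^ c * Real.log y ^ l : ℝ) : ℂ) * (-Real.log y : ℝ) := by
        rw [← integral_neg]
        refine setIntegral_congr_fun measurableSet_Ioo fun y hy => ?_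
        push_cast
        ring
      rw [h3, h2, Nat.factorial_succ]
      push_cast
      ring

theorem mellin_rpow_mul_log_ofReal {a c : ℝ} (l : ℕ) (h : a < c) :
    IntegrableOn (fun y : ℝ => y ^ (-a - 1) * (y ^ c * Real.log y ^ l)) (Set.Ioo 0 1) ∧
    ((∫ y in Set.Ioo (0 : ℝ) 1, y ^ (-a - 1) * (y ^ c * Real.log y ^ l) : ℝ) : ℂ) =
      iteratedDeriv l (fun b : ℂ => (b - a)⁻¹) c := by
  refine ⟨(mellin_rpow_mul_log c l).1 a h, ?_⟩
  rw [← integral_cpow_ofReal measurableSet_Ioo (fun y hy => hy.1)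
    (fun y => y ^ c * Real.log y ^ l), (mellin_rpow_mul_log c l).2 a (by simpa using h),
    iteratedDeriv_inv_sub]

namespace RegularMellin

variable {r s : ℝ}

theorem differentiable_dslope_entire {γ : ℂ → ℂ} (hγ : Differentiable ℂ γ) (e : ℂ) :
    Differentiable ℂ (dslope γ e) := by
  have := (Complex.differentiableOn_dslope (s := Set.univ) (c := e) univ_mem).2
    hγ.differentiableOn
  exact differentiableOn_univ.1 this

theorem dslope_eq_of_zero {γ : ℂ → ℂ} {e a : ℂ} (he : γ e = 0) (h : a ≠ e) :
    γ a = (a - e) * dslope γ e a := by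
  rw [dslope_of_ne _ h, slope_def_field, he, sub_zero]
  field_simp [sub_ne_zero.2 h]

theorem inv_Gamma_eq_zero {e t : ℝ} (h : ∃ n : ℕ, e + t = n) :
    (Complex.Gamma (-(e : ℂ) - t))⁻¹ = 0 := by
  obtain ⟨n, hn⟩ := h
  have : -(e : ℂ) - t = -n := by
    have : (e : ℂ) + t = n := by exact_mod_cast hn
    linear_combination -this
  rw [this, Complex.Gamma_neg_nat_eq_zero, inv_zero]

theorem inv_Gamma_differentiable (t : ℝ) :
    Differentiable ℂ fun b : ℂ => (Complex.Gamma (-b - t))⁻¹ :=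
  Complex.differentiable_one_div_Gamma.comp (f := fun b : ℂ => -b - t) (by fun_prop)

/-- The transform over (0,1) has a simple pole at e, and γ vanishes there because one of its two
Gamma arguments is a nonpositive integer. -/
theorem rpow {e : ℝ} (h : (∃ n : ℕ, e + r = n) ∨ ∃ n : ℕ, e + s = n) :
    RegularMellin r s fun y => y ^ e := by
  have h0 : gammaInv r s e = 0 := by
    unfold gammaInv
    rcases h with h | h <;> simp [inv_Gamma_eq_zero h]
  have hmin : min (-r) (-s) ≤ e := by
    rcases h with ⟨n, hn⟩ | ⟨n, hn⟩ <;> have : (0 : ℝ) ≤ n := n.cast_nonneg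
    · exact (min_le_left _ _).trans (by linarith)
    · exact (min_le_right _ _).trans (by linarith)
  refine ⟨fun a => -dslope (gammaInv r s) e a,
    (differentiable_dslope_entire (gammaInv_differentiable r s) e).neg, fun a ha => ?_⟩
  have hae := ha.trans_le hmin
  obtain ⟨h1, h2⟩ := mellin_rpow_mul_log_ofReal 0 hae
  simp only [pow_zero, mul_one] at h1 h2
  refine ⟨h1, ?_⟩
  have hne : (a : ℂ) ≠ e := by exact_mod_cast hae.ne
  rw [h2, dslope_eq_of_zero h0 hne, iteratedDeriv_zero]
  have := sub_ne_zero.2 hne.symm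
  field_simp
  ring

/-- The logarithm makes the pole double; at an exponent of both forms each of the two factors of γ
has a zero. -/
theorem rpow_mul_log {e : ℝ} (hr : ∃ n : ℕ, e + r = n) (hs : ∃ n : ℕ, e + s = n) :
    RegularMellin r s fun y => y ^ e * Real.log y := by
  have hmin : min (-r) (-s) ≤ e := by
    obtain ⟨n, hn⟩ := hr
    have : (0 : ℝ) ≤ n := n.cast_nonneg
    exact (min_le_left _ _).trans (by linarith)
  refine ⟨fun a => -(dslope (fun b : ℂ => (Complex.Gamma (-b - r))⁻¹) e a *
      dslope (fun b : ℂ => (Complex.Gamma (-b - s))⁻¹) e a),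
    ((differentiable_dslope_entire (inv_Gamma_differentiable r) e).mul
      (differentiable_dslope_entire (inv_Gamma_differentiable s) e)).neg, fun a ha => ?_⟩
  have hae := ha.trans_le hmin
  obtain ⟨h1, h2⟩ := mellin_rpow_mul_log_ofReal 1 hae
  simp only [pow_one] at h1 h2
  refine ⟨h1, ?_⟩
  have hne : (a : ℂ) ≠ e := by exact_mod_cast hae.ne
  have e1 := dslope_eq_of_zero (γ := fun b : ℂ => (Complex.Gamma (-b - r))⁻¹)
    (inv_Gamma_eq_zero hr) hne
  have e2 := dslope_eq_of_zero (γ := fun b : ℂ => (Complex.Gamma (-b - s))⁻¹)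
    (inv_Gamma_eq_zero hs) hne
  rw [h2, gammaInv, e1, e2, iteratedDeriv_inv_sub]
  have := sub_ne_zero.2 hne.symm
  simp only [pow_one, Nat.factorial_one, Nat.cast_one]
  have h3 : ((e : ℂ) - a) * ((e : ℂ) - a)⁻¹ = 1 := mul_inv_cancel₀ this
  generalize dslope (fun b : ℂ => (Complex.Gamma (-b - r))⁻¹) (e : ℂ) a = D₁
  generalize dslope (fun b : ℂ => (Complex.Gamma (-b - s))⁻¹) (e : ℂ) a = D₂
  linear_combination (-D₁ * D₂ * (((e : ℂ) - a) * ((e : ℂ) - a)⁻¹ + 1)) * h3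

theorem of_mem_casimirRegular {g : ℝ → ℝ} (hg : g ∈ casimirRegular r s) : RegularMellin r s g := by
  refine Submodule.span_induction ?_ ?_ (fun f g _ _ hf hg => hf.add hg)
    (fun c f _ hf => hf.const_mul c) hg
  · rintro g (⟨e, he, rfl⟩ | ⟨e, ⟨hr, hs⟩, rfl⟩)
    · exact rpow he
    · exact rpow_mul_log hr hs
  · exact ⟨0, by fun_prop, fun a _ => by simp⟩

end RegularMellin

/-- A function that is `o(y^N)` at the origin has a Mellin transform over `(0, 1)` to the left
of `N`. -/
theorem integrableOn_rpow_mul_of_isLittleO {g : ℝ → ℝ} {a₀ N σ : ℝ} (hσ : σ < N)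
    (h₀ : IntegrableOn (fun y : ℝ => y ^ (-a₀ - 1) * g y) (Set.Ioo 0 1))
    (hg : g =o[𝓝[>] 0] fun y : ℝ => y ^ N) :
    IntegrableOn (fun y : ℝ => y ^ (-σ - 1) * g y) (Set.Ioo 0 1) := by
  rcases le_or_gt σ a₀ with h | h
  · exact integrableOn_rpow_mul_Ioo h h₀
  obtain ⟨δ, hδ, hδg⟩ := mem_nhdsGT_iff_exists_Ioo_subset.1 (hg.bound one_pos)
  have hδ : 0 < δ := hδ
  have h1 : AEStronglyMeasurable (fun y : ℝ => y ^ (a₀ - σ) * (y ^ (-a₀ - 1) * g y))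
      (volume.restrict (Set.Ioo 0 1)) := AEStronglyMeasurable.mul (by fun_prop) h₀.1
  have h2 : ∀ y ∈ Set.Ioo (0 : ℝ) 1, y ^ (a₀ - σ) * (y ^ (-a₀ - 1) * g y) = y ^ (-σ - 1) * g y := by
    intro y hy
    rw [← mul_assoc, ← Real.rpow_add hy.1]
    congr 2; ring
  -- The first term dominates for y < δ, where the little-o bound holds; for y ≥ δ the factor
  -- y^{a₀-σ} is at most δ^{a₀-σ}.
  have hdom : IntegrableOn (fun y : ℝ => y ^ (N - σ - 1) +
      δ ^ (a₀ - σ) * ‖y ^ (-a₀ - 1) * g y‖) (Set.Ioo 0 1) :=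
    (integrableOn_rpow_Ioo (by linarith)).add (h₀.norm.const_mul _)
  refine Integrable.mono' hdom (h1.congr ?_) ?_
  · filter_upwards [ae_restrict_mem measurableSet_Ioo] with y hy using h2 y hy
  · filter_upwards [ae_restrict_mem measurableSet_Ioo] with y hy
    have hp : 0 ≤ y ^ (N - σ - 1) := Real.rpow_nonneg hy.1.le _
    have hq : 0 ≤ δ ^ (a₀ - σ) * ‖y ^ (-a₀ - 1) * g y‖ := by positivity
    rcases lt_or_ge y δ with hyδ | hyδ
    · have h3 : ‖g y‖ ≤ 1 * ‖y ^ N‖ := hδg ⟨hy.1, hyδ⟩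
      rw [one_mul, Real.norm_of_nonneg (Real.rpow_nonneg hy.1.le _)] at h3
      rw [norm_mul, Real.norm_of_nonneg (Real.rpow_nonneg hy.1.le _)]
      have h4 := mul_le_mul_of_nonneg_left h3 (Real.rpow_nonneg hy.1.le (-σ - 1))
      rw [← Real.rpow_add hy.1, show -σ - 1 + N = N - σ - 1 by ring] at h4
      linarith
    · rw [← h2 y hy, norm_mul, Real.norm_of_nonneg (Real.rpow_nonneg hy.1.le _)]
      have h4 := mul_le_mul_of_nonneg_right
        (Real.rpow_le_rpow_of_nonpos hδ hyδ (show a₀ - σ ≤ 0 by linarith))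
        (norm_nonneg (y ^ (-a₀ - 1) * g y))
      linarith

/-! ### Mellin transform of a sum of blocks, term by term. -/

open MeasureTheory

theorem integrable_of_hasSum {α : Type*} [MeasurableSpace α] {μ : Measure α} {F : ℕ → α → ℝ}
    {G : α → ℝ} (hF : ∀ n, Integrable (F n) μ) (hs : Summable fun n => ∫ a, ‖F n a‖ ∂μ)
    (hG : ∀ᵐ a ∂μ, HasSum (fun n => F n a) (G a)) :
    Integrable G μ ∧ HasSum (fun n => ∫ a, F n a ∂μ) (∫ a, G a ∂μ) := by
  refine ⟨⟨?_, ?_⟩, ?_⟩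
  · refine aestronglyMeasurable_of_tendsto_ae atTop
      (f := fun n a => ∑ i ∈ Finset.range n, F i a) (fun n => ?_) ?_
    · exact (integrable_finsetSum _ fun i _ => hF i).1
    · filter_upwards [hG] with a ha using ha.tendsto_sum_nat
  · have h1 : ∫⁻ a, ‖G a‖ₑ ∂μ ≤ ∫⁻ a, ∑' n, ‖F n a‖ₑ ∂μ := by
      refine lintegral_mono_ae ?_
      filter_upwards [hG] with a ha
      rw [← ha.tsum_eq]
      exact enorm_tsum_le_tsum_enorm
    refine h1.trans_lt ?_
    rw [lintegral_tsum fun n => (hF n).1.enorm]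
    have (i : ℕ) : ∫⁻ a, ‖F i a‖ₑ ∂μ = ENNReal.ofReal (∫ a, ‖F i a‖ ∂μ) :=
      (ofReal_integral_norm_eq_lintegral_enorm (hF i)).symm
    rw [funext this, ← ENNReal.ofReal_tsum_of_nonneg (fun n => integral_nonneg fun a => norm_nonneg _)
      hs]
    exact ENNReal.ofReal_lt_top
  · have h := hasSum_integral_of_summable_integral_norm hF hs
    rwa [integral_congr_ae (f := fun a => ∑' i, F i a) (g := G)
      (by filter_upwards [hG] with a ha using ha.tsum_eq)] at h

/-- This identity is the purpose of the weight ω: every Gamma function involving r or s cancels, and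
Γ(2H)/Γ(2H-1) leaves 2H - 1. -/
theorem weight_mul_blockMellin {r s a H : ℝ} (hr : |r| < H) (hs : |s| < H) (hH : 1 / 2 < H)
    (har : a < -r) (has : a < -s) :
    gammaInv r s a * ((sl2Weight r s H * blockMellin r s a H : ℝ) : ℂ) =
      ((2 * H - 1 : ℝ) : ℂ) * gammaRatio a H := by
  have h1 := abs_lt.1 hr
  have h2 := abs_lt.1 hs
  have e : gammaInv r s a = (((Real.Gamma (-a - r))⁻¹ * (Real.Gamma (-a - s))⁻¹ : ℝ) : ℂ) := by
    rw [gammaInv]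
    push_cast [← Complex.Gamma_ofReal]
    rfl
  rw [e, gammaRatio_ofReal, ← Complex.ofReal_mul, ← Complex.ofReal_mul, sl2Weight, blockMellin]
  congr 1
  have g1 := (Real.Gamma_pos_of_pos (show 0 < -a - r by linarith)).ne'
  have g2 := (Real.Gamma_pos_of_pos (show 0 < -a - s by linarith)).ne'
  have g3 := (Real.Gamma_pos_of_pos (show 0 < H - r by linarith)).ne'
  have g4 := (Real.Gamma_pos_of_pos (show 0 < H - s by linarith)).ne'
  have g5 := (Real.Gamma_pos_of_pos (show 0 < 2 * H - 1 by linarith)).ne'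
  have g6 : Real.Gamma (2 * H) = (2 * H - 1) * Real.Gamma (2 * H - 1) := by
    rw [← Real.Gamma_add_one (by linarith)]
    congr 1; ring
  rw [g6]
  generalize Real.Gamma (2 * H - 1) = G at g5
  field_simp

/-- The Mellin transforms of the terms of a sum of blocks with power-bounded coefficients. -/
theorem block_terms_mellin {x q Q : ℝ → ℝ} (h : Reparam x q) {β : ℝ}
    (hβ : Q =O[atTop] fun x : ℝ => x ^ β) {c : ℕ → ℝ} {r s a : ℝ} {L : ℕ}
    (ha : 2 * a + (1 + β) < -1) (har : a < -r) (has : a < -s)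
    (hL : ∀ n : ℕ, |r| < x (L + n : ℕ) ∧ |s| < x (L + n : ℕ) ∧ 1 / 2 < x (L + n : ℕ) ∧
      |a| < x (L + n : ℕ) ∧ c (L + n) = q (x (L + n : ℕ)) * sl2Weight r s (x (L + n : ℕ)) *
        Q (x (L + n : ℕ))) :
    (∀ n : ℕ, IntegrableOn (fun y : ℝ => y ^ (-a - 1) * (c (L + n) *
      blockFun r s (x (L + n : ℕ)) y)) (Set.Ioi 0)) ∧
    (Summable fun n : ℕ => ∫ y in Set.Ioi (0 : ℝ), ‖y ^ (-a - 1) * (c (L + n) *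
      blockFun r s (x (L + n : ℕ)) y)‖) ∧
    ∀ n : ℕ, gammaInv r s a * ((∫ y in Set.Ioi (0 : ℝ), y ^ (-a - 1) * (c (L + n) *
      blockFun r s (x (L + n : ℕ)) y) : ℝ) : ℂ) =
        q (x (L + n : ℕ)) * (((2 * x (L + n : ℕ) - 1 : ℝ) : ℂ) * gammaRatio a (x (L + n : ℕ)) *
          Q (x (L + n : ℕ))) := by
  have key : ∀ n : ℕ, IntegrableOn (fun y : ℝ => y ^ (-a - 1) *
      blockFun r s (x (L + n : ℕ)) y) (Set.Ioi 0) ∧ ∫ y in Set.Ioi (0 : ℝ), y ^ (-a - 1) *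
      blockFun r s (x (L + n : ℕ)) y = blockMellin r s a (x (L + n : ℕ)) := fun n =>
    blockFun_mellin (hL n).1 (hL n).2.1 har has (abs_lt.1 (hL n).2.2.2.1).1
  have e1 : ∀ (n : ℕ) (y : ℝ), y ^ (-a - 1) * (c (L + n) * blockFun r s (x (L + n : ℕ)) y) =
      c (L + n) * (y ^ (-a - 1) * blockFun r s (x (L + n : ℕ)) y) := fun n y => by ring
  have hval : ∀ n : ℕ, gammaInv r s a * ((c (L + n) * blockMellin r s a (x (L + n : ℕ)) : ℝ) : ℂ) =
        q (x (L + n : ℕ)) * (((2 * x (L + n : ℕ) - 1 : ℝ) : ℂ) * gammaRatio a (x (L + n : ℕ)) *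
          Q (x (L + n : ℕ))) := fun n => by
    rw [← weight_mul_blockMellin (hL n).1 (hL n).2.1 (hL n).2.2.1 har has, (hL n).2.2.2.2]
    push_cast
    ring
  refine ⟨fun n => ?_, ?_, fun n => ?_⟩
  · simp only [e1]
    exact (key n).1.const_mul _
  · have hγ : gammaInv r s a ≠ 0 := by
      rw [gammaInv]
      refine mul_ne_zero (inv_ne_zero ?_) (inv_ne_zero ?_)
      · rw [show -(a : ℂ) - r = ((-a - r : ℝ) : ℂ) by push_cast; rfl, Complex.Gamma_ofReal]
        exact_mod_cast (Real.Gamma_pos_of_pos (by linarith)).ne'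
      · rw [show -(a : ℂ) - s = ((-a - s : ℝ) : ℂ) by push_cast; rfl, Complex.Gamma_ofReal]
        exact_mod_cast (Real.Gamma_pos_of_pos (by linarith)).ne'
    have hg : (fun H : ℝ => (2 * H - 1) * ‖gammaRatio a H‖ * Q H) =O[atTop]
        fun H : ℝ => H ^ (2 * a + (1 + β)) := by
      have h2 := (two_mul_sub_one_isBigO.mul (gammaRatio_isBigO a)).mul hβ
      refine h2.trans (EventuallyEq.isBigO ?_)
      filter_upwards [eventually_gt_atTop 0] with H hH
      rw [← Real.rpow_add hH, ← Real.rpow_add hH, Complex.ofReal_re]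
      congr 1; ring
    have hsum := (h.summable ha hg L).mul_left ‖gammaInv r s a‖⁻¹
    refine hsum.congr fun n => ?_
    have e2 : ∫ y in Set.Ioi (0 : ℝ), ‖y ^ (-a - 1) * (c (L + n) *
        blockFun r s (x (L + n : ℕ)) y)‖ = |c (L + n)| * blockMellin r s a (x (L + n : ℕ)) := by
      rw [← (key n).2, ← integral_const_mul]
      refine setIntegral_congr_fun measurableSet_Ioi fun y hy => ?_
      rw [e1, norm_mul, Real.norm_eq_abs, Real.norm_of_nonneg (mul_nonneg
        (Real.rpow_nonneg (le_of_lt hy) _) (blockFun_nonneg (hL n).1 (hL n).2.1 hy))]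
    have hnn : 0 ≤ blockMellin r s a (x (L + n : ℕ)) := by
      rw [← (key n).2]
      exact setIntegral_nonneg measurableSet_Ioi fun y hy => mul_nonneg
        (Real.rpow_nonneg (le_of_lt hy) _) (blockFun_nonneg (hL n).1 (hL n).2.1 hy)
    have h3 := congrArg norm (hval n)
    rw [norm_mul, Complex.norm_real, Real.norm_eq_abs, abs_mul, abs_of_nonneg hnn] at h3
    rw [e2, ← abs_mul, inv_mul_eq_iff_eq_mul₀ (norm_ne_zero_iff.2 hγ), h3]
    simp only [norm_mul, Complex.norm_real, Real.norm_eq_abs, abs_mul, abs_norm]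
  · simp only [e1]
    rw [integral_const_mul, (key n).2, hval n]

theorem Expandable.exists_common_isBigO {ι : Type*} (J : Finset ι) {Q : ι → ℝ → ℝ}
    (hQ : ∀ j ∈ J, Expandable (Q j)) :
    ∃ β : ℝ, ∀ j ∈ J, Q j =O[atTop] fun x : ℝ => x ^ β := by
  choose! b hb using fun j hj => (hQ j hj).isBigO
  obtain ⟨β, hβ⟩ := (J.image b).exists_le
  exact ⟨β, fun j hj => (hb j hj).trans (rpow_isBigO_rpow (hβ _ (Finset.mem_image_of_mem b hj)))⟩

/-! ### Matching the coefficients of a sum of one-dimensional blocks. -/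

open MeasureTheory

/-- If a sum of blocks with expandable coefficients has, modulo Casimir-regular terms, a given
expansion at the origin, then the expansion of the coefficients is determined by it. -/
theorem coeff_expansion_of_blockSum {ι τ : Type*} (J : Finset ι) {r s : ℝ} {x q Q : ι → ℝ → ℝ}
    (hx : ∀ j ∈ J, Reparam (x j) (q j)) (hQ : ∀ j ∈ J, Expandable (Q j)) {c : ι → ℕ → ℝ}
    (hc : ∀ j ∈ J, ∀ᶠ ℓ : ℕ in atTop, c j ℓ = q j (x j ℓ) * sl2Weight r s (x j ℓ) * Q j (x j ℓ))
    {F : ℝ → ℝ} (hF : ∀ y > 0, HasSum (fun ℓ : ℕ => ∑ j ∈ J, c j ℓ * blockFun r s (x j ℓ) y) (F y))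
    (T : Finset τ) (g α : τ → ℝ) (l : τ → ℕ) {reg : ℝ → ℝ} (hreg : reg ∈ casimirRegular r s) {N : ℝ}
    (hFN : (fun y => F y - ∑ t ∈ T, g t * (y ^ α t * Real.log y ^ l t) - reg y) =o[𝓝[>] 0]
      fun y : ℝ => y ^ N) {N' : ℝ} (hN' : N' < N) :
    (fun H => ∑ j ∈ J, Q j H - ∑ t ∈ T, g t * kernelDeriv r s (l t) (α t) H) =o[atTop]
      fun H : ℝ => H ^ (-2 * N' - 2) := by
  set E : ℝ → ℝ := fun H => ∑ j ∈ J, Q j H - ∑ t ∈ T, g t * kernelDeriv r s (l t) (α t) H with hEdef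
  have hE : Expandable E := (Expandable.sum hQ).sub
    (Expandable.sum fun t _ => (kernelDeriv_expandable r s (l t) (α t)).const_mul (g t))
  obtain ⟨β₁, hβ₁⟩ := Expandable.exists_common_isBigO J hQ
  obtain ⟨β₂, hβ₂⟩ := hE.isBigO
  obtain ⟨A, hA⟩ := (T.image fun t => |α t|).exists_le
  have hA' : ∀ t ∈ T, |α t| ≤ A := fun t ht => hA _ (Finset.mem_image_of_mem _ ht)
  set β := max β₁ β₂ with hβdef
  have hβQ : ∀ j ∈ J, Q j =O[atTop] fun x : ℝ => x ^ β := fun j hj =>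
    (hβ₁ j hj).trans (rpow_isBigO_rpow (le_max_left _ _))
  have hβE : E =O[atTop] fun x : ℝ => x ^ β := hβ₂.trans (rpow_isBigO_rpow (le_max_right _ _))
  -- The point -B lies to the left of -r, -s, N, all exponents α t and the abscissa of convergence
  -- determined by the growth β. On the interval (-M, -B), with M = B + 1, all series and integrals
  -- converge and the identity can be checked directly.
  obtain ⟨B, hB⟩ := exists_gt (max (max (max 0 (max |r| |s|)) |A|) (max ((2 + β) / 2) |N|))
  simp only [max_lt_iff] at hB
  obtain ⟨⟨⟨hB0, hBr, hBs⟩, hBA⟩, hBβ, hBN⟩ := hB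
  have hαB : ∀ t ∈ T, -B < α t := fun t ht => by
    have := neg_abs_le (α t)
    have := hA' t ht
    have := le_abs_self A
    linarith
  obtain ⟨hr1, hr2⟩ := abs_lt.1 hBr
  obtain ⟨hs1, hs2⟩ := abs_lt.1 hBs
  obtain ⟨hN1, hN2⟩ := abs_lt.1 hBN
  set M := B + 1 with hM
  refine isLittleO_of_continuation hE (β := β) (B := B) (M := M) (N := N) hβE (by linarith) hB0
    (by linarith) (by linarith) ?_ hN'
  have hlarge : ∀ j ∈ J, ∀ᶠ ℓ : ℕ in atTop, M < x j ℓ := fun j hj =>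
    ((hx j hj).tendsto.comp tendsto_natCast_atTop_atTop).eventually_gt_atTop M
  have hcomp : ∀ j ∈ J, SumComparable (Metric.ball 0 M) (-B) (x j) (q j)
      fun a H => ((2 * H - 1 : ℝ) : ℂ) * gammaRatio a H * Q j H := fun j hj =>
    gammaRatio_sumComparable (hx j hj) (hQ j hj) (hβQ j hj) (by linarith) M
  have hL : ∀ᶠ L : ℕ in atTop, ∀ j ∈ J, (∀ n : ℕ, M < x j (L + n : ℕ) ∧
      c j (L + n) = q j (x j (L + n : ℕ)) * sl2Weight r s (x j (L + n : ℕ)) *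
        Q j (x j (L + n : ℕ))) ∧ ∀ᶠ L' : ℕ in atTop, ∃ Δ : ℂ → ℂ,
      DifferentiableOn ℂ Δ (Metric.ball 0 M) ∧ ∀ a : ℝ, (a : ℂ) ∈ Metric.ball (0 : ℂ) M → a < -B →
      Summable (fun n : ℕ => (q j (x j (L + n : ℕ)) : ℂ) * (((2 * x j (L + n : ℕ) - 1 : ℝ) : ℂ) *
        gammaRatio a (x j (L + n : ℕ)) * Q j (x j (L + n : ℕ)))) ∧
      Summable (fun n : ℕ => ((2 * (L' + n : ℕ) - 1 : ℝ) : ℂ) *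
        gammaRatio a (L' + n : ℕ) * Q j (L' + n : ℕ)) ∧
      (∑' n : ℕ, (q j (x j (L + n : ℕ)) : ℂ) * (((2 * x j (L + n : ℕ) - 1 : ℝ) : ℂ) *
        gammaRatio a (x j (L + n : ℕ)) * Q j (x j (L + n : ℕ)))) -
      ∑' n : ℕ, ((2 * (L' + n : ℕ) - 1 : ℝ) : ℂ) *
        gammaRatio a (L' + n : ℕ) * Q j (L' + n : ℕ) = Δ a := by
    refine (J.eventually_all).2 fun j hj => ?_
    filter_upwards [hcomp j hj, eventually_forall_ge_atTop.2 ((hlarge j hj).and (hc j hj))] with L h1 h2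
    exact ⟨fun n => h2 (L + n) (Nat.le_add_right _ _), h1⟩
  obtain ⟨L, hL⟩ := hL.exists
  have hL' := (J.eventually_all).2 fun j hj => (hL j hj).2
  -- the tail of the sum
  set head : ℝ → ℝ := fun y => ∑ ℓ ∈ Finset.range L, ∑ j ∈ J, c j ℓ * blockFun r s (x j ℓ) y
    with hhead
  set G : ℝ → ℝ := fun y => F y - head y with hG
  have hGsum : ∀ y > 0, HasSum (fun n : ℕ => ∑ j ∈ J, c j (L + n) *
      blockFun r s (x j (L + n : ℕ)) y) (G y) := fun y hy => by
    have := (hasSum_nat_add_iff' L).2 (hF y hy)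
    simpa only [add_comm _ L] using this
  have hterms : ∀ a : ℝ, -M ≤ a → a < -B → ∀ j ∈ J, _ := fun a h1 h2 j hj =>
    block_terms_mellin (c := c j) (r := r) (s := s) (a := a) (L := L) (hx j hj) (hβQ j hj)
      (by linarith) (by linarith) (by linarith) fun n => by
        have := ((hL j hj).1 n).1
        exact ⟨by linarith, by linarith, by linarith [abs_nonneg r],
          by rw [abs_of_neg (by linarith)]; linarith, ((hL j hj).1 n).2⟩
  have hGmellin : ∀ a : ℝ, -M ≤ a → a < -B →
      IntegrableOn (fun y : ℝ => y ^ (-a - 1) * G y) (Set.Ioi 0) ∧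
      HasSum (fun n : ℕ => ∫ y in Set.Ioi (0 : ℝ), y ^ (-a - 1) * ∑ j ∈ J, c j (L + n) *
        blockFun r s (x j (L + n : ℕ)) y) (∫ y in Set.Ioi (0 : ℝ), y ^ (-a - 1) * G y) := by
    intro a h1 h2
    have hint : ∀ n : ℕ, IntegrableOn (fun y : ℝ => y ^ (-a - 1) * ∑ j ∈ J, c j (L + n) *
        blockFun r s (x j (L + n : ℕ)) y) (Set.Ioi 0) := fun n => by
      simp only [Finset.mul_sum]
      exact integrable_finsetSum _ fun j hj => (hterms a h1 h2 j hj).1 n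
    refine integrable_of_hasSum hint ?_ ?_
    · refine Summable.of_nonneg_of_le (fun n => integral_nonneg fun y => norm_nonneg _) (fun n => ?_)
        (summable_sum fun j hj => (hterms a h1 h2 j hj).2.1)
      rw [← integral_finsetSum _ fun j hj => ((hterms a h1 h2 j hj).1 n).norm]
      refine integral_mono (hint n).norm
        (integrable_finsetSum _ fun j hj => ((hterms a h1 h2 j hj).1 n).norm) fun y => ?_
      beta_reduce
      rw [Finset.mul_sum]
      exact norm_sum_le _ _
    · filter_upwards [ae_restrict_mem measurableSet_Ioi] with y hy
      exact (hGsum y hy).mul_left _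
  have hI : Set.Ioo (0 : ℝ) 1 ∪ Set.Ici 1 = Set.Ioi 0 := Set.Ioo_union_Ici_eq_Ioi zero_lt_one
  have hdisj : Disjoint (Set.Ioo (0 : ℝ) 1) (Set.Ici 1) :=
    Set.disjoint_left.2 fun y hy hy' => not_le.2 hy.2 hy'
  -- the remainder at the origin
  set rem : ℝ → ℝ := fun y => F y - ∑ t ∈ T, g t * (y ^ α t * Real.log y ^ l t) - reg y with hrem
  obtain ⟨Ψ, hΨ, hΨa⟩ := ((RegularMellin.of_mem_casimirRegular hreg).add
    ((RegularMellin.sum (S := Finset.range L) fun ℓ _ => RegularMellin.sum (S := J) fun j _ =>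
      (RegularMellin.blockFun r s (x j ℓ)).const_mul (c j ℓ)).const_mul (-1)))
  have hmin : ∀ a : ℝ, a < -B → a < min (-r) (-s) := fun a ha =>
    lt_min (by linarith) (by linarith)
  have hpow : ∀ a : ℝ, a < -B → ∀ t ∈ T, _ := fun a ha t ht =>
    mellin_rpow_mul_log_ofReal (l t) (ha.trans (hαB t ht))
  have hdec : ∀ y, rem y = G y - (∑ t ∈ T, g t * (y ^ α t * Real.log y ^ l t) +
      (reg y + -1 * head y)) := fun y => by
    simp only [hrem, hG]; ring
  have hpint : ∀ a : ℝ, a < -B → IntegrableOn (fun y : ℝ => y ^ (-a - 1) *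
      ∑ t ∈ T, g t * (y ^ α t * Real.log y ^ l t)) (Set.Ioo 0 1) ∧
      ((∫ y in Set.Ioo (0 : ℝ) 1, y ^ (-a - 1) * ∑ t ∈ T, g t * (y ^ α t * Real.log y ^ l t) : ℝ) : ℂ)
        = ∑ t ∈ T, g t * iteratedDeriv (l t) (fun b : ℂ => (b - a)⁻¹) (α t) := by
    intro a ha
    simp only [Finset.mul_sum, mul_left_comm _ (g _)]
    refine ⟨integrable_finsetSum _ fun t ht => (hpow a ha t ht).1.const_mul _, ?_⟩
    rw [integral_finsetSum _ fun t ht => (hpow a ha t ht).1.const_mul _, Complex.ofReal_sum]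
    refine Finset.sum_congr rfl fun t ht => ?_
    rw [integral_const_mul, Complex.ofReal_mul, (hpow a ha t ht).2]
  have hG01 : ∀ a : ℝ, -M ≤ a → a < -B →
      IntegrableOn (fun y : ℝ => y ^ (-a - 1) * G y) (Set.Ioo 0 1) := fun a h1 h2 =>
    (hGmellin a h1 h2).1.mono_set (by rw [← hI]; exact Set.subset_union_left)
  have hG1 : ∀ a : ℝ, -M ≤ a → a < -B →
      IntegrableOn (fun y : ℝ => y ^ (-a - 1) * G y) (Set.Ici 1) := fun a h1 h2 =>
    (hGmellin a h1 h2).1.mono_set (by rw [← hI]; exact Set.subset_union_right)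
  have hremint : ∀ a : ℝ, -M ≤ a → a < -B →
      IntegrableOn (fun y : ℝ => y ^ (-a - 1) * rem y) (Set.Ioo 0 1) := fun a h1 h2 => by
    simp only [hdec, mul_sub, mul_add]
    have h3 := (hΨa a (hmin a h2)).1
    simp only [mul_add] at h3
    exact (hG01 a h1 h2).sub ((hpint a h2).1.add h3)
  have hremN : ∀ σ < N, IntegrableOn (fun y : ℝ => y ^ (-σ - 1) * rem y) (Set.Ioo 0 1) :=
    fun σ hσ => integrableOn_rpow_mul_of_isLittleO hσ (hremint (-M) le_rfl (by linarith)) hFN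
  filter_upwards [hL', eventually_gt_atTop ⌈M + A + 2⌉₊] with L' hL'' hL'M
  have hL'M := (Nat.le_ceil _).trans_lt (Nat.cast_lt (α := ℝ).2 hL'M)
  choose! Δ hΔ hΔa using hL''
  have hlat : ∀ t : τ, t ∈ T → ∃ Δ' : ℂ → ℂ, DifferentiableOn ℂ Δ' (Metric.ball 0 (L' - 2)) ∧
      ∀ a : ℝ, |a| < L' - 2 → a < α t →
      HasSum (fun n : ℕ => ((2 * (L' + n : ℕ) - 1 : ℝ) : ℂ) * gammaRatio a (L' + n : ℕ) *
        kernelDeriv r s (l t) (α t) (L' + n : ℕ))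
        (gammaInv r s a * iteratedDeriv (l t) (fun b : ℂ => (b - a)⁻¹) (α t) + Δ' a) :=
    fun t ht => kernel_lattice_sum r s (l t) (by linarith [hA' t ht])
  choose! Δ' hΔ' hΔ'a using hlat
  have hA0 : T.Nonempty → 0 ≤ A := fun ⟨t, ht⟩ => (abs_nonneg _).trans (hA' t ht)
  -- What is left once the polar terms cancel: the integral over [1,∞), the o(y^N) remainder over
  -- (0,1), the regular terms and split-off blocks in Ψ, the differences Δ between spin sums and
  -- integer sums, and the holomorphic parts Δ' of the lattice sums.
  refine ⟨fun a => gammaInv r s a * (∫ y in Set.Ici (1 : ℝ), (y : ℂ) ^ (-a - 1) * G y) +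
    gammaInv r s a * (∫ y in Set.Ioo (0 : ℝ) 1, (y : ℂ) ^ (-a - 1) * rem y) + Ψ a -
    ∑ j ∈ J, Δ j a - ∑ t ∈ T, g t * Δ' t a, ?_, ?_⟩
  · have hγ := (gammaInv_differentiable r s).differentiableOn (s := Metric.ball 0 M ∩ {z | z.re < N})
    refine DifferentiableOn.sub (DifferentiableOn.sub (DifferentiableOn.add (DifferentiableOn.add
      (hγ.mul ?_) (hγ.mul ?_)) hΨ.differentiableOn) ?_) ?_
    · refine (differentiableOn_mellin_Ici (hG1 (-M) le_rfl (by linarith))).mono fun z hz => ?_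
      have h1 : ‖z‖ < M := by simpa using hz.1
      have := (abs_le.1 (Complex.abs_re_le_norm z)).1
      change -M < z.re
      linarith
    · intro z hz
      obtain ⟨σ, h1, h2⟩ := exists_between (show z.re < N from hz.2)
      exact ((differentiableOn_mellin_Ioo (hremN σ h2)).differentiableAt
        ((isOpen_lt Complex.continuous_re continuous_const).mem_nhds h1)).differentiableWithinAt
    · exact DifferentiableOn.fun_sum fun j hj => (hΔ j hj).mono Set.inter_subset_left
    · refine DifferentiableOn.fun_sum fun t ht => ((hΔ' t ht).mono ?_).const_mul _
      refine Set.inter_subset_left.trans (Metric.ball_subset_ball ?_)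
      linarith [hA0 ⟨t, ht⟩]
  · intro a h1 h2
    have haM : |a| < M := abs_lt.2 ⟨h1, by linarith⟩
    have hab : (a : ℂ) ∈ Metric.ball (0 : ℂ) M := by simpa using haM
    have hlatt : ∀ t ∈ T, _ := fun t ht => hΔ'a t ht a
      (by linarith [hA0 ⟨t, ht⟩]) (h2.trans (hαB t ht))
    have s1 : ∑' n : ℕ, ((2 * (L' + n : ℕ) - 1 : ℝ) : ℂ) * gammaRatio a (L' + n : ℕ) *
        E (L' + n : ℕ) = ∑ j ∈ J, (∑' n : ℕ, ((2 * (L' + n : ℕ) - 1 : ℝ) : ℂ) *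
          gammaRatio a (L' + n : ℕ) * Q j (L' + n : ℕ)) - ∑ t ∈ T, g t *
          (gammaInv r s a * iteratedDeriv (l t) (fun b : ℂ => (b - a)⁻¹) (α t) + Δ' t a) := by
      refine (((hasSum_sum fun j hj => (hΔa j hj a hab h2).2.1.hasSum).sub
        (hasSum_sum fun t ht => (hlatt t ht).mul_left (g t : ℂ))).congr_fun fun n => ?_).tsum_eq
      simp only [hEdef]
      push_cast
      rw [mul_sub, Finset.mul_sum, Finset.mul_sum]
      congr 1
      refine Finset.sum_congr rfl fun t _ => ?_
      ring
    have s2 : gammaInv r s a * ((∫ y in Set.Ioi (0 : ℝ), y ^ (-a - 1) * G y : ℝ) : ℂ) =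
        ∑ j ∈ J, (Δ j a + ∑' n : ℕ, ((2 * (L' + n : ℕ) - 1 : ℝ) : ℂ) *
          gammaRatio a (L' + n : ℕ) * Q j (L' + n : ℕ)) := by
      have h3 := (Complex.hasSum_ofReal.2 (hGmellin a h1.le h2).2).mul_left (gammaInv r s a)
      refine h3.unique ?_
      refine (hasSum_sum fun j hj => (?_ : HasSum (fun n : ℕ => (q j (x j (L + n : ℕ)) : ℂ) *
        (((2 * x j (L + n : ℕ) - 1 : ℝ) : ℂ) * gammaRatio a (x j (L + n : ℕ)) *
          Q j (x j (L + n : ℕ)))) _)).congr_fun fun n => ?_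
      · have h4 := (hΔa j hj a hab h2)
        rw [← h4.2.2, sub_add_cancel]
        exact h4.1.hasSum
      · rw [← Finset.sum_congr rfl fun j hj => (hterms a h1.le h2 j hj).2.2 n, ← Finset.mul_sum,
          ← Complex.ofReal_sum, ← integral_finsetSum _ fun j hj => (hterms a h1.le h2 j hj).1 n]
        simp only [Finset.mul_sum]
    have s3 : ∫ y in Set.Ioi (0 : ℝ), y ^ (-a - 1) * G y = (∫ y in Set.Ioo (0 : ℝ) 1, y ^ (-a - 1) * G y)
        + ∫ y in Set.Ici (1 : ℝ), y ^ (-a - 1) * G y := by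
      rw [← hI, setIntegral_union hdisj measurableSet_Ici (hG01 a h1.le h2) (hG1 a h1.le h2)]
    have hΨ1 := hΨa a (hmin a h2)
    have s4 : ∫ y in Set.Ioo (0 : ℝ) 1, y ^ (-a - 1) * G y =
        (∫ y in Set.Ioo (0 : ℝ) 1, y ^ (-a - 1) * rem y) +
        ((∫ y in Set.Ioo (0 : ℝ) 1, y ^ (-a - 1) * ∑ t ∈ T, g t * (y ^ α t * Real.log y ^ l t)) +
        ∫ y in Set.Ioo (0 : ℝ) 1, y ^ (-a - 1) * (reg y + -1 * head y)) := by
      have i1 : IntegrableOn (fun y : ℝ => y ^ (-a - 1) * (reg y + -1 * head y)) (Set.Ioo 0 1) :=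
        hΨ1.1
      have i2 : IntegrableOn (fun y : ℝ => y ^ (-a - 1) * (∑ t ∈ T, g t * (y ^ α t *
          Real.log y ^ l t)) + y ^ (-a - 1) * (reg y + -1 * head y)) (Set.Ioo 0 1) :=
        (hpint a h2).1.add i1
      rw [← integral_add (hpint a h2).1 i1, ← integral_add (hremint a h1.le h2) i2]
      congr 1
      funext y
      rw [hdec]
      ring
    have s5 : ∑ t ∈ T, g t * (gammaInv r s a * iteratedDeriv (l t) (fun b : ℂ => (b - a)⁻¹) (α t) +
        Δ' t a) = gammaInv r s a * ∑ t ∈ T, g t * iteratedDeriv (l t) (fun b : ℂ => (b - a)⁻¹) (α t) +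
          ∑ t ∈ T, g t * Δ' t a := by
      rw [Finset.mul_sum, ← Finset.sum_add_distrib]
      refine Finset.sum_congr rfl fun t _ => ?_
      ring
    have hΨ2 : gammaInv r s a * ((∫ y in Set.Ioo (0 : ℝ) 1, y ^ (-a - 1) *
      (reg y + -1 * head y) : ℝ) : ℂ) = Ψ a := hΨ1.2
    beta_reduce
    rw [s1, s5, integral_cpow_ofReal measurableSet_Ici (fun y (hy : 1 ≤ y) => by linarith),
      integral_cpow_ofReal measurableSet_Ioo (fun y hy => hy.1), ← hΨ2]
    rw [s3, s4, Complex.ofReal_add, Complex.ofReal_add, Complex.ofReal_add, (hpint a h2).2,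
      Finset.sum_add_distrib] at s2
    -- The polar terms from the expansion at y = 0 and from the lattice sums are identical and drop
    -- out here.
    linear_combination -s2

/-- A combination of monomials without decaying terms that tends to zero vanishes. -/
theorem powerLog_eq_zero_of_tendsto {u : ℝ → ℝ}
    (hu : u ∈ Submodule.span ℝ (powerLogMonomial '' {t | 0 ≤ t.1})) (h : Tendsto u atTop (𝓝 0)) :
    u = 0 := by
  obtain ⟨c, hc, rfl⟩ := (Finsupp.mem_span_image_iff_linearCombination ℝ).1 hu
  rw [Finsupp.linearCombination_apply] at h ⊢
  by_cases h0 : c = 0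
  · simp [h0]
  exfalso
  obtain ⟨t, ht, hlead⟩ := powerLog_leading_mem_support h0
  have h1 := isBigO_powerLogMonomial_of_leading (Finsupp.mem_support_iff.1 ht) hlead
  have h2 : (c.sum fun i a => a • powerLogMonomial i) ∈ powerLog :=
    (Finsupp.mem_span_range_iff_exists_finsupp).2 ⟨c, rfl⟩
  obtain ⟨δ, hδ, h3⟩ := (Expandable.of_mem h2).isBigO_of_tendsto_zero h
  have h4 := le_of_rpow_isBigO_rpow ((rpow_isBigO_powerLogMonomial t).trans (h1.trans h3))
  have h5 : 0 ≤ t.1 := (Finsupp.mem_supported _ _).1 hc ht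
  linarith

/-! ### The weight as a function of the spin. -/

theorem HasSmoothExpansion.expandable {g : ℝ → ℝ} (h : HasSmoothExpansion g) : Expandable g := by
  obtain ⟨-, b, hb⟩ := h
  exact HasExpansion.expandable ⟨b, fun N => by simpa using hb 0 N⟩

/-- The truncation at N = 0 contains only non-decaying monomials and differs from h by o(1); as h →
d, it must be the constant d. The derivative bounds of the expansion are then bounds for h - d. -/
theorem HasSmoothExpansion.iteratedDeriv_isLittleO {h : ℝ → ℝ} (hh : HasSmoothExpansion h) {d : ℝ}
    (hlim : Tendsto h atTop (𝓝 d)) (i : ℕ) :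
    iteratedDeriv i (fun x => h x - d) =o[atTop] fun x : ℝ => x ^ (-i : ℝ) := by
  obtain ⟨-, b, hb⟩ := hh
  have h0 : Tendsto (fun x => h x - b.trunc 0 x) atTop (𝓝 0) := by
    have := hb 0 0
    simpa using this
  have hu : (fun x => b.trunc 0 x - d) = 0 := by
    refine powerLog_eq_zero_of_tendsto ?_ ?_
    · have e : (fun x => b.trunc 0 x - d) = (∑ t ∈ (b.finite 0).toFinset,
          b.coeff t.1 t.2 • powerLogMonomial (-t.1, t.2)) - d • powerLogMonomial (0, 0) := by
        ext x
        simp [PowerLogSeries.trunc, powerLogMonomial, mul_assoc]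
      rw [e]
      refine sub_mem (Submodule.sum_mem _ fun t ht => Submodule.smul_mem _ _
        (Submodule.subset_span ⟨_, ?_, rfl⟩)) (Submodule.smul_mem _ _
        (Submodule.subset_span ⟨_, by simp, rfl⟩))
      simp only [Set.Finite.mem_toFinset, Set.mem_ofPred_eq] at ht ⊢
      linarith [ht.1]
    · have := (hlim.sub_const d).sub h0
      simpa using this
  have e : (fun x => h x - d) = fun x => h x - b.trunc 0 x := by
    funext x
    have := congrFun hu x
    simp only [Pi.zero_apply] at this
    linarith
  rw [e]
  simpa using hb i 0

theorem hasDerivAt_iteratedDeriv_of_contDiffOn {h : ℝ → ℝ} {R : ℝ}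
    (hh : ContDiffOn ℝ (⊤ : ℕ∞) h (Set.Ioi R)) (k : ℕ) {H : ℝ} (hH : R < H) :
    HasDerivAt (iteratedDeriv k h) (iteratedDeriv (k + 1) h H) H := by
  rw [iteratedDeriv_succ, hasDerivAt_deriv_iff]
  have h1 := hh.differentiableOn_iteratedDerivWithin (m := k) (by exact_mod_cast ENat.natCast_lt_top k)
    (isOpen_Ioi.uniqueDiffOn)
  have h2 := h1.differentiableAt (Ioi_mem_nhds hH)
  refine h2.congr_of_eventuallyEq ?_
  filter_upwards [Ioi_mem_nhds hH] with x hx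
  exact (iteratedDerivWithin_of_isOpen isOpen_Ioi hx).symm

theorem SymbolFamily.of_derivs {D : ℕ → ℝ → ℝ}
    (hD : ∀ i, D i =O[atTop] fun x : ℝ => x ^ (-i : ℝ))
    (hd : ∀ i, ∀ᶠ H : ℝ in atTop, HasDerivAt (D i) (D (i + 1) H) H) (Ω : Set ℂ) (n : ℕ) :
    ∀ i : ℕ, SymbolFamily Ω n (fun _ => -i) fun _ H => (D i H : ℂ) := by
  have h0 : ∀ i : ℕ, SymbolBound Ω (fun _ => -i) fun _ H => (D i H : ℂ) := fun i => by
    obtain ⟨C, hC⟩ := (hD i).bound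
    refine ⟨C, ?_⟩
    filter_upwards [hC, eventually_ge_atTop 0] with H h1 h2
    refine ⟨differentiableOn_const _, fun w _ => ?_⟩
    rwa [Real.norm_of_nonneg (Real.rpow_nonneg h2 _), ← Complex.norm_real] at h1
  induction n with
  | zero => exact h0
  | succ n ih =>
    intro i
    refine ⟨h0 i, fun _ H => (D (i + 1) H : ℂ), (ih (i + 1)).congr_exp fun w => ?_, ?_⟩
    · push_cast; ring
    · filter_upwards [hd i] with H h w _ using h.ofReal_comp

/-- The spin as a function of the weight defines an admissible reparametrization. -/
theorem reparam_of_spin {h hb : ℝ → ℝ} {hInf ℓ₀ : ℝ} (hh : HasSmoothExpansion h)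
    (hlim : Tendsto h atTop (𝓝 hInf)) (hb_spin : ∀ ℓ > ℓ₀, hb ℓ - h (hb ℓ) = ℓ)
    (hb_diff : DifferentiableOn ℝ hb (Set.Ioi ℓ₀)) (hb_top : Tendsto hb atTop atTop) (j : ℝ) :
    Reparam (fun ℓ => hb ℓ + j) (fun H => (1 - deriv h (H - j))⁻¹) ∧
      ∀ᶠ ℓ : ℝ in atTop, deriv hb ℓ = (1 - deriv h (hb ℓ))⁻¹ := by
  obtain ⟨R, hR⟩ := hh.1
  have hderiv : ∀ᶠ ℓ : ℝ in atTop, HasDerivAt hb (1 - deriv h (hb ℓ))⁻¹ ℓ := by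
    filter_upwards [hb_top.eventually_gt_atTop R, eventually_gt_atTop ℓ₀] with ℓ h1 h2
    have h3 := (hb_diff.differentiableAt (Ioi_mem_nhds h2)).hasDerivAt
    have h4 : HasDerivAt h (deriv h (hb ℓ)) (hb ℓ) := by
      simpa using hasDerivAt_iteratedDeriv_of_contDiffOn hR 0 h1
    -- Differentiating hb - h(hb) = ℓ gives hb' (1 - h'(hb)) = 1, so the Jacobian is a function of
    -- hb itself.
    have h5 := (h3.sub (h4.comp ℓ h3)).unique ((hasDerivAt_id ℓ).congr_of_eventuallyEq (by
      filter_upwards [Ioi_mem_nhds h2] with x hx using hb_spin x hx))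
    have h6 : deriv hb ℓ * (1 - deriv h (hb ℓ)) = 1 := by linear_combination h5
    rwa [← eq_inv_of_mul_eq_one_left h6]
  refine ⟨⟨?_, ?_, fun Ω n => ?_⟩, hderiv.mono fun ℓ h => h.deriv⟩
  · filter_upwards [hderiv] with ℓ h1
    simpa using h1.add_const j
  · refine ⟨|hInf| + 1 + |j|, ?_⟩
    have h1 : ∀ᶠ ℓ : ℝ in atTop, |h (hb ℓ)| < |hInf| + 1 :=
      ((hlim.comp hb_top).abs).eventually_lt_const (by linarith)
    filter_upwards [h1, eventually_gt_atTop ℓ₀] with ℓ h1 h2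
    rw [show hb ℓ + j - ℓ = h (hb ℓ) + j by linarith [hb_spin ℓ h2]]
    exact (abs_add_le _ _).trans (by linarith)
  · have hiter : ∀ i : ℕ, iteratedDeriv (i + 1) h =o[atTop] fun x : ℝ => x ^ (-(i + 1 : ℕ) : ℝ) :=
      fun i => by
        have := hh.iteratedDeriv_isLittleO hlim (i + 1)
        have e : iteratedDeriv (i + 1) (fun x => h x - hInf) = iteratedDeriv (i + 1) h := by
          rw [iteratedDeriv_succ', iteratedDeriv_succ']
          congr 1
          funext x
          simp
        rwa [e] at this
    have hshift : ∀ i : ℕ, (fun H => iteratedDeriv (i + 1) h (H - j)) =o[atTop]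
        fun x : ℝ => x ^ (-(i + 1 : ℕ) : ℝ) := fun i => by
      simpa only [sub_eq_add_neg] using isLittleO_comp_add_const (-j) (hiter i)
    have hdiff : ∀ i : ℕ, ∀ᶠ H : ℝ in atTop, HasDerivAt (fun H => iteratedDeriv (i + 1) h (H - j))
        (iteratedDeriv (i + 2) h (H - j)) H := fun i => by
      filter_upwards [eventually_gt_atTop (R + j)] with H hH
      exact (hasDerivAt_iteratedDeriv_of_contDiffOn hR (i + 1)
        (show R < H - j by linarith)).comp_sub_const H j
    have h0 : Tendsto (fun H => deriv h (H - j)) atTop (𝓝 0) := by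
      have h1 := (hshift 0).trans_tendsto (tendsto_rpow_neg_atTop (y := ((0 + 1 : ℕ) : ℝ)) (by simp))
      simpa using h1
    set D : ℕ → ℝ → ℝ := fun i => Nat.casesOn i (fun H => 1 - deriv h (H - j))
      fun k H => -iteratedDeriv (k + 2) h (H - j) with hD
    have hsym : SymbolFamily Ω n (fun _ => 0) fun _ H => ((1 - deriv h (H - j) : ℝ) : ℂ) := by
      have := SymbolFamily.of_derivs (D := D) (fun i => ?_) (fun i => ?_) Ω n 0
      · simp only [Nat.cast_zero, neg_zero] at this
        exact this
      · cases i with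
        | zero => simpa [hD] using (h0.const_sub 1).isBigO_one ℝ
        | succ k =>
          refine (hshift (k + 1)).neg_left.isBigO.trans (rpow_isBigO_rpow ?_)
          push_cast
          linarith
      · cases i with
        | zero =>
          filter_upwards [hdiff 0] with H hH
          simpa [hD] using hH.const_sub 1
        | succ k =>
          filter_upwards [hdiff (k + 1)] with H hH
          exact hH.neg
    -- As h' → 0, the symbol 1 - h' is eventually at least 1/2.
    have := hsym.inv (m := 1 / 2) (by norm_num) (by
      filter_upwards [(h0.const_sub 1).eventually_const_lt (show (1 / 2 : ℝ) < 1 - 0 by norm_num)]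
        with H hH w _
      rw [Complex.norm_real, Real.norm_eq_abs]
      exact hH.le.trans (le_abs_self _))
    simpa using this

/-! ### Rational functions of the twist and of the inverse weight. -/

open Polynomial in
/-- The value at `(u, w)` of a polynomial in `u` whose coefficients are polynomials in `w`. -/
noncomputable def evalPair (p : ℝ[X][X]) (u w : ℝ) : ℝ :=
  eval₂RingHom (evalRingHom w) u p

open Polynomial in
theorem evalPair_eq (p : ℝ[X][X]) (u w : ℝ) :
    evalPair p u w = (p.map (evalRingHom w)).eval u := by
  rw [evalPair, coe_eval₂RingHom, eval_map]

open Polynomial in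
theorem continuous_evalPair (p : ℝ[X][X]) : Continuous fun t : ℝ × ℝ => evalPair p t.1 t.2 := by
  induction p using Polynomial.induction_on' with
  | add p q hp hq => exact (hp.add hq).congr fun t => by simp [evalPair]
  | monomial n a =>
    simp only [evalPair, coe_eval₂RingHom, eval₂_monomial, coe_evalRingHom]
    exact (a.continuous.comp continuous_snd).mul (continuous_fst.pow n)

open Polynomial in
theorem hasDerivAt_evalPair (p : ℝ[X][X]) (u w : ℝ) :
    HasDerivAt (fun u => evalPair p u w) (evalPair (derivative p) u w) u := by
  simp only [evalPair_eq, ← derivative_map]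
  exact (p.map (evalRingHom w)).hasDerivAt u

theorem tendsto_evalPair (p : Polynomial (Polynomial ℝ)) (u₀ : ℝ) :
    Tendsto (fun t : ℝ × ℝ => evalPair p t.1 t.2⁻¹) (𝓝 u₀ ×ˢ atTop) (𝓝 (evalPair p u₀ 0)) := by
  have h : Tendsto (fun t : ℝ × ℝ => (t.1, t.2⁻¹)) (𝓝 u₀ ×ˢ atTop) (𝓝 (u₀, 0)) :=
    tendsto_fst.prodMk_nhds (tendsto_inv_atTop_zero.comp tendsto_snd)
  exact ((continuous_evalPair p).tendsto (u₀, 0)).comp h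

/-- `f u H` is a rational function of `u` and `1/H`, regular at `u = u₀`, `1/H = 0`. -/
def RationalAt (u₀ : ℝ) (f : ℝ → ℝ → ℝ) : Prop :=
  ∃ N D : Polynomial (Polynomial ℝ), evalPair D u₀ 0 ≠ 0 ∧
    ∀ᶠ t : ℝ × ℝ in 𝓝 u₀ ×ˢ atTop, f t.1 t.2 = evalPair N t.1 t.2⁻¹ / evalPair D t.1 t.2⁻¹

namespace RationalAt

variable {u₀ : ℝ} {f g : ℝ → ℝ → ℝ}

theorem const (u₀ c : ℝ) : RationalAt u₀ fun _ _ => c :=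
  ⟨Polynomial.C (Polynomial.C c), 1, by simp [evalPair], Eventually.of_forall fun t => by
    simp [evalPair]⟩

theorem fst (u₀ : ℝ) : RationalAt u₀ fun u _ => u :=
  ⟨Polynomial.X, 1, by simp [evalPair], Eventually.of_forall fun t => by simp [evalPair]⟩

theorem inv_snd (u₀ : ℝ) : RationalAt u₀ fun _ H => H⁻¹ :=
  ⟨Polynomial.C Polynomial.X, 1, by simp [evalPair], Eventually.of_forall fun t => by
    simp [evalPair]⟩

theorem congr (hf : RationalAt u₀ f) (h : ∀ᶠ t : ℝ × ℝ in 𝓝 u₀ ×ˢ atTop, f t.1 t.2 = g t.1 t.2) :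
    RationalAt u₀ g := by
  obtain ⟨N, D, hD, h1⟩ := hf
  exact ⟨N, D, hD, by filter_upwards [h, h1] with t h2 h3 using h2 ▸ h3⟩

theorem den_ne_zero {D : Polynomial (Polynomial ℝ)} (hD : evalPair D u₀ 0 ≠ 0) :
    ∀ᶠ t : ℝ × ℝ in 𝓝 u₀ ×ˢ atTop, evalPair D t.1 t.2⁻¹ ≠ 0 :=
  (tendsto_evalPair D u₀).eventually_ne hD

theorem add (hf : RationalAt u₀ f) (hg : RationalAt u₀ g) :
    RationalAt u₀ fun u H => f u H + g u H := by
  obtain ⟨N, D, hD, h1⟩ := hf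
  obtain ⟨N', D', hD', h2⟩ := hg
  refine ⟨N * D' + N' * D, D * D', by simpa [evalPair] using ⟨hD, hD'⟩, ?_⟩
  filter_upwards [h1, h2, den_ne_zero hD, den_ne_zero hD'] with t h1 h2 h3 h4
  rw [h1, h2, div_add_div _ _ h3 h4]
  simp only [evalPair, map_add, map_mul]
  ring

theorem mul (hf : RationalAt u₀ f) (hg : RationalAt u₀ g) :
    RationalAt u₀ fun u H => f u H * g u H := by
  obtain ⟨N, D, hD, h1⟩ := hf
  obtain ⟨N', D', hD', h2⟩ := hg
  refine ⟨N * N', D * D', by simpa [evalPair] using ⟨hD, hD'⟩, ?_⟩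
  filter_upwards [h1, h2] with t h1 h2
  rw [h1, h2, div_mul_div_comm]
  simp only [evalPair, map_mul]

theorem neg (hf : RationalAt u₀ f) : RationalAt u₀ fun u H => -f u H := by
  simpa using (const u₀ (-1)).mul hf

theorem sub (hf : RationalAt u₀ f) (hg : RationalAt u₀ g) :
    RationalAt u₀ fun u H => f u H - g u H := by
  simpa [sub_eq_add_neg] using hf.add hg.neg

theorem const_mul (c : ℝ) (hf : RationalAt u₀ f) : RationalAt u₀ fun u H => c * f u H :=
  (const u₀ c).mul hf

theorem exists_tendsto (hf : RationalAt u₀ f) :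
    ∃ d, Tendsto (fun t : ℝ × ℝ => f t.1 t.2) (𝓝 u₀ ×ˢ atTop) (𝓝 d) := by
  obtain ⟨N, D, hD, h1⟩ := hf
  exact ⟨_, ((tendsto_evalPair N u₀).div (tendsto_evalPair D u₀) hD).congr'
    (by filter_upwards [h1] with t ht using ht.symm)⟩

theorem inv (hf : RationalAt u₀ f) {d : ℝ} (hd : d ≠ 0)
    (h : Tendsto (fun t : ℝ × ℝ => f t.1 t.2) (𝓝 u₀ ×ˢ atTop) (𝓝 d)) :
    RationalAt u₀ fun u H => (f u H)⁻¹ := by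
  obtain ⟨N, D, hD, h1⟩ := hf
  have h2 := tendsto_nhds_unique h (((tendsto_evalPair N u₀).div (tendsto_evalPair D u₀) hD).congr'
    (by filter_upwards [h1] with t ht using ht.symm))
  refine ⟨D, N, fun h0 => hd (by rw [h2, h0, zero_div]), ?_⟩
  filter_upwards [h1] with t ht
  rw [ht, inv_div]

theorem eventually_exists_tendsto (hf : RationalAt u₀ f) :
    ∀ᶠ u in 𝓝 u₀, ∃ d, Tendsto (f u) atTop (𝓝 d) := by
  obtain ⟨N, D, hD, h1⟩ := hf
  have hc : ContinuousAt (fun u => evalPair D u 0) u₀ :=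
    ((continuous_evalPair D).comp (Continuous.prodMk_left 0)).continuousAt
  filter_upwards [h1.curry, hc.eventually_ne hD] with u hu hDu
  have hw : ∀ P, Tendsto (fun H : ℝ => evalPair P u H⁻¹) atTop (𝓝 (evalPair P u 0)) := fun P =>
    (((continuous_evalPair P).comp (Continuous.prodMk_right u)).tendsto 0).comp
      tendsto_inv_atTop_zero
  exact ⟨_, ((hw N).div (hw D) hDu).congr' (by filter_upwards [hu] with H hH using hH.symm)⟩

theorem exists_deriv (hf : RationalAt u₀ f) : ∃ f', RationalAt u₀ f' ∧
    ∀ᶠ t : ℝ × ℝ in 𝓝 u₀ ×ˢ atTop, HasDerivAt (fun u => f u t.2) (f' t.1 t.2) t.1 := by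
  obtain ⟨N, D, hD, h1⟩ := hf
  refine ⟨fun u H => evalPair (N.derivative * D - N * D.derivative) u H⁻¹ /
    evalPair (D * D) u H⁻¹, ⟨_, _, by simpa [evalPair] using hD, Eventually.of_forall fun t => rfl⟩,
    ?_⟩
  obtain ⟨pa, ha, pb, hb, hab⟩ := Filter.eventually_prod_iff.1 (h1.and (den_ne_zero hD))
  refine Filter.eventually_prod_iff.2 ⟨_, ha.eventually_nhds, pb, hb, fun {u} hu {H} hH => ?_⟩
  have h2 := (hab hu.self_of_nhds hH).2
  have h3 := (hasDerivAt_evalPair N u H⁻¹).fun_div (hasDerivAt_evalPair D u H⁻¹) h2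
  have h4 : HasDerivAt (fun u => f u H) _ u := h3.congr_of_eventuallyEq
    (by filter_upwards [hu] with v hv using (hab hv hH).1)
  refine h4.congr_deriv ?_
  simp only [evalPair, map_sub, map_mul, sq]

open Polynomial in
/-- A rational function that vanishes at `1/H = 0` is divisible by `1/H`. -/
theorem snd_mul (hf : RationalAt u₀ f) (h : ∀ᶠ u in 𝓝 u₀, Tendsto (f u) atTop (𝓝 0)) :
    RationalAt u₀ fun u H => H * f u H := by
  obtain ⟨N, D, hD, h1⟩ := hf
  have hc : ContinuousAt (fun u => evalPair D u 0) u₀ :=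
    ((continuous_evalPair D).comp (Continuous.prodMk_left 0)).continuousAt
  have hN : ∀ᶠ u in 𝓝 u₀, evalPair N u 0 = 0 := by
    filter_upwards [h, h1.curry, hc.eventually_ne hD] with u h2 hu hDu
    have hw : ∀ P, Tendsto (fun H : ℝ => evalPair P u H⁻¹) atTop (𝓝 (evalPair P u 0)) := fun P =>
      (((continuous_evalPair P).comp (Continuous.prodMk_right u)).tendsto 0).comp
        tendsto_inv_atTop_zero
    have h3 := tendsto_nhds_unique h2
      (((hw N).div (hw D) hDu).congr' (by filter_upwards [hu] with H hH using hH.symm))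
    rw [eq_comm, div_eq_zero_iff] at h3
    exact h3.resolve_right hDu
  -- At 1/H = 0 the numerator is a polynomial in u that vanishes near u₀, hence identically; so
  -- every coefficient is divisible by 1/H.
  have hN0 : N.map (evalRingHom 0) = 0 := by
    refine Polynomial.eq_zero_of_infinite_isRoot _ ?_
    refine (infinite_of_mem_nhds u₀ hN).mono fun u (hu : evalPair N u 0 = 0) => ?_
    rw [evalPair_eq] at hu
    exact hu
  have hdvd : C X ∣ N := by
    refine (C_dvd_iff_dvd_coeff _ _).2 fun i => ?_
    rw [X_dvd_iff, coeff_zero_eq_eval_zero]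
    have := congrArg (fun p => coeff p i) hN0
    simpa [coeff_map] using this
  obtain ⟨N', rfl⟩ := hdvd
  refine ⟨N', D, hD, ?_⟩
  filter_upwards [h1, tendsto_snd.eventually (eventually_gt_atTop 0)] with t h2 h3
  rw [h2]
  simp only [evalPair, map_mul, coe_eval₂RingHom, eval₂_C, coe_evalRingHom, eval_X]
  have h3 : t.2 ≠ 0 := ne_of_gt h3
  field_simp

end RationalAt

/-! ### Shift coefficients and block coefficients at large weight. -/

theorem tendsto_inv_snd (u₀ : ℝ) :
    Tendsto (fun t : ℝ × ℝ => t.2⁻¹) (𝓝 u₀ ×ˢ atTop) (𝓝 0) :=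
  tendsto_inv_atTop_zero.comp tendsto_snd

theorem eventually_snd_gt (u₀ c : ℝ) : ∀ᶠ t : ℝ × ℝ in 𝓝 u₀ ×ˢ atTop, c < t.2 :=
  tendsto_snd.eventually (eventually_gt_atTop c)

namespace RationalAt

theorem one_add_mul (u₀ c : ℝ) : RationalAt u₀ fun _ H => 1 + c * H⁻¹ :=
  (const u₀ 1).add ((inv_snd u₀).const_mul c)

theorem tendsto_one_add_mul (u₀ c : ℝ) :
    Tendsto (fun t : ℝ × ℝ => 1 + c * t.2⁻¹) (𝓝 u₀ ×ˢ atTop) (𝓝 1) := by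
  simpa using ((tendsto_inv_snd u₀).const_mul c).const_add 1

theorem inv_one_add_mul (u₀ c : ℝ) : RationalAt u₀ fun _ H => (1 + c * H⁻¹)⁻¹ :=
  (one_add_mul u₀ c).inv one_ne_zero (tendsto_one_add_mul u₀ c)

theorem inv_add (u₀ c : ℝ) : RationalAt u₀ fun _ H => (H + c)⁻¹ := by
  refine ((inv_snd u₀).mul (inv_one_add_mul u₀ c)).congr ?_
  filter_upwards [eventually_snd_gt u₀ 0] with t ht
  rw [← mul_inv]
  congr 1
  field_simp

theorem div_add (u₀ b c : ℝ) : RationalAt u₀ fun _ H => (H + b) * (H + c)⁻¹ := by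
  refine ((const u₀ 1).add ((inv_add u₀ c).const_mul (b - c))).congr ?_
  filter_upwards [eventually_snd_gt u₀ (-c)] with t ht
  have : t.2 + c ≠ 0 := by linarith
  field_simp
  ring

theorem shiftBeta (r s u₀ j : ℝ) : RationalAt u₀ fun _ H => shiftBeta r s (H + j) := by
  refine ((const u₀ (-(1 / 2))).add (((inv_add u₀ j).mul (inv_add u₀ (j - 1))).const_mul
    (r * s / 2))).congr (Eventually.of_forall fun t => ?_)
  rw [Lightcone.shiftBeta, div_eq_mul_inv (r * s) (2 * (t.2 + j) * (t.2 + j - 1)), mul_inv, mul_inv,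
    show t.2 + (j - 1) = t.2 + j - 1 by ring]
  ring

theorem shiftBeta' (r s u₀ j : ℝ) : RationalAt u₀ fun _ H => shiftBeta' r s (H + j) := by
  refine ((const u₀ ((r + s) / 2)).add (((inv_add u₀ j).mul (inv_add u₀ (j - 1))).const_mul
    (r * s / 2))).congr (Eventually.of_forall fun t => ?_)
  rw [Lightcone.shiftBeta', div_eq_mul_inv (r * s) (2 * (t.2 + j) * (t.2 + j - 1)), mul_inv, mul_inv,
    show t.2 + (j - 1) = t.2 + j - 1 by ring]
  ring

theorem shiftGamma (r s u₀ j : ℝ) : RationalAt u₀ fun _ H => shiftGamma r s (H + j) := by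
  refine ((((div_add u₀ (j - r) j).mul (div_add u₀ (j + r) j)).mul
    ((div_add u₀ (j - s) (j - 1 / 2)).mul (div_add u₀ (j + s) (j + 1 / 2)))).const_mul
      (1 / 16)).congr ?_
  filter_upwards [eventually_snd_gt u₀ (-j + 1)] with t ht
  have h1 : t.2 + j ≠ 0 := by linarith
  have h2 : t.2 + (j - 1 / 2) ≠ 0 := by linarith
  have h3 : t.2 + (j + 1 / 2) ≠ 0 := by linarith
  have h4 : 4 * (t.2 + j) ^ 2 * (4 * (t.2 + j) ^ 2 - 1) =
      16 * ((t.2 + j) * (t.2 + j) * ((t.2 + (j - 1 / 2)) * (t.2 + (j + 1 / 2)))) := by ring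
  rw [Lightcone.shiftGamma, h4]
  field_simp
  ring

end RationalAt

theorem tendsto_inv_add (c : ℝ) : Tendsto (fun H : ℝ => (H + c)⁻¹) atTop (𝓝 0) :=
  tendsto_inv_atTop_zero.comp (tendsto_atTop_add_const_right _ c tendsto_id)

theorem tendsto_shiftBeta (r s j : ℝ) :
    Tendsto (fun H => shiftBeta r s (H + j)) atTop (𝓝 (-(1 / 2))) := by
  have h := ((tendsto_inv_add j).mul (tendsto_inv_add (j - 1))).const_mul (r * s / 2)
  have h1 := h.const_add (-(1 / 2))
  simp only [mul_zero, add_zero] at h1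
  refine h1.congr fun H => ?_
  rw [Lightcone.shiftBeta, div_eq_mul_inv (r * s) (2 * (H + j) * (H + j - 1)), mul_inv, mul_inv,
    show H + (j - 1) = H + j - 1 by ring]
  ring

theorem tendsto_shiftBeta' (r s j : ℝ) :
    Tendsto (fun H => shiftBeta' r s (H + j)) atTop (𝓝 ((r + s) / 2)) := by
  have h := ((tendsto_inv_add j).mul (tendsto_inv_add (j - 1))).const_mul (r * s / 2)
  have h1 := h.const_add ((r + s) / 2)
  simp only [mul_zero, add_zero] at h1
  refine h1.congr fun H => ?_
  rw [Lightcone.shiftBeta', div_eq_mul_inv (r * s) (2 * (H + j) * (H + j - 1)), mul_inv, mul_inv,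
    show H + (j - 1) = H + j - 1 by ring]
  ring

theorem tendsto_div_add (b c : ℝ) : Tendsto (fun H : ℝ => (H + b) * (H + c)⁻¹) atTop (𝓝 1) := by
  have h := ((tendsto_inv_add c).const_mul (b - c)).const_add 1
  simp only [mul_zero, add_zero] at h
  refine h.congr' ?_
  filter_upwards [eventually_gt_atTop (-c)] with H hH
  have : H + c ≠ 0 := by linarith
  field_simp
  ring

theorem tendsto_shiftGamma (r s j : ℝ) :
    Tendsto (fun H => shiftGamma r s (H + j)) atTop (𝓝 (1 / 16)) := by
  have h := (((tendsto_div_add (j - r) j).mul (tendsto_div_add (j + r) j)).mul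
    ((tendsto_div_add (j - s) (j - 1 / 2)).mul (tendsto_div_add (j + s) (j + 1 / 2)))).const_mul
      (1 / 16)
  simp only [mul_one] at h
  refine h.congr' ?_
  filter_upwards [eventually_gt_atTop (-j + 1)] with H ht
  have h1 : H + j ≠ 0 := by linarith
  have h2 : H + (j - 1 / 2) ≠ 0 := by linarith
  have h3 : H + (j + 1 / 2) ≠ 0 := by linarith
  have h4 : 4 * (H + j) ^ 2 * (4 * (H + j) ^ 2 - 1) =
      16 * ((H + j) * (H + j) * ((H + (j - 1 / 2)) * (H + (j + 1 / 2)))) := by ring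
  rw [Lightcone.shiftGamma, h4]
  field_simp
  ring

/-- Off the diagonal `j = 0` both sides of the recursion for the block coefficients grow linearly in
the weight; this is the recursion divided by the weight. -/
theorem blockA_succ_succ (ν r s u H : ℝ) (hH : H ≠ 0) (m : ℕ) (j : ℤ) :
    blockA ν r s u H (m + 2) j =
      -(((((u + m + 1 - r) * (u + m + 1 - s) - 2 * ν * (u + m + 1)
            + 2 * ν * shiftBeta' r s (H + j)) * H⁻¹
          - shiftBeta r s (H + j) * (((u + m + 1) * (u + m) - u * (u - 1) + 2 * ν * u) * H⁻¹
            + 2 * j + j * (j - 1) * H⁻¹)) * blockA ν r s u H (m + 1) j)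
        + (2 * ν * (1 + (j + 1) * H⁻¹) - (((u + m + 1) * (u + m) - u * (u - 1) + 2 * ν * u) * H⁻¹
            + 2 * (j + 1) + (j + 1) * j * H⁻¹)) * blockA ν r s u H (m + 1) (j + 1)
        + (shiftGamma r s (H + (j - 1)) * (2 * ν * ((2 - j) * H⁻¹ - 1)
          - (((u + m + 1) * (u + m) - u * (u - 1) + 2 * ν * u) * H⁻¹
            + 2 * (j - 1) + (j - 1) * (j - 2) * H⁻¹))) * blockA ν r s u H (m + 1) (j - 1)
        - (u + m - r) * (u + m - s) * H⁻¹ * (blockA ν r s u H m (j + 1)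
            + shiftBeta r s (H + j) * blockA ν r s u H m j
            + shiftGamma r s (H + (j - 1)) * blockA ν r s u H m (j - 1)))
      * (((m + 2) * (2 * u + m + 1 - 2 * ν) + j * (j - 1)) * H⁻¹ + 2 * j)⁻¹ := by
  rw [blockA]
  dsimp only
  rw [show H + j - 1 = H + ((j : ℝ) - 1) by ring]
  set X := ((m : ℝ) + 2) * (2 * u + m + 1 - 2 * ν) + j * (2 * H + j - 1) with hX
  have e : (((m : ℝ) + 2) * (2 * u + m + 1 - 2 * ν) + j * (j - 1)) * H⁻¹ + 2 * j = X * H⁻¹ := by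
    rw [hX]; field_simp; ring
  rw [e, mul_inv, inv_inv, div_eq_mul_inv]
  have hw : H * H⁻¹ = 1 := mul_inv_cancel₀ hH
  generalize shiftBeta r s (H + j) = β
  generalize shiftBeta' r s (H + j) = β'
  generalize shiftGamma r s (H + (j - 1)) = γ
  generalize blockA ν r s u H (m + 1) j = A0
  generalize blockA ν r s u H (m + 1) (j + 1) = A1
  generalize blockA ν r s u H (m + 1) (j - 1) = A2
  generalize blockA ν r s u H m j = B0
  generalize blockA ν r s u H m (j + 1) = B1
  generalize blockA ν r s u H m (j - 1) = B2
  generalize X⁻¹ = Z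
  field_simp
  ring

/-- On the diagonal the denominator does not grow with H, although the neighbours A_{m+1,±1} enter
with factors of order H. These are collected in the single combination H(A_{m+1,1} - γ A_{m+1,-1}),
where a cancellation will make it bounded. -/
theorem blockA_succ_succ_zero (ν r s u H : ℝ) (m : ℕ) :
    blockA ν r s u H (m + 2) 0 =
      -(((u + m + 1 - r) * (u + m + 1 - s) - 2 * ν * (u + m + 1) + 2 * ν * shiftBeta' r s (H + 0)
          - shiftBeta r s (H + 0) * ((u + m + 1) * (u + m) - u * (u - 1) + 2 * ν * u))
            * blockA ν r s u H (m + 1) 0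
        + (2 * ν - 2) * (H * (blockA ν r s u H (m + 1) 1
            - shiftGamma r s (H + (-1)) * blockA ν r s u H (m + 1) (-1)))
        + (2 * ν - ((u + m + 1) * (u + m) - u * (u - 1) + 2 * ν * u)) * blockA ν r s u H (m + 1) 1
        + shiftGamma r s (H + (-1)) * (4 * ν - ((u + m + 1) * (u + m) - u * (u - 1) + 2 * ν * u) - 2)
            * blockA ν r s u H (m + 1) (-1)
        - (u + m - r) * (u + m - s) * (blockA ν r s u H m 1
            + shiftBeta r s (H + 0) * blockA ν r s u H m 0
            + shiftGamma r s (H + (-1)) * blockA ν r s u H m (-1)))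
      * ((m + 2) * (2 * u + m + 1 - 2 * ν))⁻¹ := by
  rw [blockA]
  simp only [Int.cast_zero, add_zero, zero_mul, zero_add, zero_sub, sub_zero]
  rw [show H - 1 = H + -1 by ring]
  rw [div_eq_mul_inv]
  congr 1
  ring

/-- The parameter `u₀` avoids the poles of the block coefficients. -/
def RegularPoint (ν r s u₀ : ℝ) : Prop :=
  (∀ q : ℕ, 1 ≤ q → 2 * u₀ + q ≠ 2 * ν) ∧ (r * s ≠ 0 → u₀ ≠ ν)

/-- In the recursion divided by H only the parts linear in H survive; level m drops out, and the
limits β → -1/2 and γ → 1/16 give the coefficients. -/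
theorem blockA_succ_succ_tendsto {ν r s u : ℝ} {m : ℕ} {j : ℤ} (hj : j ≠ 0) {a b : ℤ → ℝ}
    (ha : ∀ i : ℤ, |i - j| ≤ 1 → Tendsto (fun H => blockA ν r s u H (m + 1) i) atTop (𝓝 (a i)))
    (hb : ∀ i : ℤ, |i - j| ≤ 1 → Tendsto (fun H => blockA ν r s u H m i) atTop (𝓝 (b i))) :
    Tendsto (fun H => blockA ν r s u H (m + 2) j) atTop
      (𝓝 (-(j * a j + (2 * ν - 2 * (j + 1)) * a (j + 1) - (ν + j - 1) / 8 * a (j - 1))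
        * (2 * j : ℝ)⁻¹)) := by
  have hw : Tendsto (fun H : ℝ => H⁻¹) atTop (𝓝 0) := tendsto_inv_atTop_zero
  have hβ := tendsto_shiftBeta r s j
  have hβ' := tendsto_shiftBeta' r s j
  have hγ := tendsto_shiftGamma r s (j - 1)
  have ha0 := ha j (by simp)
  have ha1 := ha (j + 1) (by simp)
  have ha2 := ha (j - 1) (by simp)
  have hb0 := hb j (by simp)
  have hb1 := hb (j + 1) (by simp)
  have hb2 := hb (j - 1) (by simp)
  set κ : ℝ := (u + m + 1) * (u + m) - u * (u - 1) + 2 * ν * u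
  have hE : ∀ i k : ℝ, Tendsto (fun H : ℝ => κ * H⁻¹ + 2 * i + k * H⁻¹) atTop (𝓝 (2 * i)) := by
    intro i k
    simpa using ((hw.const_mul κ).add_const (2 * i)).add (hw.const_mul k)
  have h0 := ((((hβ'.const_mul (2 * ν)).const_add ((u + m + 1 - r) * (u + m + 1 - s)
    - 2 * ν * (u + m + 1))).mul hw).sub (hβ.mul (hE j (j * (j - 1))))).mul ha0
  have h1 := ((((hw.const_mul ((j : ℝ) + 1)).const_add 1).const_mul (2 * ν)).sub
    (hE (j + 1) ((j + 1) * j))).mul ha1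
  have h2 := (hγ.mul ((((hw.const_mul (2 - (j : ℝ))).sub_const 1).const_mul (2 * ν)).sub
    (hE (j - 1) ((j - 1) * (j - 2))))).mul ha2
  have h3 := (hw.const_mul ((u + m - r) * (u + m - s))).mul ((hb1.add (hβ.mul hb0)).add
    (hγ.mul hb2))
  have hden : Tendsto (fun H : ℝ => ((m + 2) * (2 * u + m + 1 - 2 * ν) + j * (j - 1)) * H⁻¹ + 2 * j)
      atTop (𝓝 (2 * j)) := by
    simpa using (hw.const_mul (((m : ℝ) + 2) * (2 * u + m + 1 - 2 * ν) + j * (j - 1))).add_const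
      (2 * (j : ℝ))
  have hj' : (2 * j : ℝ) ≠ 0 := by
    have : (j : ℝ) ≠ 0 := by exact_mod_cast hj
    positivity
  have h := (((h0.add h1).add h2).sub h3).neg.mul (hden.inv₀ hj')
  have hlim : -(((((u + m + 1 - r) * (u + m + 1 - s) - 2 * ν * (u + m + 1)
      + 2 * ν * ((r + s) / 2)) * 0 - -(1 / 2) * (2 * (j : ℝ))) * a j
      + (2 * ν * (1 + (j + 1) * 0) - 2 * (j + 1)) * a (j + 1)
      + (1 / 16 * (2 * ν * ((2 - j) * 0 - 1) - 2 * (j - 1))) * a (j - 1))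
      - (u + m - r) * (u + m - s) * 0 * (b (j + 1) + -(1 / 2) * b j + 1 / 16 * b (j - 1)))
      * (2 * j : ℝ)⁻¹ = -(j * a j + (2 * ν - 2 * (j + 1)) * a (j + 1)
        - (ν + j - 1) / 8 * a (j - 1)) * (2 * j : ℝ)⁻¹ := by ring
  rw [← hlim]
  refine h.congr' ?_
  filter_upwards [eventually_gt_atTop 0] with H hH
  rw [blockA_succ_succ ν r s u H hH.ne']

/-- At large weight the only pole in u that can remain is at u = ν, in A_{1,0} and with a
coefficient proportional to rs; the second condition of `RegularPoint` excludes it. -/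
theorem blockA_one_rational {ν r s u₀ : ℝ} (hu : RegularPoint ν r s u₀) (j : ℤ) :
    RationalAt u₀ fun u H => blockA ν r s u H 1 j := by
  have hlin : ∀ c : ℝ, RationalAt u₀ fun u H => (1 + (c - u) * H⁻¹)⁻¹ := fun c => by
    refine RationalAt.inv (d := 1) ((RationalAt.const u₀ 1).add
      (((RationalAt.const u₀ c).sub (RationalAt.fst u₀)).mul (RationalAt.inv_snd u₀))) one_ne_zero ?_
    simpa using ((tendsto_fst.const_sub c).mul (tendsto_inv_snd u₀)).const_add 1
  have hlin' : ∀ c : ℝ, RationalAt u₀ fun u H => (1 + (u - c) * H⁻¹)⁻¹ := fun c => by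
    refine RationalAt.inv (d := 1) ((RationalAt.const u₀ 1).add
      (((RationalAt.fst u₀).sub (RationalAt.const u₀ c)).mul (RationalAt.inv_snd u₀))) one_ne_zero ?_
    simpa using ((tendsto_fst.sub_const c).mul (tendsto_inv_snd u₀)).const_add 1
  simp only [blockA]
  split_ifs with h1 h2 h3
  · refine (((RationalAt.const u₀ ν).mul ((RationalAt.const u₀ 1).sub
      ((RationalAt.fst u₀).mul (RationalAt.inv_snd u₀)))).mul (hlin (ν - 1))).congr ?_
    filter_upwards [eventually_snd_gt u₀ 0] with t ht
    have e1 : 1 + (ν - 1 - t.1) * t.2⁻¹ = (t.2 - t.1 + ν - 1) * t.2⁻¹ := by field_simp; ring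
    rw [e1, mul_inv, inv_inv, div_eq_mul_inv]
    field_simp
  · have h4 : RationalAt u₀ fun u H => (s + r - u) / 2 := by
      refine (((RationalAt.const u₀ (s + r)).sub (RationalAt.fst u₀)).const_mul (1 / 2)).congr
        (Eventually.of_forall fun t => by ring)
    refine h4.sub ?_
    by_cases hrs : r * s = 0
    · simpa [hrs] using RationalAt.const u₀ 0
    · have h5 : RationalAt u₀ fun u _ => (u - ν)⁻¹ :=
        RationalAt.inv (d := u₀ - ν) ((RationalAt.fst u₀).sub (RationalAt.const u₀ ν))
          (sub_ne_zero.2 (hu.2 hrs)) (tendsto_fst.sub_const ν)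
      have h6 : RationalAt u₀ fun u H => 1 + (ν - u * ν) * ((H + -1)⁻¹ * (H + 0)⁻¹) :=
        (RationalAt.const u₀ 1).add (((RationalAt.const u₀ ν).sub ((RationalAt.fst u₀).mul
          (RationalAt.const u₀ ν))).mul ((RationalAt.inv_add u₀ (-1)).mul (RationalAt.inv_add u₀ 0)))
      refine ((h6.mul h5).const_mul (r * s / 2)).congr ?_
      filter_upwards [eventually_snd_gt u₀ 1] with t ht
      have e1 : t.2 + -1 ≠ 0 := by linarith
      have e2 : t.2 + 0 ≠ 0 := by linarith
      have e3 : 1 + (ν - t.1 * ν) * ((t.2 + -1)⁻¹ * (t.2 + 0)⁻¹) =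
          (t.2 ^ 2 - t.2 - t.1 * ν + ν) * ((t.2 + -1)⁻¹ * (t.2 + 0)⁻¹) := by
        field_simp
        ring
      rw [e3, div_eq_mul_inv _ (2 * (t.2 - 1) * t.2 * (t.1 - ν)), mul_inv, mul_inv, mul_inv, add_zero,
        ← sub_eq_add_neg]
      ring
  · refine ((((RationalAt.const u₀ 1).add (((RationalAt.fst u₀).sub (RationalAt.const u₀ 1)).mul
      (RationalAt.inv_snd u₀))).mul (hlin' ν)).mul
      ((RationalAt.shiftGamma r s u₀ 0).const_mul ν)).congr ?_
    filter_upwards [eventually_snd_gt u₀ 1] with t ht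
    have e0 : t.2 ≠ 0 := by linarith
    have e1 : 1 + (t.1 - ν) * t.2⁻¹ = (t.1 + t.2 - ν) * t.2⁻¹ := by field_simp; ring
    have e2 : 1 + (t.1 - 1) * t.2⁻¹ = (t.1 + t.2 - 1) * t.2⁻¹ := by field_simp; ring
    have e3 : 2 * t.2 - 1 ≠ 0 := by linarith
    have e4 : 2 * t.2 + 1 ≠ 0 := by linarith
    have e5 : 4 * t.2 ^ 2 * (4 * t.2 ^ 2 - 1) = 4 * t.2 ^ 2 * (2 * t.2 - 1) * (2 * t.2 + 1) := by ring
    rw [e1, e2, mul_inv, inv_inv, shiftGamma, add_zero, e5,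
      div_eq_mul_inv _ (4 * t.2 ^ 2 * (2 * t.2 - 1) * (2 * t.2 + 1)),
      div_eq_mul_inv _ (4 * t.2 ^ 2 * (2 * t.2 - 1) * (2 * t.2 + 1) * (t.1 + t.2 - ν)),
      mul_inv _ (t.1 + t.2 - ν)]
    generalize (4 * t.2 ^ 2 * (2 * t.2 - 1) * (2 * t.2 + 1))⁻¹ = Z
    generalize (t.1 + t.2 - ν)⁻¹ = Y
    field_simp
    ring
  · exact RationalAt.const u₀ 0

theorem tendsto_div_add_add (a b : ℝ) : Tendsto (fun H : ℝ => (H + a) / (H + b)) atTop (𝓝 1) := by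
  simpa [div_eq_mul_inv] using tendsto_div_add a b

/-- The base of the symmetry: A_{1,-1} → ν and A_{1,1} → ν/16. -/
theorem blockA_one_symm (ν r s u : ℝ) (j : ℤ) : Tendsto (fun H => (16 : ℝ) ^ j *
    blockA ν r s u H 1 j - blockA ν r s u H 1 (-j)) atTop (𝓝 0) := by
  have h1 : Tendsto (fun H => blockA ν r s u H 1 (-1)) atTop (𝓝 ν) := by
    have := (tendsto_div_add_add (-u) (-u + ν - 1)).const_mul ν
    rw [mul_one] at this
    refine this.congr fun H => ?_
    simp only [blockA]
    rw [if_pos trivial, mul_div_assoc]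
    (congr 2; ring)
  have h2 : Tendsto (fun H => blockA ν r s u H 1 1) atTop (𝓝 (ν / 16)) := by
    have := ((tendsto_div_add_add (u - 1) (u - ν)).const_mul ν).mul (tendsto_shiftGamma r s 0)
    rw [mul_one, mul_one_div] at this
    refine this.congr fun H => ?_
    simp only [blockA, shiftGamma, add_zero]
    rw [if_neg (by decide), if_neg (by decide), if_pos trivial, mul_div_assoc' ν (H + (u - 1)), div_mul_div_comm]
    congr 1 <;> ring
  have h3 : ∀ i : ℤ, i ≠ 1 → i ≠ -1 → i ≠ 0 → ∀ H, blockA ν r s u H 1 i = 0 := by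
    intro i a1 a2 a3 H
    simp [blockA, a1, a2, a3]
  rcases eq_or_ne j 0 with rfl | hj0
  · simp
  rcases eq_or_ne j 1 with rfl | hj1
  · have := (h2.const_mul 16).sub h1
    rw [show 16 * (ν / 16) - ν = 0 by ring] at this
    simpa using this
  rcases eq_or_ne j (-1) with rfl | hj2
  · have := (h1.const_mul (1 / 16)).sub h2
    rw [show 1 / 16 * ν - ν / 16 = 0 by ring] at this
    simpa using this
  · have e : ∀ H, (16 : ℝ) ^ j * blockA ν r s u H 1 j - blockA ν r s u H 1 (-j) = 0 := fun H => by
      rw [h3 j hj1 hj2 hj0, h3 (-j) (by omega) (by omega) (by omega)]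
      simp
    simp [e]

/-- The block coefficients are regular rational functions at large weight; in the limit they are
symmetric under `j ↦ -j` up to a power of `16`, which makes the recursion regular on the diagonal. -/
theorem blockA_rational_and_symm {ν r s u₀ : ℝ} (hu : RegularPoint ν r s u₀) (m : ℕ) :
    ((∀ j, RationalAt u₀ fun u H => blockA ν r s u H m j) ∧
      ∀ j : ℤ, ∀ᶠ u in 𝓝 u₀, Tendsto (fun H => (16 : ℝ) ^ j * blockA ν r s u H m j
        - blockA ν r s u H m (-j)) atTop (𝓝 0)) ∧
    ((∀ j, RationalAt u₀ fun u H => blockA ν r s u H (m + 1) j) ∧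
      ∀ j : ℤ, ∀ᶠ u in 𝓝 u₀, Tendsto (fun H => (16 : ℝ) ^ j * blockA ν r s u H (m + 1) j
        - blockA ν r s u H (m + 1) (-j)) atTop (𝓝 0)) := by
  induction m with
  | zero =>
    refine ⟨⟨fun j => ?_, fun j => Eventually.of_forall fun u => ?_⟩, blockA_one_rational hu,
      fun j => Eventually.of_forall fun u => blockA_one_symm ν r s u j⟩
    · simp only [blockA]
      exact RationalAt.const u₀ _
    · rcases eq_or_ne j 0 with rfl | hj
      · simp
      · simp [blockA, hj]
  | succ m ih =>
    obtain ⟨⟨hB, -⟩, hA, hsymm⟩ := ih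
    refine ⟨⟨hA, hsymm⟩, fun j => ?_, fun j => ?_⟩
    · have hc := RationalAt.const u₀
      have hf := RationalAt.fst u₀
      have hw := RationalAt.inv_snd u₀
      have hκ : RationalAt u₀ fun u _ => (u + m + 1) * (u + m) - u * (u - 1) + 2 * ν * u :=
        ((((hf.add (hc m)).add (hc 1)).mul (hf.add (hc m))).sub (hf.mul (hf.sub (hc 1)))).add
          (hf.const_mul (2 * ν))
      have h1 : RationalAt u₀ fun u _ => (u + m + 1 - r) * (u + m + 1 - s) - 2 * ν * (u + m + 1) :=
        ((((hf.add (hc m)).add (hc 1)).sub (hc r)).mul (((hf.add (hc m)).add (hc 1)).sub (hc s))).sub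
          (((hf.add (hc m)).add (hc 1)).const_mul (2 * ν))
      have h2 : RationalAt u₀ fun u _ => (u + m - r) * (u + m - s) :=
        ((hf.add (hc m)).sub (hc r)).mul ((hf.add (hc m)).sub (hc s))
      have hd : RationalAt u₀ fun u _ => ((m : ℝ) + 2) * (2 * u + m + 1 - 2 * ν) :=
        ((((hf.const_mul 2).add (hc m)).add (hc 1)).sub (hc (2 * ν))).const_mul ((m : ℝ) + 2)
      rcases eq_or_ne j 0 with rfl | hj
      · have hβ := RationalAt.shiftBeta r s u₀ 0
        have hβ' := RationalAt.shiftBeta' r s u₀ 0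
        have hγ := RationalAt.shiftGamma r s u₀ (-1)
        -- The symmetry at j = 1 says 16 A_{m+1,1} - A_{m+1,-1} → 0, and γ → 1/16; so the bracket
        -- vanishes at 1/H = 0 and absorbs the factor H.
        have hcancel : RationalAt u₀ fun u H => H * (blockA ν r s u H (m + 1) 1
            - shiftGamma r s (H + (-1)) * blockA ν r s u H (m + 1) (-1)) := by
          refine ((hA 1).sub (hγ.mul (hA (-1)))).snd_mul ?_
          filter_upwards [hsymm 1, (hA (-1)).eventually_exists_tendsto] with u h3 ⟨d, h4⟩
          have h5 := (h3.const_mul (1 / 16)).add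
            (((tendsto_shiftGamma r s (-1)).const_sub (1 / 16)).mul h4)
          simp only [sub_self, mul_zero, zero_mul, add_zero] at h5
          refine h5.congr fun H => ?_
          rw [zpow_one]
          ring
        -- The diagonal denominator is nonzero at u₀ by the first condition of `RegularPoint` with q
        -- = m + 1.
        have hdinv : RationalAt u₀ fun u _ => (((m : ℝ) + 2) * (2 * u + m + 1 - 2 * ν))⁻¹ := by
          refine hd.inv (d := ((m : ℝ) + 2) * (2 * u₀ + m + 1 - 2 * ν)) (mul_ne_zero (by positivity)
            fun h => hu.1 (m + 1) (by omega) ?_) ?_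
          · push_cast; linarith
          · exact ((((tendsto_fst.const_mul 2).add_const (m : ℝ)).add_const 1).sub_const
              (2 * ν)).const_mul ((m : ℝ) + 2)
        refine RationalAt.congr (((((((((h1.add (hβ'.const_mul (2 * ν))).sub (hβ.mul hκ)).mul
          (hA 0)).add (hcancel.const_mul (2 * ν - 2))).add (((hc (2 * ν)).sub hκ).mul (hA 1))).add
          ((hγ.mul (((hc (4 * ν)).sub hκ).sub (hc 2))).mul (hA (-1)))).sub (h2.mul
          (((hB 1).add (hβ.mul (hB 0))).add (hγ.mul (hB (-1)))))).neg).mul hdinv)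
          (Eventually.of_forall fun t => (blockA_succ_succ_zero ν r s t.1 t.2 m).symm)
      · have hβ := RationalAt.shiftBeta r s u₀ j
        have hβ' := RationalAt.shiftBeta' r s u₀ j
        have hγ := RationalAt.shiftGamma r s u₀ (j - 1)
        have hE : ∀ i k : ℝ, RationalAt u₀ fun u H =>
            ((u + m + 1) * (u + m) - u * (u - 1) + 2 * ν * u) * H⁻¹ + 2 * i + k * H⁻¹ := fun i k =>
          ((hκ.mul hw).add (hc (2 * i))).add (hw.const_mul k)
        have hdinv : RationalAt u₀ fun u H =>
            ((((m : ℝ) + 2) * (2 * u + m + 1 - 2 * ν) + j * (j - 1)) * H⁻¹ + 2 * j)⁻¹ := by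
          refine (((hd.add (hc (j * (j - 1)))).mul hw).add (hc (2 * j))).inv (d := 2 * j)
            (by simpa using hj) ?_
          have := ((((((tendsto_fst (f := 𝓝 u₀) (g := (atTop : Filter ℝ))).const_mul 2).add_const
            (m : ℝ)).add_const 1).sub_const (2 * ν)).const_mul ((m : ℝ) + 2)).add_const
            ((j : ℝ) * (j - 1))
          simpa using (this.mul (tendsto_inv_snd u₀)).add_const (2 * (j : ℝ))
        refine RationalAt.congr ((((((((h1.add (hβ'.const_mul (2 * ν))).mul hw).sub
          (hβ.mul (hE j (j * (j - 1))))).mul (hA j)).add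
          (((((hc 1).add (hw.const_mul ((j : ℝ) + 1))).const_mul (2 * ν)).sub
            (hE (j + 1) ((j + 1) * j))).mul (hA (j + 1)))).add
          ((hγ.mul ((((hw.const_mul (2 - (j : ℝ))).sub (hc 1)).const_mul (2 * ν)).sub
            (hE (j - 1) ((j - 1) * (j - 2))))).mul (hA (j - 1)))).sub
          ((h2.mul hw).mul (((hB (j + 1)).add (hβ.mul (hB j))).add (hγ.mul (hB (j - 1)))))).neg.mul
          hdinv) ?_
        filter_upwards [eventually_snd_gt u₀ 0] with t ht
        rw [blockA_succ_succ ν r s t.1 t.2 ht.ne']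
    · rcases eq_or_ne j 0 with rfl | hj
      · simp
      have h1 := ((Finset.Icc (-|j| - 1) (|j| + 1)).eventually_all).2 fun i _ =>
        (hA i).eventually_exists_tendsto
      have h2 := ((Finset.Icc (-|j| - 1) (|j| + 1)).eventually_all).2 fun i _ =>
        (hB i).eventually_exists_tendsto
      have h3 := ((Finset.Icc (-|j| - 1) (|j| + 1)).eventually_all).2 fun i _ => hsymm i
      filter_upwards [h1, h2, h3] with u h1 h2 h3
      choose! a ha using h1
      choose! b hb using h2
      have hmem : ∀ i k : ℤ, |k| = |j| → |i - k| ≤ 1 → i ∈ Finset.Icc (-|j| - 1) (|j| + 1) := by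
        intro i k hk hi
        have h4 := abs_le.1 hi
        have h5 := abs_le.1 hk.le
        rw [Finset.mem_Icc]
        omega
      -- Under j ↦ -j the limiting recursion exchanges the roles of its j+1 and j-1 terms, and the
      -- powers of 16 match their coefficients; so the symmetry of level m+1 passes to level m+2.
      have hs : ∀ i : ℤ, |i - j| ≤ 1 → (16 : ℝ) ^ i * a i = a (-i) := by
        intro i hi
        have hi' := hmem i j rfl hi
        have hi'' := hmem (-i) (-j) (abs_neg j) (by rw [← abs_neg]; simpa [sub_eq_add_neg, add_comm] using hi)
        have := tendsto_nhds_unique (h3 i hi') (((ha i hi').const_mul _).sub (ha (-i) hi''))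
        linarith
      have t1 := blockA_succ_succ_tendsto hj (fun i hi => ha i (hmem i j rfl hi))
        (fun i hi => hb i (hmem i j rfl hi))
      have t2 := blockA_succ_succ_tendsto (neg_ne_zero.2 hj)
        (fun i hi => ha i (hmem i (-j) (abs_neg j) hi))
        (fun i hi => hb i (hmem i (-j) (abs_neg j) hi))
      have h := (t1.const_mul ((16 : ℝ) ^ j)).sub t2
      have e0 := hs j (by simp)
      have e1 := hs (j + 1) (by simp)
      have e2 := hs (j - 1) (by simp)
      rw [show -(j + 1) = -j - 1 by ring, zpow_add₀ (by norm_num), zpow_one] at e1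
      rw [show -(j - 1) = -j + 1 by ring, zpow_sub₀ (by norm_num), zpow_one] at e2
      have hz : (16 : ℝ) ^ j * (-(j * a j + (2 * ν - 2 * (j + 1)) * a (j + 1)
          - (ν + j - 1) / 8 * a (j - 1)) * (2 * j : ℝ)⁻¹) - (-(((-j : ℤ) : ℝ) * a (-j)
          + (2 * ν - 2 * (((-j : ℤ) : ℝ) + 1)) * a (-j + 1)
          - (ν + ((-j : ℤ) : ℝ) - 1) / 8 * a (-j - 1)) * (2 * ((-j : ℤ) : ℝ))⁻¹) = 0 := by
        have hj' : (j : ℝ) ≠ 0 := by exact_mod_cast hj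
        rw [← e0, ← e1, ← e2]
        push_cast
        field_simp
        ring
      rw [hz] at h
      exact h

theorem blockA_rational {ν r s u₀ : ℝ} (hu : RegularPoint ν r s u₀) (m : ℕ) (j : ℤ) :
    RationalAt u₀ fun u H => blockA ν r s u H m j :=
  (blockA_rational_and_symm hu m).1.1 j

/-! ### Uniform smoothness and Taylor expansion in the twist. -/

open Polynomial in
theorem Expandable.evalPair {h : ℝ → ℝ} (hh : Expandable h) (p : ℝ[X][X]) :
    Expandable fun H => evalPair p (h H) H⁻¹ := by
  induction p using Polynomial.induction_on' with
  | add p q hp hq => simpa [Lightcone.evalPair] using hp.add hq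
  | monomial n a =>
    simp only [Lightcone.evalPair, coe_eval₂RingHom, eval₂_monomial, coe_evalRingHom]
    refine Expandable.mul ?_ (hh.pow n)
    simp only [eval_eq_sum_range]
    exact Expandable.sum fun i _ => (Expandable.inv_id.pow i).const_mul (a.coeff i)

theorem RationalAt.expandable {u₀ : ℝ} {f : ℝ → ℝ → ℝ} (hf : RationalAt u₀ f) {h : ℝ → ℝ}
    (hh : Expandable h) (hlim : Tendsto h atTop (𝓝 u₀)) : Expandable fun H => f (h H) H := by
  obtain ⟨N, D, hD, h1⟩ := hf
  have ht : Tendsto (fun H => (h H, H)) atTop (𝓝 u₀ ×ˢ atTop) := hlim.prodMk tendsto_id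
  have hDt : Tendsto (fun H => evalPair D (h H) H⁻¹) atTop (𝓝 (evalPair D u₀ 0)) := by
    have := (tendsto_evalPair D u₀).comp ht
    simpa only [Function.comp_def] using this
  have hN' : Expandable fun H => evalPair N (h H) H⁻¹ := Expandable.evalPair hh N
  have hD' : Expandable fun H => evalPair D (h H) H⁻¹ := Expandable.evalPair hh D
  generalize evalPair D u₀ 0 = d at hD hDt
  have hD'' := hD'.inv hD hDt
  have he : ∀ᶠ H in atTop, f (h H) H = evalPair N (h H) H⁻¹ / evalPair D (h H) H⁻¹ :=
    ht.eventually h1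
  refine (hN'.mul hD'').congr' ?_
  filter_upwards [he] with H hH
  rw [hH, div_eq_mul_inv]

/-- `f u H` is, for `u` near `u₀` and `H` large, `n` times differentiable in `u` with bounded
derivatives. -/
@[reducible] def UniformlySmooth (u₀ : ℝ) : ℕ → (ℝ → ℝ → ℝ) → Prop
  | 0, f => (fun t : ℝ × ℝ => f t.1 t.2) =O[𝓝 u₀ ×ˢ atTop] fun _ => (1 : ℝ)
  | n + 1, f => ((fun t : ℝ × ℝ => f t.1 t.2) =O[𝓝 u₀ ×ˢ atTop] fun _ => (1 : ℝ)) ∧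
      ∃ f', UniformlySmooth u₀ n f' ∧
        ∀ᶠ t : ℝ × ℝ in 𝓝 u₀ ×ˢ atTop, HasDerivAt (fun u => f u t.2) (f' t.1 t.2) t.1

namespace UniformlySmooth

variable {u₀ : ℝ}

theorem of_succ : ∀ {n : ℕ} {f : ℝ → ℝ → ℝ}, UniformlySmooth u₀ (n + 1) f → UniformlySmooth u₀ n f
  | 0, _, h => h.1
  | _ + 1, _, ⟨h, f', hf', hd⟩ => ⟨h, f', of_succ hf', hd⟩

theorem add : ∀ {n : ℕ} {f g : ℝ → ℝ → ℝ}, UniformlySmooth u₀ n f → UniformlySmooth u₀ n g →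
    UniformlySmooth u₀ n fun u H => f u H + g u H
  | 0, _, _, hf, hg => IsBigO.add hf hg
  | _ + 1, _, _, ⟨hf, f', hf', hfd⟩, ⟨hg, g', hg', hgd⟩ =>
    ⟨hf.add hg, fun u H => f' u H + g' u H, hf'.add hg', by
      filter_upwards [hfd, hgd] with t h1 h2 using h1.fun_add h2⟩

theorem mul : ∀ {n : ℕ} {f g : ℝ → ℝ → ℝ}, UniformlySmooth u₀ n f → UniformlySmooth u₀ n g →
    UniformlySmooth u₀ n fun u H => f u H * g u H
  | 0, _, _, hf, hg => by simpa using IsBigO.mul hf hg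
  | _ + 1, f, g, ⟨hf, f', hf', hfd⟩, ⟨hg, g', hg', hgd⟩ =>
    ⟨by simpa using hf.mul hg, fun u H => f' u H * g u H + f u H * g' u H,
      (hf'.mul (of_succ ⟨hg, g', hg', hgd⟩)).add ((of_succ ⟨hf, f', hf', hfd⟩).mul hg'), by
      filter_upwards [hfd, hgd] with t h1 h2 using h1.fun_mul h2⟩

theorem const (n : ℕ) (c : ℝ) : UniformlySmooth u₀ n fun _ _ => c := by
  induction n generalizing c with
  | zero => exact isBigO_const_const _ one_ne_zero _
  | succ n ih => exact ⟨isBigO_const_const _ one_ne_zero _, fun _ _ => 0, ih 0,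
      Eventually.of_forall fun t => hasDerivAt_const _ _⟩

theorem neg {n : ℕ} {f : ℝ → ℝ → ℝ} (hf : UniformlySmooth u₀ n f) :
    UniformlySmooth u₀ n fun u H => -f u H := by
  simpa using (const n (-1)).mul hf

theorem sum {ι : Type*} {n : ℕ} (S : Finset ι) {f : ι → ℝ → ℝ → ℝ}
    (h : ∀ i ∈ S, UniformlySmooth u₀ n (f i)) :
    UniformlySmooth u₀ n fun u H => ∑ i ∈ S, f i u H := by
  classical
  induction S using Finset.induction_on with
  | empty => simpa using const (u₀ := u₀) n 0
  | insert i S hi ih =>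
    simp only [Finset.sum_insert hi]
    exact (h i (by simp)).add (ih fun j hj => h j (by simp [hj]))

theorem of_rational (n : ℕ) {f : ℝ → ℝ → ℝ} (hf : RationalAt u₀ f) : UniformlySmooth u₀ n f := by
  have h0 : ∀ {f : ℝ → ℝ → ℝ}, RationalAt u₀ f →
      (fun t : ℝ × ℝ => f t.1 t.2) =O[𝓝 u₀ ×ˢ atTop] fun _ => (1 : ℝ) := fun hf => by
    obtain ⟨d, hd⟩ := hf.exists_tendsto
    exact hd.isBigO_one ℝ
  induction n generalizing f with
  | zero => exact h0 hf
  | succ n ih =>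
    obtain ⟨f', hf', hd⟩ := hf.exists_deriv
    exact ⟨h0 hf, f', ih hf', hd⟩

theorem const_rpow (n : ℕ) {b : ℝ} (hb : 0 < b) (c : ℝ) :
    UniformlySmooth u₀ n fun u _ => b ^ (u + c) := by
  have h0 : (fun t : ℝ × ℝ => b ^ (t.1 + c)) =O[𝓝 u₀ ×ˢ (atTop : Filter ℝ)] fun _ => (1 : ℝ) :=
    ((Real.continuous_const_rpow hb.ne').tendsto _ |>.comp
      (tendsto_fst.add_const c)).isBigO_one ℝ
  induction n with
  | zero => exact h0
  | succ n ih =>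
    refine ⟨h0, fun u _ => b ^ (u + c) * Real.log b, ih.mul (const n _),
      Eventually.of_forall fun t => ?_⟩
    have := ((hasDerivAt_id t.1).add_const c).const_rpow hb
    simpa [mul_comm] using this

theorem comp_snd {n : ℕ} {f : ℝ → ℝ → ℝ} (hf : UniformlySmooth u₀ n f) (j : ℝ) :
    UniformlySmooth u₀ n fun u H => f u (H - j) := by
  have ht : Tendsto (fun t : ℝ × ℝ => (t.1, t.2 - j)) (𝓝 u₀ ×ˢ atTop) (𝓝 u₀ ×ˢ atTop) := by
    refine tendsto_fst.prodMk ?_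
    exact (tendsto_atTop_add_const_right _ (-j) tendsto_id).comp tendsto_snd
  induction n generalizing f with
  | zero => exact IsBigO.comp_tendsto hf ht
  | succ n ih =>
    obtain ⟨h0, f', hf', hd⟩ := hf
    exact ⟨h0.comp_tendsto ht, fun u H => f' u (H - j), ih hf', ht.eventually hd⟩

theorem comp_fst {n : ℕ} {f : ℝ → ℝ → ℝ} {c : ℝ} (hf : UniformlySmooth (u₀ + c) n f) :
    UniformlySmooth u₀ n fun u H => f (u + c) H := by
  have ht : Tendsto (fun t : ℝ × ℝ => (t.1 + c, t.2)) (𝓝 u₀ ×ˢ atTop) (𝓝 (u₀ + c) ×ˢ atTop) :=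
    (tendsto_fst.add_const c).prodMk tendsto_snd
  induction n generalizing f with
  | zero => exact IsBigO.comp_tendsto hf ht
  | succ n ih =>
    obtain ⟨h0, f', hf', hd⟩ := hf
    refine ⟨h0.comp_tendsto ht, fun u H => f' (u + c) H, ih hf', ?_⟩
    filter_upwards [ht.eventually hd] with t h1
    exact h1.comp_add_const t.1 c

theorem exists_seq : ∀ {n : ℕ} {f : ℝ → ℝ → ℝ}, UniformlySmooth u₀ n f →
    ∃ F : ℕ → ℝ → ℝ → ℝ, F 0 = f ∧
      (∀ k ≤ n, (fun t : ℝ × ℝ => F k t.1 t.2) =O[𝓝 u₀ ×ˢ atTop] fun _ => (1 : ℝ)) ∧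
      ∀ k < n, ∀ᶠ t : ℝ × ℝ in 𝓝 u₀ ×ˢ atTop,
        HasDerivAt (fun u => F k u t.2) (F (k + 1) t.1 t.2) t.1
  | 0, f, h => ⟨fun _ => f, rfl, fun _ _ => h, fun k hk => by omega⟩
  | n + 1, f, ⟨h, f', hf', hd⟩ => by
    obtain ⟨F, rfl, h1, h2⟩ := hf'.exists_seq
    refine ⟨fun k => Nat.casesOn k f F, rfl, fun k hk => ?_, fun k hk => ?_⟩
    · cases k with
      | zero => exact h
      | succ k => exact h1 k (by omega)
    · cases k with
      | zero => exact hd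
      | succ k => exact h2 k (by omega)

end UniformlySmooth

theorem iteratedDeriv_eq_of_chain {G : ℕ → ℝ → ℝ} {u₀ : ℝ} {K : ℕ}
    (h : ∀ k < K, ∀ᶠ u in 𝓝 u₀, HasDerivAt (G k) (G (k + 1) u) u) :
    ∀ k ≤ K, ∀ᶠ u in 𝓝 u₀, iteratedDeriv k (G 0) u = G k u := by
  intro k hk
  induction k with
  | zero => simp
  | succ k ih =>
    filter_upwards [(ih (by omega)).eventually_nhds, h k (by omega)] with u h1 h2
    rw [iteratedDeriv_succ, EventuallyEq.deriv_eq h1]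
    exact h2.deriv

/-- Taylor's formula, uniformly in the parameter. -/
theorem taylor_bound {u₀ : ℝ} {K : ℕ} {F : ℕ → ℝ → ℝ → ℝ}
    (hb : ∀ k ≤ K, (fun t : ℝ × ℝ => F k t.1 t.2) =O[𝓝 u₀ ×ˢ atTop] fun _ => (1 : ℝ))
    (hd : ∀ k < K, ∀ᶠ t : ℝ × ℝ in 𝓝 u₀ ×ˢ atTop,
      HasDerivAt (fun u => F k u t.2) (F (k + 1) t.1 t.2) t.1) :
    (fun t : ℝ × ℝ => F 0 t.1 t.2 - ∑ k ∈ Finset.range K,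
      F k u₀ t.2 * ((t.1 - u₀) ^ k / k.factorial)) =O[𝓝 u₀ ×ˢ atTop]
      fun t : ℝ × ℝ => (t.1 - u₀) ^ K := by
  induction K generalizing F with
  | zero => simpa using hb 0 le_rfl
  | succ K ih =>
    obtain ⟨C, hC⟩ := (ih (F := fun k => F (k + 1)) (fun k hk => hb (k + 1) (by omega))
      (fun k hk => hd (k + 1) (by omega))).bound
    obtain ⟨pa, ha, pb, hpb, hab⟩ := Filter.eventually_prod_iff.1 (hC.and (hd 0 (by omega)))
    obtain ⟨ρ, hρ, hball⟩ := Metric.eventually_nhds_iff_ball.1 ha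
    refine IsBigO.of_bound C (Filter.eventually_prod_iff.2 ⟨_, Metric.ball_mem_nhds u₀ hρ, pb, hpb,
      fun {u} hu {H} hH => ?_⟩)
    have hseg : ∀ v ∈ Set.uIcc u₀ u, |v - u₀| ≤ |u - u₀| := fun v hv => Set.abs_sub_left_of_mem_uIcc hv
    have hub : |u - u₀| < ρ := by simpa [Real.dist_eq] using hu
    have hmem : ∀ v ∈ Set.uIcc u₀ u, pa v := fun v hv => hball v (by
      rw [Metric.mem_ball, Real.dist_eq]
      exact (hseg v hv).trans_lt hub)
    have hC0 : 0 ≤ C * |u - u₀| ^ K := by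
      have := (norm_nonneg _).trans (hab (hmem u Set.right_mem_uIcc) hH).1
      simpa using this
    -- The derivative of the remainder of order K+1 is the remainder of order K for the shifted
    -- sequence, bounded along the whole segment by its bound at the endpoint u.
    have key := (convex_uIcc u₀ u).norm_image_sub_le_of_norm_hasDerivWithin_le
      (𝕜 := ℝ) (f := fun v => F 0 v H - ∑ k ∈ Finset.range (K + 1),
        F k u₀ H * ((v - u₀) ^ k / k.factorial))
      (f' := fun v => F 1 v H - ∑ k ∈ Finset.range K,
        F (k + 1) u₀ H * ((v - u₀) ^ k / k.factorial)) (C := C * |u - u₀| ^ K) (fun v hv => ?_)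
      (fun v hv => ?_) Set.left_mem_uIcc Set.right_mem_uIcc
    · beta_reduce at key
      have e0 : F 0 u₀ H - ∑ k ∈ Finset.range (K + 1),
          F k u₀ H * ((u₀ - u₀) ^ k / k.factorial) = 0 := by
        rw [Finset.sum_range_succ']
        simp
      rw [e0, sub_zero] at key
      refine key.trans (le_of_eq ?_)
      rw [Real.norm_eq_abs, norm_pow, Real.norm_eq_abs, mul_assoc, ← pow_succ]
    · refine HasDerivAt.hasDerivWithinAt ((hab (hmem v hv) hH).2.fun_sub ?_)
      simp only [Finset.sum_range_succ' _ K, pow_zero]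
      refine (HasDerivAt.fun_sum (𝕜 := ℝ) (u := Finset.range K)
        (A' := fun k => F (k + 1) u₀ H * ((v - u₀) ^ k / k.factorial)) fun k _ => ?_).add_const _
      have h1 := ((((hasDerivAt_id v).sub_const u₀).fun_pow (k + 1)).div_const
        ((k + 1).factorial : ℝ)).const_mul (F (k + 1) u₀ H)
      refine h1.congr_deriv ?_
      simp only [id, Nat.add_sub_cancel, mul_one, Nat.factorial_succ]
      push_cast
      have : (k.factorial : ℝ) ≠ 0 := by positivity
      field_simp
    · have h1 := (hab (hmem v hv) hH).1
      refine h1.trans ?_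
      rw [norm_pow, Real.norm_eq_abs]
      -- The constant C comes without a sign; it is nonnegative unless the power multiplying it
      -- vanishes.
      have hC1 : 0 ≤ C ∨ |u - u₀| ^ K = 0 := by
        by_contra! hcon
        have : 0 < |u - u₀| ^ K := lt_of_le_of_ne (by positivity) (Ne.symm hcon.2)
        nlinarith
      rcases hC1 with hC1 | hC1
      · exact mul_le_mul_of_nonneg_left (pow_le_pow_left₀ (abs_nonneg _) (hseg v hv) K) hC1
      · have h2 : |v - u₀| ^ K ≤ |u - u₀| ^ K := pow_le_pow_left₀ (abs_nonneg _) (hseg v hv) K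
        have h3 : |v - u₀| ^ K = 0 := le_antisymm (hC1 ▸ h2) (by positivity)
        rw [h3, hC1]

/-- The action `g ↦ ∑_j A_{m,j}(u, H-j) g(H-j)` of the level-`m` block coefficients. -/
noncomputable def blockOp (ν r s u : ℝ) (m : ℕ) : Module.End ℝ (ℝ → ℝ) where
  toFun g H := ∑ j ∈ Finset.Icc (-(m : ℤ)) m, blockA ν r s u (H - j) m j * g (H - j)
  map_add' f g := by
    ext H
    simp [mul_add, Finset.sum_add_distrib]
  map_smul' c g := by
    ext H
    simp [Finset.mul_sum, mul_left_comm]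

/-- The operator that produces the coefficients `C^{(n)}` from `C^{(0)}`. -/
noncomputable def coeffOp (ν r s u : ℝ) : ℕ → Module.End ℝ (ℝ → ℝ)
  | 0 => 1
  | n + 1 => -∑ i : Fin (n + 1), blockOp ν r s (u + (i : ℕ)) (n + 1 - i) * coeffOp ν r s u i
  termination_by n => n
  decreasing_by exact i.2

/-! ### The descendant operators and their two-sided inverse. -/

theorem blockOp_zero (ν r s u : ℝ) : blockOp ν r s u 0 = 1 := by
  ext g H
  simp [blockOp, blockA]

/-- The recursion is linear in C^{(0)} = S_a. Separating the operator from its argument isolates the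
dependence on a and turns the inversion into a statement about compositions of operators. -/
theorem coeffC_eq_coeffOp (ν r s a u : ℝ) (n : ℕ) (H : ℝ) :
    coeffC ν r s a u n H = coeffOp ν r s u n (sl2Coeff r s a) H := by
  induction n using Nat.strong_induction_on generalizing H with
  | _ n ih =>
    cases n with
    | zero => rw [coeffC, coeffOp]; rfl
    | succ n =>
      rw [coeffC, coeffOp]
      simp only [LinearMap.neg_apply, LinearMap.sum_apply, Module.End.mul_apply, Pi.neg_apply,
        Finset.sum_apply]
      congr 1
      refine Finset.sum_congr rfl fun i _ => ?_
      simp only [blockOp, LinearMap.coe_mk, AddHom.coe_mk]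
      refine Finset.sum_congr rfl fun j _ => ?_
      rw [ih i i.2, mul_comm]

/-- The defining recursion, read as a one-sided inversion. Level i raises the twist by i, whence the
shift of u. -/
theorem sum_blockOp_mul_coeffOp (ν r s u : ℝ) (n : ℕ) :
    ∑ i ∈ Finset.range (n + 1), blockOp ν r s (u + i) (n - i) * coeffOp ν r s u i =
      if n = 0 then 1 else 0 := by
  cases n with
  | zero => simp [blockOp_zero, coeffOp]
  | succ n =>
    rw [Finset.sum_range_succ, Nat.sub_self, blockOp_zero, one_mul, coeffOp.eq_2,
      Finset.sum_range fun i => blockOp ν r s (u + i) (n + 1 - i) * coeffOp ν r s u i]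
    simp

/-- The operators `coeffOp` are also inverse to `blockOp` on the other side. -/
theorem sum_coeffOp_mul_blockOp (ν r s u : ℝ) (n : ℕ) :
    ∑ m ∈ Finset.range (n + 1), coeffOp ν r s (u + m) (n - m) * blockOp ν r s u m =
      if n = 0 then 1 else 0 := by
  induction n using Nat.strong_induction_on with
  | _ n ih =>
    -- Associativity: A(CA) = (AC)A = A. The inner sums CA of level below n are known by induction,
    -- and the top one is then determined.
    have h1 : ∑ i ∈ Finset.range (n + 1), blockOp ν r s (u + i) (n - i) *
        (∑ m ∈ Finset.range (i + 1), coeffOp ν r s (u + m) (i - m) * blockOp ν r s u m) =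
        blockOp ν r s u n := by
      have h2 := Finset.sum_range_diag_flip (n + 1) fun m d =>
        blockOp ν r s (u + (m + d : ℕ)) (n - (m + d)) * (coeffOp ν r s (u + m) d * blockOp ν r s u m)
      have h3 : ∀ m ∈ Finset.range (n + 1), ∑ d ∈ Finset.range (n + 1 - m),
          blockOp ν r s (u + (m + d : ℕ)) (n - (m + d)) *
            (coeffOp ν r s (u + m) d * blockOp ν r s u m) =
          if m = n then blockOp ν r s u m else 0 := by
        intro m hm
        have hmn : m ≤ n := by simpa [Nat.lt_succ_iff] using hm
        have h4 := sum_blockOp_mul_coeffOp ν r s (u + m) (n - m)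
        rw [show n + 1 - m = n - m + 1 by omega]
        simp only [← mul_assoc]
        rw [← Finset.sum_mul]
        have e : ∀ d, blockOp ν r s (u + (m + d : ℕ)) (n - (m + d)) =
            blockOp ν r s (u + m + d) (n - m - d) := fun d => by
          rw [Nat.cast_add, add_assoc, Nat.sub_sub]
        simp only [e, h4]
        by_cases hmn' : m = n
        · simp [hmn']
        · rw [if_neg (by omega), if_neg hmn', zero_mul]
      rw [Finset.sum_congr rfl h3, Finset.sum_ite_eq' (Finset.range (n + 1)) n, if_pos (by simp)] at h2
      rw [← h2]
      refine Finset.sum_congr rfl fun i _ => ?_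
      rw [Finset.mul_sum]
      refine Finset.sum_congr rfl fun m hm => ?_
      have hmi : m ≤ i := by simpa [Nat.lt_succ_iff] using hm
      rw [Nat.add_sub_cancel' hmi]
    rw [Finset.sum_range_succ, Nat.sub_self, blockOp_zero, one_mul] at h1
    have h5 : ∑ i ∈ Finset.range n, blockOp ν r s (u + i) (n - i) *
        (∑ m ∈ Finset.range (i + 1), coeffOp ν r s (u + m) (i - m) * blockOp ν r s u m) =
        if n = 0 then 0 else blockOp ν r s u n := by
      rw [Finset.sum_congr rfl fun i hi => by rw [ih i (Finset.mem_range.1 hi)]]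
      cases n with
      | zero => simp
      | succ n =>
        rw [Finset.sum_eq_single_of_mem 0 (by simp) fun i _ hi => by simp [hi]]
        simp
    rw [h5] at h1
    split_ifs at h1 ⊢ with h0
    · subst h0
      simpa [blockOp_zero] using h1
    · simpa using h1

/-- The kernel of `coeffOp`. -/
noncomputable def coeffKernel (ν r s : ℝ) : ℕ → ℤ → ℝ → ℝ → ℝ
  | 0, J, _, _ => if J = 0 then 1 else 0
  | n + 1, J, u, H => -∑ i : Fin (n + 1),
      ∑ j ∈ Finset.Icc (-((n + 1 - i : ℕ) : ℤ)) ((n + 1 - i : ℕ) : ℤ),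
        coeffKernel ν r s i (J - j) u (H - j) * blockA ν r s (u + (i : ℕ)) (H - j) (n + 1 - i) j
  termination_by n => n
  decreasing_by exact i.2

theorem coeffKernel_eq_zero (ν r s : ℝ) (n : ℕ) {J : ℤ} (hJ : J ∉ Finset.Icc (-(n : ℤ)) n)
    (u H : ℝ) : coeffKernel ν r s n J u H = 0 := by
  induction n using Nat.strong_induction_on generalizing J H with
  | _ n ih =>
    cases n with
    | zero =>
      rw [coeffKernel, if_neg]
      rintro rfl
      simp at hJ
    | succ n =>
      rw [coeffKernel, neg_eq_zero]
      refine Finset.sum_eq_zero fun i _ => Finset.sum_eq_zero fun j hj => ?_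
      rw [ih i i.2, zero_mul]
      rw [Finset.mem_Icc] at hJ hj ⊢
      have := i.2
      omega

theorem sum_Icc_eq_sum_Icc_sub {f : ℤ → ℝ} {a : ℕ} (hf : ∀ J ∉ Finset.Icc (-(a : ℤ)) a, f J = 0)
    {j : ℤ} {M : ℕ} (h : |j| + a ≤ M) :
    ∑ J ∈ Finset.Icc (-(M : ℤ)) M, f (J - j) = ∑ J ∈ Finset.Icc (-(a : ℤ)) a, f J := by
  have hj := abs_le.1 (show |j| ≤ M - a by linarith)
  rw [← Finset.sum_subset (s₁ := Finset.Icc (-(a : ℤ) + j) (a + j))]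
  · refine Finset.sum_nbij' (fun J => J - j) (fun J => J + j) ?_ ?_ ?_ ?_ ?_
    · intro J hJ; simp only [Finset.mem_Icc] at hJ ⊢; omega
    · intro J hJ; simp only [Finset.mem_Icc] at hJ ⊢; omega
    · intro J _; simp
    · intro J _; simp
    · intro J _; rfl
  · intro J hJ; simp only [Finset.mem_Icc] at hJ ⊢; omega
  · intro J _ hJ
    refine hf _ ?_
    simp only [Finset.mem_Icc] at hJ ⊢
    omega

theorem coeffOp_apply (ν r s u : ℝ) (n : ℕ) (g : ℝ → ℝ) (H : ℝ) :
    coeffOp ν r s u n g H =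
      ∑ J ∈ Finset.Icc (-(n : ℤ)) n, coeffKernel ν r s n J u H * g (H - J) := by
  induction n using Nat.strong_induction_on generalizing H with
  | _ n ih =>
    cases n with
    | zero => simp [coeffOp, coeffKernel]
    | succ n =>
      rw [coeffOp]
      simp only [LinearMap.neg_apply, LinearMap.sum_apply, Module.End.mul_apply, Pi.neg_apply,
        Finset.sum_apply]
      simp only [coeffKernel, neg_mul, Finset.sum_neg_distrib, Finset.sum_mul]
      rw [Finset.sum_comm]
      congr 1
      refine Finset.sum_congr rfl fun i _ => ?_
      rw [Finset.sum_comm]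
      simp only [blockOp, LinearMap.coe_mk, AddHom.coe_mk]
      refine Finset.sum_congr rfl fun j hj => ?_
      rw [ih i i.2, Finset.mul_sum]
      rw [← sum_Icc_eq_sum_Icc_sub (j := j) (M := n + 1)]
      · refine Finset.sum_congr rfl fun J _ => ?_
        rw [show H - (j : ℝ) - ((J - j : ℤ) : ℝ) = H - J by push_cast; ring]
        ring
      · intro J hJ
        rw [coeffKernel_eq_zero ν r s i hJ]
        ring
      · rw [Finset.mem_Icc] at hj
        have h1 := i.2
        have := abs_le.2 hj
        omega

theorem sum_Icc_convolve (f : ℤ → ℤ → ℝ) (a b : ℕ) :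
    ∑ J ∈ Finset.Icc (-(a : ℤ)) a, ∑ j ∈ Finset.Icc (-(b : ℤ)) b, f J (J + j) =
      ∑ K ∈ Finset.Icc (-((a + b : ℕ) : ℤ)) ((a + b : ℕ) : ℤ), ∑ J ∈ Finset.Icc (-(a : ℤ)) a,
        if K - J ∈ Finset.Icc (-(b : ℤ)) b then f J K else 0 := by
  rw [Finset.sum_comm (s := Finset.Icc (-((a + b : ℕ) : ℤ)) ((a + b : ℕ) : ℤ))]
  refine Finset.sum_congr rfl fun J hJ => ?_
  rw [← Finset.sum_filter]
  refine Finset.sum_nbij' (fun j => J + j) (fun K => K - J) ?_ ?_ ?_ ?_ ?_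
  · intro j hj; simp only [Finset.mem_Icc, Finset.mem_filter] at hJ hj ⊢; omega
  · intro K hK; simp only [Finset.mem_Icc, Finset.mem_filter] at hK ⊢; omega
  · intro j _; simp
  · intro K _; simp
  · intro j _; rfl

/-- The operator identity, evaluated at H on the indicator function of the point H - K, isolates the
coefficient of the total shift K. -/
theorem sum_coeffKernel_mul_blockA (ν r s u H : ℝ) (n : ℕ) (K : ℤ) :
    ∑ m ∈ Finset.range (n + 1), ∑ J ∈ Finset.Icc (-((n - m : ℕ) : ℤ)) ((n - m : ℕ) : ℤ),
      (if K - J ∈ Finset.Icc (-(m : ℤ)) m then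
        coeffKernel ν r s (n - m) J (u + m) H * blockA ν r s u (H - K) m (K - J) else 0) =
      if n = 0 ∧ K = 0 then 1 else 0 := by
  have h := congrArg (fun T : Module.End ℝ (ℝ → ℝ) => T (fun x => if x = H - K then 1 else 0) H)
    (sum_coeffOp_mul_blockOp ν r s u n)
  simp only [LinearMap.sum_apply, Finset.sum_apply, Module.End.mul_apply] at h
  have e : (if n = 0 then (1 : Module.End ℝ (ℝ → ℝ)) else 0) (fun x => if x = H - K then 1 else 0) H
      = if n = 0 ∧ K = 0 then 1 else 0 := by
    have hHK : H = H - K ↔ K = 0 := by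
      rw [eq_comm, sub_eq_self, Int.cast_eq_zero]
    by_cases hn : n = 0 <;> simp [hn, hHK]
  rw [e] at h
  rw [← h]
  refine Finset.sum_congr rfl fun m _ => ?_
  rw [coeffOp_apply]
  refine Finset.sum_congr rfl fun J _ => ?_
  simp only [blockOp, LinearMap.coe_mk, AddHom.coe_mk]
  have e1 : ∀ j : ℤ, (if H - (J : ℝ) - (j : ℝ) = H - (K : ℝ) then (1 : ℝ) else 0) =
      if j = K - J then 1 else 0 := fun j => by
    have : H - (J : ℝ) - (j : ℝ) = H - (K : ℝ) ↔ j = K - J := by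
      constructor
      · intro h1
        have h2 : (j : ℝ) = ((K - J : ℤ) : ℝ) := by push_cast; linarith
        exact_mod_cast h2
      · rintro rfl
        push_cast
        ring
    simp only [this]
  simp only [e1, mul_ite, mul_one, mul_zero, Finset.sum_ite_eq']
  split_ifs
  · rw [show H - (J : ℝ) - ((K - J : ℤ) : ℝ) = H - K by push_cast; ring]
  · rfl

theorem RegularPoint.add_natCast {ν r s u₀ : ℝ} (h : RegularPoint ν r s u₀) (i : ℕ) :
    RegularPoint ν r s (u₀ + i) := by
  refine ⟨fun q hq h1 => h.1 (2 * i + q) (by omega) ?_, fun hrs h1 => ?_⟩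
  · push_cast; linarith
  · rcases Nat.eq_zero_or_pos i with rfl | hi
    · exact h.2 hrs (by simpa using h1)
    · exact h.1 (2 * i) (by omega) (by push_cast; linarith)

/-- The kernel is a polynomial in block coefficients at the twists u + i and shifted weights, and
regularity at u₀ implies regularity at every u₀ + i. -/
theorem coeffKernel_uniformlySmooth {ν r s u₀ : ℝ} (hu : RegularPoint ν r s u₀) (k n : ℕ) (J : ℤ) :
    UniformlySmooth u₀ k (coeffKernel ν r s n J) := by
  induction n using Nat.strong_induction_on generalizing J with
  | _ n ih =>
    cases n with
    | zero =>
      have : coeffKernel ν r s 0 J = fun _ _ => if J = 0 then 1 else 0 := by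
        funext u H
        rw [coeffKernel]
      rw [this]
      exact UniformlySmooth.const k _
    | succ n =>
      have : coeffKernel ν r s (n + 1) J = fun u H => -∑ i : Fin (n + 1),
          ∑ j ∈ Finset.Icc (-((n + 1 - i : ℕ) : ℤ)) ((n + 1 - i : ℕ) : ℤ),
            coeffKernel ν r s i (J - j) u (H - j) *
              blockA ν r s (u + (i : ℕ)) (H - j) (n + 1 - i) j := by
        funext u H
        rw [coeffKernel]
      rw [this]
      refine UniformlySmooth.neg (UniformlySmooth.sum _ fun i _ => UniformlySmooth.sum _ fun j _ => ?_)
      have h1 := UniformlySmooth.comp_fst (UniformlySmooth.of_rational k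
        (blockA_rational (hu.add_natCast i) (n + 1 - i) j))
      exact ((ih i i.2 (J - j)).mul h1).comp_snd j

/-! ### Integer shifts of the weight function. -/

theorem sl2Weight_pos {r s H : ℝ} (hr : r < H) (hs : s < H) (hH : 1 / 2 < H) :
    0 < sl2Weight r s H :=
  div_pos (mul_pos (Real.Gamma_pos_of_pos (by linarith)) (Real.Gamma_pos_of_pos (by linarith)))
    (Real.Gamma_pos_of_pos (by linarith))

theorem sl2Weight_eventually_pos (r s : ℝ) : ∀ᶠ H in atTop, 0 < sl2Weight r s H := by
  filter_upwards [eventually_gt_atTop r, eventually_gt_atTop s, eventually_gt_atTop (1 / 2)]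
    with H h1 h2 h3 using sl2Weight_pos h1 h2 h3

theorem sl2Weight_add_one {r s H : ℝ} (hr : r < H) (hs : s < H) (hH : 1 / 2 < H) :
    sl2Weight r s (H + 1) = sl2Weight r s H *
      (1 / 4 * ((H + -r) * (H + 0)⁻¹ * ((H + -s) * (H + -(1 / 2))⁻¹))) := by
  have e1 : Real.Gamma (H + 1 - r) = (H - r) * Real.Gamma (H - r) := by
    rw [← Real.Gamma_add_one (by linarith)]; congr 1; ring
  have e2 : Real.Gamma (H + 1 - s) = (H - s) * Real.Gamma (H - s) := by
    rw [← Real.Gamma_add_one (by linarith)]; congr 1; ring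
  have e3 : Real.Gamma (2 * (H + 1) - 1) = 2 * H * ((2 * H - 1) * Real.Gamma (2 * H - 1)) := by
    rw [← Real.Gamma_add_one (by linarith : 2 * H - 1 ≠ 0), sub_add_cancel,
      ← Real.Gamma_add_one (by linarith)]
    congr 1; ring
  have h1 : 0 < Real.Gamma (2 * H - 1) := Real.Gamma_pos_of_pos (by linarith)
  have h2 : H + -(1 / 2) ≠ 0 := by linarith
  have h3 : 2 * H - 1 = 2 * (H + -(1 / 2)) := by ring
  rw [sl2Weight, sl2Weight, e1, e2, e3]
  generalize Real.Gamma (2 * H - 1) = G at h1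
  rw [h3, add_zero]
  have h4 : H ≠ 0 := by linarith
  field_simp
  ring

/-- Integer shifts change the weight function by an expandable factor. -/
theorem exists_sl2Weight_shift (r s : ℝ) (j : ℤ) : ∃ ρ : ℝ → ℝ, Expandable ρ ∧
    (∃ d, d ≠ 0 ∧ Tendsto ρ atTop (𝓝 d)) ∧
    ∀ᶠ H in atTop, sl2Weight r s (H - j) = sl2Weight r s H * ρ H := by
  set φ : ℝ → ℝ := fun H => 1 / 4 * ((H + -r) * (H + 0)⁻¹ * ((H + -s) * (H + -(1 / 2))⁻¹)) with hφ
  have hφe : Expandable φ :=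
    ((((RationalAt.div_add 0 (-r) 0).mul (RationalAt.div_add 0 (-s) (-(1 / 2)))).const_mul
      (1 / 4)).expandable (Expandable.const 0) tendsto_const_nhds)
  have hφt : Tendsto φ atTop (𝓝 (1 / 4)) := by
    have := ((tendsto_div_add (-r) 0).mul (tendsto_div_add (-s) (-(1 / 2)))).const_mul (1 / 4)
    rwa [mul_one, mul_one] at this
  have hshift : ∀ c : ℝ, Tendsto (fun H : ℝ => H + c) atTop atTop := fun c =>
    tendsto_atTop_add_const_right _ c tendsto_id
  have hstep : ∀ᶠ H in atTop, sl2Weight r s (H + 1) = sl2Weight r s H * φ H := by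
    filter_upwards [eventually_gt_atTop r, eventually_gt_atTop s, eventually_gt_atTop (1 / 2)]
      with H h1 h2 h3 using sl2Weight_add_one h1 h2 h3
  induction j using Int.induction_on with
  | zero => exact ⟨fun _ => 1, Expandable.const 1, ⟨1, one_ne_zero, tendsto_const_nhds⟩, by simp⟩
  | succ i ih =>
    obtain ⟨ρ, hρ, ⟨d, hd, hρd⟩, hρω⟩ := ih
    have hc : Expandable fun H => φ (H + (-(i : ℝ) - 1)) := hφe.comp_add_const _
    have hct : Tendsto (fun H => φ (H + (-(i : ℝ) - 1))) atTop (𝓝 (1 / 4)) := hφt.comp (hshift _)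
    refine ⟨fun H => ρ H * (φ (H + (-(i : ℝ) - 1)))⁻¹, hρ.mul (hc.inv (by norm_num) hct),
      ⟨d * (1 / 4)⁻¹, by simpa using hd, hρd.mul (hct.inv₀ (by norm_num))⟩, ?_⟩
    filter_upwards [hρω, (hshift (-(i : ℝ) - 1)).eventually hstep,
      hct.eventually_ne (show (1 / 4 : ℝ) ≠ 0 by norm_num)] with H h1 h2 h3
    rw [← mul_assoc, ← h1, eq_mul_inv_iff_mul_eq₀ h3]
    rw [show H + (-(i : ℝ) - 1) + 1 = H - (i : ℤ) by push_cast; ring] at h2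
    rw [h2]
    congr 2
    push_cast
    ring
  | pred i ih =>
    obtain ⟨ρ, hρ, ⟨d, hd, hρd⟩, hρω⟩ := ih
    have hc : Expandable fun H => φ (H + i) := hφe.comp_add_const _
    have hct : Tendsto (fun H => φ (H + i)) atTop (𝓝 (1 / 4)) := hφt.comp (hshift _)
    refine ⟨fun H => ρ H * φ (H + i), hρ.mul hc, ⟨d * (1 / 4), mul_ne_zero hd (by norm_num),
      hρd.mul hct⟩, ?_⟩
    filter_upwards [hρω, (hshift (i : ℝ)).eventually hstep] with H h1 h2
    rw [← mul_assoc, ← h1]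
    have e1 : H - ((-(i : ℤ) - 1 : ℤ) : ℝ) = H + i + 1 := by push_cast; ring
    have e2 : H - ((-(i : ℤ) : ℤ) : ℝ) = H + i := by push_cast; ring
    rw [e1, e2, h2]

theorem sl2Weight_shift_isBigO (r s : ℝ) (j : ℤ) :
    (fun H : ℝ => sl2Weight r s (H - j)) =O[atTop] sl2Weight r s := by
  obtain ⟨ρ, -, ⟨d, -, hd⟩, h⟩ := exists_sl2Weight_shift r s j
  have h1 : (fun H => sl2Weight r s H * ρ H) =O[atTop] fun H => sl2Weight r s H * 1 :=
    (isBigO_refl _ _).mul (hd.isBigO_one ℝ)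
  refine (h1.congr_right fun H => by ring).congr' ?_ EventuallyEq.rfl
  filter_upwards [h] with H hH using hH.symm

theorem isLittleO_weight_shift {r s e : ℝ} {R : ℝ → ℝ}
    (h : R =o[atTop] fun H : ℝ => sl2Weight r s H * H ^ e) (j : ℤ) :
    (fun H : ℝ => R (H - j)) =o[atTop] fun H : ℝ => sl2Weight r s H * H ^ e := by
  have ht : Tendsto (fun H : ℝ => H - j) atTop atTop :=
    tendsto_atTop_add_const_right _ (-(j : ℝ)) tendsto_id
  refine (h.comp_tendsto ht).trans_isBigO ((sl2Weight_shift_isBigO r s j).mul ?_)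
  have hlim : Tendsto (fun H : ℝ => ((H + -(j : ℝ)) * (H + 0)⁻¹) ^ e) atTop (𝓝 1) := by
    simpa using (tendsto_div_add (-(j : ℝ)) 0).rpow_const (p := e) (by simp)
  have h3 : (fun H : ℝ => H ^ e * ((H + -(j : ℝ)) * (H + 0)⁻¹) ^ e) =O[atTop]
      fun H : ℝ => H ^ e * 1 := (isBigO_refl _ _).mul (hlim.isBigO_one ℝ)
  refine (h3.congr_right fun H => by ring).congr' ?_ EventuallyEq.rfl
  filter_upwards [eventually_gt_atTop 0, eventually_gt_atTop (j : ℝ)] with H h1 h2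
  have h4 : 0 < H + -(j : ℝ) := by linarith
  rw [add_zero, ← Real.mul_rpow h1.le (by positivity)]
  congr 1
  field_simp
  ring

/-- Evaluation at K distinct points below Λ₀ gives an invertible Vandermonde system, so each
coefficient is a fixed linear combination of the values. This separates the powers of Λ = log ybar.
-/
theorem isLittleO_of_vandermonde {R : ℕ → ℝ → ℝ} {g : ℝ → ℝ} {K : ℕ} {Λ₀ : ℝ}
    (h : ∀ Λ < Λ₀, (fun H => ∑ k ∈ Finset.range K, Λ ^ k * R k H) =o[atTop] g) {k : ℕ}
    (hk : k < K) : R k =o[atTop] g := by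
  set v : Fin K → ℝ := fun i => Λ₀ - 1 - (i : ℕ) with hv
  have hinj : Function.Injective v := fun i j hij => by
    have : ((i : ℕ) : ℝ) = (j : ℕ) := by simp only [hv] at hij; linarith
    exact Fin.ext (by exact_mod_cast this)
  have hdet : IsUnit (Matrix.vandermonde v).det :=
    isUnit_iff_ne_zero.2 (Matrix.det_vandermonde_ne_zero_iff.2 hinj)
  have e : ∀ H, R k H = ∑ i, (Matrix.vandermonde v)⁻¹ ⟨k, hk⟩ i *
      ∑ k ∈ Finset.range K, v i ^ k * R k H := fun H => by
    have h1 : (Matrix.vandermonde v)⁻¹.mulVec ((Matrix.vandermonde v).mulVec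
        fun i : Fin K => R i H) = fun i : Fin K => R i H := by
      rw [Matrix.mulVec_mulVec, Matrix.nonsing_inv_mul _ hdet, Matrix.one_mulVec]
    have h2 := congrFun h1 ⟨k, hk⟩
    simp only [Matrix.mulVec, dotProduct, Matrix.vandermonde_apply] at h2
    rw [← h2]
    refine Finset.sum_congr rfl fun i _ => ?_
    rw [Finset.sum_range fun k => v i ^ k * R k H]
  have h3 : (fun H => ∑ i, (Matrix.vandermonde v)⁻¹ ⟨k, hk⟩ i *
      ∑ k ∈ Finset.range K, v i ^ k * R k H) =o[atTop] g :=
    IsLittleO.fun_sum fun i _ => (h (v i) (by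
      have : (0 : ℝ) ≤ (i : ℕ) := Nat.cast_nonneg _
      simp only [hv]; linarith)).const_mul_left _
  exact h3.congr_left fun H => (e H).symm

theorem exp_sub_sum_isBigO {x : ℝ → ℝ} (hx : Tendsto x atTop (𝓝 0)) (K : ℕ) :
    (fun H => Real.exp (x H) - ∑ k ∈ Finset.range K, x H ^ k / k.factorial) =O[atTop]
      fun H => x H ^ K := by
  rcases Nat.eq_zero_or_pos K with rfl | hK
  · simpa using ((Real.continuous_exp.tendsto 0).comp hx).isBigO_one ℝ
  refine IsBigO.of_bound (K.succ / (K.factorial * K)) ?_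
  have h1 : ∀ᶠ H in atTop, |x H| < 1 := by
    simpa using hx.abs.eventually_lt_const (show |(0 : ℝ)| < 1 by simp)
  filter_upwards [h1] with H hH
  rw [Real.norm_eq_abs, norm_pow, Real.norm_eq_abs, mul_comm]
  exact Real.exp_bound hH.le hK

/-! ### Matching one descendant level. -/

section Level

variable {ν r s : ℝ} {p h hb : ℝ → ℝ} {hInf ℓ₀ ε : ℝ} {f : LightconeSeries}

/-- The part of the transform of `f` with given powers of the first cross-ratio and its logarithm,
divided by the common weight. -/
noncomputable def levelCoeff (r s : ℝ) (f : LightconeSeries) (m k : ℕ) (N H : ℝ) : ℝ :=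
  ∑ t ∈ (f.index m N).filter fun t => t.1 = k,
    f.coeff m t.1 t.2.1 t.2.2 * kernelDeriv r s t.2.2 t.2.1 H

/-- The matching of one descendant level for a fixed value of the first cross-ratio. -/
theorem level_expansion (hp : HasExpansion fun x => p x / sl2Weight r s x)
    (hh : HasSmoothExpansion h) (hlim : Tendsto h atTop (𝓝 hInf)) (hreg : RegularPoint ν r s hInf)
    (hb_spin : ∀ ℓ > ℓ₀, hb ℓ - h (hb ℓ) = ℓ) (hb_diff : DifferentiableOn ℝ hb (Set.Ioi ℓ₀))
    (hb_top : Tendsto hb atTop atTop) (hf : HasCasimirSingularPart ν r s p h hb ℓ₀ hInf ε f)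
    {ρ : ℤ → ℝ → ℝ} (hρ : ∀ j, Expandable (ρ j))
    (hρω : ∀ j : ℤ, ∀ᶠ H in atTop, sl2Weight r s (H - j) = sl2Weight r s H * ρ j H)
    (m : ℕ) {yb : ℝ} (hyb : yb ∈ Set.Ioo 0 ε) {N N' : ℝ} (hN : N' < N) :
    (fun H => ∑ j ∈ Finset.Icc (-(m : ℤ)) m, ρ j H * (p (H - j) / sl2Weight r s (H - j)) *
        blockA ν r s (h (H - j)) (H - j) m j * yb ^ (h (H - j) + m)
      - ∑ t ∈ f.index m N, f.coeff m t.1 t.2.1 t.2.2 * (yb ^ (hInf + m) * Real.log yb ^ t.1) *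
        kernelDeriv r s t.2.2 t.2.1 H) =o[atTop] fun H : ℝ => H ^ (-2 * N' - 2) := by
  classical
  obtain ⟨hsum, hexp⟩ := hf m yb hyb
  obtain ⟨reg, hreg', hreg_o⟩ := hexp N
  have hb0 : 0 < yb := hyb.1
  -- The coefficient of the block of weight hb(ℓ) + j; the value 0 for ℓ ≤ ℓ₀ extends the sum to all
  -- natural numbers.
  set c : ℤ → ℕ → ℝ := fun j ℓ => if ℓ₀ < (ℓ : ℝ) then deriv hb ℓ * p (hb ℓ) *
    (yb ^ (h (hb ℓ) + m) * blockA ν r s (h (hb ℓ)) (hb ℓ) m j) else 0 with hc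
  -- For each j the sum runs along x(ℓ) = hb(ℓ) + j, so all functions of hb are evaluated at H - j,
  -- and ρ_j converts the weight ω(H) into ω(H-j).
  refine coeff_expansion_of_blockSum (Finset.Icc (-(m : ℤ)) m) (r := r) (s := s)
    (x := fun j ℓ => hb ℓ + j) (q := fun j H => (1 - deriv h (H - j))⁻¹) (c := c)
    (F := fun y => ∑' ℓ : {ℓ : ℕ // ℓ₀ < ℓ}, sumTerm ν r s p h hb m yb y (ℓ : ℕ))
    (fun j _ => (reparam_of_spin hh hlim hb_spin hb_diff hb_top j).1) (fun j _ => ?_)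
    (fun j _ => ?_) (fun y hy => ?_) (f.index m N) _ (fun t => t.2.1) (fun t => t.2.2) hreg' ?_ hN
  · have h1 : Expandable fun H => p H / sl2Weight r s H := hp.expandable
    have h2 : Expandable fun H => blockA ν r s (h H) H m j :=
      (blockA_rational hreg m j).expandable hh.expandable hlim
    have h3 : Expandable fun H => yb ^ (h H + m) :=
      (hh.expandable.add (Expandable.const m)).const_rpow hb0 (hlim.add_const (m : ℝ))
    have h4 := ((h1.mul h2).mul h3).comp_add_const (-(j : ℝ))
    refine ((hρ j).mul h4).congr' (Eventually.of_forall fun H => ?_)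
    simp only [← sub_eq_add_neg]
    ring
  · have hderiv := (reparam_of_spin hh hlim hb_spin hb_diff hb_top 0).2
    have htop : Tendsto (fun ℓ : ℝ => hb ℓ + j) atTop atTop :=
      tendsto_atTop_add_const_right _ (j : ℝ) hb_top
    filter_upwards [tendsto_natCast_atTop_atTop.eventually hderiv,
      tendsto_natCast_atTop_atTop.eventually (eventually_gt_atTop ℓ₀),
      tendsto_natCast_atTop_atTop.eventually (htop.eventually (hρω j)),
      tendsto_natCast_atTop_atTop.eventually (hb_top.eventually (sl2Weight_eventually_pos r s))]
      with ℓ h1 h2 h3 h4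
    simp only [hc, if_pos h2]
    rw [add_sub_cancel_right] at h3 ⊢
    have h5 : sl2Weight r s (hb ℓ) ≠ 0 := h4.ne'
    rw [h1, h3]
    rw [h3] at h5
    have h6 := left_ne_zero_of_mul h5
    have h7 := right_ne_zero_of_mul h5
    generalize (1 - deriv h (hb ℓ))⁻¹ = q
    field_simp
  · have h1 := (hsum y hy).hasSum
    have h2 : HasSum ({ℓ : ℕ | ℓ₀ < ℓ}.indicator fun ℓ : ℕ => sumTerm ν r s p h hb m yb y ℓ)
        (∑' ℓ : {ℓ : ℕ // ℓ₀ < ℓ}, sumTerm ν r s p h hb m yb y (ℓ : ℕ)) :=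
      hasSum_subtype_iff_indicator.1 h1
    refine h2.congr_fun fun ℓ => ?_
    by_cases hℓ : ℓ₀ < (ℓ : ℝ)
    · rw [Set.indicator_of_mem (show ℓ ∈ {ℓ : ℕ | ℓ₀ < (ℓ : ℝ)} from hℓ)]
      simp only [hc, if_pos hℓ, sumTerm, blockLevel, blockFun, Finset.mul_sum]
      refine Finset.sum_congr rfl fun j _ => ?_
      ring
    · rw [Set.indicator_of_notMem (show ℓ ∉ {ℓ : ℕ | ℓ₀ < (ℓ : ℝ)} from hℓ)]
      simp only [hc, if_neg hℓ, zero_mul, Finset.sum_const_zero]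
  · exact hreg_o

/-- The matching of one descendant level and one power of the logarithm of the first cross-ratio. -/
theorem levelCoeff_expansion (hp : HasExpansion fun x => p x / sl2Weight r s x)
    (hh : HasSmoothExpansion h) (hlim : Tendsto h atTop (𝓝 hInf)) (hreg : RegularPoint ν r s hInf)
    (hb_spin : ∀ ℓ > ℓ₀, hb ℓ - h (hb ℓ) = ℓ) (hb_diff : DifferentiableOn ℝ hb (Set.Ioi ℓ₀))
    (hb_top : Tendsto hb atTop atTop) (hε : 0 < ε)
    (hf : HasCasimirSingularPart ν r s p h hb ℓ₀ hInf ε f) (m k : ℕ) (N : ℝ) :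
    (fun H => sl2Weight r s H * levelCoeff r s f m k N H - ∑ j ∈ Finset.Icc (-(m : ℤ)) m,
      p (H - j) * blockA ν r s (h (H - j)) (H - j) m j * ((h (H - j) - hInf) ^ k / k.factorial))
      =o[atTop] fun H : ℝ => sl2Weight r s H * H ^ (-2 * N - 2) := by
  classical
  choose ρ hρ _ hρω using fun j : ℤ => exists_sl2Weight_shift r s j
  set B : ℤ → ℝ → ℝ := fun j H => ρ j H * (p (H - j) / sl2Weight r s (H - j)) *
    blockA ν r s (h (H - j)) (H - j) m j with hB
  have hBe : ∀ j ∈ Finset.Icc (-(m : ℤ)) m, Expandable (B j) := fun j _ => by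
    have h1 : Expandable fun H => p H / sl2Weight r s H := hp.expandable
    have h2 : Expandable fun H => blockA ν r s (h H) H m j :=
      (blockA_rational hreg m j).expandable hh.expandable hlim
    refine ((hρ j).mul ((h1.mul h2).comp_add_const (-(j : ℝ)))).congr'
      (Eventually.of_forall fun H => ?_)
    simp only [hB, ← sub_eq_add_neg]
    ring
  obtain ⟨b, hb'⟩ := Expandable.exists_common_isBigO _ hBe
  have hη0 : Tendsto (fun H => h H - hInf) atTop (𝓝 0) := by simpa using hlim.sub_const hInf
  obtain ⟨δ, hδ, hηδ⟩ := (hh.expandable.sub (Expandable.const hInf)).isBigO_of_tendsto_zero hη0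
  have hshift : ∀ j : ℤ, Tendsto (fun H : ℝ => H - j) atTop atTop := fun j =>
    tendsto_atTop_add_const_right _ (-(j : ℝ)) tendsto_id
  have hηj0 : ∀ j : ℤ, Tendsto (fun H => h (H - j) - hInf) atTop (𝓝 0) := fun j =>
    hη0.comp (hshift j)
  obtain ⟨δ', hδ', hηδ'⟩ : ∃ δ' : ℝ, 0 < δ' ∧ ∀ j : ℤ,
      (fun H => h (H - j) - hInf) =O[atTop] fun H : ℝ => H ^ (-δ') := by
    refine ⟨δ / 2, by positivity, fun j => ?_⟩
    have h1 : (fun H => h H - hInf) =o[atTop] fun H : ℝ => H ^ (-(δ / 2)) :=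
      hηδ.trans_isLittleO (rpow_isLittleO_rpow (by linarith))
    have h2 := isLittleO_comp_add_const (-(j : ℝ)) h1
    simpa only [← sub_eq_add_neg] using h2.isBigO
  set e : ℝ := -2 * N - 2 with he
  obtain ⟨K₁, hK₁⟩ := exists_nat_gt ((b - e) / δ')
  obtain ⟨K₂, hK₂⟩ := ((f.index m (N + 1)).image fun t => t.1).exists_le
  -- K makes the remainder of the exponential series, of order H^{b-Kδ'}, negligible, and exceeds k
  -- as well as every power of log ybar occurring in f up to a = N + 1.
  set K : ℕ := max (K₁ + 1) (max (k + 1) (K₂ + 1)) with hK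
  have hKδ : b + -(K * δ') < e := by
    have h1 : (K₁ : ℝ) ≤ K := by exact_mod_cast (Nat.le_succ K₁).trans (le_max_left _ _)
    rw [div_lt_iff₀ hδ'] at hK₁
    nlinarith
  have hkK : k < K := (Nat.lt_succ_self k).trans_le ((le_max_left _ _).trans (le_max_right _ _))
  have htK : ∀ t ∈ f.index m (N + 1), t.1 < K := fun t ht =>
    (Nat.lt_succ_of_le (hK₂ _ (Finset.mem_image_of_mem _ ht))).trans_le
      ((le_max_right _ _).trans (le_max_right _ _))
  have key : (fun H => ∑ j ∈ Finset.Icc (-(m : ℤ)) m, B j H * ((h (H - j) - hInf) ^ k / k.factorial)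
      - levelCoeff r s f m k (N + 1) H) =o[atTop] fun H : ℝ => H ^ e := by
    -- With ybar = e^Λ and after division by ybar^{h∞+m}, both sides are polynomials in Λ of degree
    -- below K up to negligible terms, and they match for all Λ < log ε.
    refine isLittleO_of_vandermonde (K := K) (Λ₀ := Real.log ε) (R := fun k H =>
      ∑ j ∈ Finset.Icc (-(m : ℤ)) m, B j H * ((h (H - j) - hInf) ^ k / k.factorial)
        - levelCoeff r s f m k (N + 1) H) (fun Λ hΛ => ?_) hkK
    have hyb : Real.exp Λ ∈ Set.Ioo 0 ε :=
      ⟨Real.exp_pos _, by rwa [← Real.exp_log hε, Real.exp_lt_exp]⟩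
    have h1 := level_expansion hp hh hlim hreg hb_spin hb_diff hb_top hf hρ hρω m hyb
      (show N < N + 1 by linarith)
    have h2 : (fun H => ∑ j ∈ Finset.Icc (-(m : ℤ)) m, B j H * (Real.exp (Λ * (h (H - j) - hInf))
        - ∑ k ∈ Finset.range K, (Λ * (h (H - j) - hInf)) ^ k / k.factorial)) =o[atTop]
        fun H : ℝ => H ^ e := by
      refine IsLittleO.fun_sum fun j hj => ?_
      have h3 := exp_sub_sum_isBigO (by simpa using (hηj0 j).const_mul Λ) K
      have h4 : (fun H => (Λ * (h (H - j) - hInf)) ^ K) =O[atTop] fun H : ℝ => (H ^ (-δ')) ^ K :=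
        ((hηδ' j).const_mul_left Λ).pow K
      refine ((hb' j hj).mul (h3.trans h4)).trans_isLittleO
        (IsLittleO.congr' (rpow_isLittleO_rpow hKδ) ?_ EventuallyEq.rfl)
      filter_upwards [eventually_gt_atTop 0] with H hH
      rw [← Real.rpow_natCast, ← Real.rpow_mul hH.le, ← Real.rpow_add hH]
      congr 1; ring
    have h5 := (h1.const_mul_left (Real.exp (-(Λ * (hInf + m))))).sub h2
    refine h5.congr_left fun H => ?_
    have e1 : ∀ x : ℝ, Real.exp Λ ^ x = Real.exp (Λ * x) := fun x => (Real.exp_mul Λ x).symm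
    have e2 : ∀ x : ℝ, Real.exp (-(Λ * (hInf + m))) * Real.exp (Λ * (x + m)) =
        Real.exp (Λ * (x - hInf)) := fun x => by
      rw [← Real.exp_add]; congr 1; ring
    have e3 : Real.exp (-(Λ * (hInf + m))) * Real.exp (Λ * (hInf + m)) = 1 := by
      rw [← Real.exp_add]; simp
    simp only [Real.log_exp, e1]
    have s1 : Real.exp (-(Λ * (hInf + m))) * ∑ j ∈ Finset.Icc (-(m : ℤ)) m,
        ρ j H * (p (H - j) / sl2Weight r s (H - j)) * blockA ν r s (h (H - j)) (H - j) m j *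
          Real.exp (Λ * (h (H - j) + m)) =
        ∑ j ∈ Finset.Icc (-(m : ℤ)) m, B j H * Real.exp (Λ * (h (H - j) - hInf)) := by
      rw [Finset.mul_sum]
      refine Finset.sum_congr rfl fun j _ => ?_
      rw [← e2 (h (H - j))]
      simp only [hB]
      ring
    have s2 : Real.exp (-(Λ * (hInf + m))) * ∑ t ∈ f.index m (N + 1), f.coeff m t.1 t.2.1 t.2.2 *
        (Real.exp (Λ * (hInf + m)) * Λ ^ t.1) * kernelDeriv r s t.2.2 t.2.1 H =
        ∑ k ∈ Finset.range K, Λ ^ k * levelCoeff r s f m k (N + 1) H := by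
      rw [← Finset.sum_fiberwise_of_maps_to (t := Finset.range K) (g := fun t => t.1)
        fun t ht => Finset.mem_range.2 (htK t ht), Finset.mul_sum]
      refine Finset.sum_congr rfl fun k _ => ?_
      rw [levelCoeff, Finset.mul_sum, Finset.mul_sum]
      refine Finset.sum_congr rfl fun t ht => ?_
      rw [(Finset.mem_filter.1 ht).2]
      linear_combination (f.coeff m k t.2.1 t.2.2 * Λ ^ k * kernelDeriv r s t.2.2 t.2.1 H) * e3
    have s3 : ∑ k ∈ Finset.range K, Λ ^ k * ∑ j ∈ Finset.Icc (-(m : ℤ)) m,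
        B j H * ((h (H - j) - hInf) ^ k / k.factorial) = ∑ j ∈ Finset.Icc (-(m : ℤ)) m,
        B j H * ∑ k ∈ Finset.range K, (Λ * (h (H - j) - hInf)) ^ k / k.factorial := by
      simp only [Finset.mul_sum]
      rw [Finset.sum_comm]
      refine Finset.sum_congr rfl fun j _ => Finset.sum_congr rfl fun k _ => ?_
      rw [mul_pow]
      ring
    have s4 : ∀ (S : Finset ℤ) (u v w : ℤ → ℝ), ∑ j ∈ S, u j * (v j - w j) =
        ∑ j ∈ S, u j * v j - ∑ j ∈ S, u j * w j := fun S u v w => by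
      simp only [mul_sub, Finset.sum_sub_distrib]
    have s5 : ∀ (S : Finset ℕ) (u v w : ℕ → ℝ), ∑ j ∈ S, u j * (v j - w j) =
        ∑ j ∈ S, u j * v j - ∑ j ∈ S, u j * w j := fun S u v w => by
      simp only [mul_sub, Finset.sum_sub_distrib]
    rw [mul_sub, s1, s2, s4, s5, s3]
    abel
  -- The matching needs strict room and was done with N + 1; the terms with N < a ≤ N + 1 are
  -- o(H^{-2N-2}) and are removed again.
  have hdiff : (fun H => levelCoeff r s f m k (N + 1) H - levelCoeff r s f m k N H) =o[atTop]
      fun H : ℝ => H ^ e := by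
    have hsub : (f.index m N).filter (fun t => t.1 = k) ⊆
        (f.index m (N + 1)).filter fun t => t.1 = k := by
      intro t ht
      simp only [LightconeSeries.index, Finset.mem_filter, Set.Finite.mem_toFinset,
        Set.mem_ofPred_eq] at ht ⊢
      exact ⟨⟨by linarith [ht.1.1], ht.1.2⟩, ht.2⟩
    have h1 : (fun H => ∑ t ∈ (f.index m (N + 1)).filter (fun t => t.1 = k) \
        (f.index m N).filter (fun t => t.1 = k), f.coeff m t.1 t.2.1 t.2.2 *
          kernelDeriv r s t.2.2 t.2.1 H) =o[atTop] fun H : ℝ => H ^ e := by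
      refine IsLittleO.fun_sum fun t ht => IsLittleO.const_mul_left ?_ _
      have hlt : N < t.2.1 := by
        simp only [LightconeSeries.index, Finset.mem_sdiff, Finset.mem_filter,
          Set.Finite.mem_toFinset, Set.mem_ofPred_eq] at ht
        by_contra hcon
        exact ht.2 ⟨⟨not_lt.1 hcon, ht.1.1.2⟩, ht.1.2⟩
      have := kernelDeriv_isLittleO r s t.2.2 t.2.1 (δ := 2 * (t.2.1 - N)) (by linarith)
      rwa [show -2 * t.2.1 - 2 + 2 * (t.2.1 - N) = e by rw [he]; ring] at this
    refine h1.congr_left fun H => ?_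
    rw [levelCoeff, levelCoeff, ← Finset.sum_sdiff hsub, add_sub_cancel_right]
  have hfin := (isBigO_refl (sl2Weight r s) atTop).mul_isLittleO (key.add hdiff)
  refine hfin.neg_left.congr' ?_ EventuallyEq.rfl
  have hω : ∀ j ∈ Finset.Icc (-(m : ℤ)) m, ∀ᶠ H in atTop, sl2Weight r s H * B j H =
      p (H - j) * blockA ν r s (h (H - j)) (H - j) m j := fun j _ => by
    filter_upwards [hρω j, (hshift j).eventually (sl2Weight_eventually_pos r s)] with H h1 h2
    have h3 : sl2Weight r s (H - j) ≠ 0 := h2.ne'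
    simp only [hB]
    rw [← mul_assoc, ← mul_assoc, ← h1]
    field_simp
  filter_upwards [(Finset.eventually_all _).2 hω] with H hH
  have s4 : ∑ j ∈ Finset.Icc (-(m : ℤ)) m, p (H - j) * blockA ν r s (h (H - j)) (H - j) m j *
      ((h (H - j) - hInf) ^ k / k.factorial) = sl2Weight r s H * ∑ j ∈ Finset.Icc (-(m : ℤ)) m,
        B j H * ((h (H - j) - hInf) ^ k / k.factorial) := by
    rw [Finset.mul_sum]
    refine Finset.sum_congr rfl fun j hj => ?_
    rw [← hH j hj]
    ring
  rw [s4]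
  ring

end Level

/-! ### Inverting the descendant expansion. -/

section Density

variable {ν r s : ℝ} {p h hb : ℝ → ℝ} {hInf ℓ₀ ε : ℝ} {f : LightconeSeries}

theorem kernel_contDiffAt (r s : ℝ) {a H : ℝ} (ha : |a| < H - 1) (n : WithTop ℕ∞) :
    ContDiffAt ℝ n (fun α : ℝ => (Real.Gamma (-α - r))⁻¹ * (Real.Gamma (-α - s))⁻¹ *
      (Real.Gamma (H - α - 1) / Real.Gamma (H + α + 1))) a := by
  have h1 : ContDiffAt ℂ n (fun b : ℂ => kernel r s b H) (a : ℂ) :=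
    ((kernel_differentiableOn r s H).analyticAt
      (Metric.isOpen_ball.mem_nhds (by simpa using ha))).contDiffAt
  have h2 := h1.real_of_complex
  simpa only [← kernel_ofReal, Complex.ofReal_re] using h2

theorem iteratedDeriv_sum_sl2Coeff (r s : ℝ) (l : ℕ) {a H : ℝ} (S : Finset ℤ) (c : ℤ → ℝ)
    (ha : ∀ J ∈ S, |a| < H - J - 1) :
    iteratedDeriv l (fun α : ℝ => ∑ J ∈ S, c J * sl2Coeff r s α (H - J)) a =
      ∑ J ∈ S, c J * (sl2Weight r s (H - J) * kernelDeriv r s l a (H - J)) := by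
  have e : (fun α : ℝ => ∑ J ∈ S, c J * sl2Coeff r s α (H - J)) = fun α : ℝ => ∑ J ∈ S,
      (c J * sl2Weight r s (H - J)) * ((Real.Gamma (-α - r))⁻¹ * (Real.Gamma (-α - s))⁻¹ *
        (Real.Gamma (H - J - α - 1) / Real.Gamma (H - J + α + 1))) := by
    funext α
    refine Finset.sum_congr rfl fun J _ => ?_
    rw [sl2Coeff]
    ring
  rw [e, iteratedDeriv_fun_sum fun J hJ => contDiffAt_const.mul (kernel_contDiffAt r s (ha J hJ) _)]
  refine Finset.sum_congr rfl fun J _ => ?_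
  rw [iteratedDeriv_const_mul_field, ← mul_assoc]
  rfl

/-- The derivatives in `h₀` and `a` that define the action of the operator on logarithms, in terms of
a sequence of derivatives of the finite-difference coefficients. -/
theorem operatorCTerm_eventually_eq {u₀ yb : ℝ} {n K : ℕ} {F : ℤ → ℕ → ℝ → ℝ → ℝ}
    (hF0 : ∀ J, F J 0 = fun (u : ℝ) H => yb ^ (u + n) * coeffKernel ν r s n J u H)
    (hd : ∀ J, ∀ k < K, ∀ᶠ t : ℝ × ℝ in 𝓝 u₀ ×ˢ atTop,
      HasDerivAt (fun u => F J k u t.2) (F J (k + 1) t.1 t.2) t.1) {k : ℕ} (hk : k ≤ K) (a : ℝ)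
    (l : ℕ) :
    ∀ᶠ H in atTop, operatorCTerm ν r s u₀ k a l n yb H = ∑ J ∈ Finset.Icc (-(n : ℤ)) n,
      F J k u₀ H * (sl2Weight r s (H - J) * kernelDeriv r s l a (H - J)) := by
  have h1 : ∀ᶠ H : ℝ in atTop, ∀ J ∈ Finset.Icc (-(n : ℤ)) n, ∀ k ∈ Finset.range K,
      ∀ᶠ u in 𝓝 u₀, HasDerivAt (fun u => F J k u H) (F J (k + 1) u H) u := by
    refine (Finset.eventually_all _).2 fun J _ => (Finset.eventually_all _).2 fun k hk => ?_
    obtain ⟨pa, ha, pb, hb, hab⟩ := eventually_prod_iff.1 (hd J k (Finset.mem_range.1 hk))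
    filter_upwards [hb] with H hH
    filter_upwards [ha] with u hu using hab hu hH
  have h2 : ∀ᶠ H : ℝ in atTop, ∀ J ∈ Finset.Icc (-(n : ℤ)) n, |a| < H - J - 1 := by
    refine (Finset.eventually_all _).2 fun J _ => ?_
    filter_upwards [eventually_gt_atTop (|a| + J + 1)] with H hH
    linarith
  filter_upwards [h1, h2] with H hH ha
  set w : ℤ → ℝ := fun J => sl2Weight r s (H - J) * kernelDeriv r s l a (H - J) with hw
  set G : ℕ → ℝ → ℝ := fun k u => ∑ J ∈ Finset.Icc (-(n : ℤ)) n, F J k u H * w J with hG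
  have h3 := (iteratedDeriv_eq_of_chain (G := G) (u₀ := u₀) (K := K) (fun k hk => by
    filter_upwards [(Finset.eventually_all _).2 fun J hJ => hH J hJ k (Finset.mem_range.2 hk)]
      with u hu
    exact HasDerivAt.fun_sum fun J hJ => (hu J hJ).mul_const (w J)) k hk).self_of_nhds
  rw [operatorCTerm]
  refine Eq.trans ?_ h3
  congr 1
  funext u
  simp only [coeffC_eq_coeffOp, coeffOp_apply, Finset.mul_sum, ← mul_assoc, hG]
  rw [iteratedDeriv_sum_sl2Coeff r s l _ (fun J => yb ^ (u + n) * coeffKernel ν r s n J u H) ha]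
  simp only [hF0, hw]

/-- Summing the Taylor expansion in the twist against the matched coefficients of one descendant
level. -/
theorem taylor_level (hp : HasExpansion fun x => p x / sl2Weight r s x)
    (hh : HasSmoothExpansion h) (hlim : Tendsto h atTop (𝓝 hInf)) (hreg : RegularPoint ν r s hInf)
    (hb_spin : ∀ ℓ > ℓ₀, hb ℓ - h (hb ℓ) = ℓ) (hb_diff : DifferentiableOn ℝ hb (Set.Ioi ℓ₀))
    (hb_top : Tendsto hb atTop atTop) (hε : 0 < ε)
    (hf : HasCasimirSingularPart ν r s p h hb ℓ₀ hInf ε f) (m : ℕ) (J : ℤ) (N : ℝ) :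
    ∀ᶠ K : ℕ in atTop, ∀ F : ℕ → ℝ → ℝ → ℝ,
      (∀ k ≤ K, (fun t : ℝ × ℝ => F k t.1 t.2) =O[𝓝 (hInf + m) ×ˢ atTop] fun _ => (1 : ℝ)) →
      (∀ k < K, ∀ᶠ t : ℝ × ℝ in 𝓝 (hInf + m) ×ˢ atTop,
        HasDerivAt (fun u => F k u t.2) (F (k + 1) t.1 t.2) t.1) →
      (fun H => ∑ j ∈ Finset.Icc (-(m : ℤ)) m, p (H - J - j) *
          blockA ν r s (h (H - J - j)) (H - J - j) m j * F 0 (h (H - J - j) + m) H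
        - ∑ k ∈ Finset.range K, F k (hInf + m) H *
          (sl2Weight r s (H - J) * levelCoeff r s f m k N (H - J)))
        =o[atTop] fun H : ℝ => sl2Weight r s H * H ^ (-2 * N - 2) := by
  set e : ℝ := -2 * N - 2 with he
  have hPe : ∀ j ∈ Finset.Icc (-(m : ℤ)) m,
      Expandable fun H => p H / sl2Weight r s H * blockA ν r s (h H) H m j := fun j _ =>
    (hp.expandable).mul ((blockA_rational hreg m j).expandable hh.expandable hlim)
  obtain ⟨b, hb'⟩ := Expandable.exists_common_isBigO _ hPe
  have hη0 : Tendsto (fun H => h H - hInf) atTop (𝓝 0) := by simpa using hlim.sub_const hInf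
  obtain ⟨δ, hδ, hηδ⟩ := (hh.expandable.sub (Expandable.const hInf)).isBigO_of_tendsto_zero hη0
  have hshift : ∀ j : ℤ, Tendsto (fun H : ℝ => H - j) atTop atTop := fun j =>
    tendsto_atTop_add_const_right _ (-(j : ℝ)) tendsto_id
  have hη : ∀ j : ℤ, (fun H => h (H - J - j) - hInf) =O[atTop] fun H : ℝ => H ^ (-(δ / 2)) := by
    intro j
    have h1 : (fun H => h H - hInf) =o[atTop] fun H : ℝ => H ^ (-(δ / 2)) :=
      hηδ.trans_isLittleO (rpow_isLittleO_rpow (by linarith))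
    have h2 := isLittleO_comp_add_const (-(J : ℝ)) (isLittleO_comp_add_const (-(j : ℝ)) h1)
    simpa only [← sub_eq_add_neg] using h2.isBigO
  have hpA : ∀ j ∈ Finset.Icc (-(m : ℤ)) m, (fun H => p (H - J - j) *
      blockA ν r s (h (H - J - j)) (H - J - j) m j) =O[atTop]
      fun H : ℝ => sl2Weight r s H * H ^ (b + 1) := by
    intro j hj
    have h1 : (fun H => p H * blockA ν r s (h H) H m j) =o[atTop]
        fun H : ℝ => sl2Weight r s H * H ^ (b + 1) := by
      refine ((isBigO_refl (sl2Weight r s) atTop).mul_isLittleO ((hb' j hj).trans_isLittleO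
        (rpow_isLittleO_rpow (by linarith)))).congr' ?_ EventuallyEq.rfl
      filter_upwards [sl2Weight_eventually_pos r s] with H hH
      have := hH.ne'
      field_simp
    exact (isLittleO_weight_shift (isLittleO_weight_shift h1 j) J).isBigO
  obtain ⟨K₀, hK₀⟩ := exists_nat_gt ((b + 1 - e) / (δ / 2))
  filter_upwards [eventually_ge_atTop K₀] with K hK F hFb hFd
  have hKδ : b + 1 + -(K * (δ / 2)) < e := by
    have h1 : (K₀ : ℝ) ≤ K := by exact_mod_cast hK
    rw [div_lt_iff₀ (by positivity)] at hK₀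
    nlinarith
  have ht : ∀ j : ℤ, Tendsto (fun H : ℝ => (h (H - J - j) + m, H)) atTop
      (𝓝 (hInf + m) ×ˢ atTop) := fun j =>
    ((hlim.comp ((hshift j).comp (hshift J))).add_const (m : ℝ)).prodMk tendsto_id
  have hT := taylor_bound hFb hFd
  -- The Taylor remainder: p A (h-h∞)^K is of order ω(H) H^{b+1-Kδ/2}, negligible for K ≥ K₀.
  have hA : (fun H => ∑ j ∈ Finset.Icc (-(m : ℤ)) m, p (H - J - j) *
      blockA ν r s (h (H - J - j)) (H - J - j) m j * (F 0 (h (H - J - j) + m) H -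
        ∑ k ∈ Finset.range K, F k (hInf + m) H * ((h (H - J - j) - hInf) ^ k / k.factorial)))
      =o[atTop] fun H : ℝ => sl2Weight r s H * H ^ e := by
    refine IsLittleO.fun_sum fun j hj => ?_
    have h1 : (fun H => F 0 (h (H - J - j) + m) H -
        ∑ k ∈ Finset.range K, F k (hInf + m) H * ((h (H - J - j) - hInf) ^ k / k.factorial))
        =O[atTop] fun H => (h (H - J - j) - hInf) ^ K := by
      have h0 := hT.comp_tendsto (ht j)
      simpa only [Function.comp_def, add_sub_add_right_eq_sub] using h0
    have h2 := (hpA j hj).mul (h1.trans ((hη j).pow K))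
    refine h2.trans_isLittleO (IsLittleO.congr' ((isBigO_refl (sl2Weight r s) atTop).mul_isLittleO
      (rpow_isLittleO_rpow hKδ)) ?_ EventuallyEq.rfl)
    filter_upwards [eventually_gt_atTop 0] with H hH
    rw [mul_assoc, ← Real.rpow_natCast, ← Real.rpow_mul hH.le, ← Real.rpow_add hH]
    congr 2
    ring
  -- The moments of h - h∞ are replaced by the coefficients of f, using `levelCoeff_expansion` at H
  -- - J; the Taylor coefficients of F are bounded in H.
  have hB : (fun H => ∑ k ∈ Finset.range K, F k (hInf + m) H *
      (sl2Weight r s (H - J) * levelCoeff r s f m k N (H - J) - ∑ j ∈ Finset.Icc (-(m : ℤ)) m,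
        p (H - J - j) * blockA ν r s (h (H - J - j)) (H - J - j) m j *
          ((h (H - J - j) - hInf) ^ k / k.factorial)))
      =o[atTop] fun H : ℝ => sl2Weight r s H * H ^ e := by
    refine IsLittleO.fun_sum fun k hk => ?_
    have h1 := isLittleO_weight_shift (levelCoeff_expansion hp hh hlim hreg hb_spin hb_diff hb_top
      hε hf m k N) J
    have h2 : (fun H => F k (hInf + m) H) =O[atTop] fun _ => (1 : ℝ) :=
      (hFb k (Finset.mem_range.1 hk).le).comp_tendsto
        (tendsto_const_nhds.prodMk tendsto_id : Tendsto (fun H : ℝ => (hInf + m, H)) atTop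
          (𝓝 (hInf + m) ×ˢ atTop))
    exact (h2.mul_isLittleO h1).congr_right fun H => one_mul _
  refine (hA.sub hB).congr_left fun H => ?_
  have s4 : ∀ {ι : Type} (S : Finset ι) (u v w : ι → ℝ), ∑ j ∈ S, u j * (v j - w j) =
      ∑ j ∈ S, u j * v j - ∑ j ∈ S, u j * w j := fun S u v w => by
    simp only [mul_sub, Finset.sum_sub_distrib]
  rw [s4, s4]
  have s5 : ∑ j ∈ Finset.Icc (-(m : ℤ)) m, p (H - J - j) *
      blockA ν r s (h (H - J - j)) (H - J - j) m j *
        ∑ k ∈ Finset.range K, F k (hInf + m) H * ((h (H - J - j) - hInf) ^ k / k.factorial) =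
      ∑ k ∈ Finset.range K, F k (hInf + m) H * ∑ j ∈ Finset.Icc (-(m : ℤ)) m,
        p (H - J - j) * blockA ν r s (h (H - J - j)) (H - J - j) m j *
          ((h (H - J - j) - hInf) ^ k / k.factorial) := by
    simp only [Finset.mul_sum]
    rw [Finset.sum_comm]
    refine Finset.sum_congr rfl fun k _ => Finset.sum_congr rfl fun j _ => ?_
    ring
  rw [s5]
  abel

/-- The inversion identity between the coefficients of the blocks and of the operator. -/
theorem sum_coeffKernel_block_eq (ν r s : ℝ) (p h : ℝ → ℝ) (n : ℕ) (yb H : ℝ) :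
    ∑ m ∈ Finset.range (n + 1), ∑ J ∈ Finset.Icc (-((n - m : ℕ) : ℤ)) ((n - m : ℕ) : ℤ),
      ∑ j ∈ Finset.Icc (-(m : ℤ)) m, p (H - J - j) *
        blockA ν r s (h (H - J - j)) (H - J - j) m j *
        (yb ^ (h (H - J - j) + m + (n - m : ℕ)) *
          coeffKernel ν r s (n - m) J (h (H - J - j) + m) H) =
      if n = 0 then p H * yb ^ h H else 0 := by
  have h1 : ∀ m ∈ Finset.range (n + 1),
      ∑ J ∈ Finset.Icc (-((n - m : ℕ) : ℤ)) ((n - m : ℕ) : ℤ),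
        ∑ j ∈ Finset.Icc (-(m : ℤ)) m, p (H - J - j) *
          blockA ν r s (h (H - J - j)) (H - J - j) m j *
          (yb ^ (h (H - J - j) + m + (n - m : ℕ)) *
            coeffKernel ν r s (n - m) J (h (H - J - j) + m) H) =
      ∑ K ∈ Finset.Icc (-(n : ℤ)) n, p (H - K) * yb ^ (h (H - K) + n) *
        ∑ J ∈ Finset.Icc (-((n - m : ℕ) : ℤ)) ((n - m : ℕ) : ℤ),
          (if K - J ∈ Finset.Icc (-(m : ℤ)) m then coeffKernel ν r s (n - m) J (h (H - K) + m) H *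
            blockA ν r s (h (H - K)) (H - K) m (K - J) else 0) := by
    intro m hm
    have hmn : m ≤ n := Nat.lt_succ_iff.1 (Finset.mem_range.1 hm)
    have hcast : ((n - m : ℕ) : ℝ) = n - m := Nat.cast_sub hmn
    -- Grouping by the total shift K = J + j makes the twist h(H-K), and with it p and the power of
    -- yb, common to all terms of a group; the kernel identity then applies at that twist.
    have h2 := sum_Icc_convolve (fun J K : ℤ => p (H - K) * yb ^ (h (H - K) + n) *
      (coeffKernel ν r s (n - m) J (h (H - K) + m) H *
        blockA ν r s (h (H - K)) (H - K) m (K - J))) (n - m) m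
    rw [Nat.sub_add_cancel hmn] at h2
    simp only [Finset.mul_sum, mul_ite, mul_zero]
    rw [← h2]
    refine Finset.sum_congr rfl fun J _ => Finset.sum_congr rfl fun j _ => ?_
    rw [hcast, Int.cast_add, ← sub_sub, add_sub_cancel_left,
      show h (H - J - j) + m + ((n : ℝ) - m) = h (H - J - j) + n by ring]
    ring
  rw [Finset.sum_congr rfl h1, Finset.sum_comm]
  simp only [← Finset.mul_sum, sum_coeffKernel_mul_blockA]
  by_cases hn : n = 0
  · subst hn
    simp
  · simp [hn]

/-- The kernels of C^{(n-m)}, times ybar^{u+n-m} at u = h+m, are applied to the level-m sums and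
added over m ≤ n. The inversion identity evaluates the result exactly, as p ybar^h for n = 0 and 0
otherwise. Taylor expansion in u around h∞+m evaluates it asymptotically, and its k-th coefficient
is the derivative ∂_{h₀}^k through which the operator acts on log^k ybar. -/
theorem asymptoticDensity (hp : HasExpansion fun x => p x / sl2Weight r s x)
    (hh : HasSmoothExpansion h) (hlim : Tendsto h atTop (𝓝 hInf)) (hreg : RegularPoint ν r s hInf)
    (hb_spin : ∀ ℓ > ℓ₀, hb ℓ - h (hb ℓ) = ℓ) (hb_diff : DifferentiableOn ℝ hb (Set.Ioi ℓ₀))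
    (hb_top : Tendsto hb atTop atTop) (hε : 0 < ε)
    (hf : HasCasimirSingularPart ν r s p h hb ℓ₀ hInf ε f) :
    AsymptoticDensity ν r s p h hInf ε f := by
  classical
  intro n yb hyb N
  have hev : ∀ᶠ K : ℕ in atTop, ∀ m ∈ Finset.range (n + 1),
      (∀ t ∈ f.index m N, t.1 < K) ∧
      ∀ J ∈ Finset.Icc (-((n - m : ℕ) : ℤ)) ((n - m : ℕ) : ℤ), ∀ F : ℕ → ℝ → ℝ → ℝ,
      (∀ k ≤ K, (fun t : ℝ × ℝ => F k t.1 t.2) =O[𝓝 (hInf + m) ×ˢ atTop] fun _ => (1 : ℝ)) →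
      (∀ k < K, ∀ᶠ t : ℝ × ℝ in 𝓝 (hInf + m) ×ˢ atTop,
        HasDerivAt (fun u => F k u t.2) (F (k + 1) t.1 t.2) t.1) →
      (fun H => ∑ j ∈ Finset.Icc (-(m : ℤ)) m, p (H - J - j) *
          blockA ν r s (h (H - J - j)) (H - J - j) m j * F 0 (h (H - J - j) + m) H
        - ∑ k ∈ Finset.range K, F k (hInf + m) H *
          (sl2Weight r s (H - J) * levelCoeff r s f m k N (H - J)))
        =o[atTop] fun H : ℝ => sl2Weight r s H * H ^ (-2 * N - 2) :=
    (Finset.eventually_all _).2 fun m _ =>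
      ((Finset.eventually_all _).2 fun t _ => eventually_gt_atTop t.1).and
      ((Finset.eventually_all _).2 fun J _ =>
        taylor_level hp hh hlim hreg hb_spin hb_diff hb_top hε hf m J N)
  -- One Taylor order serves all levels m ≤ n and all shifts J, and it exceeds every power of log
  -- ybar that occurs.
  obtain ⟨K, hK⟩ := hev.exists
  have hsm : ∀ (m : ℕ) (J : ℤ), UniformlySmooth (hInf + m) K fun u H =>
      yb ^ (u + (n - m : ℕ)) * coeffKernel ν r s (n - m) J u H := fun m J =>
    (UniformlySmooth.const_rpow K hyb.1 _).mul
      (coeffKernel_uniformlySmooth (hreg.add_natCast m) K (n - m) J)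
  choose F hF0 hFb hFd using fun (m : ℕ) (J : ℤ) => (hsm m J).exists_seq
  have hmain : (fun H => ∑ m ∈ Finset.range (n + 1),
      ∑ J ∈ Finset.Icc (-((n - m : ℕ) : ℤ)) ((n - m : ℕ) : ℤ),
      (∑ j ∈ Finset.Icc (-(m : ℤ)) m, p (H - J - j) *
          blockA ν r s (h (H - J - j)) (H - J - j) m j * F m J 0 (h (H - J - j) + m) H
        - ∑ k ∈ Finset.range K, F m J k (hInf + m) H *
          (sl2Weight r s (H - J) * levelCoeff r s f m k N (H - J))))
        =o[atTop] fun H : ℝ => sl2Weight r s H * H ^ (-2 * N - 2) :=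
    IsLittleO.fun_sum fun m hm => IsLittleO.fun_sum fun J hJ =>
      (hK m hm).2 J hJ (F m J) (hFb m J) (hFd m J)
  refine hmain.congr' ?_ EventuallyEq.rfl
  have hop : ∀ᶠ H in atTop, ∀ m ∈ Finset.range (n + 1), ∀ t ∈ f.index m N,
      operatorCTerm ν r s (hInf + m) t.1 t.2.1 t.2.2 (n - m) yb H =
      ∑ J ∈ Finset.Icc (-((n - m : ℕ) : ℤ)) ((n - m : ℕ) : ℤ), F m J t.1 (hInf + m) H *
        (sl2Weight r s (H - J) * kernelDeriv r s t.2.2 t.2.1 (H - J)) :=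
    (Finset.eventually_all _).2 fun m hm => (Finset.eventually_all _).2 fun t ht =>
      operatorCTerm_eventually_eq (hF0 m) (hFd m) ((hK m hm).1 t ht).le t.2.1 t.2.2
  filter_upwards [hop] with H hH
  simp only [Finset.sum_sub_distrib]
  congr 1
  · simp only [hF0]
    exact sum_coeffKernel_block_eq ν r s p h n yb H
  · rw [operatorCTrunc]
    refine Finset.sum_congr rfl fun m hm => ?_
    have e1 : ∀ t ∈ f.index m N, f.coeff m t.1 t.2.1 t.2.2 *
        operatorCTerm ν r s (hInf + m) t.1 t.2.1 t.2.2 (n - m) yb H =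
        ∑ J ∈ Finset.Icc (-((n - m : ℕ) : ℤ)) ((n - m : ℕ) : ℤ), f.coeff m t.1 t.2.1 t.2.2 *
          (F m J t.1 (hInf + m) H *
            (sl2Weight r s (H - J) * kernelDeriv r s t.2.2 t.2.1 (H - J))) := fun t ht => by
      rw [hH m hm t ht, Finset.mul_sum]
    rw [Finset.sum_congr rfl e1, Finset.sum_comm (s := f.index m N)]
    refine Finset.sum_congr rfl fun J _ => ?_
    rw [← Finset.sum_fiberwise_of_maps_to (s := f.index m N) (t := Finset.range K)
      (g := fun t => t.1) fun t ht => Finset.mem_range.2 ((hK m hm).1 t ht)]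
    refine Finset.sum_congr rfl fun k _ => ?_
    rw [levelCoeff, Finset.mul_sum, Finset.mul_sum]
    refine Finset.sum_congr rfl fun t ht => ?_
    rw [(Finset.mem_filter.1 ht).2]
    ring

end Density

end Lightcone

theorem lemma1 (d : ℕ) (hd : 2 ≤ d) (r s : ℝ)
    (p h hb : ℝ → ℝ) (hInf ℓ₀ ε : ℝ) (hε : 0 < ε)
    (hp : Lightcone.HasExpansion fun x => p x / Lightcone.sl2Weight r s x)
    (hh : Lightcone.HasSmoothExpansion h)
    (hlim : Filter.Tendsto h Filter.atTop (nhds hInf))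
    (hpole : ∀ q : ℕ, 1 ≤ q → 2 * hInf + q ≠ 2 * Lightcone.nu d)
    (hpole₀ : r * s ≠ 0 → hInf ≠ Lightcone.nu d)
    (hb_spin : ∀ ℓ > ℓ₀, hb ℓ - h (hb ℓ) = ℓ)
    (hb_diff : DifferentiableOn ℝ hb (Set.Ioi ℓ₀))
    (hb_top : Filter.Tendsto hb Filter.atTop Filter.atTop)
    (f : Lightcone.LightconeSeries)
    (hf : Lightcone.HasCasimirSingularPart (Lightcone.nu d) r s p h hb ℓ₀ hInf ε f) :
    Lightcone.AsymptoticDensity (Lightcone.nu d) r s p h hInf ε f :=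
  Lightcone.asymptoticDensity hp hh hlim ⟨hpole, hpole₀⟩ hb_spin hb_diff hb_top hε hf
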